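/- Let $M$ be a smooth compact manifold of dimension $d\ge 2$ with (possibly empty) boundary, with a smooth Riemannian metric $g$. A Lipschitz domain is a non-empty open set $\Omega\subseteq M\setminus\partial M$ that near each point of its topological boundary $\partial\Omega$ (taken in $M$, so that it contains $\partial M\cap\overline\Omega$) is, in a chart, the region on one side of the graph of a Lipschitz function. Let $\Omega$ be a connected Lipschitz domain, let $q,r$ be smooth real functions, and let $\partial_D\Omega,\partial_N\Omega,\partial_R\Omega$ be pairwise disjoint, relatively open subsets of $\partial\Omega$ whose closures cover $\partial\Omega$. Let $H^1_{\partial_D\Omega}(\Omega)$ be the space of $u\in H^1(\Omega,g)$ whose trace vanishes on $\partial_D\Omega$, and on it consider $$T(u,v)=\int_\Omega\bigl(g(\nabla u,\nabla v)-quv\bigr)\,d\mathcal H^d_g-\int_{\partial_R\Omega}ruv\,d\mathcal H^{d-1}_g .$$ An eigenfunction of $T$ with eigenvalue $t\in\mathbb R$ is a non-zero $u\in H^1_{\partial_D\Omega}(\Omega)$ with $T(u,v)=t\langle u,v\rangle_{L^2(\Omega)}$ for all $v\in H^1_{\partial_D\Omega}(\Omega)$. Let $G$ be a finite group of smooth diffeomorphisms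 of $M$, acting faithfully on $\Omega$, each element of which maps $\Omega$ onto itself, restricts to an isometry of $(\overline\Omega,g)$, and preserves $\partial_D\Omega,\partial_N\Omega,\partial_R\Omega$ and the restrictions of $q,r$ to $\overline\Omega$. Let $\sigma:G\to\{1,-1\}$ be a homomorphism. For a subgroup $K\le G$, a function $u$ is $(K,\sigma)$-invariant if $\sigma(\phi)\,u\circ\phi^{-1}=u$ for all $\phi\in K$. The $(K,\sigma)$-eigenvalues $\lambda_1^{K,\sigma}\le\lambda_2^{K,\sigma}\le\dots$ of a form are its eigenvalues having a $(K,\sigma)$-invariant eigenfunction, each repeated according to the dimension of its space of $(K,\sigma)$-invariant eigenfunctions, with $\lambda_i^{K,\sigma}=+\infty$ if there are fewer than $i$ of them. Let $\Omega_1,\dots,\Omega_n\subseteq\Omega$ be pairwise disjoint Lipschitz domains whose closures cover $\Omega$, such that $G$ maps the collection $\{\Omega_1,\dots,\Omega_n\}$ to itself and acts transitively on it, and let $H\le G$ be the stabilizer of $\Omega_1$. Set $\partial_{\rm int}\Omega_1=\partial\Omega_1\cap\Omega$ and $\partial_{\rm ext}\Omega_1=\partial\Omega_1\setminus\overline{\partial_{\rm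 int}\Omega_1}$. For $p\in\partial_{\rm int}\Omega_1$ let $G_p$ be the group of those $\phi\in G$ that fix pointwise some neighbourhood of $p$ in $\partial_{\rm int}\Omega_1$. Let $\partial_+\Omega_1$ (respectively $\partial_-\Omega_1$) be the set of $p\in\partial_{\rm int}\Omega_1$ with $|G_p|=2$ and $\sigma(G_p)=\{1\}$ (respectively $|G_p|=2$ and $\sigma(G_p)=\{1,-1\}$), and assume that the closures of $\partial_+\Omega_1$ and $\partial_-\Omega_1$ cover $\partial_{\rm int}\Omega_1$. Let $T_{\Omega_1}$ be the form defined as above by $\Omega_1$, $g$, $q$, $r$ and $$\partial_D\Omega_1=\partial_-\Omega_1\cup(\partial_{\rm ext}\Omega_1\cap\partial_D\Omega),\quad \partial_N\Omega_1=\partial_+\Omega_1\cup(\partial_{\rm ext}\Omega_1\cap\partial_N\Omega),\quad \partial_R\Omega_1=\partial_{\rm ext}\Omega_1\cap\partial_R\Omega .$$ Then $\lambda_i^{G,\sigma}(T)=\lambda_i^{H,\sigma}(T_{\Omega_1})$ for every integer $i\ge1$, and for every $t\in\mathbb R$ restriction to $\Omega_1$ is a bijection from the $(G,\sigma)$-invariant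 eigenfunctions of $T$ with eigenvalue $t$ onto the $(H,\sigma)$-invariant eigenfunctions of $T_{\Omega_1}$ with eigenvalue $t$. -/

import Mathlib

open Set Filter MeasureTheory Bundle
open scoped Manifold ContDiff Topology ENNReal Pointwise

noncomputable section

namespace EquivSpectrum

section Geometry

variable (d : ℕ) [NeZero d] {M : Type*} [EMetricSpace M] [ChartedSpace (EuclideanHalfSpace d) M]

/-- A Lipschitz domain of the manifold with (possibly empty) boundary `M`: a non-empty open set
`Ω`, contained in the manifold interior `M ∖ ∂M`, such that near each point of its topological
boundary `frontier Ω` (which contains `∂M ∩ closure Ω`) the set `Ω` is, in a chart and in suitable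
orthonormal coordinates of `ℝ^d`, the region strictly above the graph of a Lipschitz function over
the hyperplane orthogonal to a unit vector `v`. The neighbourhood `U` is a neighbourhood in `ℝ^d`,
also at boundary points of `M`. -/
structure IsLipschitzDomain (Ω : Set M) : Prop where
  nonempty : Ω.Nonempty
  isOpen : IsOpen Ω
  subset_interior : Ω ⊆ (𝓡∂ d).interior M
  graph : ∀ p ∈ frontier Ω, ∃ U : Set (EuclideanSpace ℝ (Fin d)),
    IsOpen U ∧ extChartAt (𝓡∂ d) p p ∈ U ∧
    ∃ (v : EuclideanSpace ℝ (Fin d)) (K : NNReal) (f : EuclideanSpace ℝ (Fin d) → ℝ),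
      ‖v‖ = 1 ∧ LipschitzWith K f ∧
      ∀ y ∈ U, y ∈ extChartAt (𝓡∂ d) p '' (Ω ∩ (extChartAt (𝓡∂ d) p).source) ↔
        f (y - inner ℝ v y • v) < inner ℝ v y

variable [IsManifold (𝓡∂ d) ∞ M] [RiemannianBundle (fun p : M ↦ TangentSpace (𝓡∂ d) p)]

/-- `√(det (g_ij))` at `p`, where `g_ij` are the components of the Riemannian metric with respect
to the coordinate vector fields of the preferred chart at `x`. -/
def volDensity (x p : M) : ℝ :=
  √(Matrix.det (Matrix.of fun i j : Fin d ↦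
    inner ℝ
      ((trivializationAt (EuclideanSpace ℝ (Fin d)) (TangentSpace (𝓡∂ d)) x).symm p
        (EuclideanSpace.single i 1))
      ((trivializationAt (EuclideanSpace ℝ (Fin d)) (TangentSpace (𝓡∂ d)) x).symm p
        (EuclideanSpace.single j 1))))

/-- The components of the vector field `X` at `p` in the preferred chart at `x`. -/
def vecCoord (X : ∀ p : M, TangentSpace (𝓡∂ d) p) (x p : M) : EuclideanSpace ℝ (Fin d) :=
  (trivializationAt (EuclideanSpace ℝ (Fin d)) (TangentSpace (𝓡∂ d)) x ⟨p, X p⟩).2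

/-- The Riemannian divergence of a vector field at `x`,
`div X = (det g)^(-1/2) ∑ i, ∂_i ((det g)^(1/2) X^i)`, computed in the preferred chart at `x`. -/
def divergence (X : ∀ p : M, TangentSpace (𝓡∂ d) p) (x : M) : ℝ :=
  (volDensity d x x)⁻¹ * ∑ i : Fin d,
    fderivWithin ℝ
      (fun y ↦ volDensity d x ((extChartAt (𝓡∂ d) x).symm y) *
        vecCoord d X x ((extChartAt (𝓡∂ d) x).symm y) i)
      (range (𝓡∂ d)) (extChartAt (𝓡∂ d) x x) (EuclideanSpace.single i 1)

variable [MeasurableSpace M] [BorelSpace M]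

variable (M) in
/-- The Riemannian volume: the `d`-dimensional Hausdorff measure of the Riemannian distance,
normalized so as to agree with Lebesgue measure on `ℝ^d`. -/
abbrev vol : Measure M := μHE[d]

variable (M) in
/-- The `(d-1)`-dimensional (normalized) Hausdorff measure of the Riemannian distance. -/
abbrev surf : Measure M := μHE[d - 1]

/-- `V` is a weak gradient of `u` on `Ω`, and it is square integrable: `V` is measurable (its
components in each chart are), `|V|` is in `L²(Ω)`, and `∫_Ω g(X, V) = - ∫_Ω u div X` for every
smooth vector field `X` with compact support in `Ω`. -/
structure IsWeakGradient (Ω : Set M) (u : M → ℝ) (V : ∀ p : M, TangentSpace (𝓡∂ d) p) :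
    Prop where
  measurable : ∀ x : M, AEStronglyMeasurable (vecCoord d V x)
    ((vol d M).restrict (Ω ∩ (chartAt (EuclideanHalfSpace d) x).source))
  memLp : MemLp (fun p ↦ ‖V p‖) 2 ((vol d M).restrict Ω)
  integral_eq : ∀ X : ∀ p : M, TangentSpace (𝓡∂ d) p,
    ContMDiff (𝓡∂ d) (𝓡∂ d).tangent ∞ (fun p ↦ (⟨p, X p⟩ : TangentBundle (𝓡∂ d) M)) →
    closure {p | X p ≠ 0} ⊆ Ω →
    ∫ p in Ω, inner ℝ (X p) (V p) ∂(vol d M) = -∫ p in Ω, u p * divergence d X p ∂(vol d M)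

/-- Membership in the Sobolev space `H¹(Ω, g)`. -/
def MemH1 (Ω : Set M) (u : M → ℝ) : Prop :=
  MemLp u 2 ((vol d M).restrict Ω) ∧ ∃ V, IsWeakGradient d Ω u V

open Classical in
/-- The weak gradient of a function in `H¹(Ω, g)` (it is unique almost everywhere). -/
def weakGrad (Ω : Set M) (u : M → ℝ) : ∀ p : M, TangentSpace (𝓡∂ d) p :=
  if h : ∃ V, IsWeakGradient d Ω u V then h.choose else fun _ ↦ 0

/-- `τ ∈ L²(∂Ω)` is the trace of `u` on `∂Ω = frontier Ω`: the trace map is the continuous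
extension to `H¹(Ω)` of the restriction of `C¹` functions to `∂Ω`, that is, `τ` is the
`L²(∂Ω)`-limit of the restrictions of `C¹` functions `w k` that converge to `u` in `H¹(Ω)`
(`W k` being the weak gradient of `w k - u`). -/
def IsTrace (Ω : Set M) (u τ : M → ℝ) : Prop :=
  MemLp τ 2 ((surf d M).restrict (frontier Ω)) ∧
  ∃ (w : ℕ → M → ℝ) (W : ℕ → ∀ p : M, TangentSpace (𝓡∂ d) p),
    (∀ k, ContMDiff (𝓡∂ d) 𝓘(ℝ) 1 (w k)) ∧
    (∀ k, IsWeakGradient d Ω (fun p ↦ w k p - u p) (W k)) ∧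
    Tendsto (fun k ↦ eLpNorm (fun p ↦ w k p - u p) 2 ((vol d M).restrict Ω)) atTop (𝓝 0) ∧
    Tendsto (fun k ↦ eLpNorm (fun p ↦ ‖W k p‖) 2 ((vol d M).restrict Ω)) atTop (𝓝 0) ∧
    Tendsto (fun k ↦ eLpNorm (fun p ↦ w k p - τ p) 2 ((surf d M).restrict (frontier Ω)))
      atTop (𝓝 0)

open Classical in
/-- The trace on `∂Ω` of a function in `H¹(Ω, g)` (it is unique almost everywhere). -/
def trace (Ω : Set M) (u : M → ℝ) : M → ℝ :=
  if h : ∃ τ, IsTrace d Ω u τ then h.choose else fun _ ↦ 0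

end Geometry

/-- The data `(Ω, q, r, ∂_D Ω, ∂_N Ω, ∂_R Ω)` of a Schrödinger operator `Δ_g + q` on `Ω` with
Dirichlet, Neumann and Robin conditions (the latter with coefficient `r`). -/
structure Problem (M : Type*) where
  /-- the domain `Ω` -/
  dom : Set M
  /-- the potential `q` -/
  q : M → ℝ
  /-- the Robin coefficient `r` -/
  r : M → ℝ
  /-- the Dirichlet part of the boundary -/
  dir : Set M
  /-- the Neumann part of the boundary -/
  neu : Set M
  /-- the Robin part of the boundary -/
  rob : Set M

namespace Problem

section Spectrum

variable (d : ℕ) [NeZero d] {M : Type*} [EMetricSpace M] [ChartedSpace (EuclideanHalfSpace d) M]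
  [IsManifold (𝓡∂ d) ∞ M] [RiemannianBundle (fun p : M ↦ TangentSpace (𝓡∂ d) p)]
  [MeasurableSpace M] [BorelSpace M]

/-- The functions in `H¹(Ω, g)` whose trace vanishes on the Dirichlet part of the boundary. -/
def MemH1D (B : Problem M) (u : M → ℝ) : Prop :=
  MemH1 d B.dom u ∧ ∃ τ, IsTrace d B.dom u τ ∧ τ =ᵐ[(surf d M).restrict B.dir] 0

/-- The bilinear form
`T(u, v) = ∫_Ω (g(∇u, ∇v) - q u v) - ∫_{∂_R Ω} r u v`. -/
def form (B : Problem M) (u v : M → ℝ) : ℝ :=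
  ∫ p in B.dom, (inner ℝ (weakGrad d B.dom u p) (weakGrad d B.dom v p) - B.q p * u p * v p)
      ∂(vol d M)
    - ∫ p in B.rob, B.r p * trace d B.dom u p * trace d B.dom v p ∂(surf d M)

/-- `u ∈ L²(Ω, g)` is an eigenfunction of `T` with eigenvalue `t`. -/
def IsEigenfunction (B : Problem M) (t : ℝ) (u : Lp ℝ 2 ((vol d M).restrict B.dom)) : Prop :=
  u ≠ 0 ∧ B.MemH1D d u ∧
    ∀ v : M → ℝ, B.MemH1D d v → B.form d u v = t * ∫ p in B.dom, u p * v p ∂(vol d M)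

variable {G : Type*} [Group G] [MulAction G M]

/-- `u` is `(K, σ)`-invariant on `Ω`: `σ(a) u ∘ a⁻¹ = u` almost everywhere on `Ω`, for all
`a` in the group `K`. -/
def IsInvariant (Ω : Set M) (K : Subgroup G) (σ : G →* ℤˣ) (u : M → ℝ) : Prop :=
  ∀ a ∈ K, (fun p ↦ ((σ a : ℤ) : ℝ) * u (a⁻¹ • p)) =ᵐ[(vol d M).restrict Ω] u

/-- The `(K, σ)`-invariant eigenfunctions of `T` with eigenvalue `t`. -/
def invEigenfunctions (B : Problem M) (K : Subgroup G) (σ : G →* ℤˣ) (t : ℝ) :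
    Set (Lp ℝ 2 ((vol d M).restrict B.dom)) :=
  {u | B.IsEigenfunction d t u ∧ IsInvariant d B.dom K σ u}

/-- The `i`-th `(K, σ)`-eigenvalue of `T` (`i ≥ 1`), the eigenvalues that have a
`(K, σ)`-invariant eigenfunction being listed in non-decreasing order with multiplicity: the least
`t` for which the invariant eigenfunctions with eigenvalue at most `t` span a space of dimension
at least `i`. It is `+∞` if there are fewer than `i` such eigenvalues. -/
def eigenvalue (B : Problem M) (K : Subgroup G) (σ : G →* ℤˣ) (i : ℕ) : EReal :=
  sInf ((fun t : ℝ ↦ (t : EReal)) ''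
    {t : ℝ | (i : Cardinal) ≤ Module.rank ℝ
      (Submodule.span ℝ (⋃ s ∈ Iic t, B.invEigenfunctions d K σ s))})

variable (G) in
/-- Admissible data: `Ω` is a Lipschitz domain; `q` and `r` are smooth; the three boundary parts
are pairwise disjoint open subsets of `∂Ω` whose closures cover `∂Ω`; the group `G` acts on `M` by
smooth diffeomorphisms that map `Ω` onto itself and restrict to isometries of `(closure Ω, g)`, and
it preserves the three boundary parts and the restrictions of `q` and `r` to `closure Ω`. -/
structure IsAdmissible (B : Problem M) : Prop where
  lipschitz : IsLipschitzDomain d B.dom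
  smooth_q : ContMDiff (𝓡∂ d) 𝓘(ℝ) ∞ B.q
  smooth_r : ContMDiff (𝓡∂ d) 𝓘(ℝ) ∞ B.r
  dir_open : ∃ U, IsOpen U ∧ B.dir = frontier B.dom ∩ U
  neu_open : ∃ U, IsOpen U ∧ B.neu = frontier B.dom ∩ U
  rob_open : ∃ U, IsOpen U ∧ B.rob = frontier B.dom ∩ U
  disjoint_dir_neu : Disjoint B.dir B.neu
  disjoint_dir_rob : Disjoint B.dir B.rob
  disjoint_neu_rob : Disjoint B.neu B.rob
  cover : frontier B.dom = closure B.dir ∪ closure B.neu ∪ closure B.rob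
  smooth_act : ∀ a : G, ContMDiff (𝓡∂ d) (𝓡∂ d) ∞ (fun p : M ↦ a • p)
  act_dom : ∀ a : G, a • B.dom = B.dom
  isometry : ∀ a : G, ∀ p ∈ closure B.dom, ∀ v w : TangentSpace (𝓡∂ d) p,
    inner ℝ (mfderiv (𝓡∂ d) (𝓡∂ d) (fun p : M ↦ a • p) p v)
      (mfderiv (𝓡∂ d) (𝓡∂ d) (fun p : M ↦ a • p) p w) = inner ℝ v w
  act_dir : ∀ a : G, a • B.dir = B.dir
  act_neu : ∀ a : G, a • B.neu = B.neu
  act_rob : ∀ a : G, a • B.rob = B.rob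
  act_q : ∀ a : G, ∀ p ∈ closure B.dom, B.q (a • p) = B.q p
  act_r : ∀ a : G, ∀ p ∈ closure B.dom, B.r (a • p) = B.r p

/-- Restriction of square integrable functions to a subdomain. -/
def restrictLp {Ω Ω₁ : Set M} (h : Ω₁ ⊆ Ω) (u : Lp ℝ 2 ((vol d M).restrict Ω)) :
    Lp ℝ 2 ((vol d M).restrict Ω₁) :=
  ((Lp.memLp u).mono_measure (Measure.restrict_mono h le_rfl)).toLp u

end Spectrum

end Problem

section Pieces

variable {M : Type*} [TopologicalSpace M]

/-- The interior boundary `∂Ω₁ ∩ Ω` of a subdomain `Ω₁` of `Ω`. -/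
def intBdry (Ω Ω₁ : Set M) : Set M := frontier Ω₁ ∩ Ω

/-- The exterior boundary of a subdomain `Ω₁` of `Ω`. -/
def extBdry (Ω Ω₁ : Set M) : Set M := frontier Ω₁ \ closure (intBdry Ω Ω₁)

variable {G : Type*} [Group G] [MulAction G M]

/-- The group `G_p` of those elements of `G` that fix pointwise a neighbourhood of `p` in the
interior boundary of `Ω₁`. -/
def localFixer (G : Type*) [Group G] [MulAction G M] (Ω Ω₁ : Set M) (p : M) : Set G :=
  {a | ∃ U : Set M, IsOpen U ∧ p ∈ U ∧ ∀ x ∈ U ∩ intBdry Ω Ω₁, a • x = x}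

/-- `∂₊Ω₁`: the points `p` of the interior boundary with `|G_p| = 2` and `σ(G_p) = {1}`. -/
def plusBdry (σ : G →* ℤˣ) (Ω Ω₁ : Set M) : Set M :=
  {p ∈ intBdry Ω Ω₁ | (localFixer G Ω Ω₁ p).ncard = 2 ∧ σ '' localFixer G Ω Ω₁ p = {1}}

/-- `∂₋Ω₁`: the points `p` of the interior boundary with `|G_p| = 2` and `σ(G_p) = {1, -1}`. -/
def minusBdry (σ : G →* ℤˣ) (Ω Ω₁ : Set M) : Set M :=
  {p ∈ intBdry Ω Ω₁ | (localFixer G Ω Ω₁ p).ncard = 2 ∧ σ '' localFixer G Ω Ω₁ p = {1, -1}}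

/-- The problem induced on the piece `Ω₁`: the boundary conditions of `Ω` on the exterior boundary,
Dirichlet conditions on `∂₋Ω₁` and Neumann conditions on `∂₊Ω₁`. -/
def Problem.reduced (B : Problem M) (σ : G →* ℤˣ) (Ω₁ : Set M) : Problem M where
  dom := Ω₁
  q := B.q
  r := B.r
  dir := minusBdry σ B.dom Ω₁ ∪ (extBdry B.dom Ω₁ ∩ B.dir)
  neu := plusBdry σ B.dom Ω₁ ∪ (extBdry B.dom Ω₁ ∩ B.neu)
  rob := extBdry B.dom Ω₁ ∩ B.rob

/-- `Ω` is partitioned, up to boundaries, into the finitely many pairwise disjoint Lipschitz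
domains `P i`, which `G` permutes transitively. -/
structure IsTransitivePartition (d : ℕ) [NeZero d] {M : Type*} [EMetricSpace M]
    [ChartedSpace (EuclideanHalfSpace d) M] (G : Type*) [Group G] [MulAction G M]
    (Ω : Set M) {n : ℕ} (P : Fin n → Set M) : Prop where
  lipschitz : ∀ i, IsLipschitzDomain d (P i)
  subset : ∀ i, P i ⊆ Ω
  disjoint : ∀ i j, i ≠ j → Disjoint (P i) (P j)
  cover : Ω ⊆ ⋃ i, closure (P i)
  permutes : ∀ (a : G) (i : Fin n), ∃ j, a • P i = P j
  transitive : ∀ i j, ∃ a : G, a • P i = P j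

end Pieces

end EquivSpectrum

end

set_option linter.unusedSectionVars false

noncomputable section

open Set Filter MeasureTheory Bundle
open ENNReal (ofReal ofReal_mul ofReal_le_ofReal ofReal_ne_top mul_ne_top ofReal_lt_top mul_lt_top
  ofReal_one sum_ne_top)
open Finset (sum_congr sum_mul sum_le_sum mul_sum sum_eq_zero mem_insert_of_mem mem_insert_self
  sum_sub_distrib sum_const sum_nonneg sum_add_distrib sum_insert abs_sum_le_sum_abs sum_range_succ
  sum_filter aestronglyMeasurable_fun_sum)
open Metric (ball ball_subset_ball closedBall ball_mem_nhds mem_ball isOpen_ball mem_ball_self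
  eball)
open MeasureTheory.Measure (restrict_mono restrict_restrict restrict_apply)
open Real (norm_eq_abs norm_of_nonneg)
open scoped Manifold ContDiff Topology ENNReal Pointwise

namespace EquivSpectrum

/-! The proof is a reflection principle. For a function `u` on `Ω` let `symm σ u` be the signed sum
of its translates under `G`. Up to the null frontiers of the pieces, the translates of `P k` fill
`Ω`, so a `(G, σ)`-invariant function is determined by its restriction to `P k`. Conversely, an
invariant function `v` on `P k` is, up to the factor `|H|`, the restriction of `ext σ (P k) v`, the
symmetrization of its extension by zero. Symmetrization is self-adjoint for `G`-invariant integrals.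
Hence, for invariant `u`, `T(u, symm w) = |G| T(u, w)` (`form_symm`) and `T(u, ext v) = |G| T_{P
k}(u, v)` (`form_ext`), and the same holds for `L²` products. Once `symm` and `ext` are known to
respect the two form domains, these identities carry the weak eigenvalue equation in both directions
(`mapsTo_restrictLp`, `surjOn_restrictLp`). Restriction is linear and injective on all invariant
functions, so it preserves the dimensions of spans of eigenfunctions and therefore the counted
eigenvalues.

The work lies in the form domains. For restriction, the trace of an invariant function must vanish
on `∂₋`. This holds because symmetrized `C¹` approximants vanish at every point fixed by an element
of sign `-1` (`isTrace_symm_piece`).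

For extension, `ext v` must have no jump across the walls between pieces. Moving the symmetrization
onto the test field, one needs `∫_{P k} div (v Y) = 0` for every `σ`-equivariant field `Y` supported
in `Ω` (`integral_inner_eq`). On `∂₋` the trace of `v` vanishes. On `∂₊` the wall is fixed by an
involution that preserves `Y`, so `Y` is tangent to it. Tangency is used in the form `|dH(Y)| ≤ C
H`, where `H` is the squared displacement in a chart. The cutoffs `H / (H + 1/(n+1))` kill the
boundary values, while their derivatives along `Y` stay bounded and tend to zero
(`exists_displacement`, `EquivSpectrum.exists_flux_eq_zero`). The rest of the wall is null, because
its points are fixed by two distinct nontrivial elements (`surf_fix_inter_fix`), and the flux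
through it is controlled by an `L¹` bound on the boundary values (`EquivSpectrum.exists_flux_le`).

On `∂Ω` the points with nontrivial stabilizer are null (`surf_frontier_inter_fix`). Off them each
boundary point touches a single piece, and the trace of `ext v` is read off piece by piece
(`isTrace_ext`). The null-set results rest on the fact that, for a faithful finite action on a
connected domain, an element whose derivative at a fixed point is the identity is trivial.

The analytic basis consists of the identification of Hausdorff measure in a chart with density times
Lebesgue measure (`chartMeasure_eq`), the divergence theorem (`integral_divergence`), the trace
inequality on Lipschitz domains (`trace_inequality`) and the density of `C¹` functions in `H¹` by
one-sided mollification (`exists_approxH1`). -/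

variable {d : ℕ} [NeZero d] {M : Type*} [EMetricSpace M] [CompactSpace M]
  [ChartedSpace (EuclideanHalfSpace d) M] [IsManifold (𝓡∂ d) ∞ M]
  [RiemannianBundle (fun p : M ↦ TangentSpace (𝓡∂ d) p)]
  [IsContMDiffRiemannianBundle (𝓡∂ d) ∞ (EuclideanSpace ℝ (Fin d)) (fun p : M ↦ TangentSpace (𝓡∂ d) p)]
  [IsRiemannianManifold (𝓡∂ d) M] [MeasurableSpace M] [BorelSpace M]
  {G : Type*} [Group G] [MulAction G M] {σ : G →* ℤˣ} {B : Problem M} {n : ℕ}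
  {P : Fin n → Set M} {k : Fin n} {p c q : M} {A D Ω O : Set M}

/-- The model with corners; below: `ϑ` the volume, `Γ`, `𝓒` the extended and the plain chart at a
point, `Θ` the inverse of `Γ`, `Δ` the domain of the chart, `Ξ` the interior of the manifold, `𝓣` its
tangent spaces, `Λ`, `𝓢` the restrictions of the volume and of the surface measure to a set, `Ck` the
functions of class `C^k`, `𝓓` the differential, `𝐞` the standard basis, `ℓ` the action of `G`. -/
local notation "Υ" => 𝓡∂ d
local notation "ϑ" => vol d M
local notation:max "Γ" => extChartAt Υ
local notation:max "𝓒" => chartAt (EuclideanHalfSpace d)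
local notation:max "Θ" c:max => PartialEquiv.symm (extChartAt Υ c)
local notation:max "Δ" c:max =>
  PartialEquiv.source (PartialHomeomorph.toPartialEquiv
    (OpenPartialHomeomorph.toPartialHomeomorph (chartAt (EuclideanHalfSpace d) c)))
local notation:max "Ξ" M:max => ModelWithCorners.interior (I := Υ) M
local notation:max "𝓣" => TangentSpace Υ
local notation:max "Λ" s:max => Measure.restrict ϑ s
local notation:max "𝓢" s:max => Measure.restrict (surf d _) s
local notation:max "Ck" => ContMDiff Υ 𝓘(ℝ)
local notation:max "𝓓" => mfderiv Υ 𝓘(ℝ)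
local notation:max "𝐞" i:max => EuclideanSpace.single i (1 : ℝ)
local notation "IsWG" => IsWeakGradient d
local notation "IsLD" => IsLipschitzDomain d
local notation "Dv" => divergence d
local notation "VC" => vecCoord d
local notation "VD" => volDensity d
local notation "Tr" => IsTrace d
local notation:max "ℓ" b:max => fun p : M => b • p

/-- Vector fields. -/
abbrev VF (d : ℕ) [NeZero d] (M : Type*) [EMetricSpace M] [ChartedSpace (EuclideanHalfSpace d) M]
    [IsManifold (𝓡∂ d) ∞ M] := ∀ p : M, TangentSpace (𝓡∂ d) p

local notation "VM" => VF d M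

variable {X V W Y : VF d M} {f u u' w τ η v : M → ℝ}

/-- The model space `ℝ^d`. -/
abbrev Eu (d : ℕ) : Type := EuclideanSpace ℝ (Fin d)

local notation "Є" => Eu d

variable (d) in
lemma mem_src (p : M) : p ∈ Δ p := mem_chart_source _ p

lemma one_le_infty : (1 : ℕ∞ω) ≤ (∞ : ℕ∞ω) := by exact_mod_cast le_top

lemma exists_bound {M : Type*} [TopologicalSpace M] [CompactSpace M] {f : M → ℝ} (hf : Continuous f)
    : ∃ C, ∀ p, ‖f p‖ ≤ C := by
  simpa using isCompact_univ.exists_bound_of_continuousOn hf.continuousOn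

lemma squeeze {ι : Type*} {l : Filter ι} {f g : ι → ℝ≥0∞} (hg : Tendsto g l (𝓝 0)) (h : ∀ i, f i ≤ g
    i) : Tendsto f l (𝓝 0) :=
  tendsto_of_tendsto_of_tendsto_of_le_of_le tendsto_const_nhds hg (fun _ => zero_le) h

lemma lintegral_ofReal_mul {α : Type*} [MeasurableSpace α] {μ : Measure α} {c : ℝ} {f : α → ℝ≥0∞} :
    ∫⁻ x, ofReal c * f x ∂μ = ofReal c * ∫⁻ x, f x ∂μ :=
  lintegral_const_mul' _ _ ofReal_ne_top

/-! ### Tangent coordinates and the metric in a chart -/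

/-- The tangent vector at `p` with coordinates `v` in the preferred chart at `c`. -/
def lift (c p : M) : Є →ₗ[ℝ] 𝓣 p := ((trivializationAt Є 𝓣 c).symmₗ ℝ p)

/-- The coordinates of a tangent vector at `p` in the preferred chart at `c`. -/
def coord (c p : M) : 𝓣 p →ₗ[ℝ] Є := ((trivializationAt Є 𝓣 c).linearMapAt ℝ p)

lemma mem_baseSet (hp : p ∈ Δ c) : p ∈ (trivializationAt Є 𝓣 c).baseSet := by
  rwa [TangentBundle.trivializationAt_baseSet]

lemma lift_apply (hp : p ∈ Δ c) (v : Є) : lift c p v = (trivializationAt Є 𝓣 c).symm p v := by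
  rw [lift, Trivialization.coe_symmₗ _ (mem_baseSet hp)]

lemma coord_lift (hp : p ∈ Δ c) (v : Є) : coord c p (lift c p v) = v :=
  (trivializationAt Є 𝓣 c).linearMapAt_symmₗ (mem_baseSet hp) v

lemma lift_coord (hp : p ∈ Δ c) (v : 𝓣 p) : lift c p (coord c p v) = v :=
  (trivializationAt Є 𝓣 c).symmₗ_linearMapAt (mem_baseSet hp) v

lemma vecCoord_eq (hp : p ∈ Δ c) (X : VM) : VC X c p = coord c p (X p) :=
    by rw [coord, vecCoord, Trivialization.linearMapAt_apply, if_pos (mem_baseSet hp)]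

/-- Coordinates as a linear equivalence. -/
def liftEquiv (hp : p ∈ Δ c) : Є ≃ₗ[ℝ] 𝓣 p :=
  LinearEquiv.ofLinearMap (lift c p) (coord c p) (LinearMap.ext (lift_coord hp))
    (LinearMap.ext (coord_lift hp))

lemma coord_mfderiv_eq (hp : p ∈ Δ c) (v : 𝓣 p) : coord c p v = mfderiv Υ 𝓘(ℝ, Є) (Γ c) p v
    := by rw [← TangentBundle.continuousLinearMapAt_trivializationAt hp]; rfl

lemma lift_mfderiv_eq (hp : p ∈ Δ c) (v : Є) : lift c p v = mfderivWithin 𝓘(ℝ, Є) Υ (Θ c) (range Υ)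
    (Γ c p) v := by rw [← TangentBundle.symmL_trivializationAt hp]; rfl

lemma contMDiffOn_lift (c : M) (v : Є) : ContMDiffOn Υ (Υ).tangent ∞ (fun p => (⟨p, lift c p v⟩ :
    TangentBundle Υ M)) Δ c := by
  have h := (trivializationAt Є 𝓣 c).contMDiffOn_symm (IB := Υ) (n := ∞)
  have h2 : ContMDiffOn Υ ((Υ).prod 𝓘(ℝ, Є)) ∞ (fun p : M => (p, v)) Δ c :=
    contMDiffOn_id.prodMk contMDiffOn_const
  refine (h.comp h2 ?_).congr ?_
  · intro p hp; rw [Trivialization.target_eq]; exact ⟨mem_baseSet hp, mem_univ _⟩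
  · intro p hp; simp only [Function.comp_apply]
    rw [lift_apply hp, Trivialization.mk_symm _ (mem_baseSet hp)]

/-- Freezes the metric at one point: `T` carries the inner product of the tangent space, read in
coordinates, to the standard one, so that `T` composed with the chart is almost an isometry near
`p`. -/
lemma exists_isometry_frame (hp : p ∈ Δ c) : ∃ T : Є ≃L[ℝ] Є, (∀ v w, inner ℝ (T v) (T w) = inner ℝ
    (lift c p v) (lift c p w)) := by
  have : FiniteDimensional ℝ (𝓣 p) := (liftEquiv hp).finiteDimensional
  have hd : Module.finrank ℝ (𝓣 p) = d := by rw [← (liftEquiv hp).finrank_eq]; simp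
  let b := (stdOrthonormalBasis ℝ (𝓣 p)).reindex (finCongr hd)
  refine ⟨((liftEquiv hp).trans b.repr.toLinearEquiv).toContinuousLinearEquiv, fun v w => ?_⟩
  exact b.repr.inner_map_map _ _

lemma volDensity_eq (hp : p ∈ Δ c) : VD c p = √(Matrix.det (Matrix.of fun i j : Fin d => inner ℝ
    (lift c p (𝐞 i)) (lift c p (EuclideanSpace.single j 1)))) := by simp only [lift_apply hp]; rfl

/-- The Gram matrix equals `Aᵀ A` with `A` the matrix of `T`. The density is thus the factor by
which `T` scales Lebesgue measure. -/
lemma volDensity_eq_det (hp : p ∈ Δ c) (T : Є ≃L[ℝ] Є) (hT : ∀ v w, inner ℝ (T v) (T w) = inner ℝ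
    (lift c p v) (lift c p w)) : VD c p = |LinearMap.det (T : Є →ₗ[ℝ] Є)| := by
  let b := (EuclideanSpace.basisFun (Fin d) ℝ).toBasis
  let A := LinearMap.toMatrix b b (T : Є →ₗ[ℝ] Є)
  have hA : (Matrix.of fun i j : Fin d =>
      inner ℝ (lift c p (𝐞 i)) (lift c p (𝐞 j))) = A.transpose * A := by
    ext i j; rw [Matrix.of_apply, ← hT, Matrix.mul_apply, PiLp.inner_apply]
    refine sum_congr rfl fun k _ => ?_; simp [A, b, LinearMap.toMatrix_apply, mul_comm]
  rw [volDensity_eq hp, hA, Matrix.det_mul, Matrix.det_transpose, ← sq, Real.sqrt_sq_eq_abs,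
    LinearMap.det_toMatrix]

lemma volDensity_pos (hp : p ∈ Δ c) : 0 < VD c p := by
  obtain ⟨T, hT⟩ := exists_isometry_frame hp; rw [volDensity_eq_det hp T hT]
  exact abs_pos.2 (LinearEquiv.isUnit_det' T.toLinearEquiv).ne_zero

lemma contMDiffOn_inner_lift (c : M) (v w : Є) : ContMDiffOn Υ 𝓘(ℝ) ∞ (fun p => inner ℝ (lift c p v)
    (lift c p w)) Δ c :=
  ContMDiffOn.inner_bundle (contMDiffOn_lift c v) (contMDiffOn_lift c w)

lemma contMDiffOn_volDensity (c : M) : ContMDiffOn Υ 𝓘(ℝ) ∞ (VD c) Δ c := by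
  have h1 : ContMDiffOn Υ 𝓘(ℝ) ∞ (fun p => Matrix.det (Matrix.of fun i j : Fin d =>
      inner ℝ (lift c p (𝐞 i)) (lift c p (𝐞 j))))
      Δ c := by
    simp only [Matrix.det_apply, Matrix.of_apply, Units.smul_def, zsmul_eq_mul]
    exact contMDiffOn_finsetSum fun i _ => contMDiffOn_const.mul
      (contMDiffOn_finsetProd fun j _ => contMDiffOn_inner_lift c _ _)
  intro p hp
  have h2 : Matrix.det (Matrix.of fun i j : Fin d =>
      inner ℝ (lift c p (𝐞 i)) (lift c p (𝐞 j))) ≠ 0 := by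
    intro h; have := volDensity_pos hp; rw [volDensity_eq hp, h] at this; simp at this
  have h3 := (Real.contDiffAt_sqrt h2 (n := ∞)).contMDiffAt.comp_contMDiffWithinAt p (h1 p hp)
  exact h3.congr (fun q hq => volDensity_eq hq) (volDensity_eq hp)

/-- The metric is determined by finitely many continuous Gram entries, so the quadratic forms at `q`
and at `p` differ by at most a small multiple of the one at `p`, uniformly in the vector. -/
lemma eventually_norm_lift_le (hp : p ∈ Δ c) {r : ℝ} (hr : 1 < r) : ∀ᶠ q in 𝓝 p, ∀ v : Є, ‖lift c q
    v‖ ≤ r * ‖lift c p v‖ ∧ ‖lift c p v‖ ≤ r * ‖lift c q v‖ := by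
  obtain ⟨T, hT⟩ := exists_isometry_frame hp
  have hTn : ∀ v, ‖T v‖ ^ 2 = ‖lift c p v‖ ^ 2 := fun v => by
    rw [← real_inner_self_eq_norm_sq, ← real_inner_self_eq_norm_sq, hT]
  obtain ⟨C, hC0, hC⟩ : ∃ C : ℝ, 0 < C ∧ ∀ v : Є, ‖v‖ ^ 2 ≤ C * ‖lift c p v‖ ^ 2 := by
    refine ⟨(‖(T.symm : Є →L[ℝ] Є)‖ + 1) ^ 2, by positivity, fun v => ?_⟩; rw [← hTn, ← mul_pow]
    gcongr
    calc ‖v‖ = ‖(T.symm : Є →L[ℝ] Є) (T v)‖ := by simp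
      _ ≤ ‖(T.symm : Є →L[ℝ] Є)‖ * ‖T v‖ := ContinuousLinearMap.le_opNorm _ _
      _ ≤ _ := by gcongr; linarith
  let g : Fin d → Fin d → M → ℝ := fun i j q => inner ℝ (lift c q (𝐞 i)) (lift c q (𝐞 j))
  have hexp : ∀ q (v : Є), ‖lift c q v‖ ^ 2 = ∑ i, ∑ j, v i * v j * g i j q := by
    intro q v
    have hv : v = ∑ i, v i • (𝐞 i) := by
      have := (EuclideanSpace.basisFun (Fin d) ℝ).sum_repr v; simpa using this.symm
    conv_lhs => rw [hv]
    rw [← real_inner_self_eq_norm_sq]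
    simp only [map_sum, map_smul, sum_inner, inner_sum, real_inner_smul_left, real_inner_smul_right]
    exact sum_congr rfl fun i _ => sum_congr rfl fun j _ => by
      simp only [g]; rw [real_inner_comm]; ring
  -- This choice gives `1 - θ = 1 / r²` exactly, and `1 + θ ≤ r²` because `r² + 1 / r² ≥ 2`.
  set θ : ℝ := 1 - 1 / r ^ 2 with hθ; have hr2 : 1 < r ^ 2 := by nlinarith
  have hθ0 : 0 < θ := by rw [hθ, sub_pos, div_lt_one (by positivity)]; exact hr2
  have hd0 : 0 < (d : ℝ) := by exact_mod_cast Nat.pos_of_ne_zero (NeZero.ne d)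
  have hev : ∀ᶠ q in 𝓝 p, ∀ i j, |g i j q - g i j p| ≤ θ / (C * d * d) := by
    simp only [eventually_all]; intro i j
    have hcont : ContinuousAt (g i j) p :=
      ((contMDiffOn_inner_lift c _ _).continuousOn p hp).continuousAt
        ((𝓒 c).open_source.mem_nhds hp)
    have := Metric.tendsto_nhds.1 hcont.tendsto (θ / (C * d * d)) (by positivity)
    filter_upwards [this] with q hq; rw [Real.dist_eq] at hq; exact hq.le
  filter_upwards [hev] with q hq v
  have hdiff : |‖lift c q v‖ ^ 2 - ‖lift c p v‖ ^ 2| ≤ θ * ‖lift c p v‖ ^ 2 := by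
    rw [hexp q v, hexp p v, ← sum_sub_distrib, ← hexp p v]
    calc |∑ i, (∑ j, v i * v j * g i j q - ∑ j, v i * v j * g i j p)|
        ≤ ∑ i, ∑ j, ‖v‖ ^ 2 * (θ / (C * d * d)) := by
          refine (abs_sum_le_sum_abs _ _).trans (sum_le_sum fun i _ => ?_); rw [← sum_sub_distrib]
          refine (abs_sum_le_sum_abs _ _).trans (sum_le_sum fun j _ => ?_)
          rw [← mul_sub, abs_mul, abs_mul, sq]
          have h1 : |v i| ≤ ‖v‖ := by simpa using PiLp.norm_apply_le v i
          have h2 : |v j| ≤ ‖v‖ := by simpa using PiLp.norm_apply_le v j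
          have := hq i j; gcongr
      _ = ‖v‖ ^ 2 * (θ / C) := by
          simp only [sum_const, Finset.card_univ, Fintype.card_fin, nsmul_eq_mul]; field_simp
      _ ≤ (C * ‖lift c p v‖ ^ 2) * (θ / C) := by gcongr; exact hC v
      _ = _ := by field_simp
  obtain ⟨h1, h2⟩ := abs_le.1 hdiff; have hr0 : 0 < r := by linarith
  have h5 : (1 + θ) ≤ r ^ 2 := by
    rw [hθ]; have : 1 / r ^ 2 * r ^ 2 = 1 := by field_simp
    nlinarith [sq_nonneg (r ^ 2 - 1), this, sq_nonneg (1 / r ^ 2 - 1), sq_nonneg (1 / r ^ 2 - r ^ 2)]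
  constructor
  · refine le_of_sq_le_sq ?_ (by positivity); rw [mul_pow]; nlinarith [sq_nonneg ‖lift c p v‖]
  · refine le_of_sq_le_sq ?_ (by positivity); rw [mul_pow]
    have h6 : ‖lift c p v‖ ^ 2 * (1 / r ^ 2) ≤ ‖lift c q v‖ ^ 2 := by rw [hθ] at h1; nlinarith
    calc ‖lift c p v‖ ^ 2 = r ^ 2 * (‖lift c p v‖ ^ 2 * (1 / r ^ 2)) := by field_simp
      _ ≤ _ := by gcongr

/-! ### Strict differentiability and comparison of distances near a point -/

/-- The mean value inequality on the convex set `ball ∩ s`. Working within a convex set covers the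
half space, hence also boundary points of the manifold. -/
lemma _root_.ContDiffWithinAt.exists_strict {E F : Type*} [NormedAddCommGroup E] [NormedSpace ℝ E]
    [NormedAddCommGroup F] [NormedSpace ℝ F] {f : E → F} {s : Set E} {x : E} (hs : Convex ℝ s) (hu :
    UniqueDiffOn ℝ s) (hx : x ∈ s) (h : ContDiffWithinAt ℝ 1 f s x) {ε : ℝ} (hε : 0 < ε) : ∃ δ > 0,
    ∀ y ∈ ball x δ ∩ s, ∀ z ∈ ball x δ ∩ s, ‖f z - f y - fderivWithin ℝ f s x (z - y)‖ ≤ ε * ‖z - y‖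
    := by
  have h1 : ContinuousWithinAt (fderivWithin ℝ f s) s x :=
    (h.fderivWithin_right (m := 0) hu (by norm_num) hx).continuousWithinAt
  have h2 : ∀ᶠ y in 𝓝[s] x, ContDiffWithinAt ℝ 1 f s y := by
    have := h.eventually (by simp); rwa [insert_eq_of_mem hx] at this
  have h3 : ∀ᶠ y in 𝓝[s] x, ‖fderivWithin ℝ f s y - fderivWithin ℝ f s x‖ ≤ ε := by
    filter_upwards [Metric.tendsto_nhds.1 h1.tendsto ε hε] with y hy
    rw [dist_eq_norm] at hy; exact hy.le
  obtain ⟨δ, hδ, hball⟩ := Metric.mem_nhdsWithin_iff.1 (h2.and h3)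
  refine ⟨δ, hδ, fun y hy z hz => ?_⟩
  have hconv : Convex ℝ (ball x δ ∩ s) := (convex_ball _ _).inter hs
  refine hconv.norm_image_sub_le_of_norm_hasFDerivWithin_le'
    (f' := fderivWithin ℝ f s) (fun w hw => ?_) (fun w hw => (hball hw).2) hy hz
  exact (((hball hw).1.differentiableWithinAt (by simp)).hasFDerivWithinAt).mono inter_subset_right

lemma exists_ball_extChartAt (hp : p ∈ Δ c) {s : Set M} (hs : s ∈ 𝓝 p) : ∃ R > 0, ∀ y ∈ ball (Γ c p)
    R ∩ range Υ, y ∈ (Γ c).target ∧ (Θ c) y ∈ s := by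
  have hp' : p ∈ (Γ c).source := by rwa [extChartAt_source]
  have h1 := extChartAt_target_mem_nhdsWithin' (I := Υ) hp'
  have h2 : (Θ c) ⁻¹' s ∈ 𝓝[range Υ] (Γ c p) :=
    nhdsWithin_le_nhds (extChartAt_preimage_mem_nhds' hp' hs)
  obtain ⟨R, hR, h⟩ := Metric.mem_nhdsWithin_iff.1 (inter_mem h1 h2)
  exact ⟨R, hR, fun y hy => h hy⟩

lemma preimage_ball_mem_nhds (hp : p ∈ Δ c) {R : ℝ} (hR : 0 < R) : Δ c ∩ Γ c ⁻¹' ball (Γ c p) R ∈ 𝓝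
    p := by
  have hp' : p ∈ (Γ c).source := by rwa [extChartAt_source]
  exact inter_mem ((𝓒 c).open_source.mem_nhds hp)
    ((continuousAt_extChartAt' hp').preimage_mem_nhds (ball_mem_nhds _ hR))

/-- The derivative of `a : M → M` at `p` in the preferred charts at `c` and `c'`. -/
def derivCoord (a : M → M) (c c' p : M) : Є →ₗ[ℝ] Є :=
  coord c' (a p) ∘ₗ (mfderiv Υ Υ a p).toLinearMap ∘ₗ lift c p

lemma derivCoord_apply (a : M → M) (c c' p : M) (v : Є) : derivCoord a c c' p v = coord c' (a p)
    (mfderiv Υ Υ a p (lift c p v)) := rfl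

lemma contDiffWithinAt_chart {a : M → M} {n : ℕ∞ω} (ha : ContMDiff Υ Υ n a) (hn : n ≤ (∞ : ℕ∞ω)) {c'
    : M} (hp : p ∈ Δ c) (hp' : a p ∈ Δ c') : ContDiffWithinAt ℝ n (Γ c' ∘ a ∘ (Θ c)) (range Υ) (Γ c
    p) := by
  have : IsManifold Υ n M := IsManifold.of_le (n := ∞) hn
  have h := (contMDiffAt_iff_of_mem_source hp hp').1 (ha p); exact h.2

lemma fderivWithin_chart {a : M → M} (ha : ContMDiff Υ Υ 1 a) {c' : M} (hp : p ∈ (𝓒 c).source) (hp'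
    : a p ∈ Δ c') (v : Є) : fderivWithin ℝ (Γ c' ∘ a ∘ (Θ c)) (range Υ) (Γ c p) v = derivCoord a c
    c' p v := by
  have hps : p ∈ (Γ c).source := by rwa [extChartAt_source]
  have hinv : (Θ c) (Γ c p) = p := (Γ c).left_inv hps
  have huniq : UniqueMDiffWithinAt 𝓘(ℝ, Є) (range Υ) (Γ c p) :=
    (uniqueMDiffWithinAt_iff_uniqueDiffWithinAt).2
      ((Υ).uniqueDiffOn _ (extChartAt_target_subset_range c ((Γ c).map_source hps)))
  have hsymm : MDifferentiableWithinAt 𝓘(ℝ, Є) Υ (Θ c) (range Υ) (Γ c p) :=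
    mdifferentiableWithinAt_extChartAt_symm ((Γ c).map_source hps)
  rw [derivCoord_apply, coord_mfderiv_eq hp', lift_mfderiv_eq hp, ← mfderivWithin_eq_fderivWithin]
  have ha' : MDifferentiableAt Υ Υ a (Θ c (Γ c p)) := ha.mdifferentiable one_ne_zero _
  have hc' : MDifferentiableAt Υ 𝓘(ℝ, Є) (Γ c')
      (a (Θ c (Γ c p))) := by rw [hinv]; exact mdifferentiableAt_extChartAt hp'
  have h1 := mfderiv_comp_mfderivWithin (x := Γ c p) ha' hsymm huniq
  have h2 := mfderiv_comp_mfderivWithin (x := Γ c p)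
    (f := a ∘ (Θ c)) hc' (ha'.comp_mdifferentiableWithinAt _ hsymm) huniq
  rw [h2, h1]
  -- The chain rule produces derivatives at `Θ c (Γ c p)`, whose tangent space is formally a
  -- different type from that at `p`. Generalizing the base point allows the equality of points to
  -- be substituted.
  have key : ∀ (q : M) (w : Є), q = p → mfderiv Υ 𝓘(ℝ, Є) (Γ c') (a q) (mfderiv Υ Υ a q w) =
      mfderiv Υ 𝓘(ℝ, Є) (Γ c') (a p) (mfderiv Υ Υ a p w) := by rintro q w rfl; rfl
  exact key _ _ hinv

lemma eventually_strict {a : M → M} (ha : ContMDiff Υ Υ 1 a) {c' : M} (hp : p ∈ (𝓒 c).source) (hp' :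
    a p ∈ Δ c') {ε : ℝ} (hε : 0 < ε) : ∃ N ∈ 𝓝 p, ∀ y ∈ N, ∀ z ∈ N, ‖Γ c' (a z) - Γ c' (a y) -
    derivCoord a c c' p (Γ c z - Γ c y)‖ ≤ ε * ‖Γ c z - Γ c y‖ := by
  have hps : p ∈ (Γ c).source := by rwa [extChartAt_source]
  obtain ⟨δ, hδ, h⟩ := (contDiffWithinAt_chart ha one_le_infty hp hp').exists_strict (Υ).convex_range
    (Υ).uniqueDiffOn (extChartAt_target_subset_range c ((Γ c).map_source hps)) hε
  refine ⟨_, preimage_ball_mem_nhds hp hδ, fun y hy z hz => ?_⟩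
  have hmem : ∀ y ∈ Δ c ∩ Γ c ⁻¹' ball (Γ c p) δ, Γ c y ∈ ball (Γ c p) δ ∩ range Υ ∧
      (Θ c) (Γ c y) = y := by
    intro y hy; have hys : y ∈ (Γ c).source := by rw [extChartAt_source]; exact hy.1
    exact ⟨⟨hy.2, extChartAt_target_subset_range c ((Γ c).map_source hys)⟩, (Γ c).left_inv hys⟩
  have := h _ (hmem y hy).1 _ (hmem z hz).1; rw [fderivWithin_chart ha hp hp'] at this
  simpa only [Function.comp_apply, (hmem y hy).2, (hmem z hz).2] using this

/-- The straight segment in the chart is an admissible curve from `y` to `z`: a small ball meets the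
half space in a convex set. Its length is at most `r` times its length in the metric frozen at `p`.
-/
lemma eventually_edist_le (hp : p ∈ Δ c) {r : ℝ} (hr : 1 < r) : ∃ N ∈ 𝓝 p, ∀ y ∈ N, ∀ z ∈ N, edist y
    z ≤ ofReal (r * ‖lift c p (Γ c z - Γ c y)‖) := by
  obtain ⟨R, hR, hball⟩ := exists_ball_extChartAt hp (inter_mem (eventually_norm_lift_le hp hr)
    ((𝓒 c).open_source.mem_nhds hp))
  refine ⟨_, preimage_ball_mem_nhds hp hR, fun y hy z hz => ?_⟩
  have hys : y ∈ (Γ c).source := by rw [extChartAt_source]; exact hy.1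
  have hzs : z ∈ (Γ c).source := by rw [extChartAt_source]; exact hz.1
  rw [IsRiemannianManifold.out (I := Υ) y z]; set φ := Γ c with hφ
  let η := ContinuousAffineMap.lineMap (R := ℝ) (φ y) (φ z)
  set γ := φ.symm ∘ η with hγ
  have hη : ∀ t ∈ Icc (0 : ℝ) 1, η t ∈ ball (φ p) R ∩ range Υ := by
    have hconv : Convex ℝ (ball (φ p) R ∩ range Υ) := (convex_ball _ _).inter (Υ).convex_range
    have hsub := hconv.segment_subset (x := φ y) (y := φ z)
      ⟨hy.2, extChartAt_target_subset_range c (φ.map_source hys)⟩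
      ⟨hz.2, extChartAt_target_subset_range c (φ.map_source hzs)⟩
    intro t ht; apply hsub; rw [segment_eq_image_lineMap]
    exact ⟨t, ht, by simp [η, ContinuousAffineMap.coe_lineMap_eq]⟩
  have hηd : ContDiff ℝ 1 η := ContinuousAffineMap.contDiff _
  have η_smooth : ContMDiffOn 𝓘(ℝ, ℝ) 𝓘(ℝ, Є) 1 η (Icc 0 1) := hηd.contMDiff.contMDiffOn
  have h1 : Manifold.riemannianEDist Υ y z ≤ Manifold.pathELength Υ γ 0 1 := by
    apply Manifold.riemannianEDist_le_pathELength _ _ _ zero_le_one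
    · exact (contMDiffOn_extChartAt_symm c).comp η_smooth (fun t ht => (hball _ (hη t ht)).1)
    · simp [hγ, η, ContinuousAffineMap.coe_lineMap_eq, φ.left_inv hys]
    · simp [hγ, η, ContinuousAffineMap.coe_lineMap_eq, φ.left_inv hzs]
  refine h1.trans ?_; rw [Manifold.pathELength_eq_lintegral_mfderivWithin_Icc]
  calc _ ≤ ∫⁻ _ in Icc (0 : ℝ) 1, ofReal (r * ‖lift c p (φ z - φ y)‖) := by
        refine setLIntegral_mono' measurableSet_Icc (fun t ht => ?_); have hb := hball _ (hη t ht)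
        have hs : φ.symm (η t) ∈ Δ c := hb.2.2
        have hcomp : mfderivWithin 𝓘(ℝ, ℝ) Υ γ (Icc 0 1) t =
            (mfderivWithin 𝓘(ℝ, Є) Υ φ.symm (range Υ) (η t)) ∘L
              (mfderivWithin 𝓘(ℝ, ℝ) 𝓘(ℝ, Є) η (Icc 0 1) t) := by
          apply mfderivWithin_comp
          · exact mdifferentiableWithinAt_extChartAt_symm hb.1
          · exact η_smooth.mdifferentiableOn one_ne_zero t ht
          · exact fun t ht => (hη t ht).2
          · rw [uniqueMDiffWithinAt_iff_uniqueDiffWithinAt]; exact uniqueDiffOn_Icc zero_lt_one t ht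
        have hη1 : mfderivWithin 𝓘(ℝ, ℝ) 𝓘(ℝ, Є) η (Icc 0 1) t (1 : ℝ) = φ z - φ y := by
          have hder : HasDerivAt η (φ z - φ y) t := by
            have := AffineMap.hasDerivAt_lineMap (a := φ y) (b := φ z) (x := t)
            simpa [η, ContinuousAffineMap.coe_lineMap_eq] using this
          rw [mfderivWithin_eq_fderivWithin, fderivWithin_eq_fderiv
            (uniqueDiffOn_Icc zero_lt_one t ht) hder.differentiableAt,
            hder.hasFDerivAt.fderiv]
          exact one_smul ℝ _
        have hval : mfderivWithin 𝓘(ℝ, ℝ) Υ γ (Icc 0 1) t (1 : ℝ) =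
            lift c (φ.symm (η t)) (φ z - φ y) := by
          rw [lift_mfderiv_eq hs, ← hη1, ← hφ, φ.right_inv hb.1, hcomp]; rfl
        refine (congrArg (‖·‖ₑ) hval).trans_le ?_; change ‖lift c (φ.symm (η t)) (φ z - φ y)‖ₑ ≤ _
        rw [← ofReal_norm]; exact ofReal_le_ofReal ((hb.2.1 _).1)
    _ = _ := by simp

/-- A nearly shortest curve between points close to `p` stays where the metric is comparable with
the frozen one, and there its chart image is at least as long as the chord. -/
lemma eventually_le_edist (hp : p ∈ Δ c) {r : ℝ} (hr : 1 < r) : ∃ N ∈ 𝓝 p, ∀ y ∈ N, ∀ z ∈ N, ofReal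
    ‖lift c p (Γ c z - Γ c y)‖ ≤ ofReal r * edist y z := by
  obtain ⟨ρ, hρ, hρt, hball⟩ : ∃ ρ > 0, ρ ≠ ⊤ ∧ eball p ρ ⊆
      {q | ∀ v : Є, ‖lift c q v‖ ≤ r * ‖lift c p v‖ ∧ ‖lift c p v‖ ≤ r * ‖lift c q v‖} ∩ Δ c := by
    obtain ⟨ρ, hρ, h⟩ := EMetric.mem_nhds_iff.1 (inter_mem (eventually_norm_lift_le hp hr)
      ((𝓒 c).open_source.mem_nhds hp))
    exact ⟨min ρ 1, lt_min hρ one_pos, by simp,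
      (Metric.eball_subset_eball (min_le_left _ _)).trans h⟩
  obtain ⟨T, hT⟩ := exists_isometry_frame hp
  have hTn : ∀ v, ‖T v‖ = ‖lift c p v‖ := fun v => by
    rw [norm_eq_sqrt_real_inner, norm_eq_sqrt_real_inner, hT]
  -- Points within `ρ/4` of `p` are less than `ρ/2` apart, so a curve from `y` of length at most
  -- `ρ/2` remains in the ball of radius `ρ`.
  refine ⟨eball p (ρ / 4), Metric.eball_mem_nhds _ (by simp [hρ.ne']), fun y hy z hz => ?_⟩
  have hr0 : ofReal r ≠ 0 := by simp; linarith
  set φ := Γ c with hφ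
  -- The distance is an infimum of lengths and need not be attained, so the bound is proved for
  -- every `L` slightly above it.
  suffices H : ∀ L, edist y z < L → L ≤ ρ / 2 → ofReal ‖lift c p (φ z - φ y)‖ ≤ ofReal r * L by
    have he : edist y z < ρ / 2 := by
      have h4 : ρ / 4 + ρ / 4 ≤ ρ / 2 := by
        rw [← two_mul, show (4 : ℝ≥0∞) = 2 * 2 by norm_num, mul_comm 2 (ρ / _),
          ENNReal.div_eq_inv_mul, ENNReal.mul_inv (by simp) (by simp), ENNReal.div_eq_inv_mul,
          mul_comm _ (2 : ℝ≥0∞), ← mul_assoc, ← mul_assoc, ENNReal.mul_inv_cancel (by simp) (by simp), one_mul]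
      calc edist y z ≤ edist y p + edist z p := edist_triangle_right _ _ _
        _ < ρ / 4 + ρ / 4 := ENNReal.add_lt_add hy hz
        _ ≤ ρ / 2 := h4
    by_contra! hlt
    have h1 : edist y z < ofReal ‖lift c p (φ z - φ y)‖ / ofReal r := by
      rw [ENNReal.lt_div_iff_mul_lt (Or.inl hr0) (Or.inl ofReal_ne_top), mul_comm]; exact hlt
    obtain ⟨L, hL1, hL2⟩ := exists_between (lt_min h1 he)
    have h2 := H L hL1 (hL2.le.trans (min_le_right _ _)); have h3 := hL2.trans_le (min_le_left _ _)
    rw [ENNReal.lt_div_iff_mul_lt (Or.inl hr0) (Or.inl ofReal_ne_top), mul_comm] at h3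
    exact absurd h2 (not_le.2 h3)
  intro L hL hLρ; rw [IsRiemannianManifold.out (I := Υ) y z] at hL
  obtain ⟨γ, hγ0, hγ1, γ_smooth, hγ⟩ := Manifold.exists_lt_of_riemannianEDist_lt hL
  have hmem : ∀ t ∈ Icc (0 : ℝ) 1, γ t ∈ eball p ρ := by
    intro t ht
    have h1 : edist y (γ t) ≤ L := by
      rw [IsRiemannianManifold.out (I := Υ) y (γ t)]
      calc _ ≤ Manifold.pathELength Υ γ 0 t :=
            Manifold.riemannianEDist_le_pathELength (γ_smooth.mono (Icc_subset_Icc_right ht.2))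
              hγ0 rfl ht.1
        _ ≤ Manifold.pathELength Υ γ 0 1 := Manifold.pathELength_mono le_rfl ht.2
        _ ≤ L := hγ.le
    calc edist (γ t) p ≤ edist (γ t) y + edist y p := edist_triangle _ _ _
      _ < ρ / 2 + ρ / 2 := by
          rw [edist_comm (γ t)]
          refine ENNReal.add_lt_add_of_le_of_lt ?_ (h1.trans hLρ) (hy.trans_le ?_)
          · exact ne_top_of_le_ne_top (ENNReal.div_ne_top hρt (by simp)) (h1.trans hLρ)
          · exact ENNReal.div_le_div_left (by norm_num) _
      _ = ρ := ENNReal.add_halves ρ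
  have hsrc : ∀ t ∈ Icc (0 : ℝ) 1, γ t ∈ Δ c := fun t ht => (hball (hmem t ht)).2
  let f : ℝ → Є := fun t => T (φ (γ t))
  have hφγ : ContMDiffOn 𝓘(ℝ, ℝ) 𝓘(ℝ, Є) 1 (φ ∘ γ) (Icc 0 1) :=
    contMDiffOn_extChartAt.comp (t := Δ c) γ_smooth hsrc
  have hφγ' : ContDiffOn ℝ 1 (φ ∘ γ) (Icc 0 1) := contMDiffOn_iff_contDiffOn.1 hφγ
  have hf : ContDiffOn ℝ 1 f (Icc 0 1) := T.contDiff.comp_contDiffOn hφγ'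
  have h1 : ofReal ‖lift c p (φ z - φ y)‖ = ‖f 1 - f 0‖ₑ := by
    rw [← ofReal_norm, ← hTn]; simp [f, hγ0, hγ1]
  rw [h1]
  calc ‖f 1 - f 0‖ₑ ≤ ∫⁻ t in Icc (0 : ℝ) 1, ‖derivWithin f (Icc 0 1) t‖ₑ :=
        enorm_sub_le_lintegral_derivWithin_Icc_of_contDiffOn_Icc hf zero_le_one
    _ ≤ ∫⁻ t in Icc (0 : ℝ) 1, ofReal r *
          ‖mfderivWithin 𝓘(ℝ, ℝ) Υ γ (Icc 0 1) t (1 : ℝ)‖ₑ := by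
        refine setLIntegral_mono' measurableSet_Icc (fun t ht => ?_)
        have hu : UniqueDiffWithinAt ℝ (Icc (0 : ℝ) 1) t := uniqueDiffOn_Icc zero_lt_one t ht
        have hcomp : mfderivWithin 𝓘(ℝ, ℝ) 𝓘(ℝ, Є) (φ ∘ γ) (Icc 0 1) t =
            (mfderiv Υ 𝓘(ℝ, Є) φ (γ t)) ∘L (mfderivWithin 𝓘(ℝ, ℝ) Υ γ (Icc 0 1) t) := by
          apply mfderiv_comp_mfderivWithin
          · exact mdifferentiableAt_extChartAt (hsrc t ht)
          · exact γ_smooth.mdifferentiableOn one_ne_zero t ht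
          · rwa [uniqueMDiffWithinAt_iff_uniqueDiffWithinAt]
        set w : 𝓣 (γ t) := mfderivWithin 𝓘(ℝ, ℝ) Υ γ (Icc 0 1) t (1 : ℝ) with hw
        have hder : derivWithin (φ ∘ γ) (Icc 0 1) t = coord c (γ t) w := by
          rw [coord_mfderiv_eq (hsrc t ht), ← fderivWithin_derivWithin,
            ← mfderivWithin_eq_fderivWithin, hcomp]
          rfl
        have hderf : derivWithin f (Icc 0 1) t = T (coord c (γ t) w) := by
          rw [← hder]
          exact ((T.hasFDerivAt.comp_hasDerivWithinAt t
            ((hφγ'.differentiableOn one_ne_zero t ht).hasDerivWithinAt)).derivWithin hu)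
        rw [hderf, ← ofReal_norm, ← ofReal_norm, hTn, ← ofReal_mul (by linarith)]
        refine ofReal_le_ofReal ?_; have := ((hball (hmem t ht)).1 (coord c (γ t) w)).2
        rwa [lift_coord (hsrc t ht)] at this
    _ = ofReal r * Manifold.pathELength Υ γ 0 1 := by
        rw [lintegral_ofReal_mul, Manifold.pathELength_eq_lintegral_mfderivWithin_Icc]; rfl
    _ ≤ ofReal r * L := by gcongr

/-! ### Localizing measure comparisons, and Hausdorff measure under Lipschitz maps -/

section Abstract

/-- Countable measurable decomposition of a set subordinate to neighbourhoods of its points. -/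
lemma exists_disjoint_cover {X : Type*} [TopologicalSpace X] [SecondCountableTopology X]
    [MeasurableSpace X] [OpensMeasurableSpace X] (A : Set X) (N : X → Set X) (hN : ∀ x ∈ A, N x ∈ 𝓝
    x) : ∃ D : ℕ → Set X, (∀ n, MeasurableSet (D n)) ∧ Pairwise (Function.onFun Disjoint D) ∧ A ⊆ ⋃
    n, D n ∧ ∀ n, D n = ∅ ∨ ∃ x ∈ A, D n ⊆ N x := by
  rcases A.eq_empty_or_nonempty with rfl | hne
  · exact ⟨fun _ => ∅, by simp, fun _ _ _ => by simp [Function.onFun], by simp, by simp⟩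
  obtain ⟨t, htA, htc, hcov⟩ := TopologicalSpace.countable_cover_nhdsWithin
    (s := A) (f := fun x => interior (N x)) (fun x hx => nhdsWithin_le_nhds
      (isOpen_interior.mem_nhds (mem_interior_iff_mem_nhds.2 (hN x hx))))
  have htne : t.Nonempty := by
    obtain ⟨x, hx⟩ := hne; obtain ⟨y, hy, -⟩ := mem_iUnion₂.1 (hcov hx); exact ⟨y, hy⟩
  obtain ⟨u, rfl⟩ := htc.exists_eq_range htne
  refine ⟨disjointed fun n => interior (N (u n)), fun n => ?_, disjoint_disjointed _, ?_, fun n => ?_⟩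
  · exact MeasurableSet.disjointed (fun n => isOpen_interior.measurableSet) n
  · rw [iUnion_disjointed]; simpa [biUnion_range] using hcov
  · exact Or.inr ⟨u n, htA ⟨n, rfl⟩, (disjointed_subset _ _).trans interior_subset⟩

/-- Countable additivity is applied to the restriction of `μ` to `A`, so `A` itself need not be
measurable. -/
lemma measure_eq_tsum_inter {X : Type*} [MeasurableSpace X] (μ : Measure X) {A : Set X} {D : ℕ → Set
    X} (hD : ∀ n, MeasurableSet (D n)) (hdis : Pairwise (Function.onFun Disjoint D)) (hA : A ⊆ ⋃ n,
    D n) : μ A = ∑' n, μ (D n ∩ A) := by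
  have h := measure_iUnion (μ := μ.restrict A) hdis hD
  rw [restrict_apply (MeasurableSet.iUnion hD), inter_eq_right.2 hA] at h; rw [h]
  exact tsum_congr fun n => restrict_apply (hD n)

lemma measure_le_of_locally_le {X : Type*} [TopologicalSpace X] [SecondCountableTopology X]
    [MeasurableSpace X] [OpensMeasurableSpace X] (μ ν : Measure X) {s : Set X} {C : ℝ≥0∞} (h : ∀ x ∈
    s, ∃ N ∈ 𝓝 x, ∀ B ⊆ N ∩ s, MeasurableSet B → μ B ≤ C * ν B) {B : Set X} (hB : MeasurableSet B)
    (hBs : B ⊆ s) : μ B ≤ C * ν B := by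
  choose! N hN hle using h; obtain ⟨D, hDm, hdis, hcov, hsub⟩ := exists_disjoint_cover s N hN
  rw [measure_eq_tsum_inter μ hDm hdis (hBs.trans hcov),
    measure_eq_tsum_inter ν hDm hdis (hBs.trans hcov), ← ENNReal.tsum_mul_left]
  refine ENNReal.tsum_le_tsum fun n => ?_; rcases hsub n with h0 | ⟨x, hx, hsub⟩
  · simp [h0]
  · exact hle x hx _ (inter_subset_inter hsub hBs) ((hDm n).inter hB)

/-- Lets the distortion `r` of an almost-isometry tend to `1`. -/
lemma _root_.ENNReal.le_of_forall_one_lt_pow_mul {a b : ℝ≥0∞} (k : ℕ) (h : ∀ r : ℝ, 1 < r → a ≤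
    ofReal r ^ k * b) : a ≤ b := by
  rcases eq_or_ne b ⊤ with rfl | hb
  · exact le_top
  have h1 : Tendsto (fun r : ℝ => ofReal r ^ k * b) (𝓝[>] 1) (𝓝 (ofReal 1 ^ k * b)) := by
    refine tendsto_nhdsWithin_of_tendsto_nhds (ENNReal.Tendsto.mul_const ?_ (Or.inr hb))
    exact ((ENNReal.continuous_pow k).tendsto _).comp (ENNReal.continuous_ofReal.tendsto 1)
  have := ge_of_tendsto h1 (Filter.eventually_of_mem self_mem_nhdsWithin h); simpa using this

variable {X Y : Type*} [EMetricSpace X] [MeasurableSpace X] [BorelSpace X] [EMetricSpace Y]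
  [MeasurableSpace Y] [BorelSpace Y]

lemma hausdorff_image_le {f : X → Y} {A : Set X} (m : ℕ) {r : ℝ} (h : ∀ y ∈ A, ∀ z ∈ A, edist (f y)
    (f z) ≤ ofReal r * edist y z) : μHE[m] (f '' A) ≤ ofReal r ^ m * μHE[m] A := by
  have hL : LipschitzOnWith r.toNNReal f A := fun y hy z hz => h y hy z hz
  have := hL.hausdorffMeasure_image_le (d := m) (by positivity)
  rw [Measure.euclideanHausdorffMeasure_def, Measure.euclideanHausdorffMeasure_def,
    Measure.smul_apply, Measure.smul_apply, ENNReal.smul_def, ENNReal.smul_def, smul_eq_mul,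
    smul_eq_mul, mul_left_comm]
  gcongr; simpa [ofReal] using this

/-- The Lipschitz constant is only local, so `A` is cut into countably many pieces on which it is
valid. -/
lemma euclideanHausdorffMeasure_image_le_of_locally [SecondCountableTopology X] {f : X → Y} {A : Set
    X} (m : ℕ) {r : ℝ} (h : ∀ x ∈ A, ∃ N ∈ 𝓝 x, ∀ y ∈ N ∩ A, ∀ z ∈ N ∩ A, edist (f y) (f z) ≤ ofReal
    r * edist y z) : μHE[m] (f '' A) ≤ ofReal r ^ m * μHE[m] A := by
  choose! N hN hle using h; obtain ⟨D, hDm, hdis, hcov, hsub⟩ := exists_disjoint_cover A N hN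
  rw [measure_eq_tsum_inter μHE[m] hDm hdis hcov, ← ENNReal.tsum_mul_left]
  have h1 : f '' A ⊆ ⋃ n, f '' (D n ∩ A) := by
    rw [← image_iUnion, ← iUnion_inter, inter_eq_right.2 hcov]
  refine (measure_mono h1).trans ((measure_iUnion_le _).trans (ENNReal.tsum_le_tsum fun n => ?_))
  rcases hsub n with h0 | ⟨x, hx, hsub⟩
  · simp [h0]
  · exact hausdorff_image_le m fun y hy z hz =>
      hle x hx y ⟨hsub hy.1, hy.2⟩ z ⟨hsub hz.1, hz.2⟩

end Abstract

/-! ### The Riemannian volume in a chart -/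

lemma measurableSet_target (c : M) : MeasurableSet (Γ c).target := by
  rw [extChartAt_target]
  exact ((𝓒 c).open_target.preimage
    (Υ).continuous_symm).measurableSet.inter (Υ).isClosed_range.measurableSet

lemma isEmbedding_chart (c : M) : Topology.IsEmbedding (fun x : (Γ c).source => Γ c x) := by
  let e : (Γ c).source ≃ₜ (Γ c).target :=
    { toFun := fun x => ⟨Γ c x, (Γ c).map_source x.2⟩
      invFun := fun y => ⟨(Θ c) y, (Γ c).map_target y.2⟩
      left_inv := fun x => Subtype.ext ((Γ c).left_inv x.2)
      right_inv := fun y => Subtype.ext ((Γ c).right_inv y.2)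
      continuous_toFun := (continuousOn_iff_continuous_domRestrict.1
        (continuousOn_extChartAt c)).subtype_mk _
      continuous_invFun := (continuousOn_iff_continuous_domRestrict.1
        (continuousOn_extChartAt_symm c)).subtype_mk _ }
  exact (Topology.IsEmbedding.subtypeVal.comp e.isEmbedding :)

lemma range_chart (c : M) : range (fun x : (Γ c).source => Γ c x) = (Γ c).target := by
  rw [← (Γ c).image_source_eq_target, image_eq_range]

lemma measSet_chart_source (c : M) : MeasurableSet (Γ c).source :=
  (isOpen_extChartAt_source c).measurableSet

lemma measEmb_chart (c : M) : MeasurableEmbedding (fun x : (Γ c).source => Γ c x) :=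
  (isEmbedding_chart c).measurableEmbedding (by rw [range_chart]; exact measurableSet_target c)

/-- The Riemannian volume density in the preferred chart at `c`, as a function on `ℝ^d`. -/
def chartDensity (c : M) (y : Є) : ℝ := VD c (Θ c y)

/-- The image of the Riemannian volume under the preferred chart at `c`. -/
def chartMeasure (c : M) : Measure Є :=
  (Measure.comap Subtype.val ϑ).map (fun x : (Γ c).source => Γ c x)

lemma chartMeasure_apply (c : M) {B : Set Є} (hB : B ⊆ (Γ c).target) : chartMeasure c B = ϑ (Θ c ''
    B) := by
  rw [chartMeasure, (measEmb_chart c).map_apply,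
    comap_subtype_coe_apply (measSet_chart_source c)]
  congr 1; ext p; constructor
  · rintro ⟨x, hx, rfl⟩; exact ⟨_, hx, (Γ c).left_inv x.2⟩
  · rintro ⟨y, hy, rfl⟩
    exact ⟨⟨_, (Γ c).map_target (hB hy)⟩,
      by rw [mem_preimage, (Γ c).right_inv (hB hy)]; exact hy, rfl⟩

lemma contMDiffOn_chartDensity (c : M) : ContDiffOn ℝ ∞ (chartDensity c) (Γ c).target := by
  rw [← contMDiffOn_iff_contDiffOn]
  refine (contMDiffOn_volDensity c).comp (contMDiffOn_extChartAt_symm c) fun y hy => ?_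
  have := (Γ c).map_target hy; rwa [extChartAt_source] at this

lemma chartDensity_pos {y : Є} (hy : y ∈ (Γ c).target) : 0 < chartDensity c y := by
  have := (Γ c).map_target hy; rw [extChartAt_source] at this; exact volDensity_pos this

/-- Near a point, volume and Lebesgue measure in a chart are almost proportional. -/
lemma exists_nhds_chartMeasure {y : Є} (hy : y ∈ (Γ c).target) {r : ℝ} (hr : 1 < r) : ∃ N ∈ 𝓝 y, ∀ B
    ⊆ N ∩ (Γ c).target, MeasurableSet B → chartMeasure c B ≤ ofReal r ^ (d + 1) * ∫⁻ z in B, ofReal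
    (chartDensity c z) ∧ ∫⁻ z in B, ofReal (chartDensity c z) ≤ ofReal r ^ (d + 1) * chartMeasure c
    B := by
  set φ := Γ c with hφ; have hps : φ.symm y ∈ φ.source := φ.map_target hy
  have hp : φ.symm y ∈ Δ c := by rwa [hφ, extChartAt_source] at hps
  obtain ⟨N1, hN1, h1⟩ := eventually_edist_le hp hr
  obtain ⟨N2, hN2, h2⟩ := eventually_le_edist hp hr
  obtain ⟨R, hR, hball⟩ := exists_ball_extChartAt hp (inter_mem hN1 hN2)
  rw [← hφ, φ.right_inv hy] at hball; have hρ0 : 0 < chartDensity c y := chartDensity_pos hy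
  have hcont : ∀ᶠ z in 𝓝[φ.target] y, chartDensity c z < r * chartDensity c y ∧
      chartDensity c y < r * chartDensity c z := by
    have hc := (contMDiffOn_chartDensity c).continuousOn y hy
    refine (hc.tendsto.eventually_lt_const (by nlinarith)).and ?_
    exact (hc.tendsto.const_mul r).eventually_const_lt (by nlinarith)
  obtain ⟨N3, hN3, h3⟩ := mem_nhdsWithin_iff_exists_mem_nhds_inter.1 hcont
  obtain ⟨T, hT⟩ := exists_isometry_frame hp
  have hTn : ∀ v, ‖T v‖ = ‖lift c (φ.symm y) v‖ := fun v => by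
    rw [norm_eq_sqrt_real_inner, norm_eq_sqrt_real_inner, hT]
  have hdet : chartDensity c y = |LinearMap.det (T : Є →ₗ[ℝ] Є)| := volDensity_eq_det hp T hT
  -- After the frozen linear map `T`, the chart is `r`-bi-Lipschitz, which costs `r ^ d` in
  -- Hausdorff measure. One more factor `r` replaces the density at `y` by the density at nearby
  -- points, hence the exponent `d + 1`.
  refine ⟨ball y R ∩ N3, inter_mem (ball_mem_nhds _ hR) hN3, fun B hBN hBm => ?_⟩
  have hBt : B ⊆ φ.target := fun z hz => (hBN hz).2
  have hB : ∀ z ∈ B, φ.symm z ∈ N1 ∩ N2 ∧ φ (φ.symm z) = z := fun z hz =>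
    ⟨(hball z ⟨(hBN hz).1.1, extChartAt_target_subset_range c (hBt hz)⟩).2, φ.right_inv (hBt hz)⟩
  have hvolT : volume (T '' B) = ofReal (chartDensity c y) * volume B := by
    rw [hdet]; exact Measure.addHaar_image_linearMap volume (T : Є →ₗ[ℝ] Є) B
  rw [chartMeasure_apply c hBt]
  have hE : ∀ s : Set Є, μHE[d] s = volume s := fun s => by
    rw [EuclideanSpace.euclideanHausdorffMeasure_eq_volume]
  constructor
  · have him : φ.symm '' B = (fun u => φ.symm (T.symm u)) '' (T '' B) := by rw [image_image]; simp
    have hle : ϑ (φ.symm '' B) ≤ ofReal r ^ d * volume (T '' B) := by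
      rw [him, ← hE]; apply hausdorff_image_le; rintro _ ⟨u, hu, rfl⟩ _ ⟨w, hw, rfl⟩
      simp only [ContinuousLinearEquiv.symm_apply_apply]
      refine (h1 _ (hB u hu).1.1 _ (hB w hw).1.1).trans ?_
      rw [← hφ, (hB u hu).2, (hB w hw).2, ← hTn, map_sub, ofReal_mul (by linarith),
        edist_comm, edist_eq_enorm_sub, ofReal_norm]
    refine hle.trans ?_; rw [hvolT, pow_succ, mul_assoc]; gcongr ofReal r ^ d * ?_
    rw [← setLIntegral_const, ← lintegral_ofReal_mul]; refine setLIntegral_mono' hBm fun z hz => ?_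
    rw [← ofReal_mul (by linarith)]; exact ofReal_le_ofReal (h3 ⟨(hBN hz).1.2, hBt hz⟩).2.le
  · have him : T '' B = (fun u => T (φ u)) '' (φ.symm '' B) := by
      rw [image_image]; exact image_congr fun z hz => by rw [(hB z hz).2]
    have hle : volume (T '' B) ≤ ofReal r ^ d * ϑ (φ.symm '' B) := by
      rw [← hE, him]; apply hausdorff_image_le; rintro _ ⟨u, hu, rfl⟩ _ ⟨w, hw, rfl⟩
      refine le_trans ?_ (h2 _ (hB u hu).1.2 _ (hB w hw).1.2)
      rw [edist_comm, edist_eq_enorm_sub, ← map_sub, ← ofReal_norm, hTn]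
    calc ∫⁻ z in B, ofReal (chartDensity c z)
        ≤ ∫⁻ z in B, ofReal (r * chartDensity c y) :=
          setLIntegral_mono' hBm fun z hz => ofReal_le_ofReal (h3 ⟨(hBN hz).1.2, hBt hz⟩).1.le
      _ = ofReal r * volume (T '' B) := by
          rw [setLIntegral_const, hvolT, ofReal_mul (by linarith), mul_assoc]
      _ ≤ ofReal r * (ofReal r ^ d * ϑ (φ.symm '' B)) := by gcongr
      _ = _ := by rw [pow_succ]; ring

/-- Each of the two measures is locally at most `r ^ (d + 1)` times the other, for every `r > 1`.
Such bounds glue over a countable partition, and `r → 1` gives equality. -/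
lemma chartMeasure_eq (c : M) : chartMeasure c = (volume.restrict (Γ c).target).withDensity fun y =>
    ofReal (chartDensity c y) := by
  set φ := Γ c with hφ
  set ν := (volume.restrict φ.target).withDensity fun y => ofReal (chartDensity c y)
  have hν : ∀ B ⊆ φ.target, MeasurableSet B → ν B = ∫⁻ z in B, ofReal (chartDensity c z) := by
    intro B hB hBm; rw [withDensity_apply _ hBm, restrict_restrict hBm, inter_eq_left.2 hB]
  have hle1 : ∀ B ⊆ φ.target, MeasurableSet B → chartMeasure c B ≤ ν B := by
    intro B hB hBm; refine ENNReal.le_of_forall_one_lt_pow_mul (d + 1) fun r hr => ?_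
    refine measure_le_of_locally_le _ _ (fun y hy => ?_) hBm hB
    obtain ⟨N, hN, h⟩ := exists_nhds_chartMeasure hy hr
    exact ⟨N, hN, fun B' hB' hm => by
      rw [hν B' (hB'.trans inter_subset_right) hm]; exact (h B' hB' hm).1⟩
  have hle2 : ∀ B ⊆ φ.target, MeasurableSet B → ν B ≤ chartMeasure c B := by
    intro B hB hBm; refine ENNReal.le_of_forall_one_lt_pow_mul (d + 1) fun r hr => ?_
    refine measure_le_of_locally_le _ _ (fun y hy => ?_) hBm hB
    obtain ⟨N, hN, h⟩ := exists_nhds_chartMeasure hy hr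
    exact ⟨N, hN, fun B' hB' hm => by
      rw [hν B' (hB'.trans inter_subset_right) hm]; exact (h B' hB' hm).2⟩
  have ht : MeasurableSet φ.target := measurableSet_target c; ext B hB
  have h1 : chartMeasure c B = chartMeasure c (B ∩ φ.target) := by
    rw [chartMeasure, (measEmb_chart c).map_apply,
      (measEmb_chart c).map_apply, ← range_chart]
    congr 1; ext x; simp
  have h2 : ν B = ν (B ∩ φ.target) := by
    rw [withDensity_apply _ hB, withDensity_apply _ (hB.inter ht), restrict_restrict hB,
      restrict_restrict (hB.inter ht), inter_assoc, inter_self]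
  rw [h1, h2]
  exact le_antisymm (hle1 _ inter_subset_right (hB.inter ht))
    (hle2 _ inter_subset_right (hB.inter ht))

/-- The set `A` in the preferred chart at `c`. -/
def chartSet (c : M) (A : Set M) : Set Є := (Γ c).target ∩ (Θ c) ⁻¹' A

local notation "CS" => chartSet (d := d)

lemma measSet_chartSet (c : M) (hA : MeasurableSet A) : MeasurableSet (CS c A) := by
  have h := (measEmb_chart (d := d) c).measurableSet_image' (hA.preimage measurable_subtype_coe)
  convert h using 1
  ext y; constructor
  · rintro ⟨h1, h2⟩; exact ⟨⟨_, (Γ c).map_target h1⟩, h2, (Γ c).right_inv h1⟩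
  · rintro ⟨x, hx, rfl⟩; refine ⟨(Γ c).map_source x.2, ?_⟩
    simp only [mem_preimage, (Γ c).left_inv x.2]; exact hx

/-- Both restricted measures are images of one measure on the chart source under measurable
embeddings. Integrals, null sets and measurability can therefore be transported without
measurability assumptions on the integrand. -/
lemma exists_common_measure (c : M) (hA : MeasurableSet A) (hAs : A ⊆ (Γ c).source) : ∃ m : Measure
    (Γ c).source, Λ A = m.map Subtype.val ∧ (chartMeasure c).restrict (CS c A) = m.map (fun x : (Γ
    c).source => Γ c x) := by
  refine ⟨(Measure.comap Subtype.val ϑ).restrict (Subtype.val ⁻¹' A), ?_, ?_⟩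
  · rw [← Measure.restrict_map measurable_subtype_coe hA,
      map_comap_subtype_coe (measSet_chart_source c), restrict_restrict hA,
      inter_eq_left.2 hAs]
  · rw [chartMeasure, Measure.restrict_map (measEmb_chart c).measurable
      (measSet_chartSet c hA)]
    congr 2; ext x
    simp only [chartSet, mem_preimage, mem_inter_iff, (Γ c).left_inv x.2,
      (Γ c).map_source x.2, true_and]

lemma chartMeasure_restrict (c : M) (hA : MeasurableSet A) : (chartMeasure (d := d) c).restrict (CS
    c A) = (volume.restrict (CS c A)).withDensity fun y => ofReal (chartDensity c y) := by
  have h : CS c A ⊆ (Γ c).target := inter_subset_left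
  rw [chartMeasure_eq, restrict_withDensity (measSet_chartSet c hA),
    restrict_restrict (measSet_chartSet c hA), inter_eq_left.2 h]

lemma aemeas_chartDensity (c : M) (A : Set M) : AEMeasurable (chartDensity (d := d) c)
    (volume.restrict (CS c A)) :=
  ((contMDiffOn_chartDensity c).continuousOn.aemeasurable (measurableSet_target c)).mono_set
    inter_subset_left

lemma ae_chartMeasure (c : M) (hA : MeasurableSet A) : ae ((chartMeasure c).restrict (CS c A)) = ae
    (volume.restrict (CS c A)) := by
  rw [chartMeasure_restrict c hA]
  refine le_antisymm (withDensity_absolutelyContinuous _ _).ae_le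
    (withDensity_absolutelyContinuous' ?_ ?_).ae_le
  · exact (aemeas_chartDensity c A).ennreal_ofReal
  · filter_upwards [self_mem_ae_restrict (measSet_chartSet c hA)] with y hy
    simpa using chartDensity_pos hy.1

lemma ae_chart_iff (c : M) (hA : MeasurableSet A) (hAs : A ⊆ (Γ c).source) {P : M → Prop} : (∀ᵐ p ∂Λ
    A, P p) ↔ ∀ᵐ y ∂volume.restrict (CS c A), P ((Θ c) y) := by
  obtain ⟨m, h1, h2⟩ := exists_common_measure c hA hAs
  rw [← ae_chartMeasure c hA, h1, h2, (MeasurableEmbedding.subtype_coe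
    (measSet_chart_source c)).ae_map_iff, (measEmb_chart c).ae_map_iff]
  refine eventually_congr (.of_forall fun x => ?_); rw [(Γ c).left_inv x.2]

lemma aestronglyMeasurable_chart_iff {F : Type*} [TopologicalSpace F] (c : M) (hA : MeasurableSet A)
    (hAs : A ⊆ (Γ c).source) {f : M → F} : AEStronglyMeasurable f Λ A ↔ AEStronglyMeasurable (fun y
    => f (Θ c y)) (volume.restrict (CS c A)) :=
    by
  obtain ⟨m, h1, h2⟩ := exists_common_measure c hA hAs
  have h3 : AEStronglyMeasurable (fun y => f (Θ c y))
      ((chartMeasure c).restrict (CS c A)) ↔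
      AEStronglyMeasurable (fun y => f (Θ c y)) (volume.restrict (CS c A)) :=
    ⟨fun h => h.mono_ac (Measure.ae_le_iff_absolutelyContinuous.1 (ae_chartMeasure c hA).ge),
      fun h => h.mono_ac (Measure.ae_le_iff_absolutelyContinuous.1 (ae_chartMeasure c hA).le)⟩
  rw [← h3, h1, h2, (MeasurableEmbedding.subtype_coe
    (measSet_chart_source c)).aestronglyMeasurable_map_iff,
    (measEmb_chart c).aestronglyMeasurable_map_iff]
  have : (fun y => f (Θ c y)) ∘ (fun x : (Γ c).source => Γ c x) = f ∘ Subtype.val := by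
    ext x; simp only [Function.comp_apply, (Γ c).left_inv x.2]
  rw [this]

lemma setLIntegral_chart (c : M) (hA : MeasurableSet A) (hAs : A ⊆ (Γ c).source) (f : M → ℝ≥0∞) : ∫⁻
    p in A, f p ∂ϑ = ∫⁻ y in CS c A, ofReal (chartDensity c y) * f (Θ c y) := by
  obtain ⟨m, h1, h2⟩ := exists_common_measure c hA hAs
  have h3 := lintegral_withDensity_eq_lintegral_mul_non_measurable₀
    (volume.restrict (CS c A))
    (f := fun y => ofReal (chartDensity c y))
    (aemeas_chartDensity c A).ennreal_ofReal
    (.of_forall fun _ => ofReal_lt_top)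
    (fun y => f (Θ c y))
  simp only [Pi.mul_apply] at h3
  rw [← h3, ← chartMeasure_restrict c hA, h1, h2, (MeasurableEmbedding.subtype_coe
    (measSet_chart_source c)).lintegral_map, (measEmb_chart c).lintegral_map]
  refine lintegral_congr fun x => ?_; rw [(Γ c).left_inv x.2]

lemma setIntegral_chart (c : M) (hA : MeasurableSet A) (hAs : A ⊆ (Γ c).source) (f : M → ℝ) : ∫ p in
    A, f p ∂ϑ = ∫ y in CS c A, chartDensity c y * f (Θ c y) :=
    by
  obtain ⟨m, h1, h2⟩ := exists_common_measure c hA hAs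
  have h3 := integral_withDensity_eq_integral_toReal_smul₀
    (μ := volume.restrict (CS c A))
    (f := fun y => ofReal (chartDensity c y))
    (aemeas_chartDensity c A).ennreal_ofReal
    (.of_forall fun _ => ofReal_lt_top)
    (fun y => f (Θ c y))
  rw [← chartMeasure_restrict c hA, h2, (measEmb_chart c).integral_map] at h3
  rw [h1, (MeasurableEmbedding.subtype_coe (measSet_chart_source c)).integral_map]
  have h4 : ∫ x, f (Subtype.val x) ∂m = ∫ x, f ((Θ c) (Γ c (Subtype.val x))) ∂m :=
    integral_congr_ae (.of_forall fun x => by simp only [(Γ c).left_inv x.2])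
  rw [h4, h3]; refine setIntegral_congr_fun (measSet_chartSet c hA) fun y hy => ?_
  simp only [smul_eq_mul]; rw [ENNReal.toReal_ofReal (chartDensity_pos hy.1).le]

/-! ### Charts are locally bi-Lipschitz -/

lemma exists_norm_lift_bound (hp : p ∈ Δ c) : ∃ C : ℝ, 0 < C ∧ ∀ v : Є, ‖lift c p v‖ ≤ C * ‖v‖ ∧ ‖v‖
    ≤ C * ‖lift c p v‖ := by
  obtain ⟨T, hT⟩ := exists_isometry_frame hp
  have hTn : ∀ v, ‖T v‖ = ‖lift c p v‖ := fun v => by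
    rw [norm_eq_sqrt_real_inner, norm_eq_sqrt_real_inner, hT]
  refine ⟨‖(T : Є →L[ℝ] Є)‖ + ‖(T.symm : Є →L[ℝ] Є)‖ + 1, by positivity, fun v => ?_⟩; rw [← hTn]
  constructor
  · calc ‖T v‖ ≤ ‖(T : Є →L[ℝ] Є)‖ * ‖v‖ := ContinuousLinearMap.le_opNorm (T : Є →L[ℝ] Є) v
      _ ≤ _ := by gcongr; linarith [norm_nonneg (T.symm : Є →L[ℝ] Є)]
  · calc ‖v‖ = ‖(T.symm : Є →L[ℝ] Є) (T v)‖ := by simp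
      _ ≤ ‖(T.symm : Є →L[ℝ] Є)‖ * ‖T v‖ := ContinuousLinearMap.le_opNorm _ _
      _ ≤ _ := by gcongr; linarith [norm_nonneg (T : Є →L[ℝ] Є)]

lemma eventually_norm_lift_bound (hp : p ∈ Δ c) : ∃ C : ℝ, 0 < C ∧ ∀ᶠ q in 𝓝 p, ∀ v : Є, ‖lift c q
    v‖ ≤ C * ‖v‖ ∧ ‖v‖ ≤ C * ‖lift c q v‖ := by
  obtain ⟨C, hC, h⟩ := exists_norm_lift_bound hp; refine ⟨2 * C, by positivity, ?_⟩
  filter_upwards [eventually_norm_lift_le hp one_lt_two] with q hq v; obtain ⟨h1, h2⟩ := hq v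
  obtain ⟨h3, h4⟩ := h v; constructor
  · linarith
  · nlinarith

lemma exists_chart_bilipschitz (hp : p ∈ Δ c) : ∃ C : ℝ, 0 < C ∧ ∃ N ∈ 𝓝 p, ∀ y ∈ N, ∀ z ∈ N, edist
    y z ≤ ofReal C * edist (Γ c y) (Γ c z) ∧ edist (Γ c y) (Γ c z) ≤ ofReal C * edist y z := by
  obtain ⟨C, hC, h⟩ := exists_norm_lift_bound hp
  obtain ⟨N1, hN1, h1⟩ := eventually_edist_le hp one_lt_two
  obtain ⟨N2, hN2, h2⟩ := eventually_le_edist hp one_lt_two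
  refine ⟨2 * C, by positivity, N1 ∩ N2, inter_mem hN1 hN2, fun y hy z hz => ⟨?_, ?_⟩⟩
  · refine (h1 y hy.1 z hz.1).trans ?_
    rw [edist_comm (Γ c y), edist_eq_enorm_sub, ← ofReal_norm,
      ← ofReal_mul (by positivity), mul_assoc]
    exact ofReal_le_ofReal (by gcongr; exact (h _).1)
  · rw [edist_comm (Γ c y), edist_eq_enorm_sub, ← ofReal_norm]
    calc _ ≤ ofReal (C * ‖lift c p (Γ c z - Γ c y)‖) :=
          ofReal_le_ofReal (h _).2
      _ ≤ ofReal C * (ofReal 2 * edist y z) := by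
          rw [ofReal_mul hC.le]; gcongr; exact h2 y hy.2 z hz.2
      _ = _ := by rw [mul_comm 2 C, ofReal_mul hC.le, mul_assoc]

/-- To first order `a` is its derivative at `p`, which preserves the norm. The distortion is one
factor `s` from each of the two charts and one from the linearization error. -/
lemma exists_lipschitz_of_isometry {a : M → M} (ha : ContMDiff Υ Υ 1 a) (hiso : ∀ v : 𝓣 p, ‖mfderiv
    Υ Υ a p v‖ = ‖v‖) {r : ℝ} (hr : 1 < r) : ∃ N ∈ 𝓝 p, ∀ y ∈ N, ∀ z ∈ N, edist (a y) (a z) ≤ ofReal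
    r * edist y z := by
  have hp := mem_src d p; have hp' := mem_src d (a p)
  obtain ⟨C, hC, hC1⟩ := exists_norm_lift_bound hp
  obtain ⟨C', hC', hC1'⟩ := exists_norm_lift_bound hp'
  -- choose `s > 1` and `ε > 0` with `s * s * (1 + C' * ε * C) ≤ r`
  obtain ⟨s, hs1, hs⟩ : ∃ s : ℝ, 1 < s ∧ s ^ 3 ≤ r := by
    have : Tendsto (fun s : ℝ => s ^ 3) (𝓝[>] 1) (𝓝 (1 ^ 3)) :=
      ((continuous_pow 3).tendsto 1).mono_left nhdsWithin_le_nhds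
    rw [one_pow] at this
    obtain ⟨s, h1, h2⟩ := ((this.eventually_lt_const hr).and self_mem_nhdsWithin).exists
    exact ⟨s, h2, h1.le⟩
  set ε := (s - 1) / (C' * C) with hε; have hε0 : 0 < ε := div_pos (by linarith) (by positivity)
  obtain ⟨N1, hN1, h1⟩ := eventually_edist_le hp' hs1
  obtain ⟨N2, hN2, h2⟩ := eventually_le_edist hp hs1
  obtain ⟨N3, hN3, h3⟩ := eventually_strict ha hp hp' hε0
  refine ⟨a ⁻¹' N1 ∩ N2 ∩ N3, inter_mem (inter_mem (ha.continuous.continuousAt hN1) hN2) hN3,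
    fun y hy z hz => ?_⟩
  set h := Γ p z - Γ p y
  have hD : ‖lift (a p) (a p) (derivCoord a p (a p) p h)‖ = ‖lift p p h‖ := by
    rw [derivCoord_apply, lift_coord hp', hiso]
  have hle : ‖lift (a p) (a p) (Γ (a p) (a z) - Γ (a p) (a y))‖ ≤ s * ‖lift p p h‖ := by
    have hsplit := map_sub (lift (d := d) (a p) (a p))
      (Γ (a p) (a z) - Γ (a p) (a y)) (derivCoord a p (a p) p h)
    have h4 : ‖lift (a p) (a p) (Γ (a p) (a z) - Γ (a p) (a y)
        - derivCoord a p (a p) p h)‖ ≤ C' * (ε * (C * ‖lift p p h‖)) :=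
      ((hC1' _).1.trans (mul_le_mul_of_nonneg_left (h3 y hy.2 z hz.2) hC'.le)).trans
        (by gcongr; exact (hC1 h).2)
    have h5 : C' * (ε * (C * ‖lift p p h‖)) = (s - 1) * ‖lift p p h‖ := by rw [hε]; field_simp
    calc _ = ‖lift (a p) (a p) (Γ (a p) (a z) - Γ (a p) (a y)
        - derivCoord a p (a p) p h) + lift (a p) (a p) (derivCoord a p (a p) p h)‖ := by
          rw [hsplit, sub_add_cancel]
      _ ≤ (s - 1) * ‖lift p p h‖ + ‖lift p p h‖ := by
          refine (norm_add_le _ _).trans (add_le_add (h4.trans h5.le) hD.le)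
      _ = _ := by ring
  calc edist (a y) (a z) ≤ _ := h1 _ hy.1.1 _ hz.1.1
    _ ≤ ofReal (s * (s * ‖lift p p h‖)) := by refine ofReal_le_ofReal ?_; gcongr
    _ = ofReal (s ^ 2) * ofReal ‖lift p p h‖ := by rw [← ofReal_mul (by positivity)]; congr 1; ring
    _ ≤ ofReal (s ^ 2) * (ofReal s * edist y z) := by gcongr; exact h2 y hy.1.2 z hz.1.2
    _ = ofReal (s ^ 3) * edist y z := by rw [← mul_assoc, ← ofReal_mul (by positivity)]; congr 2
    _ ≤ _ := by gcongr

/-! ### Isometric actions preserve Hausdorff measures -/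

variable (d G Ω) in
/-- `G` acts by smooth diffeomorphisms which map the open set `Ω` onto itself and restrict to
isometries of its closure. -/
structure IsomAction : Prop where
  smooth : ∀ a : G, ContMDiff Υ Υ ∞ ℓ a
  isOpen : IsOpen Ω
  dom : ∀ a : G, a • Ω = Ω
  isometry : ∀ a : G, ∀ p ∈ closure Ω, ∀ v w : 𝓣 p, inner ℝ (mfderiv Υ Υ ℓ a p v)
      (mfderiv Υ Υ ℓ a p w) = inner ℝ v w

local notation "Iso" => IsomAction d G Ω

namespace IsomAction

lemma continuous (h : Iso) (a : G) : Continuous ℓ a := (h.smooth a).continuous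

lemma smul_mem (h : Iso) (a : G) (hp : p ∈ Ω) : a • p ∈ Ω := by
  rw [← h.dom a]; exact smul_mem_smul_set hp

lemma smul_mem_closure (h : Iso) (a : G) (hp : p ∈ closure Ω) : a • p ∈ closure Ω := by
  rw [← h.dom a]; exact map_mem_closure (h.continuous a) hp fun q hq => smul_mem_smul_set hq

lemma smul_mem_iff (h : Iso) (a : G) : a • p ∈ Ω ↔ p ∈ Ω :=
  ⟨fun hp => by simpa using h.smul_mem a⁻¹ hp, h.smul_mem a⟩

lemma smul_mem_closure_iff (h : Iso) (a : G) : a • p ∈ closure Ω ↔ p ∈ closure Ω :=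
  ⟨fun hp => by simpa using h.smul_mem_closure a⁻¹ hp, h.smul_mem_closure a⟩

lemma norm_mfderiv (h : Iso) (a : G) (hp : p ∈ closure Ω) (v : 𝓣 p) : ‖mfderiv Υ Υ ℓ a p v‖ = ‖v‖ :=
    by
  rw [norm_eq_sqrt_real_inner, norm_eq_sqrt_real_inner, h.isometry a p hp]

/-- The derivative is known to be isometric only at points of `closure Ω`. Since the action is `C¹`,
this already gives, for each `r > 1`, an `r`-Lipschitz bound on a full neighbourhood of such a
point. -/
lemma measure_image_le (h : Iso) (m : ℕ) (a : G) (hA : A ⊆ closure Ω) : μHE[m] (ℓ a '' A) ≤ μHE[m] A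
    := by
  have : SecondCountableTopology M := EMetric.secondCountable_of_sigmaCompact M
  refine ENNReal.le_of_forall_one_lt_pow_mul m fun r hr => ?_
  refine euclideanHausdorffMeasure_image_le_of_locally m fun p hp => ?_
  obtain ⟨N, hN, h1⟩ := exists_lipschitz_of_isometry ((h.smooth a).of_le one_le_infty)
    (h.norm_mfderiv a (hA hp)) hr
  exact ⟨N, hN, fun y hy z hz => h1 y hy.1 z hz.1⟩

lemma measure_image (h : Iso) (m : ℕ) (a : G) (hA : A ⊆ closure Ω) : μHE[m] (ℓ a '' A) = μHE[m] A :=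
    by
  refine le_antisymm (h.measure_image_le m a hA) ?_
  have hA' : ℓ a '' A ⊆ closure Ω := by rintro _ ⟨p, hp, rfl⟩; exact h.smul_mem_closure a (hA hp)
  have := h.measure_image_le m a⁻¹ hA'
  rwa [image_image, show (fun p : M => a⁻¹ • a • p) = id by ext; simp, image_id] at this

lemma measurePreserving (h : Iso) (m : ℕ) (a : G) (hA : A ⊆ closure Ω) : MeasurePreserving ℓ a
    (μHE[m].restrict A) (μHE[m].restrict (ℓ a '' A)) := by
  refine ⟨(h.continuous a).measurable, ?_⟩
  have hinv : ℓ a '' A = (fun p : M => a⁻¹ • p) ⁻¹' A := by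
    ext p; constructor
    · rintro ⟨q, hq, rfl⟩; simpa using hq
    · intro hp; exact ⟨a⁻¹ • p, hp, by simp⟩
  ext B hB
  rw [Measure.map_apply (h.continuous a).measurable hB,
    restrict_apply ((h.continuous a).measurable hB), restrict_apply hB,
    ← h.measure_image m a (inter_subset_right.trans hA)]
  congr 1; ext p; constructor
  · rintro ⟨q, ⟨hq, hq'⟩, rfl⟩; exact ⟨hq, q, hq', rfl⟩
  · rintro ⟨hp, q, hq, rfl⟩; exact ⟨q, ⟨hp, hq⟩, rfl⟩

lemma measurableEmbedding (h : Iso) (a : G) : MeasurableEmbedding (fun p : M => a • p) := by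
  let e : M ≃ₜ M := ⟨MulAction.toPerm a, h.continuous a, h.continuous a⁻¹⟩
  exact e.measurableEmbedding

end IsomAction

lemma isLocallyFiniteMeasure_vol : IsLocallyFiniteMeasure ϑ := by
  refine ⟨fun p => ?_⟩; have hp := mem_src d p
  obtain ⟨C, hC, N, hN, h⟩ := exists_chart_bilipschitz hp; set φ := Γ p with hφ
  set N' := N ∩ (Δ p ∩ φ ⁻¹' ball (φ p) 1)
  refine ⟨N', inter_mem hN (preimage_ball_mem_nhds hp one_pos), ?_⟩
  have hleft : ∀ y ∈ N', φ.symm (φ y) = y := fun y hy =>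
    φ.left_inv (by rw [hφ, extChartAt_source]; exact hy.2.1)
  have him : N' = φ.symm '' (φ '' N') := by
    rw [image_image]; exact (image_congr hleft |>.trans (image_id' _)).symm
  have hle : ϑ N' ≤ ofReal C ^ d * μHE[d] (φ '' N') := by
    conv_lhs => rw [him]
    apply hausdorff_image_le; rintro _ ⟨u, hu, rfl⟩ _ ⟨w, hw, rfl⟩
    rw [hleft u hu, hleft w hw]; exact (h u hu.1 w hw.1).1
  refine hle.trans_lt (mul_lt_top (by simp) ?_)
  rw [EuclideanSpace.euclideanHausdorffMeasure_eq_volume]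
  refine lt_of_le_of_lt (measure_mono ?_) (measure_ball_lt_top (x := φ p) (r := 1))
  rintro _ ⟨u, hu, rfl⟩; exact hu.2.2

lemma finite_vol : IsFiniteMeasure ϑ := by
  have := isLocallyFiniteMeasure_vol (d := d) (M := M); infer_instance

/-! ### The divergence theorem -/

lemma integral_fderiv_eq_zero {f : Є → ℝ} (hf : ContDiff ℝ 1 f) (hc : HasCompactSupport f) (v : Є) :
    ∫ y, fderiv ℝ f y v = 0 := by
  have h1 : Continuous (fun y => fderiv ℝ f y v) :=
    (hf.continuous_fderiv one_ne_zero).clm_apply continuous_const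
  have h2 : HasCompactSupport (fun y => fderiv ℝ f y v) := by
    refine (hc.fderiv (𝕜 := ℝ)).comp_left (g := fun L : Є →L[ℝ] ℝ => L v) ?_; simp
  have := integral_mul_fderiv_eq_neg_fderiv_mul_of_integrable (μ := (volume : Measure Є))
    (f := fun _ => (1 : ℝ)) (g := f) (v := v) (by simp)
    (by simpa using h1.integrable_of_hasCompactSupport h2)
    (by simpa using hf.continuous.integrable_of_hasCompactSupport hc)
    (fun _ _ => differentiableAt_const _) (fun x _ => hf.differentiable one_ne_zero x)
  simpa using this

/-- Extension by zero of a function which vanishes off a compact set. -/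
lemma contDiff_indicator {E F : Type*} [NormedAddCommGroup E] [NormedSpace ℝ E] [NormedAddCommGroup
    F] [NormedSpace ℝ F] {W K : Set E} {f : E → F} {n : ℕ∞ω} (hW : IsOpen W) (hK : IsClosed K) (hKW
    : K ⊆ W) (hf : ContDiffOn ℝ n f W) (h0 : ∀ y ∈ W, y ∉ K → f y = 0) : ContDiff ℝ n (W.indicator
    f) := by
  rw [contDiff_iff_contDiffAt]; intro y; by_cases hy : y ∈ W
  · refine (hf.contDiffAt (hW.mem_nhds hy)).congr_of_eventuallyEq ?_
    filter_upwards [hW.mem_nhds hy] with z hz; rw [indicator_of_mem hz]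
  · refine (contDiffAt_const (c := (0 : F))).congr_of_eventuallyEq ?_
    filter_upwards [hK.isOpen_compl.mem_nhds (fun h => hy (hKW h))] with z hz; by_cases hzW : z ∈ W
    · rw [indicator_of_mem hzW, h0 z hzW hz]
    · rw [indicator_of_notMem hzW]

/-- A point of the manifold interior is mapped into the topological interior of the target by every
chart around it. Hence open subsets of the interior have open images in `ℝ^d`, where derivatives
within the half space are ordinary derivatives. -/
lemma isOpen_chartSet (c : M) (hO : IsOpen O) (hOi : O ⊆ Ξ M) : IsOpen (CS c O) := by
  have : CS c O = interior (Γ c).target ∩ (Θ c) ⁻¹' O := by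
    ext y; refine ⟨fun ⟨h1, h2⟩ => ⟨?_, h2⟩, fun ⟨h1, h2⟩ => ⟨interior_subset h1, h2⟩⟩
    have hs := (Γ c).map_target h1; rw [extChartAt_source] at hs
    have := ((Υ).isInteriorPoint_iff_of_mem_atlas (n := ∞) (by simp)
      (chart_mem_atlas (EuclideanHalfSpace d) c) hs).1 (hOi h2)
    change Γ c (Θ c y) ∈ interior (Γ c).target at this; rwa [(Γ c).right_inv h1] at this
  rw [this]
  exact ((continuousOn_extChartAt_symm c).mono interior_subset).isOpen_inter_preimage
    isOpen_interior hO

lemma isOpen_interior_M : IsOpen (Ξ M) := (Υ).isOpen_interior (n := ∞) (by simp)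

lemma mem_source_of_mem {y : Є} (hy : y ∈ CS c O) : (Θ c) y ∈ (𝓒 c).source
    := by have := (Γ c).map_target hy.1; rwa [extChartAt_source] at this

lemma chart_mem_chartSet (hp : p ∈ O) (hs : p ∈ Δ c) : Γ c p ∈ CS c O := by
  have hs' : p ∈ (Γ c).source := by rwa [extChartAt_source]
  refine ⟨(Γ c).map_source hs', ?_⟩; rw [mem_preimage, (Γ c).left_inv hs']; exact hp

lemma chart_left_inv (hs : p ∈ Δ c) : (Θ c) (Γ c p) = p :=
  (Γ c).left_inv (by rwa [extChartAt_source])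

lemma range_mem_nhds (hO : IsOpen O) (hOi : O ⊆ Ξ M) {y : Є} (hy : y ∈ CS c O) : range Υ ∈ 𝓝 y :=
  mem_of_superset ((isOpen_chartSet c hO hOi).mem_nhds hy)
    (inter_subset_left.trans (extChartAt_target_subset_range c))

lemma contDiffOn_chart_fun {F : Type*} [NormedAddCommGroup F] [NormedSpace ℝ F] {n : ℕ∞ω} (hn : n ≤
    (∞ : ℕ∞ω)) {f : M → F} (hf : ContMDiffOn Υ 𝓘(ℝ, F) n f Δ c) : ContDiffOn ℝ n (fun y => f (Θ c
    y)) (Γ c).target := by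
  have : IsManifold Υ n M := IsManifold.of_le (n := ∞) hn; rw [← contMDiffOn_iff_contDiffOn]
  refine hf.comp (contMDiffOn_extChartAt_symm c) fun y hy => ?_; have := (Γ c).map_target hy
  rwa [extChartAt_source] at this

variable (d) in
/-- The differential of a real function, as a linear form on the tangent space. -/
def dif (f : M → ℝ) (p : M) : 𝓣 p →ₗ[ℝ] ℝ where
  toFun v := 𝓓 f p v
  map_add' v w := map_add (𝓓 f p) v w
  map_smul' r v := map_smul (𝓓 f p) r v

local notation "Df" => dif d

lemma fderivWithin_chart_fun (hf : MDifferentiableAt Υ 𝓘(ℝ) f p) (hp : p ∈ Δ c) (v : Є) :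
    fderivWithin ℝ (fun y => f (Θ c y)) (range Υ) (Γ c p) v = Df f p (lift c p v) := by
  change _ = 𝓓 f p (lift c p v); have hps : p ∈ (Γ c).source := by rwa [extChartAt_source]
  have hinv : (Θ c) (Γ c p) = p := chart_left_inv hp
  have huniq : UniqueMDiffWithinAt 𝓘(ℝ, Є) (range Υ) (Γ c p) :=
    (uniqueMDiffWithinAt_iff_uniqueDiffWithinAt).2
      ((Υ).uniqueDiffOn _ (extChartAt_target_subset_range c ((Γ c).map_source hps)))
  have hsymm : MDifferentiableWithinAt 𝓘(ℝ, Є) Υ (Θ c) (range Υ) (Γ c p) :=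
    mdifferentiableWithinAt_extChartAt_symm ((Γ c).map_source hps)
  rw [lift_mfderiv_eq hp, ← mfderivWithin_eq_fderivWithin]
  have hf' : MDifferentiableAt Υ 𝓘(ℝ) f (Θ c (Γ c p)) := by rwa [hinv]
  have h1 := mfderiv_comp_mfderivWithin (x := Γ c p) hf' hsymm huniq
  have h2 : mfderivWithin 𝓘(ℝ, Є) 𝓘(ℝ) (fun y => f (Θ c y)) (range Υ) (Γ c p) = _ := h1; rw [h2]
  have key : ∀ (q : M) (w : Є), q = p → 𝓓 f q w = 𝓓 f p w := by rintro q w rfl; rfl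
  exact key _ _ hinv

/-- Smooth vector fields. -/
abbrev SmoothField (X : VM) : Prop :=
  ContMDiff Υ (Υ).tangent ∞ (fun p => (⟨p, X p⟩ : TangentBundle Υ M))

lemma SmoothField.contMDiffOn_vecCoord (hX : SmoothField X) (c : M) : ContMDiffOn Υ 𝓘(ℝ, Є) ∞ (VC X
    c) Δ c := by
  have h := (trivializationAt Є 𝓣 c).contMDiffOn (IB := Υ) (n := ∞)
  have h2 := h.comp (hX.contMDiffOn (s := Δ c))
    (fun p hp => by rw [mem_preimage, Trivialization.mem_source]; exact mem_baseSet hp)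
  exact contMDiff_snd.comp_contMDiffOn h2

lemma SmoothField.smul (hX : SmoothField X) (hf : Ck ∞ f) : SmoothField (fun p => f p • X p) :=
  ContMDiff.smul_section hf hX

lemma SmoothField.add (hX : SmoothField X) (hY : SmoothField Y) : SmoothField (fun p => X p + Y p)
    :=
  ContMDiff.add_section hX hY

/-- The divergence computed in the preferred chart at `c`. -/
def chartDiv (c : M) (X : VM) (p : M) : ℝ :=
  (VD c p)⁻¹ * ∑ i : Fin d, fderivWithin ℝ (fun y => VD c (Θ c y) * VC X c (Θ c y) i)
      (range Υ) (Γ c p) (𝐞 i)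

lemma chartDiv_congr (hp : p ∈ Δ c) (h : ∀ᶠ q in 𝓝 p, X q = Y q) : chartDiv c X p = chartDiv c Y p
    := by
  have hp' : p ∈ (Γ c).source := by rwa [extChartAt_source]
  have h1 : ∀ᶠ y in 𝓝 (Γ c p), X (Θ c y) = Y (Θ c y) := extChartAt_preimage_mem_nhds' hp' h
  unfold chartDiv; congr 1; refine sum_congr rfl fun i _ => ?_; congr 1
  refine Filter.EventuallyEq.fderivWithin_eq (nhdsWithin_le_nhds ?_) ?_
  · filter_upwards [h1] with y hy; simp only [vecCoord, hy]
  · simp only [vecCoord, h1.self_of_nhds]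

lemma divergence_congr (h : ∀ᶠ q in 𝓝 p, X q = Y q) : Dv X p = Dv Y p :=
  chartDiv_congr (mem_chart_source _ p) h

lemma divergence_zero (p : M) : Dv (fun q : M => (0 : 𝓣 q)) p = 0 := by
  have h : ∀ y : Є, VC (fun q : M => (0 : 𝓣 q)) p (Θ p y) = VC (fun q : M => (0 : 𝓣 q)) p
      (Θ p y) := fun y => rfl
  have hp' : p ∈ (Γ p).source := mem_extChartAt_source p; unfold divergence
  rw [sum_eq_zero, mul_zero]; intro i _
  have h1 : (fun y => VD p (Θ p y) * VC (fun q : M => (0 : 𝓣 q)) p (Θ p y) i)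
      =ᶠ[𝓝 (Γ p p)] fun _ => (0 : ℝ) := by
    have := extChartAt_preimage_mem_nhds' (I := Υ) hp'
      ((𝓒 p).open_source.mem_nhds (mem_chart_source _ p))
    filter_upwards [this] with y hy; rw [vecCoord_eq hy, map_zero]; simp
  rw [Filter.EventuallyEq.fderivWithin_eq (nhdsWithin_le_nhds h1) h1.self_of_nhds]; simp

lemma SmoothField.contDiffOn_chart (hX : SmoothField X) (c : M) (i : Fin d) : ContDiffOn ℝ ∞ (fun y
    => VD c (Θ c y) * VC X c (Θ c y) i) (Γ c).target := by
  refine (contDiffOn_chart_fun le_rfl (contMDiffOn_volDensity c)).mul ?_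
  exact (EuclideanSpace.proj (𝕜 := ℝ) i).contDiff.comp_contDiffOn
    (contDiffOn_chart_fun le_rfl (hX.contMDiffOn_vecCoord c))

lemma continuousOn_chartDiv (hX : SmoothField X) (c : M) : ContinuousOn (chartDiv c X) ((𝓒 c).source
    ∩ Ξ M) := by
  unfold chartDiv
  refine ContinuousOn.mul (ContinuousOn.inv₀ ((contMDiffOn_volDensity c).continuousOn.mono
    inter_subset_left) fun p hp => (volDensity_pos hp.1).ne') ?_
  refine continuousOn_finsetSum _ fun i _ => ?_; set W := CS c (Ξ M) with hWdef
  have hW : IsOpen W := isOpen_chartSet c isOpen_interior_M subset_rfl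
  have h1 : ContinuousOn (fderiv ℝ (fun y => VD c (Θ c y) * VC X c (Θ c y) i)) W :=
    ((hX.contDiffOn_chart c i).mono inter_subset_left).continuousOn_fderiv_of_isOpen hW (by simp)
  have h2 : ContinuousOn (fun p => fderiv ℝ (fun y => VD c (Θ c y) * VC X c (Θ c y) i) (Γ c p)
        (𝐞 i))
      (Δ c ∩ Ξ M) := by
    refine ContinuousOn.clm_apply (h1.comp ?_ fun p hp => chart_mem_chartSet hp.2 hp.1)
      continuousOn_const
    exact (continuousOn_extChartAt c).mono (by rw [extChartAt_source]; exact inter_subset_left)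
  refine h2.congr fun p hp => ?_; simp only
  rw [fderivWithin_of_mem_nhds (range_mem_nhds isOpen_interior_M subset_rfl
    (chart_mem_chartSet hp.2 hp.1))]

/-- In a chart, `f div X + df(X)` becomes, up to the density, a Euclidean divergence. -/
lemma exists_chartDiv_eq_sum (hX : SmoothField X) (hf : Ck 1 f) {K : Set M} (hO : IsOpen O) (hOi : O
    ⊆ Ξ M) (hOs : O ⊆ Δ c) (hK : IsCompact K) (hKO : K ⊆ O) (h0 : ∀ p ∈ O, p ∉ K → f p = 0 ∨ X p =
    0) : ∃ F : Fin d → Є → ℝ, (∀ i, ContDiff ℝ 1 (F i)) ∧ (∀ i, tsupport (F i) ⊆ Γ c '' K) ∧ (∀ i, ∀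
    y ∈ CS c O, F i y = f (Θ c y) * (chartDensity c y * VC X c (Θ c y) i)) ∧ ∀ y ∈ CS c O,
    chartDensity c y * (f (Θ c y) * chartDiv c X (Θ c y) + Df f (Θ c y) (X ((Γ c).symm y))) = ∑ i,
    fderiv ℝ (F i) y (𝐞 i) := by
  have hOs' : O ⊆ (Γ c).source := by rwa [extChartAt_source]
  set φ := Γ c with hφ; set W := CS c O with hWdef
  have hW : IsOpen W := isOpen_chartSet c hO hOi
  let g : Fin d → Є → ℝ := fun i y => VD c (φ.symm y) * VC X c (φ.symm y) i
  let F : Fin d → Є → ℝ := fun i y => f (φ.symm y) * g i y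
  have hg : ∀ i, ContDiffOn ℝ 1 (g i) W := fun i =>
    ((hX.contDiffOn_chart c i).mono inter_subset_left).of_le one_le_infty
  have hfc : ContDiffOn ℝ 1 (fun y => f (φ.symm y)) W :=
    (contDiffOn_chart_fun one_le_infty hf.contMDiffOn).mono inter_subset_left
  have hF : ∀ i, ContDiffOn ℝ 1 (F i) W := fun i => hfc.mul (hg i)
  have hK' : IsCompact (φ '' K) := hK.image_of_continuousOn
    ((continuousOn_extChartAt c).mono (hKO.trans hOs'))
  have hK'W : φ '' K ⊆ W := by
    rintro _ ⟨p, hp, rfl⟩; exact chart_mem_chartSet (hKO hp) (hOs (hKO hp))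
  have hF0 : ∀ i, ∀ y ∈ W, y ∉ φ '' K → F i y = 0 := by
    intro i y hy hyK; have hyK' : φ.symm y ∉ K := fun h => hyK ⟨_, h, φ.right_inv hy.1⟩
    rcases h0 _ hy.2 hyK' with h | h
    · exact mul_eq_zero.2 (Or.inl h)
    · simp only [F, g]; rw [vecCoord_eq (mem_source_of_mem hy), h, map_zero]; simp
  have hind : ∀ i, ContDiff ℝ 1 (W.indicator (F i)) := fun i =>
    contDiff_indicator hW hK'.isClosed hK'W (hF i) (hF0 i)
  -- The components of the density times `f X` vanish on `W` off a compact subset, so extension by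
  -- zero makes them `C¹` on all of `ℝ^d`.
  refine ⟨fun i => W.indicator (F i), hind, fun i => ?_, fun i y hy => indicator_of_mem hy _, ?_⟩
  · refine closure_minimal (fun y hy => ?_) hK'.isClosed; by_contra hyK; by_cases hyW : y ∈ W
    · exact hy (by dsimp only; rw [indicator_of_mem hyW, hF0 i y hyW hyK])
    · exact hy (indicator_of_notMem hyW _)
  · intro y hy; have hsrc : φ.symm y ∈ Δ c := mem_source_of_mem hy
    have hr : range Υ ∈ 𝓝 y := range_mem_nhds hO hOi hy
    have hφy : φ (φ.symm y) = y := φ.right_inv hy.1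
    have hρ : VD c (φ.symm y) ≠ 0 := (volDensity_pos hsrc).ne'
    have h1 : ∀ i, fderiv ℝ (W.indicator (F i)) y = fderiv ℝ (F i) y := fun i => by
      refine Filter.EventuallyEq.fderiv_eq ?_; filter_upwards [hW.mem_nhds hy] with z hz
      rw [indicator_of_mem hz]
    have hfd : DifferentiableAt ℝ (fun y => f (φ.symm y)) y :=
      (hfc.contDiffAt (hW.mem_nhds hy)).differentiableAt one_ne_zero
    have hgd : ∀ i, DifferentiableAt ℝ (g i) y := fun i =>
      ((hg i).contDiffAt (hW.mem_nhds hy)).differentiableAt one_ne_zero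
    have h2 : ∀ i, fderiv ℝ (F i) y (𝐞 i) = f (φ.symm y) * fderiv ℝ (g i) y (𝐞 i) +
        g i y * fderiv ℝ (fun y => f (φ.symm y)) y (𝐞 i) := fun i => by
      have := fderiv_mul hfd (hgd i); change fderiv ℝ (fun y => f (φ.symm y) * g i y) y _ = _
      rw [fderiv_fun_mul hfd (hgd i)]; simp
    have h3 : Df f (φ.symm y) (X (φ.symm y)) = ∑ i, VC X c (φ.symm y) i *
          fderiv ℝ (fun y => f (φ.symm y)) y (𝐞 i) := by
      have hX' := lift_coord hsrc (X (φ.symm y)); rw [← vecCoord_eq hsrc] at hX'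
      have h4 := fderivWithin_chart_fun (hf.mdifferentiable one_ne_zero _) hsrc (VC X c (φ.symm y))
      rw [hX', ← hφ, hφy, fderivWithin_of_mem_nhds hr] at h4; rw [← h4]
      have hv : VC X c (φ.symm y) = ∑ i, VC X c (φ.symm y) i • (𝐞 i) := by
        have := (EuclideanSpace.basisFun (Fin d) ℝ).sum_repr (VC X c (φ.symm y))
        simpa using this.symm
      conv_lhs => rw [hv]
      simp [map_sum]
    simp only [h1, h2]; rw [h3, chartDiv, ← hφ, hφy]; simp only [fderivWithin_of_mem_nhds hr]
    change VD c (φ.symm y) * _ = _; rw [sum_add_distrib, mul_add]; congr 1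
    · rw [mul_sum, mul_sum, mul_sum]; refine sum_congr rfl fun i _ => ?_
      rw [mul_left_comm, mul_inv_cancel_left₀ hρ]
    · rw [mul_sum]; refine sum_congr rfl fun i _ => ?_; simp only [g]; ring

/-- Integration by parts in one chart. -/
lemma integral_chartDiv (hX : SmoothField X) (hf : Ck 1 f) {K : Set M} (hO : IsOpen O) (hOi : O ⊆ Ξ
    M) (hOs : O ⊆ Δ c) (hK : IsCompact K) (hKO : K ⊆ O) (h0 : ∀ p ∈ O, p ∉ K → f p = 0 ∨ X p = 0) :
    ∫ p in O, (f p * chartDiv c X p + Df f p (X p)) ∂ϑ = 0 := by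
  have hOs' : O ⊆ (Γ c).source := by rwa [extChartAt_source]
  obtain ⟨F, hF, hFs, -, hpt⟩ := exists_chartDiv_eq_sum hX hf hO hOi hOs hK hKO h0
  have hK' : IsCompact (Γ c '' K) := hK.image_of_continuousOn
    ((continuousOn_extChartAt c).mono (hKO.trans hOs'))
  have hsupp : ∀ i, HasCompactSupport (F i) := fun i =>
    hK'.of_isClosed_subset (isClosed_tsupport _) (hFs i)
  rw [setIntegral_chart c hO.measurableSet hOs',
    setIntegral_congr_fun (isOpen_chartSet c hO hOi).measurableSet hpt,
    setIntegral_eq_integral_of_forall_compl_eq_zero, integral_finsetSum]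
  · exact sum_eq_zero fun i _ => integral_fderiv_eq_zero (hF i) (hsupp i) _
  · intro i _
    refine Continuous.integrable_of_hasCompactSupport
      (((hF i).continuous_fderiv one_ne_zero).clm_apply continuous_const) ?_
    exact ((hsupp i).fderiv (𝕜 := ℝ)).comp_left (g := fun L : Є →L[ℝ] ℝ => L _) (by simp)
  · intro y hy; refine sum_eq_zero fun i _ => ?_
    have hy' : y ∉ tsupport (F i) := fun h => by
      obtain ⟨q, hq, rfl⟩ := hFs i h; exact hy (chart_mem_chartSet (hKO hq) (hOs (hKO hq)))
    rw [Function.notMem_support.1 fun h => hy' (support_fderiv_subset ℝ h)]; rfl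

/-- A finite smooth partition of unity subordinate to an open cover. -/
lemma exists_finite_partition (U : M → Set M) (hU : ∀ p, IsOpen (U p)) (hp : ∀ p, p ∈ U p) : ∃ (t :
    Finset M) (η : M → M → ℝ), (∀ c, Ck ∞ (η c)) ∧ (∀ c, tsupport (η c) ⊆ U c) ∧ (∀ c p, 0 ≤ η c p)
    ∧ ∀ p, ∑ c ∈ t, η c p = 1 := by
  obtain ⟨t, ht⟩ := isCompact_univ.elim_finite_subcover U hU (fun p _ => mem_iUnion.2 ⟨p, hp p⟩)
  obtain ⟨f, hf⟩ := SmoothPartitionOfUnity.exists_isSubordinate Υ (isClosed_univ (X := M))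
    (fun c : t => U c) (fun c => hU c) (fun p hp => by
      obtain ⟨c, hc, h⟩ := mem_iUnion₂.1 (ht hp); exact mem_iUnion.2 ⟨⟨c, hc⟩, h⟩)
  classical
  refine ⟨t, fun c => if h : c ∈ t then f ⟨c, h⟩ else 0, fun c => ?_, fun c => ?_, fun c p => ?_,
    fun p => ?_⟩
  · dsimp only; split_ifs with h
    · exact (f ⟨c, h⟩).contMDiff
    · exact contMDiff_const
  · dsimp only; split_ifs with h
    · exact hf ⟨c, h⟩
    · rw [tsupport_eq_empty_iff.2 rfl]; exact empty_subset _
  · dsimp only; split_ifs with h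
    · exact f.nonneg _ _
    · exact le_rfl
  · have h1 := f.sum_eq_one (mem_univ p); rw [finsum_eq_sum_of_fintype] at h1
    rw [← h1, ← Finset.sum_coe_sort]; refine sum_congr rfl fun c _ => ?_; simp [c.2]

/-- A smooth function which equals one near a compact set and is supported in a
neighbourhood. -/
lemma exists_cutoff {K U : Set M} (hK : IsClosed K) (hU : IsOpen U) (hKU : K ⊆ U) : ∃ χ : M → ℝ, Ck
    ∞ χ ∧ tsupport χ ⊆ U ∧ (∀ᶠ p in 𝓝ˢ K, χ p = 1) ∧ ∀ p, χ p ∈ Icc (0 : ℝ) 1 := by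
  obtain ⟨V, hV, hKV, hVU⟩ := normal_exists_closure_subset hK hU hKU
  obtain ⟨V', hV', hKV', hVU'⟩ := normal_exists_closure_subset hK hV hKV
  obtain ⟨f, h0, h1, h2⟩ := exists_contMDiffMap_zero_one_of_isClosed (n := ⊤) Υ
    (s := Vᶜ) (t := closure V') hV.isClosed_compl isClosed_closure
    (disjoint_left.2 fun p hp hp' => hp (hVU' hp'))
  refine ⟨f, f.contMDiff, ?_, ?_, h2⟩
  · refine (closure_mono ?_).trans hVU; intro p hp; by_contra h; exact hp (h0 h)
  · filter_upwards [(hV'.mem_nhdsSet).2 hKV'] with p hp; exact h1 (subset_closure hp)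

/-- Even at a boundary point, a relatively open subset of the half space contains a nonempty open
subset of `ℝ^d`, and Lebesgue-null sets in the chart correspond to null sets for the volume. -/
lemma openPos_vol : (ϑ).IsOpenPosMeasure := by
  refine ⟨fun U hU hne h0 => ?_⟩; obtain ⟨p, hp⟩ := hne; set A := U ∩ (Γ p).source with hA
  have hAo : IsOpen A := hU.inter (isOpen_extChartAt_source p)
  have h0' : ϑ A = 0 := measure_mono_null inter_subset_left h0
  have h1 : ∀ᵐ q ∂Λ A, False := by rw [Measure.restrict_eq_zero.2 h0']; simp
  rw [ae_chart_iff p hAo.measurableSet inter_subset_right] at h1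
  have h2 : volume (CS p A) = 0 := by simpa using h1
  have h3 : CS p A ∈ 𝓝[range Υ] (Γ p p) := by
    have ht := extChartAt_target_mem_nhdsWithin (I := Υ) p
    have hs := (continuousAt_extChartAt_symm (I := Υ) p).preimage_mem_nhds
      (hAo.mem_nhds (by rw [extChartAt_to_inv]; exact ⟨hp, mem_extChartAt_source p⟩))
    exact inter_mem ht (mem_nhdsWithin_of_mem_nhds hs)
  obtain ⟨V, hV, hpV, hVs⟩ := mem_nhdsWithin.1 h3
  have hcl := (Υ).range_subset_closure_interior (mem_range_self (𝓒 p p))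
  obtain ⟨y, hyV, hyI⟩ := mem_closure_iff.1 hcl V hV hpV
  have h4 : (V ∩ interior (range Υ)) ⊆ CS p A := fun z hz =>
    hVs ⟨hz.1, interior_subset hz.2⟩
  exact (hV.inter isOpen_interior).measure_ne_zero volume ⟨y, hyV, hyI⟩ (measure_mono_null h4 h2)

/-- Continuous functions on an open set with the same integrals against test functions agree. -/
lemma eqOn_of_integral_eq (hO : IsOpen O) {g : M → ℝ} (hf : ContinuousOn f O) (hg : ContinuousOn g
    O) (h : ∀ ψ : M → ℝ, Ck ∞ ψ → tsupport ψ ⊆ O → ∫ p in O, ψ p * f p ∂ϑ = ∫ p in O, ψ p * g p ∂ϑ)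
    : EqOn f g O := by
  have := openPos_vol (d := d) (M := M); have := finite_vol (d := d) (M := M)
  have := (Υ).locallyCompactSpace; have := ChartedSpace.locallyCompactSpace (EuclideanHalfSpace d) M
  have hloc : LocallyIntegrableOn (fun p => f p - g p) O ϑ :=
    (hf.sub hg).locallyIntegrableOn hO.measurableSet
  have hint : ∀ ψ : M → ℝ, Ck ∞ ψ → tsupport ψ ⊆ O → ∀ F : M → ℝ,
      ContinuousOn F O → IntegrableOn (fun p => ψ p * F p) O ϑ := by
    intro ψ hψ hs F hF
    have hcont : Continuous (fun p => ψ p * F p) := by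
      rw [continuous_iff_continuousAt]; intro p; by_cases hp : p ∈ O
      · exact hψ.continuous.continuousAt.mul (hF.continuousAt (hO.mem_nhds hp))
      · have : (fun p => ψ p * F p) =ᶠ[𝓝 p] fun _ => 0 := by
          have := notMem_tsupport_iff_eventuallyEq.1 (fun h => hp (hs h))
          filter_upwards [this] with q hq; rw [hq]; simp
        exact this.continuousAt
    exact (hcont.continuousOn.integrableOn_compact isCompact_univ).mono_set (subset_univ _)
  have h1 := hO.ae_eq_zero_of_integral_contMDiff_smul_eq_zero Υ hloc fun ψ hψ _ hs => by
    have h2 : ∫ p, ψ p • (f p - g p) ∂ϑ = ∫ p in O, ψ p • (f p - g p) ∂ϑ := by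
      refine (setIntegral_eq_integral_of_forall_compl_eq_zero fun p hp => ?_).symm
      rw [image_eq_zero_of_notMem_tsupport (fun h => hp (hs h)), zero_smul]
    rw [h2]; simp only [smul_eq_mul, mul_sub]
    rw [integral_sub (hint ψ hψ hs f hf) (hint ψ hψ hs g hg), h ψ hψ hs, sub_self]
  refine Measure.eqOn_open_of_ae_eq (μ := ϑ) ?_ hO hf hg
  rw [EventuallyEq, ae_restrict_iff' hO.measurableSet]; filter_upwards [h1] with p hp hpO
  exact sub_eq_zero.1 (hp hpO)

lemma continuous_dif (hX : SmoothField X) (hf : Ck 1 f) : Continuous (fun p => Df f p (X p)) := by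
  have h := hf.continuous_tangentMap le_rfl; have h2 := h.comp hX.continuous
  have h3 : Continuous (fun p : TangentBundle 𝓘(ℝ) ℝ => p.2) := by
    have := (tangentBundleModelSpaceHomeomorph 𝓘(ℝ)).continuous; exact continuous_snd.comp this
  exact h3.comp h2

/-- Independence of the chart is obtained without a transformation formula. In every chart the
divergence is minus the formal adjoint of the differential for the same volume, so the two
expressions have equal integrals against test functions. Being continuous, they agree. -/
lemma chartDiv_eq_divergence (hX : SmoothField X) (hp : p ∈ Δ c) (hpi : p ∈ Ξ M) : chartDiv c X p =
    Dv X p := by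
  set O := (Δ c ∩ Δ p) ∩ Ξ M with hOdef
  have hO : IsOpen O := ((𝓒 c).open_source.inter (𝓒 p).open_source).inter isOpen_interior_M
  have hc : ContinuousOn (chartDiv c X) O :=
    (continuousOn_chartDiv hX c).mono fun q hq => ⟨hq.1.1, hq.2⟩
  have hc' : ContinuousOn (chartDiv p X) O :=
    (continuousOn_chartDiv hX p).mono fun q hq => ⟨hq.1.2, hq.2⟩
  have := finite_vol (d := d) (M := M)
  have hint : ∀ ψ : M → ℝ, Ck ∞ ψ → tsupport ψ ⊆ O → ∀ F : M → ℝ,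
      ContinuousOn F O → IntegrableOn (fun p => ψ p * F p) O ϑ := by
    intro ψ hψ hs F hF
    have h1 : IntegrableOn (fun p => ψ p * F p) (tsupport ψ) ϑ :=
      ((hψ.continuous.continuousOn).mul (hF.mono hs)).integrableOn_compact
        (isClosed_tsupport ψ).isCompact
    refine (h1.of_forall_sdiff_eq_zero hO.measurableSet fun q hq => ?_)
    rw [image_eq_zero_of_notMem_tsupport hq.2, zero_mul]
  have hd : ∀ ψ : M → ℝ, Ck ∞ ψ → IntegrableOn (fun p => Df ψ p (X p)) O ϑ :=
    fun ψ hψ => ((continuous_dif hX (hψ.of_le one_le_infty)).continuousOn.integrableOn_compact isCompact_univ).mono_set (subset_univ _)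
  refine eqOn_of_integral_eq (d := d) hO hc hc' (fun ψ hψ hs => ?_)
    ⟨⟨hp, mem_chart_source _ p⟩, hpi⟩
  have hψ1 : Ck 1 ψ := hψ.of_le one_le_infty
  have e1 := integral_chartDiv hX hψ1 (c := c) hO inter_subset_right (fun q hq => hq.1.1)
    (isClosed_tsupport ψ).isCompact hs (fun q _ hq => Or.inl (image_eq_zero_of_notMem_tsupport hq))
  have e2 := integral_chartDiv hX hψ1 (c := p) hO inter_subset_right (fun q hq => hq.1.2)
    (isClosed_tsupport ψ).isCompact hs (fun q _ hq => Or.inl (image_eq_zero_of_notMem_tsupport hq))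
  rw [integral_add (hint ψ hψ hs _ hc) (hd ψ hψ)] at e1
  rw [integral_add (hint ψ hψ hs _ hc') (hd ψ hψ)] at e2; linarith

lemma continuousOn_divergence (hX : SmoothField X) : ContinuousOn (Dv X) (Ξ M) := by
  intro p hp; have hO : IsOpen (Δ p ∩ Ξ M) := (𝓒 p).open_source.inter isOpen_interior_M
  have h1 : ContinuousAt (chartDiv p X) p :=
    (continuousOn_chartDiv hX p).continuousAt (hO.mem_nhds ⟨mem_chart_source _ p, hp⟩)
  refine (h1.congr ?_).continuousWithinAt
  filter_upwards [hO.mem_nhds ⟨mem_chart_source _ p, hp⟩] with q hq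
  exact chartDiv_eq_divergence hX hq.1 hq.2

lemma divergence_eq_zero (hp : p ∉ closure {p | X p ≠ 0}) : Dv X p = 0 := by
  rw [divergence_congr (Y := fun _ => 0), divergence_zero]
  filter_upwards [isClosed_closure.isOpen_compl.mem_nhds hp] with q hq; by_contra h
  exact hq (subset_closure h)

lemma continuous_divergence (hX : SmoothField X) (hs : closure {p | X p ≠ 0} ⊆ Ξ M) : Continuous (Dv
    X) := by
  rw [continuous_iff_continuousAt]; intro p; by_cases hp : p ∈ closure {p | X p ≠ 0}
  · exact (continuousOn_divergence hX).continuousAt (isOpen_interior_M.mem_nhds (hs hp))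
  · refine (continuousAt_const (y := (0 : ℝ))).congr ?_
    filter_upwards [isClosed_closure.isOpen_compl.mem_nhds hp] with q hq
    exact (divergence_eq_zero hq).symm

lemma dif_eq_fderivWithin (hf : MDifferentiableAt Υ 𝓘(ℝ) f p) (hp : p ∈ Δ c) (v : 𝓣 p) : Df f p v =
    fderivWithin ℝ (fun y => f (Θ c y)) (range Υ) (Γ c p) (coord c p v)
    := by rw [fderivWithin_chart_fun hf hp, lift_coord hp]

lemma diffWithinAt_chart (hf : MDifferentiableAt Υ 𝓘(ℝ) f p) : DifferentiableWithinAt ℝ (fun y => f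
    (Θ p y)) (range Υ) (Γ p p) :=
  ((mdifferentiableAt_iff _ _).1 hf).2

lemma uniqueDiff_chart (p : M) : UniqueDiffWithinAt ℝ (range Υ) (Γ p p) :=
  (Υ).uniqueDiffOn _ (mem_range_self _)

lemma dif_mul {g : M → ℝ} (hf : MDifferentiableAt Υ 𝓘(ℝ) f p) (hg : MDifferentiableAt Υ 𝓘(ℝ) g p) (v
    : 𝓣 p) : Df (fun q => f q * g q) p v = f p * Df g p v + g p * Df f p v :=
    by
  have hp := mem_src d p; have hfg : MDifferentiableAt Υ 𝓘(ℝ) (fun q => f q * g q) p := hf.mul hg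
  rw [dif_eq_fderivWithin hfg hp, dif_eq_fderivWithin hf hp, dif_eq_fderivWithin hg hp,
    fderivWithin_fun_mul (uniqueDiff_chart p) (diffWithinAt_chart hf)
      (diffWithinAt_chart hg)]
  simp only [add_apply, smul_apply, smul_eq_mul, extChartAt_to_inv]

lemma dif_sum {ι : Type*} {t : Finset ι} {f : ι → M → ℝ} (hf : ∀ i ∈ t, MDifferentiableAt Υ 𝓘(ℝ) (f
    i) p) (v : 𝓣 p) : Df (fun q => ∑ i ∈ t, f i q) p v = ∑ i ∈ t, Df (f i) p v := by
  have hp := mem_src d p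
  have hs : MDifferentiableAt Υ 𝓘(ℝ) (fun q => ∑ i ∈ t, f i q) p := by
    classical
    induction t using Finset.induction_on with
    | empty => simpa using mdifferentiableAt_const
    | insert a t ha ih =>
      simp only [sum_insert ha]
      exact (hf a (mem_insert_self _ _)).add (ih fun i hi => hf i (mem_insert_of_mem hi))
  rw [dif_eq_fderivWithin hs hp, sum_congr rfl fun i hi => dif_eq_fderivWithin (hf i hi) hp v,
    fderivWithin_fun_sum (uniqueDiff_chart p)
      fun i hi => diffWithinAt_chart (hf i hi)]
  simp

lemma dif_sub {g : M → ℝ} (hf : MDifferentiableAt Υ 𝓘(ℝ) f p) (hg : MDifferentiableAt Υ 𝓘(ℝ) g p) (v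
    : 𝓣 p) : Df (fun q => f q - g q) p v = Df f p v - Df g p v := by
  have hp := mem_src d p; have hfg : MDifferentiableAt Υ 𝓘(ℝ) (fun q => f q - g q) p := hf.sub hg
  rw [dif_eq_fderivWithin hfg hp, dif_eq_fderivWithin hf hp, dif_eq_fderivWithin hg hp,
    fderivWithin_fun_sub (uniqueDiff_chart p) (diffWithinAt_chart hf)
      (diffWithinAt_chart hg)]
  simp

lemma dif_congr {g : M → ℝ} (h : f =ᶠ[𝓝 p] g) (v : 𝓣 p) : Df f p v = Df g p v := by
  have key : (𝓓 f p : Є →L[ℝ] ℝ) = 𝓓 g p := h.mfderiv_eq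
  exact congrArg (fun L : Є →L[ℝ] ℝ => L v) key

lemma dif_const (a : ℝ) (p : M) (v : 𝓣 p) : Df (fun _ => a) p v = 0 := by
  have hp := mem_src d p; rw [dif_eq_fderivWithin mdifferentiableAt_const hp]; simp

lemma dif_eq_zero (h : p ∉ tsupport f) (v : 𝓣 p) : Df f p v = 0 := by
  rw [dif_congr (notMem_tsupport_iff_eventuallyEq.1 h)]; exact dif_const 0 p v

lemma eventually_symm_mem_source (p : M) : ∀ᶠ y in 𝓝 (Γ p p), (Θ p) y ∈ Δ p :=
  extChartAt_preimage_mem_nhds' (I := Υ) (mem_extChartAt_source p)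
    ((𝓒 p).open_source.mem_nhds (mem_chart_source _ p))

lemma SmoothField.differentiableWithinAt (hX : SmoothField X) (p : M) (i : Fin d) :
    DifferentiableWithinAt ℝ (fun y => VD p (Θ p y) * VC X p ((Θ p) y) i) (range Υ) (Γ p p) :=
  (((hX.contDiffOn_chart p i).differentiableOn (by simp)) _ (mem_extChartAt_target p)).mono_of_mem_nhdsWithin
    (extChartAt_target_mem_nhdsWithin p)

lemma divergence_smul (hX : SmoothField X) (hη : Ck ∞ η) (p : M) : Dv (fun q => η q • X q) p = η p *
    Dv X p + Df η p (X p) := by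
  have hp := mem_src d p; have hη' : MDifferentiableAt Υ 𝓘(ℝ) η p := hη.mdifferentiable (by simp) p
  set φ := Γ p with hφ; have hinv : φ.symm (φ p) = p := extChartAt_to_inv p
  let g : Fin d → Є → ℝ := fun i y => VD p (φ.symm y) * VC X p (φ.symm y) i
  have h1 : ∀ i, fderivWithin ℝ (fun y => VD p (φ.symm y) *
      VC (fun q => η q • X q) p (φ.symm y) i) (range Υ) (φ p) (𝐞 i) =
      η p * fderivWithin ℝ (g i) (range Υ) (φ p) (𝐞 i) +
      VD p p * (VC X p p i * fderivWithin ℝ (fun y => η (φ.symm y)) (range Υ) (φ p) (𝐞 i)) := by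
    intro i
    have e : (fun y => VD p (φ.symm y) * VC (fun q => η q • X q) p (φ.symm y) i)
        =ᶠ[𝓝 (φ p)] fun y => η (φ.symm y) * g i y := by
      filter_upwards [eventually_symm_mem_source p] with y hy; simp only [g]
      rw [vecCoord_eq hy, vecCoord_eq hy, map_smul]; simp only [PiLp.smul_apply, smul_eq_mul]; ring
    rw [Filter.EventuallyEq.fderivWithin_eq (nhdsWithin_le_nhds e) e.self_of_nhds,
      fderivWithin_fun_mul (uniqueDiff_chart p) (diffWithinAt_chart hη')
      (hX.differentiableWithinAt p i)]
    simp only [g, add_apply, smul_apply, smul_eq_mul, ← hφ, hinv]; ring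
  have h2 : Df η p (X p) = ∑ i, VC X p p i *
        fderivWithin ℝ (fun y => η (φ.symm y)) (range Υ) (φ p) (𝐞 i) := by
    rw [dif_eq_fderivWithin hη' hp, ← vecCoord_eq hp]
    have hv : VC X p p = ∑ i, VC X p p i • (𝐞 i) := by
      have := (EuclideanSpace.basisFun (Fin d) ℝ).sum_repr (VC X p p); simpa using this.symm
    conv_lhs => rw [hv]
    simp [map_sum, hφ]
  have hρ : VD p p ≠ 0 := (volDensity_pos hp).ne'; unfold divergence
  rw [sum_congr rfl fun i _ => h1 i, sum_add_distrib, ← mul_sum,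
    ← mul_sum, ← h2, mul_add, inv_mul_cancel_left₀ hρ]
  ring

lemma divergence_add (hX : SmoothField X) (hY : SmoothField Y) (p : M) : Dv (fun q => X q + Y q) p =
    Dv X p + Dv Y p := by
  have hp := mem_src d p; unfold divergence; rw [← mul_add, ← sum_add_distrib]; congr 1
  refine sum_congr rfl fun i _ => ?_
  have e : (fun y => VD p (Θ p y) * VC (fun q => X q + Y q) p (Θ p y) i) =ᶠ[𝓝 (Γ p p)] fun y =>
        VD p (Θ p y) * VC X p (Θ p y) i +
        VD p (Θ p y) * VC Y p (Θ p y) i := by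
    filter_upwards [eventually_symm_mem_source p] with y hy
    rw [vecCoord_eq hy, vecCoord_eq hy, vecCoord_eq hy, map_add]; simp only [PiLp.add_apply]; ring
  rw [Filter.EventuallyEq.fderivWithin_eq (nhdsWithin_le_nhds e) e.self_of_nhds,
    fderivWithin_fun_add (uniqueDiff_chart p) (hX.differentiableWithinAt p i)
      (hY.differentiableWithinAt p i)]
  simp

/-- A partition of unity splits `f` into pieces supported in chart domains, and for each piece the
one-chart formula applies with the compact set `tsupport (η c)` intersected with the support of `X`.
-/
lemma integral_divergence (hX : SmoothField X) (hf : Ck 1 f) (hO : IsOpen O) (hOi : O ⊆ Ξ M) (hs :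
    closure {p | X p ≠ 0} ⊆ O) : ∫ p in O, (f p * Dv X p + Df f p (X p)) ∂ϑ = 0 := by
  have := finite_vol (d := d) (M := M)
  have hint : ∀ F : M → ℝ, Continuous F → IntegrableOn F O ϑ := fun F hF =>
    (hF.continuousOn.integrableOn_compact isCompact_univ).mono_set (subset_univ _)
  obtain ⟨t, η, hη, hηs, -, hsum⟩ := exists_finite_partition (d := d) (fun c : M => Δ c)
    (fun c => (𝓒 c).open_source) (fun c => mem_chart_source _ c)
  have hη1 : ∀ c, Ck 1 (η c) := fun c => (hη c).of_le one_le_infty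
  have hηf : ∀ c, Ck 1 (fun p => η c p * f p) := fun c => (hη1 c).mul hf
  have hpt : ∀ p, f p * Dv X p + Df f p (X p) =
      ∑ c ∈ t, ((η c p * f p) * Dv X p + Df (fun p => η c p * f p) p (X p)) := by
    intro p
    rw [sum_add_distrib, ← sum_mul, ← sum_mul, hsum, one_mul,
      ← dif_sum fun c _ => (hηf c).mdifferentiable one_ne_zero p]
    congr 1; refine dif_congr (.of_forall fun q => ?_) _; rw [← sum_mul, hsum, one_mul]
  have hdiv := continuous_divergence hX (hs.trans hOi); simp only [hpt]
  have hi : ∀ c ∈ t, IntegrableOn (fun p => (η c p * f p) * Dv X p +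
      Df (fun p => η c p * f p) p (X p)) O ϑ := fun c _ =>
    hint _ (((hηf c).continuous.mul hdiv).add (continuous_dif hX (hηf c)))
  rw [integral_finsetSum _ hi]; refine sum_eq_zero fun c _ => ?_
  have hOc : IsOpen (O ∩ Δ c) := hO.inter (𝓒 c).open_source
  have h1 := integral_chartDiv hX (hηf c) (c := c) hOc (inter_subset_left.trans hOi)
    inter_subset_right (K := tsupport (η c) ∩ closure {p | X p ≠ 0})
    ((isClosed_tsupport _).inter isClosed_closure).isCompact
    (fun q hq => ⟨hs hq.2, hηs c hq.1⟩) (fun q _ hq => by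
      by_contra h; push Not at h
      exact hq ⟨subset_closure fun h0 => h.1 (by rw [h0, zero_mul]), subset_closure h.2⟩)
  have h2 : EqOn (fun p => (η c p * f p) * chartDiv c X p + Df (fun p => η c p * f p) p (X p))
      (fun p => (η c p * f p) * Dv X p + Df (fun p => η c p * f p) p (X p))
      (O ∩ Δ c) := fun q hq => by simp only [chartDiv_eq_divergence hX hq.2 (hOi hq.1)]
  rw [← h1, setIntegral_congr_fun hOc.measurableSet h2]
  refine setIntegral_eq_of_subset_of_forall_sdiff_eq_zero hO.measurableSet inter_subset_left
    fun q hq => ?_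
  have hq' : q ∉ tsupport (η c) := fun h => hq.2 ⟨hq.1, hηs c h⟩
  rw [image_eq_zero_of_notMem_tsupport hq', zero_mul, zero_mul, zero_add]
  exact dif_eq_zero (fun h => hq' (tsupport_mul_subset_left h)) _

/-! ### Gram matrix, gradients and measurable vector fields -/

/-- The coordinate vector fields. -/
def coordField (c : M) (i : Fin d) (p : M) : 𝓣 p := lift c p (𝐞 i)

/-- The matrix of the metric in the preferred chart at `c`. -/
def gram (c p : M) : Matrix (Fin d) (Fin d) ℝ :=
  Matrix.of fun i j => inner ℝ (coordField c i p) (coordField c j p)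

lemma eq_sum_coordField (hp : p ∈ Δ c) (v : 𝓣 p) : v = ∑ i, coord c p v i • coordField c i p := by
  conv_lhs => rw [← lift_coord hp v]
  have hv : coord c p v = ∑ i, coord c p v i • (𝐞 i) := by
    have := (EuclideanSpace.basisFun (Fin d) ℝ).sum_repr (coord c p v); simpa using this.symm
  conv_lhs => rw [hv]
  simp only [map_sum, map_smul, coordField]

lemma gram_det_ne_zero (hp : p ∈ Δ c) : (gram (d := d) c p).det ≠ 0 := by
  have h := volDensity_pos (d := d) hp; rw [volDensity_eq hp] at h; exact (Real.sqrt_pos.1 h).ne'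

lemma gram_mulVec (hp : p ∈ Δ c) (v : 𝓣 p) (i : Fin d) : inner ℝ (coordField c i p) v = ∑ j, gram c
    p i j * coord c p v j := by
  conv_lhs => rw [eq_sum_coordField hp v]
  rw [inner_sum]; refine sum_congr rfl fun j _ => ?_
  rw [inner_smul_right, gram, Matrix.of_apply, mul_comm]

lemma coord_eq_inv (hp : p ∈ Δ c) (v : 𝓣 p) (i : Fin d) : coord c p v i = ∑ j, (gram c p)⁻¹ i j *
    inner ℝ (coordField c j p) v := by
  have h1 : (fun j => inner ℝ (coordField c j p) v) = (gram c p).mulVec (coord c p v).ofLp := by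
    ext j; rw [gram_mulVec hp]; rfl
  have h2 : (gram c p)⁻¹.mulVec (fun j => inner ℝ (coordField c j p) v) = (coord c p v).ofLp := by
    rw [h1, Matrix.mulVec_mulVec, Matrix.nonsing_inv_mul _ (gram_det_ne_zero hp).isUnit,
      Matrix.one_mulVec]
  exact (congrFun h2 i).symm

lemma inner_eq_gram (hp : p ∈ Δ c) (v w : 𝓣 p) : inner ℝ v w = ∑ i, ∑ j, coord c p v i * (gram c p i
    j * coord c p w j) := by
  conv_lhs => rw [eq_sum_coordField hp v]
  rw [sum_inner]; refine sum_congr rfl fun i _ => ?_; rw [inner_smul_left, gram_mulVec hp, mul_sum]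
  simp

/-- The Riesz representation of a linear form on a tangent space. -/
lemma exists_inner_eq (L : 𝓣 p →ₗ[ℝ] ℝ) : ∃ V : 𝓣 p, ∀ v, inner ℝ v V = L v := by
  have hp := mem_src d p; let b : Fin d → ℝ := fun i => L (coordField p i p)
  refine ⟨lift p p (WithLp.toLp 2 ((gram p p)⁻¹.mulVec b)), fun v => ?_⟩
  rw [eq_sum_coordField hp v, sum_inner, map_sum]; refine sum_congr rfl fun i _ => ?_
  rw [inner_smul_left, gram_mulVec hp, coord_lift hp, map_smul]
  have : ∑ j, gram p p i j * (WithLp.toLp 2 ((gram p p)⁻¹.mulVec b)) j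
      = (gram p p).mulVec ((gram p p)⁻¹.mulVec b) i := rfl
  rw [this, Matrix.mulVec_mulVec, Matrix.mul_nonsing_inv _ (gram_det_ne_zero hp).isUnit,
    Matrix.one_mulVec]
  simp [b]

variable (d) in
/-- The Riemannian gradient. -/
def grad (w : M → ℝ) (p : M) : 𝓣 p := (exists_inner_eq (Df w p)).choose

local notation "Gd" => grad d

lemma inner_grad (w : M → ℝ) (p : M) (v : 𝓣 p) : inner ℝ v (Gd w p) = Df w p v
    := (exists_inner_eq (Df w p)).choose_spec v

lemma contMDiffOn_coordField (c : M) (i : Fin d) : ContMDiffOn Υ (Υ).tangent ∞ (fun p => (⟨p,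
    coordField c i p⟩ : TangentBundle Υ M)) Δ c := contMDiffOn_lift c _

lemma continuousOn_gram (c : M) : ContinuousOn (gram (d := d) c) Δ c :=
  continuousOn_pi.2 fun _ => continuousOn_pi.2 fun _ => (contMDiffOn_inner_lift c _ _).continuousOn

lemma continuousOn_gram_inv (c : M) : ContinuousOn (fun p => (gram (d := d) c p)⁻¹) Δ c := by
  simp only [Matrix.inv_def, Ring.inverse_eq_inv']; have hg := continuousOn_gram (d := d) c
  refine ContinuousOn.smul (ContinuousOn.inv₀ ?_ fun p hp => gram_det_ne_zero hp) ?_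
  · exact (continuous_id.matrix_det).comp_continuousOn hg
  · exact (continuous_id.matrix_adjugate).comp_continuousOn hg

lemma continuousOn_gram_apply (c : M) (i j : Fin d) : ContinuousOn (fun p => gram (d := d) c p i j)
    Δ c :=
  continuousOn_pi.1 (continuousOn_pi.1 (continuousOn_gram c) i) j

lemma continuousOn_gram_inv_apply (c : M) (i j : Fin d) : ContinuousOn (fun p => (gram (d := d) c
    p)⁻¹ i j) Δ c :=
  continuousOn_pi.1 (continuousOn_pi.1 (continuousOn_gram_inv c) i) j

variable (d) in
/-- Measurability of vector fields in charts. -/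
def MeasField (A : Set M) (V : VM) : Prop := ∀ c : M, AEStronglyMeasurable (VC V c) (Λ (A ∩ Δ c))

local notation "MF" => MeasField d

lemma measSet_source (c : M) : MeasurableSet Δ c := (𝓒 c).open_source.measurableSet

/-- Contravariant and covariant components determine each other through the Gram matrix and its
inverse, both continuous in the chart. The covariant ones are convenient for sums, multiples and
pullbacks. -/
lemma measField_iff (hA : MeasurableSet A) : MF A V ↔ ∀ (c : M) (i : Fin d), AEStronglyMeasurable
    (fun p => inner ℝ (coordField c i p) (V p)) (Λ (A ∩ (𝓒 c).source)) := by
  have hcoord : ∀ c, AEStronglyMeasurable (VC V c) (Λ (A ∩ Δ c)) ↔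
      ∀ i, AEStronglyMeasurable (fun p => coord c p (V p) i) (Λ (A ∩ Δ c)) := by
    intro c; have hm := hA.inter (measSet_source (d := d) c)
    have h1 : AEStronglyMeasurable (VC V c) (Λ (A ∩ Δ c)) ↔
      AEStronglyMeasurable (fun p => coord c p (V p)) (Λ (A ∩ Δ c)) := by
      refine aestronglyMeasurable_congr ?_; filter_upwards [ae_restrict_mem hm] with p hp
      exact vecCoord_eq hp.2 V
    rw [h1]; constructor
    · intro h i; exact (EuclideanSpace.proj (𝕜 := ℝ) i).continuous.comp_aestronglyMeasurable h
    · intro h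
      have h2 : AEMeasurable (fun p i => coord c p (V p) i) (Λ (A ∩ Δ c)) :=
        aemeasurable_pi_lambda _ fun i => (h i).aemeasurable
      have h3 := (PiLp.continuous_toLp 2 (fun _ : Fin d => ℝ)).comp_aestronglyMeasurable
        h2.aestronglyMeasurable
      exact h3
  constructor
  · intro h c i; have hm := hA.inter (measSet_source (d := d) c)
    refine AEStronglyMeasurable.congr (f := fun p => ∑ j, gram c p i j * coord c p (V p) j) ?_ ?_
    · refine aestronglyMeasurable_fun_sum _ fun j _ => AEStronglyMeasurable.mul ?_ ?_
      · exact ((continuousOn_gram_apply c i j).mono inter_subset_right).aestronglyMeasurable hm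
      · exact (hcoord c).1 (h c) j
    · filter_upwards [ae_restrict_mem hm] with p hp; exact (gram_mulVec hp.2 _ _).symm
  · intro h c; have hm := hA.inter (measSet_source (d := d) c)
    refine (hcoord c).2 fun i => ?_
    refine AEStronglyMeasurable.congr
      (f := fun p => ∑ j, (gram c p)⁻¹ i j * inner ℝ (coordField c j p) (V p)) ?_ ?_
    · refine aestronglyMeasurable_fun_sum _ fun j _ => AEStronglyMeasurable.mul ?_ (h c j)
      exact ((continuousOn_gram_inv_apply c i j).mono inter_subset_right).aestronglyMeasurable hm
    · filter_upwards [ae_restrict_mem hm] with p hp; exact (coord_eq_inv hp.2 _ _).symm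

lemma aestronglyMeasurable_of_charts (h : ∀ c : M, AEStronglyMeasurable f (Λ (A ∩ Δ c))) :
    AEStronglyMeasurable f Λ A := by
  obtain ⟨t, ht⟩ := isCompact_univ.elim_finite_subcover (fun c : M => Δ c)
    (fun c => (𝓒 c).open_source)
    (fun p _ => mem_iUnion.2 ⟨p, mem_chart_source _ p⟩)
  have hA : A = ⋃ c : t, A ∩ (𝓒 (c : M)).source := by
    rw [← inter_iUnion]; refine (inter_eq_left.2 fun p _ => ?_).symm
    obtain ⟨c, hc, h⟩ := mem_iUnion₂.1 (ht (mem_univ p)); exact mem_iUnion.2 ⟨⟨c, hc⟩, h⟩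
  rw [hA, aestronglyMeasurable_iUnion_iff]; exact fun c => h c

lemma MeasField.mono {A' : Set M} (h : MF A V) (hA : A' ⊆ A) : MF A' V := fun c =>
  (h c).mono_measure (restrict_mono (inter_subset_inter_left _ hA) le_rfl)

lemma MeasField.aestronglyMeasurable_coord (hA : MeasurableSet A) (h : MF A V) (c : M) (i : Fin d) :
    AEStronglyMeasurable (fun p => coord c p (V p) i) (Λ (A ∩ (𝓒 c).source)) := by
  refine AEStronglyMeasurable.congr
    ((EuclideanSpace.proj (𝕜 := ℝ) i).continuous.comp_aestronglyMeasurable (h c)) ?_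
  filter_upwards [ae_restrict_mem (hA.inter (measSet_source (d := d) c))] with p hp
  rw [vecCoord_eq hp.2]; rfl

lemma MeasField.inner (hA : MeasurableSet A) (hV : MF A V) (hW : MF A W) : AEStronglyMeasurable (fun
    p => inner ℝ (V p) (W p)) Λ A := by
  refine aestronglyMeasurable_of_charts (d := d) fun c => ?_
  have hm := hA.inter (measSet_source (d := d) c)
  refine AEStronglyMeasurable.congr
    (f := fun p => ∑ i, ∑ j, coord c p (V p) i * (gram c p i j * coord c p (W p) j)) ?_ ?_
  · refine aestronglyMeasurable_fun_sum _ fun i _ => aestronglyMeasurable_fun_sum _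
      fun j _ => (hV.aestronglyMeasurable_coord hA c i).mul
        (AEStronglyMeasurable.mul ?_ (hW.aestronglyMeasurable_coord hA c j))
    exact ((continuousOn_gram_apply c i j).mono inter_subset_right).aestronglyMeasurable hm
  · filter_upwards [ae_restrict_mem hm] with p hp; exact (inner_eq_gram hp.2 _ _).symm

lemma MeasField.norm (hA : MeasurableSet A) (hV : MF A V) : AEStronglyMeasurable (fun p => ‖V p‖) Λ
    A := by
  simp only [norm_eq_sqrt_real_inner]
  exact Real.continuous_sqrt.comp_aestronglyMeasurable (hV.inner hA hV)

lemma measField_of_contOn (hA : MeasurableSet A) (hX : ContinuousOn (fun p => (⟨p, X p⟩ :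
    TangentBundle Υ M)) A) : MF A X := by
  intro c; refine ContinuousOn.aestronglyMeasurable ?_ (hA.inter (measSet_source (d := d) c))
  have h := (trivializationAt Є 𝓣 c).continuousOn
  have h2 := h.comp (hX.mono (s := A) (t := A ∩ Δ c) inter_subset_left)
    (fun p hp => by rw [Trivialization.mem_source]; exact mem_baseSet hp.2)
  exact continuous_snd.comp_continuousOn h2

lemma MeasField.add (hA : MeasurableSet A) (hV : MF A V) (hW : MF A W) : MF A (fun p => V p + W p)
    := by
  rw [measField_iff hA] at *; intro c i; simp only [inner_add_right]; exact (hV c i).add (hW c i)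

lemma MeasField.sub (hA : MeasurableSet A) (hV : MF A V) (hW : MF A W) : MF A (fun p => V p - W p)
    := by
  rw [measField_iff hA] at *; intro c i; simp only [inner_sub_right]; exact (hV c i).sub (hW c i)

lemma MeasField.smul (hA : MeasurableSet A) (hV : MF A V) (hf : AEStronglyMeasurable f Λ A) : MF A
    (fun p => f p • V p) := by
  rw [measField_iff hA] at *; intro c i; simp only [inner_smul_right]
  exact (hf.mono_measure (restrict_mono inter_subset_left le_rfl)).mul (hV c i)

lemma continuousOn_dif (hX : ContinuousOn (fun p => (⟨p, X p⟩ : TangentBundle Υ M)) O) (hf : Ck 1 f)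
    : ContinuousOn (fun p => Df f p (X p)) O := by
  have h := hf.continuous_tangentMap le_rfl; have h2 := h.comp_continuousOn hX
  have h3 : Continuous (fun p : TangentBundle 𝓘(ℝ) ℝ => p.2) := by
    have := (tangentBundleModelSpaceHomeomorph 𝓘(ℝ)).continuous; exact continuous_snd.comp this
  exact h3.comp_continuousOn h2

lemma measField_grad (hw : Ck 1 w) (hA : MeasurableSet A) : MF A (Gd w) := by
  rw [measField_iff hA]; intro c i; simp only [inner_grad]
  exact ((continuousOn_dif (contMDiffOn_coordField c i).continuousOn hw).mono
    inter_subset_right).aestronglyMeasurable (hA.inter (measSet_source (d := d) c))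

/-- In a chart the squared norm is `∑ gⁱʲ ∂ᵢw ∂ⱼw`, with continuous coefficients. -/
lemma continuous_norm_grad (hw : Ck 1 w) : Continuous (fun p => ‖Gd w p‖) := by
  rw [continuous_iff_continuousAt]; intro c
  have hS := (𝓒 c).open_source.mem_nhds (mem_chart_source _ c)
  refine ContinuousOn.continuousAt ?_ hS
  have hb : ∀ i, ContinuousOn (fun p => Df w p (coordField c i p)) Δ c := fun i =>
    continuousOn_dif (contMDiffOn_coordField c i).continuousOn hw
  have h : ContinuousOn (fun p => √(∑ i, ∑ j, (gram c p)⁻¹ i j * Df w p (coordField c j p) *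
      Df w p (coordField c i p))) Δ c := by
    refine Real.continuous_sqrt.comp_continuousOn ?_
    exact continuousOn_finsetSum _ fun i _ => continuousOn_finsetSum _ fun j _ =>
      ((continuousOn_gram_inv_apply c i j).mul (hb j)).mul (hb i)
  refine h.congr fun p hp => ?_; simp only; rw [norm_eq_sqrt_real_inner]; congr 1
  nth_rw 1 [eq_sum_coordField hp (Gd w p)]; rw [sum_inner]; refine sum_congr rfl fun i _ => ?_
  rw [inner_smul_left, inner_grad, coord_eq_inv hp, ← sum_mul]; simp [inner_grad]

/-! ### Calculus of weak gradients -/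

section WeakGradient

lemma memLp_of_cont (hf : Continuous f) (q : ℝ≥0∞) (D : Set M) : MemLp f q (Λ D) := by
  have := finite_vol (d := d) (M := M); obtain ⟨C, hC⟩ := exists_bound hf
  exact MemLp.of_bound (hf.aestronglyMeasurable) C (.of_forall fun p => hC p)

lemma integrable_of_cont (hf : Continuous f) (D : Set M) : IntegrableOn f D ϑ
    := memLp_one_iff_integrable.1 (memLp_of_cont hf 1 D)

/-- `X` is a test field on `D`. -/
structure IsTest (D : Set M) (X : VM) : Prop where
  smooth : SmoothField X
  supp : closure {p | X p ≠ 0} ⊆ D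

lemma IsTest.eq_zero (hX : IsTest D X) (hp : p ∉ D) : X p = 0 := by
  by_contra h; exact hp (hX.supp (subset_closure h))

lemma IsTest.divergence_eq_zero (hX : IsTest D X) (hp : p ∉ D) : Dv X p = 0 :=
  EquivSpectrum.divergence_eq_zero fun h => hp (hX.supp h)

lemma IsTest.mono {D' : Set M} (hX : IsTest D X) (h : D ⊆ D') : IsTest D' X
    := ⟨hX.smooth, hX.supp.trans h⟩

lemma SmoothField.continuous_norm (hX : SmoothField X) : Continuous (fun p => ‖X p‖) := by
  have h : Ck ∞ (fun p => inner ℝ (X p) (X p)) := ContMDiff.inner_bundle hX hX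
  simp only [norm_eq_sqrt_real_inner]; exact Real.continuous_sqrt.comp h.continuous

lemma SmoothField.measField (hX : SmoothField X) (hA : MeasurableSet A) : MF A X :=
  measField_of_contOn hA hX.continuous.continuousOn

lemma integrable_inner (hD : MeasurableSet D) (hV : MF D V) (hW : MF D W) (hV2 : MemLp (fun p => ‖V
    p‖) 2 Λ D) (hW2 : MemLp (fun p => ‖W p‖) 2 (Λ D)) : IntegrableOn (fun p => inner ℝ (V p) (W p))
    D ϑ := by
  refine (hV2.integrable_mul hW2).mono (hV.inner hD hW) (.of_forall fun p => ?_)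
  simp only [Pi.mul_apply, norm_mul, norm_norm]; exact norm_inner_le_norm _ _

lemma IsTest.integrable_inner (hD : MeasurableSet D) (hX : SmoothField X) (hW : MF D W) (hW2 : MemLp
    (fun p => ‖W p‖) 2 Λ D) : IntegrableOn (fun p => inner ℝ (X p) (W p)) D ϑ :=
  EquivSpectrum.integrable_inner hD (hX.measField hD) hW (memLp_of_cont hX.continuous_norm 2 D) hW2

lemma IsTest.integrable_mul (hDi : D ⊆ Ξ M) (hX : IsTest D X) (hu : MemLp u 2 (Λ D)) : IntegrableOn
    (fun p => u p * Dv X p) D ϑ :=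
  hu.integrable_mul (memLp_of_cont (continuous_divergence hX.smooth (hX.supp.trans hDi)) 2 D)

variable {V' : VF d M}

lemma IsWeakGradient.measField (h : IsWG D u V) : MF D V := h.measurable

lemma IsWeakGradient.test (h : IsWG D u V) (hX : IsTest D X) : ∫ p in D, inner ℝ (X p) (V p) ∂ϑ = -∫
    p in D, u p * Dv X p ∂ϑ :=
  h.integral_eq X hX.smooth hX.supp

lemma isWeakGradient_grad (hD : IsOpen D) (hDi : D ⊆ Ξ M) (hw : ContMDiff Υ 𝓘(ℝ) 1 w) : IsWG D w (Gd
    w) where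
  measurable := measField_grad hw hD.measurableSet
  memLp := memLp_of_cont (continuous_norm_grad hw) 2 D
  integral_eq X hX hs := by
    have h := integral_divergence hX hw hD hDi hs
    have i1 : IntegrableOn (fun p => w p * Dv X p) D ϑ :=
      integrable_of_cont (hw.continuous.mul (continuous_divergence hX (hs.trans hDi))) D
    rw [integral_add i1 (integrable_of_cont (continuous_dif hX hw) D)] at h
    simp only [inner_grad]; linarith

lemma IsWeakGradient.add (hD : IsOpen D) (hDi : D ⊆ Ξ M) (hu : MemLp u 2 (Λ D)) (hu' : MemLp u' 2 Λ
    D) (h : IsWG D u V) (h' : IsWG D u' V') : IsWG D (fun p => u p + u' p) (fun p => V p + V' p) where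
  measurable := MeasField.add hD.measurableSet h.measField h'.measField
  memLp := by
    refine (h.memLp.add h'.memLp).mono
      (MeasField.norm hD.measurableSet (MeasField.add hD.measurableSet h.measField h'.measField))
      (.of_forall fun p => ?_)
    simp only [norm_norm, Pi.add_apply]; exact (norm_add_le _ _).trans (le_abs_self _)
  integral_eq X hX hs := by
    have ht : IsTest D X := ⟨hX, hs⟩; simp only [inner_add_right, add_mul]
    rw [integral_add (IsTest.integrable_inner hD.measurableSet hX h.measField h.memLp)
      (IsTest.integrable_inner hD.measurableSet hX h'.measField h'.memLp),
      integral_add (ht.integrable_mul hDi hu) (ht.integrable_mul hDi hu'), h.test ht, h'.test ht,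
      neg_add]

lemma IsWeakGradient.const_smul (hD : IsOpen D) (h : IsWG D u V) (a : ℝ) : IsWG D (fun p => a * u p)
    (fun p => a • V p) where
  measurable := MeasField.smul hD.measurableSet h.measField aestronglyMeasurable_const
  memLp := by simp only [norm_smul]; exact h.memLp.const_mul ‖a‖
  integral_eq X hX hs := by
    simp only [inner_smul_right, mul_assoc]
    rw [integral_const_mul, integral_const_mul, h.integral_eq X hX hs, mul_neg]

lemma IsWeakGradient.sub (hD : IsOpen D) (hDi : D ⊆ Ξ M) (hu : MemLp u 2 (Λ D)) (hu' : MemLp u' 2 Λ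
    D) (h : IsWG D u V) (h' : IsWG D u' V') : IsWG D (fun p => u p - u' p) (fun p => V p - V' p) :=
    by
  have := h.add hD hDi hu (hu'.const_mul (-1)) (h'.const_smul hD (-1))
  simpa [sub_eq_add_neg] using this

lemma isWeakGradient_zero : IsWG D (fun _ => 0) (fun _ => 0) where
  measurable c := by
    refine (measField_of_contOn (MeasurableSet.univ (α := M)) ?_).mono (subset_univ D) c
    exact (contMDiff_zeroSection ℝ (IB := Υ) (n := ∞) (F := Є)
      (TangentSpace (M := M) Υ)).continuous.continuousOn
  memLp := by simp
  integral_eq X hX hs := by simp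

lemma IsWeakGradient.sum {ι : Type*} (hD : IsOpen D) (hDi : D ⊆ Ξ M) {u : ι → M → ℝ} {V : ι → VM} (t
    : Finset ι) (hu : ∀ i ∈ t, MemLp (u i) 2 Λ D) (h : ∀ i ∈ t, IsWG D (u i) (V i)) : IsWG D (fun p
    => ∑ i ∈ t, u i p) (fun p => ∑ i ∈ t, V i p) := by
  classical
  induction t using Finset.induction_on with
  | empty => simpa using isWeakGradient_zero
  | insert a t ha ih =>
    simp only [sum_insert ha]
    refine (h a (mem_insert_self _ _)).add hD hDi (hu a (mem_insert_self _ _)) ?_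
      (ih (fun i hi => hu i (mem_insert_of_mem hi)) (fun i hi => h i (mem_insert_of_mem hi)))
    exact memLp_finsetSum t fun i hi => hu i (mem_insert_of_mem hi)

lemma IsWeakGradient.congr (h : IsWG D u V) (hu : u =ᵐ[Λ D] u') (hV : ∀ᵐ p ∂Λ D, V p = V' p) : IsWG
    D u' V' where
  measurable c := by
    refine (h.measurable c).congr ?_
    filter_upwards [ae_restrict_of_ae_restrict_of_subset inter_subset_left hV] with p hp
    simp only [vecCoord, hp]
  memLp := h.memLp.ae_eq (by filter_upwards [hV] with p hp; rw [hp])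
  integral_eq X hX hs := by
    rw [integral_congr_ae (g := fun p => inner ℝ (X p) (V p)), h.integral_eq X hX hs,
      integral_congr_ae (g := fun p => u' p * Dv X p)]
    · filter_upwards [hu] with p hp; rw [hp]
    · filter_upwards [hV] with p hp; rw [hp]

lemma IsWeakGradient.mono {D' : Set M} (hD : IsOpen D) (h : IsWG D u V) (hs : D' ⊆ D) : IsWG D' u V where
  measurable := MeasField.mono h.measField hs
  memLp := h.memLp.mono_measure (restrict_mono hs le_rfl)
  integral_eq X hX hX' := by
    have ht : IsTest D' X := ⟨hX, hX'⟩; have h1 := h.test (ht.mono hs)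
    rw [setIntegral_eq_of_subset_of_forall_sdiff_eq_zero hD.measurableSet hs fun p hp => by
        rw [ht.eq_zero hp.2, inner_zero_left],
      setIntegral_eq_of_subset_of_forall_sdiff_eq_zero hD.measurableSet hs fun p hp => by
        rw [ht.divergence_eq_zero hp.2, mul_zero]] at h1
    exact h1

lemma IsTest.smul (hX : IsTest D X) (hf : Ck ∞ f) : IsTest D (fun p => f p • X p) :=
  ⟨hX.smooth.smul hf, (closure_mono fun p (hp : f p • X p ≠ 0) => show X p ≠ 0 from fun h => hp (by simp [h])).trans hX.supp⟩

lemma memLp_mul_of_cont (hf : Continuous f) (hu : MemLp u 2 Λ D) : MemLp (fun p => f p * u p) 2 Λ D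
    := by
  obtain ⟨C, hC⟩ := exists_bound hf
  refine (hu.const_mul C).mono (hf.aestronglyMeasurable.mul hu.1) (.of_forall fun p => ?_)
  rw [norm_mul, norm_mul]
  exact mul_le_mul_of_nonneg_right ((hC p).trans (le_abs_self C)) (norm_nonneg _)

/-- The product rule. -/
lemma IsWeakGradient.mul (hD : IsOpen D) (hDi : D ⊆ Ξ M) (hu : MemLp u 2 (Λ D)) (h : IsWG D u V) (hη
    : Ck ∞ η) : IsWG D (fun p => η p * u p) (fun p => η p • V p + u p • Gd η p) := by
  have hη1 : Ck 1 η := hη.of_le one_le_infty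
  have m1 : MF D (fun p => η p • V p) :=
    MeasField.smul hD.measurableSet h.measField hη.continuous.aestronglyMeasurable
  have m2 : MF D (fun p => u p • Gd η p) :=
    MeasField.smul hD.measurableSet (measField_grad hη1 hD.measurableSet) hu.1
  have l1 : MemLp (fun p => ‖η p • V p‖) 2 Λ D := by
    simp only [norm_smul]; exact memLp_mul_of_cont hη.continuous.norm h.memLp
  have l2 : MemLp (fun p => ‖u p • Gd η p‖) 2 Λ D := by
    simp only [norm_smul, mul_comm ‖u _‖]
    exact memLp_mul_of_cont (continuous_norm_grad hη1) hu.norm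
  refine ⟨MeasField.add hD.measurableSet m1 m2, ?_, fun X hX hs => ?_⟩
  · refine (l1.add l2).mono (MeasField.norm hD.measurableSet (MeasField.add hD.measurableSet m1 m2))
      (.of_forall fun p => ?_)
    simp only [norm_norm, Pi.add_apply]; exact (norm_add_le _ _).trans (le_abs_self _)
  · have ht : IsTest D X := ⟨hX, hs⟩; have h1 := h.test (ht.smul hη)
    have e1 : ∀ p, inner ℝ (X p) (η p • V p + u p • Gd η p) =
        inner ℝ (η p • X p) (V p) + u p * Df η p (X p) := fun p => by
      rw [inner_add_right, inner_smul_right, inner_smul_right, inner_grad, inner_smul_left]; simp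
    have e2 : ∀ p, u p * Dv (fun q => η q • X q) p =
        η p * u p * Dv X p + u p * Df η p (X p) := fun p => by rw [divergence_smul hX hη]; ring
    have i3 : IntegrableOn (fun p => u p * Df η p (X p)) D ϑ :=
      hu.integrable_mul (memLp_of_cont (continuous_dif hX hη1) 2 D)
    simp only [e1, e2] at h1 ⊢
    rw [integral_add (IsTest.integrable_inner hD.measurableSet (ht.smul hη).smooth h.measField h.memLp)
      i3, h1, integral_add (ht.integrable_mul hDi (memLp_mul_of_cont hη.continuous hu)) i3]
    ring

/-- The test field `ψ ∂_i`, for a function `ψ` supported in a chart. -/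
lemma isTest_coordField (i : Fin d) {ψ : M → ℝ} (hψ : Ck ∞ ψ) (hs : tsupport ψ ⊆ D ∩ Δ c) : IsTest D
    (fun p => ψ p • coordField c i p) := by
  refine ⟨?_, ?_⟩
  · exact ContMDiffOn.smul_section_of_tsupport hψ.contMDiffOn
      (𝓒 c).open_source (hs.trans inter_subset_right)
      (contMDiffOn_coordField c i)
  · refine (closure_mono fun p (hp : ψ p • coordField c i p ≠ 0) => ?_).trans
      (hs.trans inter_subset_left)
    intro h; exact hp (by rw [h, zero_smul])

lemma ae_eq_zero_of_charts {P : M → Prop} (h : ∀ c : M, ∀ᵐ p ∂Λ (D ∩ (𝓒 c).source), P p) : ∀ᵐ p ∂Λ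
    D, P p := by
  obtain ⟨t, ht⟩ := isCompact_univ.elim_finite_subcover (fun c : M => Δ c)
    (fun c => (𝓒 c).open_source)
    (fun p _ => mem_iUnion.2 ⟨p, mem_chart_source _ p⟩)
  have hA : D = ⋃ c : t, D ∩ (𝓒 (c : M)).source := by
    rw [← inter_iUnion]; refine (inter_eq_left.2 fun p _ => ?_).symm
    obtain ⟨c, hc, h⟩ := mem_iUnion₂.1 (ht (mem_univ p)); exact mem_iUnion.2 ⟨⟨c, hc⟩, h⟩
  rw [hA, ae_restrict_iUnion_iff]; exact fun c => h c

/-- Testing with `ψ ∂ᵢ`, for `ψ` supported in a chart, shows that each covariant component vanishes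
almost everywhere. -/
lemma ae_eq_zero_of_integral_test (hD : IsOpen D) {Z : VM} (hZ : MF D Z) (hZ2 : MemLp (fun p => ‖Z
    p‖) 2 Λ D) (h : ∀ X, IsTest D X → ∫ p in D, inner ℝ (X p) (Z p) ∂ϑ = 0) : ∀ᵐ p ∂Λ D, Z p = 0 :=
    by
  have := finite_vol (d := d) (M := M); refine ae_eq_zero_of_charts (d := d) fun c => ?_
  set S := Δ c with hSdef; have hS : IsOpen S := (𝓒 c).open_source
  have hDS : IsOpen (D ∩ S) := hD.inter hS
  have key : ∀ i : Fin d, ∀ᵐ p ∂Λ (D ∩ S), inner ℝ (coordField c i p) (Z p) = 0 := by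
    intro i; rw [ae_restrict_iff' hDS.measurableSet]
    refine hDS.ae_eq_zero_of_integral_contMDiff_smul_eq_zero Υ ?_ fun ψ hψ _ hs => ?_
    · intro p hp; obtain ⟨C, hC, hb⟩ := eventually_norm_lift_bound (d := d) hp.2
      obtain ⟨N, hN, hNo, hpN⟩ := mem_nhds_iff.1 hb
      refine ⟨(D ∩ S) ∩ N, inter_mem_nhdsWithin _ (hNo.mem_nhds hpN), ?_⟩
      have hsub : (D ∩ S) ∩ N ⊆ D := fun q hq => hq.1.1
      have i1 : IntegrableOn (fun p => ‖Z p‖) ((D ∩ S) ∩ N) ϑ :=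
        (hZ2.integrable (by norm_num)).mono_measure (restrict_mono hsub le_rfl)
      refine (i1.const_mul (C * ‖(𝐞 i : Є)‖)).mono ?_ ?_
      · refine (((measField_iff hD.measurableSet).1 hZ) c i).mono_measure
          (restrict_mono inter_subset_left le_rfl)
      · filter_upwards [ae_restrict_mem (hDS.inter hNo).measurableSet] with q hq
        rw [norm_mul, norm_norm]
        refine (norm_inner_le_norm _ _).trans (mul_le_mul_of_nonneg_right ?_ (norm_nonneg _))
        exact ((hN hq.2 _).1).trans (le_abs_self _)
    · have h1 := h _ (isTest_coordField i hψ hs); simp only [inner_smul_left] at h1; rw [← h1]; symm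
      refine setIntegral_eq_integral_of_forall_compl_eq_zero fun p hp => ?_
      rw [image_eq_zero_of_notMem_tsupport fun h => hp (hs h).1]; simp
  filter_upwards [ae_all_iff.2 key, ae_restrict_mem hDS.measurableSet] with p hp hpS
  have h2 : inner ℝ (Z p) (Z p) = 0 := by
    nth_rw 1 [eq_sum_coordField hpS.2 (Z p)]; rw [sum_inner]; refine sum_eq_zero fun i _ => ?_
    rw [inner_smul_left, hp i, mul_zero]
  exact inner_self_eq_zero.1 h2

/-- Uniqueness of the weak gradient. -/
lemma IsWeakGradient.unique (hD : IsOpen D) (h : IsWG D u V) (h' : IsWG D u V') : ∀ᵐ p ∂Λ D, V p =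
    V' p := by
  have hm := MeasField.sub hD.measurableSet h.measField h'.measField
  have h2 : MemLp (fun p => ‖V p - V' p‖) 2 Λ D := by
    refine (h.memLp.add h'.memLp).mono (MeasField.norm hD.measurableSet hm) (.of_forall fun p => ?_)
    simp only [norm_norm, Pi.add_apply]; exact (norm_sub_le _ _).trans (le_abs_self _)
  filter_upwards [ae_eq_zero_of_integral_test hD hm h2 fun X hX => by
    simp only [inner_sub_right]
    rw [integral_sub (IsTest.integrable_inner hD.measurableSet hX.smooth h.measField h.memLp)
      (IsTest.integrable_inner hD.measurableSet hX.smooth h'.measField h'.memLp), h.test hX,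
      h'.test hX, sub_self]] with p hp
  exact sub_eq_zero.1 hp

lemma MemH1.isWeakGradient (h : MemH1 d D u) : IsWG D u (weakGrad d D u) := by
  rw [weakGrad, dif_pos h.2]; exact h.2.choose_spec

end WeakGradient

/-! ### Pulling back fields under the group action -/

/-- The pullback of a vector field under the action of a group element. -/
def pull (b : G) (V : VM) (q : M) : 𝓣 q := VectorField.mpullback Υ Υ ℓ b V q

variable (d) in
/-- The derivative of the action of a group element. -/
def dAct (b : G) (q : M) : 𝓣 q →L[ℝ] 𝓣 (b • q) := mfderiv Υ Υ ℓ b q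

variable (d G M) in
/-- A smooth action. -/
abbrev SmoothAct : Prop := ∀ a : G, ContMDiff Υ Υ ∞ ℓ a

local notation "SA" => SmoothAct d M G

/-- A group element as a diffeomorphism. -/
def SmoothAct.diffeo (h : SA) (b : G) : M ≃ₘ^∞⟮Υ, Υ⟯ M where
  toEquiv := MulAction.toPerm b
  contMDiff_toFun := h b
  contMDiff_invFun := h b⁻¹

lemma SmoothAct.isInvertible (h : SA) (b : G) (q : M) : (mfderiv Υ Υ (fun p : M => b • p)
    q).IsInvertible :=
  ⟨(h.diffeo b).mfderivToContinuousLinearEquiv (by simp) q, rfl⟩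

lemma dAct_pull (h : SA) (b : G) (V : VM) (q : M) : dAct d b q (pull b V q) = V (b • q) := by
  obtain ⟨e, he⟩ := h.isInvertible b q; unfold dAct pull
  rw [VectorField.mpullback_apply, ← he, ContinuousLinearMap.inverse_equiv]
  exact e.apply_symm_apply _

lemma dAct_injective (h : SA) (b : G) (q : M) : Function.Injective (dAct d b q) := by
  obtain ⟨e, he⟩ := h.isInvertible b q; unfold dAct; rw [← he]; exact e.injective

/-- The chain rule, stated in the model space: `(b' * b) • q` and `b' • b • q` are equal only
propositionally, so their tangent spaces are formally different types. -/
lemma dAct_mul (h : SA) (b b' : G) (q : M) (w : 𝓣 q) : (dAct d (b' * b) q w : Є) = dAct d b' (b • q)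
    (dAct d b q w) := by
  have h1 : (fun p : M => (b' * b) • p) = (fun p : M => b' • p) ∘ fun p => b • p := by
    ext p; exact mul_smul b' b p
  have h2 := mfderiv_comp (I := Υ) (I' := Υ) (I'' := Υ) q
    ((h b').mdifferentiable (by simp) (b • q)) ((h b).mdifferentiable (by simp) q)
  have key : ∀ f g : M → M, f = g → (mfderiv Υ Υ f q w : Є) =
      mfderiv Υ Υ g q w := by rintro f g rfl; rfl
  refine (key _ _ h1).trans ?_; exact congrArg (fun L : Є →L[ℝ] Є => L w) h2

lemma dAct_one (q : M) (w : 𝓣 q) : (dAct d (1 : G) q w : Є) = w := by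
  have h1 : (fun p : M => (1 : G) • p) = id := by ext p; exact one_smul G p
  have key : ∀ f g : M → M, f = g → (mfderiv Υ Υ f q w : Є) =
      mfderiv Υ Υ g q w := by rintro f g rfl; rfl
  refine (key _ _ h1).trans ?_; rw [mfderiv_id]; rfl

lemma pull_pull (h : SA) (b b' : G) (V : VM) (q : M) : pull b (pull b' V) q = pull (b' * b) V q :=
    by
  refine dAct_injective h (b' * b) q ?_; rw [dAct_pull h]
  have h1 := dAct_mul h b b' q (pull b (pull b' V) q); rw [dAct_pull h, dAct_pull h] at h1
  refine Eq.trans h1 ?_; have key : ∀ x y : M, x = y → (V x : Є) = V y := by rintro x y rfl; rfl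
  exact key _ _ (mul_smul b' b q).symm

lemma pull_one (h : SA) (V : VM) (q : M) : pull (1 : G) V q = V q := by
  refine dAct_injective h (1 : G) q ?_; rw [dAct_pull h]; refine Eq.trans ?_ (dAct_one q (V q)).symm
  have key : ∀ x y : M, x = y → (V x : Є) = V y := by rintro x y rfl; rfl
  exact key _ _ (one_smul G q)

lemma pull_eq_zero_iff (h : SA) (b : G) (V : VM) (q : M) : pull b V q = 0 ↔ V (b • q) = 0 := by
  rw [← dAct_pull h b V q]; constructor
  · intro h1; rw [h1, map_zero]
  · intro h1; exact dAct_injective h b q (by rw [h1, map_zero])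

lemma SmoothField.pull (h : SA) (b : G) (hX : SmoothField X) : SmoothField (EquivSpectrum.pull b X)
    :=
  ContMDiff.mpullback_vectorField hX (h b) (h.isInvertible b) (by simp)

lemma dif_comp_act (h : SA) (b : G) (hf : Ck 1 f) (q : M) (w : 𝓣 q) : Df (fun p => f (b • p)) q w =
    Df f (b • q) (dAct d b q w) := by
  have h2 := mfderiv_comp (I := Υ) (I' := Υ) (I'' := 𝓘(ℝ)) q (g := f)
    (hf.mdifferentiable one_ne_zero (b • q)) ((h b).mdifferentiable (by simp) q)
  exact congrArg (fun L : Є →L[ℝ] ℝ => L w) h2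

lemma isTest_pull (h : SA) (b : G) (hX : IsTest D X) : IsTest (ℓ b ⁻¹' D) (pull b X) := by
  refine ⟨hX.smooth.pull h b, ?_⟩
  have hc : IsClosed (ℓ b ⁻¹' closure {p | X p ≠ 0}) := isClosed_closure.preimage (h b).continuous
  refine (closure_minimal (fun q hq => ?_) hc).trans (preimage_mono hX.supp)
  exact subset_closure fun h0 => hq ((pull_eq_zero_iff h b X q).2 h0)

namespace IsomAction

lemma inner_pull (h : Iso) (b : G) (V : VM) (hq : q ∈ closure Ω) (w : 𝓣 q) : inner ℝ w (pull b V q)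
    = inner ℝ (dAct d b q w) (V (b • q)) := by
  rw [← dAct_pull h.smooth b V q]; exact (h.isometry b q hq _ _).symm

lemma inner_pull_pull (h : Iso) (b : G) (V W : VM) (hq : q ∈ closure Ω) : inner ℝ (pull b V q) (pull
    b W q) = inner ℝ (V (b • q)) (W (b • q)) := by
  rw [h.inner_pull b W hq, dAct_pull h.smooth]

lemma norm_pull (h : Iso) (b : G) (V : VM) (hq : q ∈ closure Ω) : ‖pull b V q‖ = ‖V (b • q)‖ := by
  rw [norm_eq_sqrt_real_inner, h.inner_pull_pull b V V hq, ← norm_eq_sqrt_real_inner]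

lemma preimage_subset (h : Iso) (b : G) (hD : D ⊆ Ω) : ℓ b ⁻¹' D ⊆ Ω
    := fun _ hq => (h.smul_mem_iff b).1 (hD hq)

lemma mpres_preimage (h : Iso) (m : ℕ) (b : G) (hA : A ⊆ closure Ω) : MeasurePreserving ℓ b
    (μHE[m].restrict (ℓ b ⁻¹' A)) (μHE[m].restrict A) := by
  have h1 : ℓ b ⁻¹' A ⊆ closure Ω := fun q hq => (h.smul_mem_closure_iff b).1 (hA hq)
  have h2 := h.measurePreserving m b h1; rwa [image_preimage_eq _ (MulAction.surjective b)] at h2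

lemma setIntegral_comp (h : Iso) (m : ℕ) (b : G) (hA : A ⊆ closure Ω) (f : M → ℝ) : ∫ q in ℓ b ⁻¹'
    A, f (b • q) ∂(μHE[m] : Measure M) = ∫ p in A, f p ∂(μHE[m] : Measure M) :=
  (h.mpres_preimage m b hA).integral_comp (h.measurableEmbedding b) f

/-- The divergence is determined by integration by parts, and the action preserves the volume and
the pairing of differentials with fields. Both sides therefore have the same integrals against test
functions on `Ω`, and both are continuous. -/
lemma divergence_pull (h : Iso) (hΩ : Ω ⊆ Ξ M) (b : G) (hX : SmoothField X) (hq : q ∈ Ω) : Dv (pull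
    b X) q = Dv X (b • q) := by
  have hpre : ℓ b ⁻¹' Ω = Ω := by ext p; exact h.smul_mem_iff b
  have hc1 : ContinuousOn (Dv (pull b X)) Ω :=
    (continuousOn_divergence (hX.pull h.smooth b)).mono hΩ
  have hc2 : ContinuousOn (fun q => Dv X (b • q)) Ω :=
    ((continuousOn_divergence hX).mono hΩ).comp (h.continuous b).continuousOn
      fun p hp => h.smul_mem b hp
  have key : ∀ Y : VM, SmoothField Y → ∀ ψ : M → ℝ, Ck ∞ ψ → tsupport ψ ⊆ Ω →
      ∫ p in Ω, ψ p * Dv Y p ∂ϑ = -∫ p in Ω, Df ψ p (Y p) ∂ϑ := by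
    intro Y hY ψ hψ hs; have hψ1 : Ck 1 ψ := hψ.of_le one_le_infty
    have ht : closure {p | ψ p • Y p ≠ 0} ⊆ Ω := by
      refine (closure_mono fun p (hp : ψ p • Y p ≠ 0) => ?_).trans hs; intro h0
      exact hp (by rw [h0, zero_smul])
    have h1 := integral_divergence (hY.smul hψ) (contMDiff_const (c := (1 : ℝ))) h.isOpen hΩ ht
    simp only [divergence_smul hY hψ, dif_const, one_mul, add_zero] at h1
    have i2 : IntegrableOn (fun p => Df ψ p (Y p)) Ω ϑ :=
      integrable_of_cont (continuous_dif hY hψ1) Ω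
    have i1 : IntegrableOn (fun p => ψ p * Dv Y p) Ω ϑ := by
      have hcont := continuous_divergence (hY.smul hψ) (ht.trans hΩ)
      have := (integrable_of_cont hcont Ω).sub i2; refine this.congr (.of_forall fun p => ?_)
      simp only [Pi.sub_apply, divergence_smul hY hψ]; ring
    rw [integral_add i1 i2] at h1; linarith
  refine eqOn_of_integral_eq (d := d) h.isOpen hc1 hc2 (fun ψ hψ hs => ?_) hq
  have hψ' : Ck ∞ (fun p => ψ (b⁻¹ • p)) := hψ.comp (h.smooth b⁻¹)
  have hs' : tsupport (fun p => ψ (b⁻¹ • p)) ⊆ Ω := by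
    have hc : IsClosed ((fun p : M => b⁻¹ • p) ⁻¹' tsupport ψ) :=
      (isClosed_tsupport ψ).preimage (h.continuous b⁻¹)
    refine (closure_minimal (fun p hp => ?_) hc).trans fun p hp => (h.smul_mem_iff b⁻¹).1 (hs hp)
    exact subset_closure hp
  rw [key _ (hX.pull h.smooth b) ψ hψ hs]
  have e1 := h.setIntegral_comp d b (subset_closure (s := Ω)) (fun p => ψ (b⁻¹ • p) * Dv X p)
  rw [hpre] at e1; simp only [inv_smul_smul] at e1; rw [e1, key X hX _ hψ' hs', neg_inj]
  have e2 := h.setIntegral_comp d b (subset_closure (s := Ω))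
    (fun p => Df (fun p => ψ (b⁻¹ • p)) p (X p))
  rw [hpre] at e2; rw [← e2]; refine setIntegral_congr_fun h.isOpen.measurableSet fun p hp => ?_
  rw [← dAct_pull h.smooth b X p, ← dif_comp_act h.smooth b (hψ'.of_le one_le_infty)]
  simp only [inv_smul_smul]

lemma memLp_comp (h : Iso) (m : ℕ) (b : G) (hA : A ⊆ closure Ω) (hu : MemLp u 2 (μHE[m].restrict A))
    : MemLp (fun q => u (b • q)) 2 (μHE[m].restrict (ℓ b ⁻¹' A)) :=
  hu.comp_measurePreserving (h.mpres_preimage m b hA)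

/-- By the isometry property, a covariant component of `pull b V` at `q` is the inner product of `V`
at `b • q` with a coordinate field transported by `b⁻¹`. That transported field is continuous where
it is needed, and composition with a measure-preserving map keeps measurability. -/
lemma measField_pull (h : Iso) (b : G) (hD : IsOpen D) (hDΩ : D ⊆ Ω) (hV : MF D V) : MF (ℓ b ⁻¹' D)
    (pull b V) := by
  have hpre := hD.preimage (h.continuous b); rw [measField_iff hpre.measurableSet]; intro c i
  set S := Δ c with hS; have hSo : IsOpen S := (𝓒 c).open_source
  set T := D ∩ ((fun p : M => b⁻¹ • p) ⁻¹' S) with hT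
  have hTo : IsOpen T := hD.inter (hSo.preimage (h.continuous b⁻¹))
  have hpT : ℓ b ⁻¹' T = (ℓ b ⁻¹' D) ∩ S := by ext p; simp [hT]
  have hf : MF T (pull b⁻¹ (coordField (d := d) c i)) := by
    refine measField_of_contOn hTo.measurableSet ?_
    have := ContMDiffOn.mpullback_vectorField_preimage (I := Υ) (I' := Υ) (m := ∞) (n := ∞)
      (contMDiffOn_coordField (d := d) c i) (h.smooth b⁻¹)
      (fun x _ => SmoothAct.isInvertible h.smooth b⁻¹ x) (by simp)
    exact this.continuousOn.mono inter_subset_right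
  have hm := hf.inner hTo.measurableSet (hV.mono inter_subset_left)
  have hmp := h.mpres_preimage d b (A := T) ((inter_subset_left.trans hDΩ).trans subset_closure)
  rw [hpT] at hmp; refine (hm.comp_measurePreserving hmp).congr ?_
  filter_upwards [ae_restrict_mem (hpre.inter hSo).measurableSet] with q hq
  have hqΩ : q ∈ closure Ω := subset_closure (h.preimage_subset b hDΩ hq.1)
  rw [h.inner_pull b V hqΩ]; simp only [Function.comp]; congr 1
  have h1 := dAct_mul h.smooth b b⁻¹ q (coordField c i q)
  refine dAct_injective h.smooth b⁻¹ (b • q) ?_; rw [dAct_pull h.smooth]; refine Eq.trans ?_ h1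
  have key1 : ∀ x : M, x = q → (coordField c i x : Є) = coordField c i q := by rintro x rfl; rfl
  have key2 : ∀ a : G, a = 1 → (dAct d a q (coordField c i q) : Є) = coordField c i q := by
    rintro a rfl; exact dAct_one q _
  rw [key2 _ (inv_mul_cancel b)]; exact key1 _ (inv_smul_smul b q)

/-- Testing `V` with `pull b⁻¹ X` and changing variables by `b` turns the defining identity on `D`
into the one on its preimage. -/
lemma isWeakGradient_pull (h : Iso) (hΩ : Ω ⊆ Ξ M) (b : G) (hD : IsOpen D) (hDΩ : D ⊆ Ω) (hu : IsWG
    D u V) : IsWG (ℓ b ⁻¹' D) (fun q => u (b • q)) (pull b V) := by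
  have hpre := hD.preimage (h.continuous b); have hcl : D ⊆ closure Ω := hDΩ.trans subset_closure
  refine ⟨h.measField_pull b hD hDΩ hu.measField, ?_, fun X hX hs => ?_⟩
  · refine (h.memLp_comp d b hcl hu.memLp).ae_eq ?_
    filter_upwards [ae_restrict_mem hpre.measurableSet] with q hq
    exact (h.norm_pull b V (subset_closure (h.preimage_subset b hDΩ hq))).symm
  · have hX' : IsTest ((fun p : M => b⁻¹ • p) ⁻¹' (ℓ b ⁻¹' D)) (pull b⁻¹ X) :=
      isTest_pull h.smooth b⁻¹ ⟨hX, hs⟩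
    have hDD : (fun p : M => b⁻¹ • p) ⁻¹' (ℓ b ⁻¹' D) = D := by ext p; simp
    rw [hDD] at hX'; have h1 := hu.test hX'
    rw [← h.setIntegral_comp d b hcl, ← h.setIntegral_comp d b hcl] at h1
    have hpp : ∀ q, pull b (pull b⁻¹ X) q = X q := fun q => by
      rw [pull_pull h.smooth]
      have : ∀ a : G, a = 1 → pull a X q = X q := by rintro a rfl; exact pull_one h.smooth X q
      exact this _ (inv_mul_cancel b)
    have e1 : EqOn (fun q => inner ℝ (pull b⁻¹ X (b • q)) (V (b • q)))
        (fun q => inner ℝ (X q) (pull b V q)) (ℓ b ⁻¹' D) := fun q hq => by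
      simp only; rw [← h.inner_pull_pull b _ V (subset_closure (h.preimage_subset b hDΩ hq)), hpp]
    have e2 : EqOn (fun q => u (b • q) * Dv (pull b⁻¹ X) (b • q))
        (fun q => u (b • q) * Dv X q) (ℓ b ⁻¹' D) := fun q hq => by
      simp only; rw [← h.divergence_pull hΩ b hX'.smooth (h.preimage_subset b hDΩ hq)]; congr 1
      exact divergence_congr (Eventually.of_forall hpp)
    rw [setIntegral_congr_fun hpre.measurableSet e1, setIntegral_congr_fun hpre.measurableSet e2] at h1
    exact h1

end IsomAction

/-! ### Graph coordinates and a one-dimensional trace estimate -/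

section Euclidean

/-- The hyperplane orthogonal to `v`. -/
abbrev Hyp (v : Є) : Submodule ℝ Є := (ℝ ∙ v)ᗮ

/-- The height of `y` above the graph of `f` in direction `v`. -/
def height (v : Є) (f : Є → ℝ) (y : Є) : ℝ := inner ℝ v y - f (y - inner ℝ v y • v)

/-- Graph coordinates. -/
def graphMap (v : Є) (f : Є → ℝ) (x : Hyp v × ℝ) : Є := (x.1 : Є) + (f x.1 + x.2) • v

lemma continuous_height (v : Є) {f : Є → ℝ} (hf : Continuous f) : Continuous (height v f) :=
    by unfold height; fun_prop

lemma continuous_graphMap (v : Є) {f : Є → ℝ} (hf : Continuous f) : Continuous (graphMap v f) := by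
  unfold graphMap
  have : Continuous (fun x : Hyp v × ℝ => (x.1 : Є)) := continuous_subtype_val.comp continuous_fst
  fun_prop

variable {v : Eu d}

lemma inner_hyp (z : Hyp v) : inner ℝ v (z : Є) = 0 :=
  Submodule.mem_orthogonal_singleton_iff_inner_right.1 z.2

lemma inner_graphMap (hv : ‖v‖ = 1) (f : Є → ℝ) (x : Hyp v × ℝ) : inner ℝ v (graphMap v f x) = f x.1
    + x.2 := by
  rw [graphMap, inner_add_right, inner_hyp, inner_smul_right, real_inner_self_eq_norm_sq, hv]; ring

lemma height_graphMap (hv : ‖v‖ = 1) (f : Є → ℝ) (x : Hyp v × ℝ) : height v f (graphMap v f x) = x.2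
    := by rw [height, inner_graphMap hv, graphMap, add_sub_cancel_right]; ring

lemma height_add_smul (hv : ‖v‖ = 1) (f : Є → ℝ) (y : Є) (s : ℝ) : height v f (y + s • v) = height v
    f y + s := by
  have h : inner ℝ v (y + s • v) = inner ℝ v y + s := by
    rw [inner_add_right, inner_smul_right, real_inner_self_eq_norm_sq, hv]; ring
  have h2 : y + s • v - (inner ℝ v y + s) • v = y - inner ℝ v y • v := by rw [add_smul]; abel
  rw [height, h, h2, height]; ring

/-- The orthogonal projection to the hyperplane. -/
def hypProj (hv : ‖v‖ = 1) (y : Є) : Hyp v :=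
  ⟨y - inner ℝ v y • v, Submodule.mem_orthogonal_singleton_iff_inner_right.2 (by
    rw [inner_sub_right, inner_smul_right, real_inner_self_eq_norm_sq, hv]; ring)⟩

lemma continuous_hypProj (hv : ‖v‖ = 1) : Continuous (hypProj hv) := by
  unfold hypProj; refine Continuous.subtype_mk ?_ _; fun_prop

lemma graphMap_hypProj (hv : ‖v‖ = 1) (f : Є → ℝ) (y : Є) : graphMap v f (hypProj hv y, height v f
    y) = y := by
  simp only [graphMap, hypProj, height]; rw [add_sub_cancel, sub_add_cancel]

lemma hypProj_graphMap (hv : ‖v‖ = 1) (f : Є → ℝ) (x : Hyp v × ℝ) : hypProj hv (graphMap v f x) =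
    x.1 := by
  refine Subtype.ext ?_; rw [hypProj]; simp only
  rw [inner_graphMap hv, graphMap, add_sub_cancel_right]

/-- Graph coordinates as a homeomorphism. -/
def graphHomeo (hv : ‖v‖ = 1) {f : Є → ℝ} (hf : Continuous f) : (Hyp v × ℝ) ≃ₜ Є where
  toFun := graphMap v f
  invFun y := (hypProj hv y, height v f y)
  left_inv x := by dsimp only; rw [hypProj_graphMap hv, height_graphMap hv]
  right_inv y := graphMap_hypProj hv f y
  continuous_toFun := continuous_graphMap v hf
  continuous_invFun := (continuous_hypProj hv).prodMk (continuous_height v hf)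

lemma norm_hypProj_sub_le (hv : ‖v‖ = 1) (y y' : Є) : ‖(hypProj hv y : Є) - hypProj hv y'‖ ≤ ‖y -
    y'‖ := by
  have h : (hypProj hv y : Є) - hypProj hv y' = (y - y') - inner ℝ v (y - y') • v := by
    simp only [hypProj, inner_sub_right, sub_smul]; abel
  rw [h]
  have h2 : ‖(y - y') - inner ℝ v (y - y') • v‖ ^ 2 = ‖y - y'‖ ^ 2 - (inner ℝ v (y - y')) ^ 2 := by
    rw [norm_sub_sq_real, inner_smul_right, norm_smul, hv, real_inner_comm v, mul_one,
      norm_eq_abs, sq_abs]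
    ring
  refine le_of_sq_le_sq ?_ (norm_nonneg _); nlinarith [sq_nonneg (inner ℝ v (y - y'))]

lemma finrank_hyp (hv : ‖v‖ = 1) : Module.finrank ℝ (Hyp v) = d - 1 := by
  have h0 : v ≠ 0 := by rintro rfl; simp at hv
  obtain ⟨n, hn⟩ := Nat.exists_eq_succ_of_ne_zero (NeZero.ne d)
  have : Fact (Module.finrank ℝ Є = n + 1) := ⟨by simp [hn]⟩
  rw [Submodule.finrank_orthogonal_span_singleton (n := n) h0]; omega

/-- Fubini's theorem in graph coordinates. -/
lemma exists_volume_eq_map (hv : ‖v‖ = 1) {f : Є → ℝ} (hf : Continuous f) : ∃ c : ENNReal, c ≠ 0 ∧ c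
    ≠ ⊤ ∧ (volume : Measure Є) = c • Measure.map (graphMap v f) ((volume : Measure (Hyp v)).prod
    (volume : Measure ℝ)) := by
  let e0 : (Hyp v × ℝ) ≃L[ℝ] Є := LinearEquiv.toContinuousLinearEquiv
    { toFun := fun x => (x.1 : Є) + x.2 • v
      map_add' := fun x y => by simp [add_smul]; abel
      map_smul' := fun r x => by simp [mul_smul]
      invFun := fun y => (hypProj hv y, inner ℝ v y)
      left_inv := fun x => by
        have := hypProj_graphMap hv (fun _ => 0) x; have h2 := inner_graphMap hv (fun _ => 0) x
        simp only [graphMap, zero_add] at this h2; simp only [this, h2]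
      right_inv := fun y => by
        have := graphMap_hypProj hv (fun _ => 0) y
        simpa only [graphMap, height, zero_add, sub_zero] using this }
  set ν := (volume : Measure (Hyp v)).prod (volume : Measure ℝ) with hν
  have h1 : (Measure.map e0 ν).IsAddHaarMeasure := e0.isAddHaarMeasure_map ν
  have h2 := Measure.isAddLeftInvariant_eq_smul (volume : Measure Є) (Measure.map e0 ν)
  refine ⟨(Measure.addHaarScalarFactor (volume : Measure Є) (Measure.map e0 ν) : ENNReal), ?_,
    ENNReal.coe_ne_top, ?_⟩
  · rw [ENNReal.coe_ne_zero]; intro h0; rw [h0, zero_smul] at h2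
    exact NeZero.ne (volume : Measure Є) h2
  -- `graphMap` is a linear isomorphism preceded by a shear along the last factor. The shear
  -- preserves the product measure fibre by fibre, and the linear map produces a Haar measure,
  -- unique up to a constant.
  · have hshear : MeasurePreserving (fun x : Hyp v × ℝ => (x.1, f x.1 + x.2)) ν ν := by
      refine MeasurePreserving.skew_product (MeasurePreserving.id (volume : Measure (Hyp v)))
        (μc := (volume : Measure ℝ)) (μd := (volume : Measure ℝ)) (g := fun z t => f z + t) ?_
        (.of_forall fun z => (measurePreserving_add_left volume (f z)).map_eq)
      have : Continuous (fun x : Hyp v × ℝ => f x.1 + x.2) := by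
        have : Continuous (fun x : Hyp v × ℝ => (x.1 : Є)) :=
          continuous_subtype_val.comp continuous_fst
        fun_prop
      exact this.measurable
    have h3 : graphMap v f = e0 ∘ fun x : Hyp v × ℝ => (x.1, f x.1 + x.2) := by ext1 x; rfl
    rw [h3, ← Measure.map_map e0.continuous.measurable hshear.measurable, hshear.map_eq]; exact h2

/-- The fundamental theorem of calculus for `g(t)² (1 - t/δ)`, which equals `g(0)²` at `0` and
vanishes at `δ`. -/
lemma sq_le_lintegral_Ioo {g g' : ℝ → ℝ} {δ : ℝ} (hδ : 0 < δ) (hg : ContinuousOn g (Icc 0 δ)) (hg' :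
    ContinuousOn g' (Icc 0 δ)) (hd : ∀ t ∈ Ioo 0 δ, HasDerivAt g (g' t) t) : ofReal (g 0 ^ 2) ≤ ∫⁻ t
    in Ioo 0 δ, ofReal ((δ⁻¹ + 1) * (g t ^ 2 + g' t ^ 2)) := by
  let F : ℝ → ℝ := fun t => g t ^ 2 * (1 - t / δ)
  let F' : ℝ → ℝ := fun t => 2 * g t * g' t * (1 - t / δ) - g t ^ 2 / δ
  have hFc : ContinuousOn F (Icc 0 δ) := by refine (hg.pow 2).mul ?_; fun_prop
  have hF'c : ContinuousOn F' (Icc 0 δ) := by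
    refine ContinuousOn.sub (((continuousOn_const.mul hg).mul hg').mul ?_) ((hg.pow 2).div_const δ)
    fun_prop
  have hFd : ∀ t ∈ Ioo 0 δ, HasDerivAt F (F' t) t := fun t ht => by
    have h1 := (hd t ht).pow 2
    have h2 : HasDerivAt (fun t : ℝ => 1 - t / δ) (-(1 / δ)) t := by
      simpa using ((hasDerivAt_id t).div_const δ).const_sub 1
    have h3 : HasDerivAt F (_ : ℝ) t := h1.mul h2; refine h3.congr_deriv ?_; simp [F']; ring
  have hFTC := intervalIntegral.integral_eq_sub_of_hasDerivAt_of_le hδ.le hFc hFd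
    (hF'c.intervalIntegrable_of_Icc hδ.le)
  have hF0 : F 0 = g 0 ^ 2 := by simp [F]
  have hFδ : F δ = 0 := by simp [F, hδ.ne']
  rw [hF0, hFδ, zero_sub, intervalIntegral.integral_of_le hδ.le, integral_Ioc_eq_integral_Ioo] at hFTC
  have hG : ContinuousOn (fun t => (δ⁻¹ + 1) * (g t ^ 2 + g' t ^ 2)) (Icc 0 δ) :=
    continuousOn_const.mul ((hg.pow 2).add (hg'.pow 2))
  have hGi : IntegrableOn (fun t => (δ⁻¹ + 1) * (g t ^ 2 + g' t ^ 2)) (Ioo 0 δ) :=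
    (hG.integrableOn_compact isCompact_Icc).mono_set Ioo_subset_Icc_self
  have hF'i : IntegrableOn F' (Ioo 0 δ) :=
    (hF'c.integrableOn_compact isCompact_Icc).mono_set Ioo_subset_Icc_self
  rw [← ofReal_integral_eq_lintegral_ofReal hGi (.of_forall fun t => by positivity)]
  refine ofReal_le_ofReal ?_
  have h3 : g 0 ^ 2 = ∫ t in Ioo 0 δ, -F' t := by rw [integral_neg]; linarith
  rw [h3]; refine setIntegral_mono_on hF'i.neg hGi measurableSet_Ioo fun t ht => ?_
  have h4 : 0 ≤ 1 - t / δ := by rw [sub_nonneg, div_le_one hδ]; exact ht.2.le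
  have h5 : 1 - t / δ ≤ 1 := by have : 0 ≤ t / δ := div_nonneg ht.1.le hδ.le; linarith
  simp only [F']
  have h6 : -(2 * g t * g' t * (1 - t / δ)) ≤ g t ^ 2 + g' t ^ 2 := by
    have : |2 * g t * g' t| ≤ g t ^ 2 + g' t ^ 2 := by
      rw [abs_le]; constructor <;> nlinarith [sq_nonneg (g t + g' t), sq_nonneg (g t - g' t)]
    calc -(2 * g t * g' t * (1 - t / δ)) ≤ |2 * g t * g' t| * (1 - t / δ) := by
          rw [← neg_mul]; exact mul_le_mul_of_nonneg_right (neg_le_abs _) h4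
      _ ≤ |2 * g t * g' t| * 1 := mul_le_mul_of_nonneg_left h5 (abs_nonneg _)
      _ ≤ _ := by linarith
  have h7 : g t ^ 2 / δ ≤ δ⁻¹ * (g t ^ 2 + g' t ^ 2) := by
    rw [div_eq_inv_mul]; have : 0 ≤ δ⁻¹ := inv_nonneg.2 hδ.le
    nlinarith [sq_nonneg (g' t), mul_nonneg this (sq_nonneg (g' t))]
  linarith

end Euclidean

/-! ### Lipschitz graph charts and the boundary measure -/

/-- A ball of radius `R` about a boundary point `p` of `D`, in the chart at `p`, in which `D` lies
above a Lipschitz graph and the metric is comparable to the Euclidean one. -/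
structure GraphChart (D : Set M) (p : M) (R C : ℝ) (K : NNReal) (v : Є) (f : Є → ℝ) :
    Prop where
  R_pos : 0 < R
  C_pos : 0 < C
  norm_v : ‖v‖ = 1
  lip : LipschitzWith K f
  target : ∀ y ∈ ball (Γ p p) R, 0 ≤ height v f y → y ∈ (Γ p).target
  mem_iff : ∀ y ∈ ball (Γ p p) R, y ∈ CS p D ↔ 0 < height v f y
  edist_le : ∀ y ∈ ball (Γ p p) R ∩ (Γ p).target, ∀ z ∈ ball (Γ p p) R ∩ (Γ p).target,
    edist (Θ p y) (Θ p z) ≤ ofReal C * edist y z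
  le_edist : ∀ y ∈ ball (Γ p p) R ∩ (Γ p).target, ∀ z ∈ ball (Γ p p) R ∩ (Γ p).target,
    edist y z ≤ ofReal C * edist (Θ p y) (Θ p z)
  norm_lift : ∀ y ∈ ball (Γ p p) R ∩ (Γ p).target, ∀ w : Є, ‖lift p (Θ p y) w‖ ≤ C * ‖w‖ ∧
      ‖w‖ ≤ C * ‖lift p (Θ p y) w‖
  density : ∀ y ∈ ball (Γ p p) R ∩ (Γ p).target, chartDensity p y ≤ C ∧ 1 ≤ C * chartDensity p y

section Local

variable {R C : ℝ} {K : NNReal} {v : Eu d} {f : Eu d → ℝ}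

lemma image_chart_eq (p : M) (D : Set M) : Γ p '' (D ∩ (Γ p).source) = CS p D := by
  ext y; constructor
  · rintro ⟨q, ⟨h1, h2⟩, rfl⟩; refine ⟨(Γ p).map_source h2, ?_⟩
    rw [mem_preimage, (Γ p).left_inv h2]; exact h1
  · rintro ⟨h1, h2⟩; exact ⟨_, ⟨h2, (Γ p).map_target h1⟩, (Γ p).right_inv h1⟩

lemma GraphChart.mono (h : GraphChart D p R C K v f) {R' : ℝ} (hR' : 0 < R') (hRR : R' ≤ R) :
    GraphChart D p R' C K v f where
  R_pos := hR'
  C_pos := h.C_pos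
  norm_v := h.norm_v
  lip := h.lip
  target y hy := h.target y (ball_subset_ball hRR hy)
  mem_iff y hy := h.mem_iff y (ball_subset_ball hRR hy)
  edist_le y hy z hz := h.edist_le y ⟨ball_subset_ball hRR hy.1, hy.2⟩ z
    ⟨ball_subset_ball hRR hz.1, hz.2⟩
  le_edist y hy z hz := h.le_edist y ⟨ball_subset_ball hRR hy.1, hy.2⟩ z
    ⟨ball_subset_ball hRR hz.1, hz.2⟩
  norm_lift y hy := h.norm_lift y ⟨ball_subset_ball hRR hy.1, hy.2⟩
  density y hy := h.density y ⟨ball_subset_ball hRR hy.1, hy.2⟩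

variable (d) in
/-- The neighbourhood of `p` corresponding to a ball in the chart. -/
def chartBall (p : M) (R : ℝ) : Set M := (Γ p).source ∩ Γ p ⁻¹' ball (Γ p p) R

local notation "ChB" => chartBall d

lemma isOpen_chartBall (p : M) (R : ℝ) : IsOpen (ChB p R) :=
  (continuousOn_extChartAt p).isOpen_inter_preimage (isOpen_extChartAt_source p) isOpen_ball

lemma mem_chartBall (p : M) {R : ℝ} (hR : 0 < R) : p ∈ ChB p R :=
  ⟨mem_extChartAt_source p, mem_ball_self hR⟩

lemma chart_mem_iff (hq : q ∈ (Γ p).source) : Γ p q ∈ CS p D ↔ q ∈ D := by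
  constructor
  · intro h; have := h.2; rwa [mem_preimage, (Γ p).left_inv hq] at this
  · intro h; refine ⟨(Γ p).map_source hq, ?_⟩; rwa [mem_preimage, (Γ p).left_inv hq]

lemma GraphChart.continuous_height (h : GraphChart D p R C K v f) : Continuous (height v f) :=
  EquivSpectrum.continuous_height v h.lip.continuous

lemma GraphChart.mem_dom_iff (h : GraphChart D p R C K v f) (hq : q ∈ ChB p R) : q ∈ D ↔ 0 < height
    v f (Γ p q) := by rw [← chart_mem_iff hq.1, h.mem_iff _ hq.2]

lemma tendsto_add_smul (y v : Є) : Tendsto (fun s : ℝ => y + s • v) (𝓝[>] 0) (𝓝 y) := by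
  have : Continuous (fun s : ℝ => y + s • v) := by fun_prop
  simpa using (this.tendsto 0).mono_left nhdsWithin_le_nhds

/-- Moving a point on or above the graph slightly in direction `v` raises its height and puts it
into `D`. -/
lemma GraphChart.symm_mem_closure (h : GraphChart D p R C K v f) {y : Є} (hy : y ∈ ball (Γ p p) R)
    (h0 : 0 ≤ height v f y) : (Θ p) y ∈ closure D := by
  have ht := tendsto_add_smul y v
  have hball : ∀ᶠ s : ℝ in 𝓝[>] 0, y + s • v ∈ ball (Γ p p) R := ht (isOpen_ball.mem_nhds hy)
  have hmem : ∀ᶠ s : ℝ in 𝓝[>] 0, y + s • v ∈ CS p D := by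
    filter_upwards [hball, self_mem_nhdsWithin] with s hs hs0
    rw [h.mem_iff _ hs, height_add_smul h.norm_v]; have : (0 : ℝ) < s := hs0; linarith
  have hc : Tendsto (fun s : ℝ => (Θ p) (y + s • v)) (𝓝[>] 0) (𝓝 (Θ p y)) := by
    have h1 := continuousOn_extChartAt_symm (I := Υ) p y (h.target y hy h0)
    refine h1.tendsto.comp (tendsto_nhdsWithin_iff.2 ⟨ht, ?_⟩)
    filter_upwards [hmem] with s hs using hs.1
  exact mem_closure_of_tendsto hc (hmem.mono fun s hs => hs.2)

lemma GraphChart.mem_closure_iff (h : GraphChart D p R C K v f) (hq : q ∈ ChB p R) : q ∈ closure D ↔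
    0 ≤ height v f (Γ p q) := by
  constructor
  · intro hc; by_contra hneg; push Not at hneg
    have hU : IsOpen (ChB p R ∩ Γ p ⁻¹' {y | height v f y < 0}) := by
      have h1 := (continuousOn_extChartAt (I := Υ) p).isOpen_inter_preimage (isOpen_extChartAt_source p)
        (isOpen_lt h.continuous_height (continuous_const (y := (0 : ℝ))))
      have h2 := (isOpen_chartBall (d := d) p R).inter h1
      convert h2 using 1
      ext x; exact ⟨fun hx => ⟨hx.1, hx.1.1, hx.2⟩, fun hx => ⟨hx.1, hx.2.2⟩⟩
    obtain ⟨x, hx, hxD⟩ := _root_.mem_closure_iff.1 hc _ hU ⟨hq, hneg⟩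
    have := (h.mem_dom_iff hx.1).1 hxD; have h3 : height v f (Γ p x) < 0 := hx.2; linarith
  · intro h0; have := h.symm_mem_closure hq.2 h0; rwa [(Γ p).left_inv hq.1] at this

lemma GraphChart.mem_frontier_iff (h : GraphChart D p R C K v f) (hD : IsOpen D) (hq : q ∈ ChB p R)
    : q ∈ frontier D ↔ height v f (Γ p q) = 0 := by
  rw [hD.frontier_eq, Set.mem_sdiff, h.mem_closure_iff hq, h.mem_dom_iff hq, not_lt]
  exact ⟨fun h => le_antisymm h.2 h.1, fun h => ⟨h.ge, h.le⟩⟩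

/-- The points of the hyperplane over which the graph lies in the ball. -/
def base (p : M) (R : ℝ) (v : Є) (f : Є → ℝ) : Set (Hyp v) :=
  {z | graphMap v f (z, 0) ∈ ball (Γ p p) R}

/-- The parametrization of the boundary near `p`. -/
def bdryMap (p : M) (v : Є) (f : Є → ℝ) (z : Hyp v) : M := (Θ p) (graphMap v f (z, 0))

lemma GraphChart.isOpen_base (h : GraphChart D p R C K v f) : IsOpen (base p R v f) :=
  isOpen_ball.preimage ((continuous_graphMap v h.lip.continuous).comp (by fun_prop))

lemma GraphChart.height_zero (h : GraphChart D p R C K v f) (z : Hyp v) : height v f (graphMap v f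
    (z, 0)) = 0 := height_graphMap h.norm_v f (z, 0)

lemma GraphChart.base_target (h : GraphChart D p R C K v f) {z : Hyp v} (hz : z ∈ base p R v f) :
    graphMap v f (z, 0) ∈ (Γ p).target := h.target _ hz (h.height_zero z).ge

lemma GraphChart.bdryMap_mem (h : GraphChart D p R C K v f) (hD : IsOpen D) {z : Hyp v} (hz : z ∈
    base p R v f) : bdryMap p v f z ∈ frontier D ∩ ChB p R := by
  have hz' := h.base_target hz
  have h1 : bdryMap p v f z ∈ ChB p R :=
    ⟨(Γ p).map_target hz', by rw [mem_preimage, bdryMap, (Γ p).right_inv hz']; exact hz⟩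
  refine ⟨(h.mem_frontier_iff hD h1).2 ?_, h1⟩; rw [bdryMap, (Γ p).right_inv hz', h.height_zero]

lemma GraphChart.exists_bdryMap (h : GraphChart D p R C K v f) (hD : IsOpen D) (hq : q ∈ frontier D
    ∩ ChB p R) : hypProj h.norm_v (Γ p q) ∈ base p R v f ∧ bdryMap p v f (hypProj h.norm_v (Γ p q))
    = q := by
  have h0 := (h.mem_frontier_iff hD hq.2).1 hq.1; have h1 := graphMap_hypProj h.norm_v f (Γ p q)
  rw [h0] at h1; refine ⟨?_, ?_⟩
  · rw [base, mem_ofPred_eq, h1]; exact hq.2.2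
  · rw [bdryMap, h1, (Γ p).left_inv hq.2.1]

lemma GraphChart.continuousOn_bdryMap (h : GraphChart D p R C K v f) : ContinuousOn (bdryMap p v f)
    (base p R v f) :=
  (continuousOn_extChartAt_symm p).comp
    ((continuous_graphMap v h.lip.continuous).comp (by fun_prop)).continuousOn
    fun _ hz => h.base_target hz

lemma GraphChart.edist_bdryMap_le (h : GraphChart D p R C K v f) {z z' : Hyp v} (hz : z ∈ base p R v
    f) (hz' : z' ∈ base p R v f) : edist (bdryMap p v f z) (bdryMap p v f z') ≤ ofReal (C * (1 + K))
    * edist z z' := by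
  refine (h.edist_le _ ⟨hz, h.base_target hz⟩ _ ⟨hz', h.base_target hz'⟩).trans ?_
  rw [ofReal_mul h.C_pos.le, mul_assoc]; gcongr
  rw [edist_dist, edist_dist, ← ofReal_mul (by positivity)]; refine ofReal_le_ofReal ?_
  have e : graphMap v f (z, 0) - graphMap v f (z', 0) = ((z : Є) - z') + (f z - f z') • v := by
    simp only [graphMap, add_zero, sub_smul]; abel
  rw [dist_eq_norm, e, Subtype.dist_eq, dist_eq_norm]; refine (norm_add_le _ _).trans ?_
  rw [norm_smul, h.norm_v, mul_one, ← dist_eq_norm (f z)]; have := h.lip.dist_le_mul z z'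
  rw [dist_eq_norm (z : Є)] at this; linarith

lemma volume_hyp (hv : ‖v‖ = 1) : (volume : Measure (Hyp v)) = μHE[d - 1] := by
  rw [← finrank_hyp hv, InnerProductSpace.euclideanHausdorffMeasure_eq_volume]

lemma GraphChart.aemeasurable_bdryMap (h : GraphChart D p R C K v f) : AEMeasurable (bdryMap p v f)
    ((volume : Measure (Hyp v)).restrict (base p R v f)) :=
  h.continuousOn_bdryMap.aemeasurable h.isOpen_base.measurableSet

/-- The boundary is the image of the base under `bdryMap`, which is Lipschitz with constant `C (1 +
K)`, so surface measure is controlled by Lebesgue measure on the hyperplane. -/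
lemma GraphChart.surf_le (h : GraphChart D p R C K v f) (hD : IsOpen D) : 𝓢 (frontier D ∩ ChB p R) ≤
    (ofReal (C * (1 + K)) ^ (d - 1)) • Measure.map (bdryMap p v f) ((volume : Measure (Hyp
    v)).restrict (base p R v f)) := by
  refine Measure.le_iff.2 fun T hT => ?_
  rw [restrict_apply hT, Measure.smul_apply,
    Measure.map_apply_of_aemeasurable h.aemeasurable_bdryMap hT, smul_eq_mul,
    Measure.restrict_apply' h.isOpen_base.measurableSet, volume_hyp h.norm_v]
  refine le_trans (measure_mono ?_) (hausdorff_image_le (d - 1)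
    fun z hz z' hz' => h.edist_bdryMap_le hz.2 hz'.2)
  rintro q ⟨hqT, hq⟩; obtain ⟨h1, h2⟩ := h.exists_bdryMap hD hq
  exact ⟨_, ⟨by rw [mem_preimage, h2]; exact hqT, h1⟩, h2⟩

/-- The converse comparison: the inverse of the parametrization is the chart followed by orthogonal
projection, which is `C`-Lipschitz. -/
lemma GraphChart.le_surf (h : GraphChart D p R C K v f) (hD : IsOpen D) : Measure.map (bdryMap p v
    f) ((volume : Measure (Hyp v)).restrict (base p R v f)) ≤ (ofReal C ^ (d - 1)) • (surf d
    M).restrict (frontier D ∩ ChB p R) := by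
  have hm : MeasurableSet (frontier D ∩ ChB p R) :=
    isClosed_frontier.measurableSet.inter (isOpen_chartBall p R).measurableSet
  refine Measure.le_iff.2 fun T hT => ?_
  rw [Measure.smul_apply, Measure.map_apply_of_aemeasurable h.aemeasurable_bdryMap hT, smul_eq_mul,
    Measure.restrict_apply' h.isOpen_base.measurableSet, volume_hyp h.norm_v,
    Measure.restrict_apply' hm]
  refine le_trans (measure_mono ?_) (hausdorff_image_le
    (f := fun q => hypProj h.norm_v (Γ p q)) (A := T ∩ (frontier D ∩ ChB p R))
    (d - 1) (r := C) fun q hq q' hq' => ?_)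
  · rintro z ⟨hzT, hz⟩; refine ⟨bdryMap p v f z, ⟨hzT, h.bdryMap_mem hD hz⟩, ?_⟩
    simp only [bdryMap]; rw [(Γ p).right_inv (h.base_target hz), hypProj_graphMap]
  · have h1 := h.le_edist _ ⟨hq.2.2.2, (Γ p).map_source hq.2.2.1⟩ _
      ⟨hq'.2.2.2, (Γ p).map_source hq'.2.2.1⟩
    rw [(Γ p).left_inv hq.2.2.1, (Γ p).left_inv hq'.2.2.1] at h1; refine le_trans ?_ h1
    rw [edist_dist, edist_dist, Subtype.dist_eq, dist_eq_norm, dist_eq_norm]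
    exact ofReal_le_ofReal (norm_hypProj_sub_le _ _ _)

end Local

local notation "ChB" => chartBall d

/-! ### Existence of graph charts and the local trace inequality -/

section Exists

/-- Interior points are included by means of a trivial graph, so that later local arguments treat
all points of the closure alike. -/
lemma IsLipschitzDomain.exists_graph (hD : IsLD D) (hp : p ∈ closure D) : ∃ U : Set Є, IsOpen U ∧ Γ
    p p ∈ U ∧ ∃ (v : Є) (K : NNReal) (f : Є → ℝ), ‖v‖ = 1 ∧ LipschitzWith K f ∧ ∀ y ∈ U, y ∈ CS p D
    ↔ f (y - inner ℝ v y • v) < inner ℝ v y := by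
  by_cases hpD : p ∈ D
  · set y₀ := Γ p p
    -- The constant graph lies one unit below `y₀`, so the whole unit ball is above it.
    refine ⟨CS p D ∩ ball y₀ 1,
      (isOpen_chartSet p hD.isOpen hD.subset_interior).inter isOpen_ball,
      ⟨chart_mem_chartSet hpD (mem_chart_source _ p), mem_ball_self one_pos⟩,
      𝐞 0, 0, fun _ => inner ℝ (𝐞 0) y₀ - 1, by simp,
      LipschitzWith.const' _, fun y hy => ⟨fun _ => ?_, fun _ => hy.1⟩⟩
    have h1 := abs_real_inner_le_norm (EuclideanSpace.single (0 : Fin d) (1 : ℝ)) (y₀ - y)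
    have h2 : ‖y₀ - y‖ < 1 := by rw [← dist_eq_norm, dist_comm]; exact hy.2
    rw [inner_sub_right, PiLp.norm_single, norm_one, one_mul] at h1
    linarith [le_abs_self (inner ℝ (EuclideanSpace.single (0 : Fin d) (1 : ℝ)) y₀ -
      inner ℝ (EuclideanSpace.single (0 : Fin d) (1 : ℝ)) y)]
  · have := hD.graph p (hD.isOpen.frontier_eq ▸ ⟨hp, hpD⟩); rwa [image_chart_eq] at this

lemma exists_graphChart (hD : IsLD D) (hp : p ∈ closure D) {N : Set M} (hN : N ∈ 𝓝 p) : ∃ (R C : ℝ)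
    (K : NNReal) (v : Є) (f : Є → ℝ), GraphChart D p R C K v f ∧ ChB p R ⊆ N := by
  obtain ⟨U, hU, hpU, v, K, f, hv, hf, hUf⟩ := hD.exists_graph hp; have hps := mem_src d p
  obtain ⟨C1, hC1, N1, hN1, h1⟩ := exists_chart_bilipschitz (d := d) hps
  obtain ⟨C2, hC2, h2⟩ := eventually_norm_lift_bound (d := d) hps; set ρ := VD p p with hρ
  have hρ0 : 0 < ρ := volDensity_pos hps
  have h3 : ∀ᶠ q in 𝓝 p, VD p q < 2 * ρ ∧ ρ / 2 < VD p q := by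
    have hc : ContinuousAt (VD p) p := (contMDiffOn_volDensity p).continuousOn.continuousAt
      ((𝓒 p).open_source.mem_nhds hps)
    exact (hc.eventually_lt_const (by linarith)).and (hc.eventually_const_lt (by linarith))
  obtain ⟨R0, hR0, h4⟩ := exists_ball_extChartAt (d := d) hps
    (inter_mem (inter_mem hN hN1) (inter_mem h2 h3))
  obtain ⟨R1, hR1, h5⟩ := Metric.isOpen_iff.1 hU _ hpU
  have htr := extChartAt_target_subset_range (I := Υ) p
  have hb0 : ∀ y ∈ ball (Γ p p) (min R0 R1) ∩ (Γ p).target, (Θ p) y ∈ (N ∩ N1) ∩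
        ({q | ∀ v : Є, ‖lift p q v‖ ≤ C2 * ‖v‖ ∧ ‖v‖ ≤ C2 * ‖lift p q v‖} ∩
         {q | VD p q < 2 * ρ ∧ ρ / 2 < VD p q}) := fun y hy =>
    (h4 y ⟨ball_subset_ball (min_le_left _ _) hy.1, htr hy.2⟩).2
  set C := C1 + C2 + 2 * ρ + 2 / ρ with hC
  have hCC1 : C1 ≤ C := by have : 0 < 2 / ρ := by positivity
                           linarith
  have hCC2 : C2 ≤ C := by have : 0 < 2 / ρ := by positivity
                           linarith
  refine ⟨min R0 R1, C, K, v, f, ⟨lt_min hR0 hR1, by positivity, hv, hf, ?_, ?_, ?_, ?_, ?_, ?_⟩, ?_⟩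
  -- A point on or above the graph is a limit of points of the image of `D` along `v`, so it lies in
  -- the closed half space.
  · intro y hy h0; refine (h4 y ⟨ball_subset_ball (min_le_left _ _) hy, ?_⟩).1
    have ht := tendsto_add_smul y v; refine (Υ).isClosed_range.mem_of_tendsto ht ?_
    have hball : ∀ᶠ s : ℝ in 𝓝[>] 0, y + s • v ∈ U :=
      ht (hU.mem_nhds (h5 (ball_subset_ball (min_le_right _ _) hy)))
    filter_upwards [hball, self_mem_nhdsWithin] with s hs hs0; refine htr ((hUf _ hs).2 ?_).1
    have h6 : 0 < height v f (y + s • v) := by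
      rw [height_add_smul hv]; have : (0 : ℝ) < s := hs0; linarith
    rw [height] at h6; linarith
  · intro y hy; rw [hUf y (h5 (ball_subset_ball (min_le_right _ _) hy)), height, sub_pos]
  · intro y hy z hz; have h6 := (h1 _ (hb0 y hy).1.2 _ (hb0 z hz).1.2).1
    rw [(Γ p).right_inv hy.2, (Γ p).right_inv hz.2] at h6; exact h6.trans (by gcongr)
  · intro y hy z hz; have h6 := (h1 _ (hb0 y hy).1.2 _ (hb0 z hz).1.2).2
    rw [(Γ p).right_inv hy.2, (Γ p).right_inv hz.2] at h6; exact h6.trans (by gcongr)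
  · intro y hy w; obtain ⟨h6, h7⟩ := (hb0 y hy).2.1 w
    exact ⟨h6.trans (by gcongr), h7.trans (by gcongr)⟩
  · intro y hy; obtain ⟨h6, h7⟩ := (hb0 y hy).2.2; change VD p _ ≤ C ∧ 1 ≤ C * VD p _
    refine ⟨?_, ?_⟩
    · have : 0 < 2 / ρ := by positivity
      linarith
    · have h8 : 2 / ρ ≤ C := by linarith
      calc (1 : ℝ) = 2 / ρ * (ρ / 2) := by field_simp
        _ ≤ C * _ := by gcongr
  · intro q hq; have h6 := (hb0 _ ⟨hq.2, (Γ p).map_source hq.1⟩).1.1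
    rwa [(Γ p).left_inv hq.1] at h6

variable {R C : ℝ} {K : NNReal} {v : Eu d} {f : Eu d → ℝ}

/-- The trace inequality near a boundary point. -/
lemma GraphChart.trace_le (h : GraphChart D p R C K v f) (hD : IsOpen D) (hDi : D ⊆ Ξ M) : ∃ C' :
    ℝ≥0∞, C' ≠ ⊤ ∧ ∀ w : M → ℝ, Ck 1 w → ∫⁻ q in frontier D ∩ ChB p (R / 2), ofReal (w q ^ 2) ∂(surf
    d M) ≤ C' * ∫⁻ q in D, ofReal (w q ^ 2 + ‖Gd w q‖ ^ 2) ∂ϑ := by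
  have hR := h.R_pos; have h' := h.mono (half_pos hR) (half_le_self hR.le); set φ := Γ p with hφ
  set δ := R / 2 with hδ; have hδ0 : 0 < δ := half_pos hR
  obtain ⟨c, hc0, hct, hvol⟩ := exists_volume_eq_map h.norm_v h.lip.continuous
  -- The first factor comes from the one-dimensional inequality; `C ^ 2` comes from bounding the
  -- derivative along `v` by `C` times the norm of the gradient.
  set b := (δ⁻¹ + 1) * (1 + C ^ 2) with hb; have hC0 := h.C_pos
  refine ⟨ofReal (C * (1 + K)) ^ (d - 1) * (c⁻¹ * (ofReal C * ofReal b)), ?_, fun w hw => ?_⟩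
  · exact mul_ne_top (ENNReal.pow_ne_top ofReal_ne_top) (mul_ne_top (ENNReal.inv_ne_top.2 hc0)
        (mul_ne_top ofReal_ne_top ofReal_ne_top))
  let H : M → ℝ≥0∞ := fun q => ofReal (b * (w q ^ 2 + ‖Gd w q‖ ^ 2))
  have hH : Continuous H := by
    have := continuous_norm_grad hw; have := hw.continuous; refine ENNReal.continuous_ofReal.comp ?_
    fun_prop
  set E := ball (φ p) R ∩ CS p D with hE
  have hEo : IsOpen E := isOpen_ball.inter (isOpen_chartSet p hD hDi)
  -- the boundary integral as an integral over the hyperplane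
  have s1 : ∫⁻ q in frontier D ∩ ChB p δ, ofReal (w q ^ 2) ∂(surf d M) ≤
      ofReal (C * (1 + K)) ^ (d - 1) * ∫⁻ z in base p δ v f, ofReal (w (bdryMap p v f z) ^ 2) := by
    refine (lintegral_mono' (h'.surf_le hD) le_rfl).trans ?_
    rw [lintegral_smul_measure, lintegral_map' _ h'.aemeasurable_bdryMap, smul_eq_mul]
    exact (ENNReal.continuous_ofReal.comp (hw.continuous.pow 2)).measurable.aemeasurable
  -- the fundamental theorem of calculus along `v`
  have s2 : ∀ z ∈ base p δ v f, ofReal (w (bdryMap p v f z) ^ 2) ≤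
      ∫⁻ t in Ioo 0 δ, E.indicator (fun y => H (φ.symm y)) (graphMap v f (z, t)) := by
    intro z hz
    have hgm : ∀ t, graphMap v f (z, t) = graphMap v f (z, 0) + t • v := fun t => by
      simp only [graphMap, add_zero, add_smul]; abel
    have hball : ∀ t ∈ Icc 0 δ, graphMap v f (z, t) ∈ ball (φ p) R := by
      intro t ht; rw [hgm, mem_ball, dist_eq_norm]
      have h1 : ‖graphMap v f (z, 0) - φ p‖ < δ := by rw [← dist_eq_norm]; exact hz
      calc ‖graphMap v f (z, 0) + t • v - φ p‖ = ‖(graphMap v f (z, 0) - φ p) + t • v‖ := by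
            congr 1; abel
        _ ≤ ‖graphMap v f (z, 0) - φ p‖ + ‖t • v‖ := norm_add_le _ _
        _ < δ + δ := by
            rw [norm_smul, h.norm_v, mul_one, norm_eq_abs, abs_of_nonneg ht.1]; linarith [ht.2]
        _ = R := by rw [hδ]; ring
    have htar : ∀ t ∈ Icc 0 δ, graphMap v f (z, t) ∈ φ.target := fun t ht =>
      h.target _ (hball t ht) (by rw [height_graphMap h.norm_v]; exact ht.1)
    have hmem : ∀ t ∈ Ioo 0 δ, graphMap v f (z, t) ∈ E := fun t ht =>
      ⟨hball t ⟨ht.1.le, ht.2.le⟩, (h.mem_iff _ (hball t ⟨ht.1.le, ht.2.le⟩)).2 (by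
        rw [height_graphMap h.norm_v]; exact ht.1)⟩
    have hwc : ContDiffOn ℝ 1 (fun y => w (φ.symm y)) φ.target :=
      contDiffOn_chart_fun one_le_infty hw.contMDiffOn
    have huniq : UniqueDiffOn ℝ φ.target := uniqueDiffOn_extChartAt_target p
    have hline : Continuous fun t => graphMap v f (z, t) :=
      (continuous_graphMap v h.lip.continuous).comp (by fun_prop)
    have key := sq_le_lintegral_Ioo (g := fun t => w (φ.symm (graphMap v f (z, t))))
      (g' := fun t => fderivWithin ℝ (fun y => w (φ.symm y)) φ.target (graphMap v f (z, t)) v) hδ0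
      (hwc.continuousOn.comp hline.continuousOn htar)
      (((hwc.continuousOn_fderivWithin huniq le_rfl).comp hline.continuousOn htar).clm_apply
        continuousOn_const) fun t ht => ?_
    · refine key.trans (setLIntegral_mono' measurableSet_Ioo fun t ht => ?_)
      rw [indicator_of_mem (hmem t ht)]; refine ofReal_le_ofReal ?_
      set y := graphMap v f (z, t) with hy; have hyE := hmem t ht
      have hsrc : φ.symm y ∈ Δ p := mem_source_of_mem hyE.2
      have hnt : φ.target ∈ 𝓝 y := mem_of_superset (hEo.mem_nhds hyE) fun x hx => hx.2.1
      have hnr : range Υ ∈ 𝓝 y := range_mem_nhds hD hDi hyE.2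
      have e1 : fderivWithin ℝ (fun y => w (φ.symm y)) φ.target y v =
          inner ℝ (lift p (φ.symm y) v) (Gd w (φ.symm y)) := by
        rw [inner_grad, ← fderivWithin_chart_fun (hw.mdifferentiable one_ne_zero _) hsrc, ← hφ,
          φ.right_inv hyE.2.1, fderivWithin_of_mem_nhds hnt, fderivWithin_of_mem_nhds hnr]
      have e2 : |fderivWithin ℝ (fun y => w (φ.symm y)) φ.target y v| ≤ C * ‖Gd w (φ.symm y)‖ := by
        rw [e1]
        refine (abs_real_inner_le_norm _ _).trans (mul_le_mul_of_nonneg_right ?_ (norm_nonneg _))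
        have := (h.norm_lift y ⟨hyE.1, hyE.2.1⟩ v).1; rwa [h.norm_v, mul_one] at this
      have e3 : (fderivWithin ℝ (fun y => w (φ.symm y)) φ.target y v) ^ 2 ≤
          C ^ 2 * ‖Gd w (φ.symm y)‖ ^ 2 := by
        rw [← sq_abs, ← mul_pow]; exact pow_le_pow_left₀ (abs_nonneg _) e2 2
      rw [hb, mul_assoc]; refine mul_le_mul_of_nonneg_left ?_ (by positivity)
      nlinarith [sq_nonneg (w (φ.symm y)), sq_nonneg ‖Gd w (φ.symm y)‖,
        mul_nonneg (sq_nonneg C) (sq_nonneg (w (φ.symm y)))]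
    · have hyE := hmem t ht
      have hnt : φ.target ∈ 𝓝 (graphMap v f (z, t)) :=
        mem_of_superset (hEo.mem_nhds hyE) fun x hx => hx.2.1
      have h1 : HasFDerivAt (fun y => w (φ.symm y))
          (fderivWithin ℝ (fun y => w (φ.symm y)) φ.target (graphMap v f (z, t)))
          (graphMap v f (z, t)) :=
        ((hwc.differentiableOn one_ne_zero _ hyE.2.1).hasFDerivWithinAt).hasFDerivAt hnt
      have h2 : HasDerivAt (fun t => graphMap v f (z, t)) v t := by
        have : HasDerivAt (fun t : ℝ => graphMap v f (z, 0) + t • v) ((1 : ℝ) • v) t :=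
          ((hasDerivAt_id t).smul_const v).const_add _
        rw [one_smul] at this; exact this.congr_of_eventuallyEq (Eventually.of_forall hgm)
      exact h1.comp_hasDerivAt t h2
  have hmeas : AEMeasurable (fun x : Hyp v × ℝ => E.indicator (fun y => H (φ.symm y)) (graphMap v f x))
      ((volume : Measure (Hyp v)).prod (volume : Measure ℝ)) := by
    have h1 : Measurable (E.indicator (fun y => H (φ.symm y))) := by
      refine measurable_of_restrict_of_restrict_compl hEo.measurableSet ?_ ?_
      · have h2 : ContinuousOn (fun y => H (φ.symm y)) E :=
          hH.comp_continuousOn ((continuousOn_extChartAt_symm p).mono fun y hy => hy.2.1)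
        have h3 : E.domRestrict (E.indicator fun y => H (φ.symm y)) =
            E.domRestrict fun y => H (φ.symm y) := by ext y; exact indicator_of_mem y.2 _
        rw [h3]; exact (continuousOn_iff_continuous_domRestrict.1 h2).measurable
      · have h3 : Eᶜ.domRestrict (E.indicator fun y => H (φ.symm y)) = fun _ => 0 := by
          ext y; exact indicator_of_notMem y.2 _
        rw [h3]; exact measurable_const
    exact (h1.comp (continuous_graphMap v h.lip.continuous).measurable).aemeasurable
  -- Fubini
  have s3 : ∫⁻ z in base p δ v f, ofReal (w (bdryMap p v f z) ^ 2) ≤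
      c⁻¹ * ∫⁻ y in E, H (φ.symm y) := by
    calc ∫⁻ z in base p δ v f, ofReal (w (bdryMap p v f z) ^ 2)
        ≤ ∫⁻ z in base p δ v f, ∫⁻ t in Ioo 0 δ,
            E.indicator (fun y => H (φ.symm y)) (graphMap v f (z, t)) :=
          setLIntegral_mono' h'.isOpen_base.measurableSet s2
      _ ≤ ∫⁻ z, ∫⁻ t, E.indicator (fun y => H (φ.symm y)) (graphMap v f (z, t)) :=
          (setLIntegral_le_lintegral _ _).trans (lintegral_mono fun z => setLIntegral_le_lintegral _ _)
      _ = ∫⁻ x, E.indicator (fun y => H (φ.symm y)) (graphMap v f x)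
            ∂((volume : Measure (Hyp v)).prod (volume : Measure ℝ)) := by
          rw [lintegral_prod _ hmeas]
      _ = ∫⁻ y, E.indicator (fun y => H (φ.symm y)) y ∂(Measure.map (graphMap v f)
            ((volume : Measure (Hyp v)).prod (volume : Measure ℝ))) :=
          ((graphHomeo h.norm_v h.lip.continuous).measurableEmbedding.lintegral_map _).symm
      _ = c⁻¹ * ∫⁻ y in E, H (φ.symm y) := by
          rw [← lintegral_indicator hEo.measurableSet]
          conv_rhs => rw [hvol]
          rw [lintegral_smul_measure, smul_eq_mul, ← mul_assoc, ENNReal.inv_mul_cancel hc0 hct, one_mul]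
  -- back to the manifold
  have s4 : ∫⁻ y in E, H (φ.symm y) ≤ ofReal C * ∫⁻ q in D, H q ∂ϑ := by
    have hDs : MeasurableSet (D ∩ φ.source) := (hD.inter (isOpen_extChartAt_source p)).measurableSet
    have hEs : E ⊆ CS p (D ∩ φ.source) := fun y hy =>
      ⟨hy.2.1, hy.2.2, φ.map_target hy.2.1⟩
    calc ∫⁻ y in E, H (φ.symm y)
        ≤ ∫⁻ y in E, ofReal C * (ofReal (chartDensity p y) * H (φ.symm y)) := by
          refine setLIntegral_mono' hEo.measurableSet fun y hy => ?_
          rw [← mul_assoc, ← ofReal_mul hC0.le]; refine le_mul_of_one_le_left zero_le ?_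
          rw [ENNReal.one_le_ofReal]; exact (h.density y ⟨hy.1, hy.2.1⟩).2
      _ ≤ ∫⁻ y in CS p (D ∩ φ.source),
            ofReal C * (ofReal (chartDensity p y) * H (φ.symm y)) :=
          lintegral_mono_set hEs
      _ = ofReal C * ∫⁻ q in D ∩ φ.source, H q ∂ϑ := by
          rw [lintegral_ofReal_mul, setLIntegral_chart p hDs inter_subset_right]
      _ ≤ _ := by gcongr; exact inter_subset_left
  have s5 : ∫⁻ q in D, H q ∂ϑ = ofReal b * ∫⁻ q in D, ofReal (w q ^ 2 + ‖Gd w q‖ ^ 2) ∂ϑ := by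
    rw [← lintegral_ofReal_mul]; refine lintegral_congr fun q => ?_
    rw [← ofReal_mul (by positivity)]
  refine s1.trans ?_; rw [mul_assoc]; gcongr; refine s3.trans ?_; rw [mul_assoc]; gcongr
  rw [mul_assoc, ← s5]; exact s4

end Exists

lemma eLpNorm_two_sq {α : Type*} [MeasurableSpace α] (μ : Measure α) (f : α → ℝ) : eLpNorm f 2 μ ^ 2
    = ∫⁻ x, ofReal (f x ^ 2) ∂μ := by
  rw [eLpNorm_eq_lintegral_rpow_enorm_toReal (by norm_num) (by norm_num)]
  rw [← ENNReal.rpow_natCast, ← ENNReal.rpow_mul]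
  simp only [ENNReal.toReal_ofNat, Nat.cast_ofNat, one_div, ne_eq, OfNat.ofNat_ne_zero,
    not_false_eq_true, inv_mul_cancel₀, ENNReal.rpow_one]
  refine lintegral_congr fun x => ?_
  rw [Real.enorm_eq_ofReal_abs, ENNReal.rpow_ofNat, ← ENNReal.ofReal_pow (abs_nonneg _), sq_abs]

lemma eLpNorm_le_add_of_ae_le {α : Type*} [MeasurableSpace α] {μ : Measure α} {f g h : α → ℝ} (hg :
    AEStronglyMeasurable g μ) (hh : AEStronglyMeasurable h μ) (hf : ∀ᵐ x ∂μ, ‖f x‖ ≤ g x + h x) :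
    eLpNorm f 2 μ ≤ eLpNorm g 2 μ + eLpNorm h 2 μ := by
  refine le_trans (eLpNorm_mono_ae (g := g + h) ?_) (eLpNorm_add_le hg hh one_le_two)
  filter_upwards [hf] with x hx; exact hx.trans (le_abs_self _)

/-! ### The trace inequality and traces of Sobolev functions -/

section Trace

variable {τ' : M → ℝ}

lemma trace_inequality_lintegral (hD : IsLD D) : ∃ C : ℝ≥0∞, C ≠ ⊤ ∧ ∀ w : M → ℝ, Ck 1 w → ∫⁻ q in
    frontier D, ofReal (w q ^ 2) ∂(surf d M) ≤ C * ∫⁻ q in D, ofReal (w q ^ 2 + ‖Gd w q‖ ^ 2) ∂ϑ :=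
    by
  have hex : ∀ p : M, p ∈ frontier D → ∃ N : Set M, IsOpen N ∧ p ∈ N ∧ ∃ C' : ℝ≥0∞, C' ≠ ⊤ ∧
      ∀ w : M → ℝ, Ck 1 w →
      ∫⁻ q in frontier D ∩ N, ofReal (w q ^ 2) ∂(surf d M) ≤
        C' * ∫⁻ q in D, ofReal (w q ^ 2 + ‖Gd w q‖ ^ 2) ∂ϑ := by
    intro p hp
    obtain ⟨R, C, K, v, f, h, -⟩ := exists_graphChart hD (frontier_subset_closure hp) univ_mem
    exact ⟨_, isOpen_chartBall p (R / 2), mem_chartBall p (half_pos h.R_pos),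
      h.trace_le hD.isOpen hD.subset_interior⟩
  choose! N hN hpN C' hC' hw using hex
  obtain ⟨t, ht, hcov⟩ := isClosed_frontier.isCompact.elim_nhds_subcover N
    fun p hp => (hN p hp).mem_nhds (hpN p hp)
  refine ⟨∑ p ∈ t, C' p, (ENNReal.sum_lt_top.2 fun p hp => (hC' p (ht p hp)).lt_top).ne,
    fun w hwc => ?_⟩
  calc ∫⁻ q in frontier D, ofReal (w q ^ 2) ∂(surf d M)
      ≤ ∫⁻ q in ⋃ p ∈ t, frontier D ∩ N p, ofReal (w q ^ 2) ∂(surf d M) := by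
        refine lintegral_mono_set fun q hq => ?_; obtain ⟨p, hp, h⟩ := mem_iUnion₂.1 (hcov hq)
        exact mem_iUnion₂.2 ⟨p, hp, hq, h⟩
    _ ≤ ∑ p ∈ t, ∫⁻ q in frontier D ∩ N p, ofReal (w q ^ 2) ∂(surf d M) := by
        classical
        have hgen : ∀ s : Finset M, ∫⁻ q in ⋃ p ∈ s, frontier D ∩ N p, ofReal (w q ^ 2) ∂(surf d M)
            ≤ ∑ p ∈ s, ∫⁻ q in frontier D ∩ N p, ofReal (w q ^ 2) ∂(surf d M) := by
          intro s; induction s using Finset.induction_on with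
          | empty => simp
          | insert a s ha ih =>
            rw [sum_insert ha, Finset.set_biUnion_insert]
            exact (lintegral_union_le _ _ _).trans (by gcongr)
        exact hgen t
    _ ≤ ∑ p ∈ t, C' p * ∫⁻ q in D, ofReal (w q ^ 2 + ‖Gd w q‖ ^ 2) ∂ϑ :=
        sum_le_sum fun p hp => hw p (ht p hp) w hwc
    _ = _ := by rw [sum_mul]

lemma trace_inequality (hD : IsLD D) : ∃ C : ℝ≥0∞, C ≠ ⊤ ∧ ∀ w : M → ℝ, ContMDiff Υ 𝓘(ℝ) 1 w →
    eLpNorm w 2 (𝓢 (frontier D)) ≤ C * (eLpNorm w 2 (Λ D) + eLpNorm (fun p => ‖Gd w p‖) 2 Λ D) := by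
  obtain ⟨C, hC, h⟩ := trace_inequality_lintegral hD; refine ⟨C + 1, by simp [hC], fun w hw => ?_⟩
  have h1 := h w hw; set a := eLpNorm w 2 Λ D; set b := eLpNorm (fun p => ‖Gd w p‖) 2 Λ D
  have h2 : ∫⁻ q in D, ofReal (w q ^ 2 + ‖Gd w q‖ ^ 2) ∂ϑ = a ^ 2 + b ^ 2 := by
    rw [eLpNorm_two_sq, eLpNorm_two_sq, ← lintegral_add_left]
    · exact lintegral_congr fun q => ENNReal.ofReal_add (sq_nonneg _) (sq_nonneg _)
    · exact (ENNReal.continuous_ofReal.comp (hw.continuous.pow 2)).measurable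
  rw [h2, ← eLpNorm_two_sq] at h1
  have h3 : eLpNorm w 2 (𝓢 (frontier D)) ^ 2 ≤ ((C + 1) * (a + b)) ^ 2 := by
    refine h1.trans ?_
    calc C * (a ^ 2 + b ^ 2) ≤ (C + 1) ^ 2 * (a + b) ^ 2 := by
          gcongr
          · calc C ≤ (C + 1) * 1 := by rw [mul_one]; exact le_self_add
              _ ≤ (C + 1) * (C + 1) := by gcongr; exact le_add_self
              _ = _ := (sq _).symm
          · calc a ^ 2 + b ^ 2 ≤ a ^ 2 + b ^ 2 + 2 * a * b := le_self_add
              _ = (a + b) ^ 2 := by ring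
      _ = _ := by rw [mul_pow]
  exact (ENNReal.pow_le_pow_left_iff two_ne_zero).1 h3

/-- The trace inequality for the constant function `1`. -/
lemma surf_frontier_lt_top (hD : IsLD D) : surf d M (frontier D) < ⊤ := by
  obtain ⟨C, hC, h⟩ := trace_inequality_lintegral hD; have := finite_vol (d := d) (M := M)
  have h1 := h (fun _ => 1) contMDiff_const
  simp only [one_pow, ofReal_one, lintegral_const, Measure.restrict_apply_univ, one_mul] at h1
  refine h1.trans_lt (mul_lt_top hC.lt_top ?_)
  obtain ⟨B, hB⟩ := exists_bound (continuous_norm_grad (d := d) (M := M) (w := fun _ => (1 : ℝ)) contMDiff_const)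
  refine (lintegral_mono (g := fun _ => ofReal (1 + B ^ 2)) fun q => ?_).trans_lt ?_
  · refine ofReal_le_ofReal ?_; have := hB q; rw [norm_norm] at this; gcongr
  · rw [lintegral_const]; exact mul_lt_top ofReal_lt_top (measure_lt_top _ _)

lemma isFiniteMeasure_surf_frontier (hD : IsLD D) : IsFiniteMeasure ((surf d M).restrict (frontier
    D)) :=
  ⟨by rw [Measure.restrict_apply_univ]; exact surf_frontier_lt_top hD⟩

/-- A set of finite `(d-1)`-dimensional Hausdorff measure has zero `d`-dimensional measure. -/
lemma vol_frontier_eq_zero (hD : IsLD D) : ϑ (frontier D) = 0 := by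
  have hd : d - 1 < d := Nat.sub_lt (Nat.pos_of_ne_zero (NeZero.ne d)) one_pos
  exact (Measure.euclideanHausdorffMeasure_zero_or_top hd (frontier D)).resolve_right
    (surf_frontier_lt_top hD).ne

lemma memLp_surf_of_cont (hD : IsLD D) (hf : Continuous f) : MemLp f 2 ((surf d M).restrict
    (frontier D)) := by
  have := isFiniteMeasure_surf_frontier hD; obtain ⟨C, hC⟩ := exists_bound hf
  exact MemLp.of_bound (hf.aestronglyMeasurable) C (.of_forall fun p => hC p)

variable (d D u) in
/-- The `C¹` functions `w k` converge to `u` in `H¹(D)`. -/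
structure ApproxH1 (w : ℕ → M → ℝ) (W : ℕ → VM) : Prop where
  contMDiff : ∀ k, Ck 1 (w k)
  isWeakGradient : ∀ k, IsWG D (fun p => w k p - u p) (W k)
  tendsto : Tendsto (fun k => eLpNorm (fun p => w k p - u p) 2 Λ D) atTop (𝓝 0)
  tendsto_grad : Tendsto (fun k => eLpNorm (fun p => ‖W k p‖) 2 Λ D) atTop (𝓝 0)

lemma isTrace_iff : Tr D u τ ↔ MemLp τ 2 (𝓢 (frontier D)) ∧ ∃ w W, ApproxH1 d D u w W ∧ Tendsto (fun
    k => eLpNorm (fun p => w k p - τ p) 2 (𝓢 (frontier D))) atTop (𝓝 0) :=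
  ⟨fun ⟨h, w, W, h1, h2, h3, h4, h5⟩ => ⟨h, w, W, ⟨h1, h2, h3, h4⟩, h5⟩,
    fun ⟨h, w, W, h1, h5⟩ => ⟨h, w, W, h1.1, h1.2, h1.3, h1.4, h5⟩⟩

lemma tendsto_zero_of_le {α : Type*} {l : Filter α} {a b c : α → ℝ≥0∞} (ha : Tendsto a l (𝓝 0)) (hb
    : Tendsto b l (𝓝 0)) (h : ∀ i, c i ≤ a i + b i) : Tendsto c l (𝓝 0) := by
  have h1 := ha.add hb; rw [add_zero] at h1; exact squeeze h1 h

/-- The trace inequality for the difference of two `C¹` functions, routed through `u`. It makes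
boundary values of an approximating sequence Cauchy and the limit independent of the sequence,
giving existence and uniqueness of traces. -/
lemma trace_dist_le (hD : IsLD D) : ∃ C : ℝ≥0∞, C ≠ ⊤ ∧ ∀ (u w w' : M → ℝ) (W W' : VM), MemLp u 2 Λ
    D → Ck 1 w → Ck 1 w' → IsWG D (fun p => w p - u p) W → IsWG D (fun p => w' p - u p) W' → eLpNorm
    (fun p => w p - w' p) 2 (𝓢 (frontier D)) ≤ C * (eLpNorm (fun p => w p - u p) 2 Λ D + eLpNorm
    (fun p => ‖W p‖) 2 Λ D) + C * (eLpNorm (fun p => w' p - u p) 2 Λ D + eLpNorm (fun p => ‖W' p‖) 2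
    (Λ D)) := by
  obtain ⟨C, hC, h⟩ := trace_inequality hD; refine ⟨C, hC, fun u w w' W W' hu hw hw' hW hW' => ?_⟩
  have hDo := hD.isOpen; have hDi := hD.subset_interior
  have m1 : MemLp (fun p => w p - u p) 2 Λ D :=
    (memLp_of_cont (d := d) hw.continuous 2 D).sub hu
  have m2 : MemLp (fun p => w' p - u p) 2 Λ D :=
    (memLp_of_cont (d := d) hw'.continuous 2 D).sub hu
  have hc : Ck 1 (fun p => w p - w' p) := hw.sub hw'; have h1 := h _ hc
  have hWW := hW.sub hDo hDi m1 m2 hW'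
  have hWW' : IsWG D (fun p => w p - w' p) (fun p => W p - W' p) :=
    hWW.congr (.of_forall fun p => by simp) (.of_forall fun p => rfl)
  have hg := (isWeakGradient_grad hDo hDi hc).unique hDo hWW'
  have e1 : eLpNorm (fun p => w p - w' p) 2 Λ D ≤ eLpNorm (fun p => w p - u p) 2 Λ D +
      eLpNorm (fun p => w' p - u p) 2 Λ D := by
    refine le_trans (le_of_eq ?_) (eLpNorm_sub_le m1.1 m2.1 one_le_two); congr 1; ext p; simp
  have e2 : eLpNorm (fun p => ‖Gd (fun p => w p - w' p) p‖) 2 Λ D ≤ eLpNorm (fun p => ‖W p‖) 2 Λ D +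
      eLpNorm (fun p => ‖W' p‖) 2 Λ D := by
    refine eLpNorm_le_add_of_ae_le hW.memLp.1 hW'.memLp.1 ?_; filter_upwards [hg] with p hp
    rw [hp, norm_norm]; exact norm_sub_le _ _
  refine h1.trans ?_; rw [← mul_add]; refine mul_le_mul_right ?_ C
  refine (add_le_add e1 e2).trans (le_of_eq ?_); ring

lemma ApproxH1.tendsto_sum {w : ℕ → M → ℝ} {W : ℕ → VM} (h : ApproxH1 d D u w W) {C : ℝ≥0∞} (hC : C
    ≠ ⊤) : Tendsto (fun k => C * (eLpNorm (fun p => w k p - u p) 2 Λ D + eLpNorm (fun p => ‖W k p‖)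
    2 Λ D)) atTop (𝓝 0) := by
  have h1 := h.tendsto.add h.tendsto_grad; rw [add_zero] at h1
  have h2 := ENNReal.Tendsto.const_mul h1 (Or.inr hC); rwa [mul_zero] at h2

/-- Existence of the trace of an `H¹`-limit of `C¹` functions. -/
lemma ApproxH1.exists_trace (hD : IsLD D) (hu : MemLp u 2 Λ D) {w : ℕ → M → ℝ} {W : ℕ → VM} (h :
    ApproxH1 d D u w W) : ∃ τ, Tr D u τ ∧ Tendsto (fun k => eLpNorm (fun p => w k p - τ p) 2 (𝓢
    (frontier D))) atTop (𝓝 0) := by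
  obtain ⟨C, hC, hdist⟩ := trace_dist_le hD
  have hm : ∀ k, MemLp (w k) 2 (𝓢 (frontier D)) := fun k =>
    memLp_surf_of_cont hD (h.contMDiff k).continuous
  have hcau : CauchySeq (fun k => (hm k).toLp (w k)) := by
    rw [EMetric.cauchySeq_iff]; intro ε hε
    have h2 := (h.tendsto_sum hC).eventually_lt_const (ENNReal.half_pos hε.ne')
    obtain ⟨N, hN⟩ := eventually_atTop.1 h2; refine ⟨N, fun m hm' n hn => ?_⟩
    rw [Lp.edist_toLp_toLp]
    refine (hdist u (w m) (w n) (W m) (W n) hu (h.contMDiff m) (h.contMDiff n)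
      (h.isWeakGradient m) (h.isWeakGradient n)).trans_lt ?_
    calc _ < ε / 2 + ε / 2 := ENNReal.add_lt_add (hN m hm') (hN n hn)
      _ = ε := ENNReal.add_halves ε
  obtain ⟨τ, hτ⟩ := cauchySeq_tendsto_of_complete hcau
  have ht : Tendsto (fun k => eLpNorm (fun p => w k p - τ p) 2 (𝓢 (frontier D))) atTop (𝓝 0) := by
    rw [tendsto_iff_edist_tendsto_0] at hτ; refine hτ.congr fun k => ?_; rw [Lp.edist_def]
    refine eLpNorm_congr_ae ?_; filter_upwards [(hm k).coeFn_toLp] with p hp; simp [hp]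
  exact ⟨τ, isTrace_iff.2 ⟨Lp.memLp τ, w, W, h, ht⟩, ht⟩

/-- Uniqueness of the trace. -/
lemma IsTrace.unique (hD : IsLD D) (hu : MemLp u 2 Λ D) (h : Tr D u τ) (h' : Tr D u τ') : τ =ᵐ[𝓢
    (frontier D)] τ' := by
  obtain ⟨hτ, w, W, hw, ht⟩ := isTrace_iff.1 h; obtain ⟨hτ', w', W', hw', ht'⟩ := isTrace_iff.1 h'
  obtain ⟨C, hC, hdist⟩ := trace_dist_le hD
  have hm : ∀ k, MemLp (w k) 2 (𝓢 (frontier D)) := fun k =>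
    memLp_surf_of_cont hD (hw.contMDiff k).continuous
  have hm' : ∀ k, MemLp (w' k) 2 (𝓢 (frontier D)) := fun k =>
    memLp_surf_of_cont hD (hw'.contMDiff k).continuous
  have h1 : Tendsto (fun k => eLpNorm (fun p => w k p - w' k p) 2 (𝓢 (frontier D))) atTop (𝓝 0) :=
    tendsto_zero_of_le (hw.tendsto_sum hC) (hw'.tendsto_sum hC) fun k =>
      hdist u _ _ _ _ hu (hw.contMDiff k) (hw'.contMDiff k) (hw.isWeakGradient k)
        (hw'.isWeakGradient k)
  have h2 : Tendsto (fun k => eLpNorm (fun p => w k p - τ' p) 2 (𝓢 (frontier D))) atTop (𝓝 0) := by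
    refine tendsto_zero_of_le h1 ht' fun k => ?_
    refine le_trans (le_of_eq ?_) (eLpNorm_add_le ((hm k).sub (hm' k)).1 ((hm' k).sub hτ').1 one_le_two)
    congr 1; ext p; simp
  have h3 : Tendsto (fun _ : ℕ => eLpNorm (fun p => τ p - τ' p) 2
      (𝓢 (frontier D))) atTop (𝓝 0) := by
    refine tendsto_zero_of_le ht h2 fun k => ?_; rw [add_comm]
    refine le_trans (le_of_eq ?_) (eLpNorm_sub_le ((hm k).sub hτ').1 ((hm k).sub hτ).1 one_le_two)
    congr 1; ext p; simp
  have h4 := tendsto_nhds_unique tendsto_const_nhds h3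
  filter_upwards [(eLpNorm_eq_zero_iff (f := fun p => τ p - τ' p) (hτ.sub hτ').1
    (by norm_num)).1 h4] with p hp
  exact sub_eq_zero.1 hp

lemma isTrace_trace (h : ∃ τ, Tr D u τ) : Tr D u (trace d D u) := by
  rw [trace, dif_pos h]; exact h.choose_spec

lemma IsTrace.congr_trace (h : Tr D u τ) (hτ : τ =ᵐ[𝓢 (frontier D)] τ') : Tr D u τ' := by
  obtain ⟨h1, w, W, h2, h3⟩ := isTrace_iff.1 h
  refine isTrace_iff.2 ⟨h1.ae_eq hτ, w, W, h2, h3.congr fun k => eLpNorm_congr_ae ?_⟩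
  filter_upwards [hτ] with p hp; rw [hp]

lemma ApproxH1.congr {w : ℕ → M → ℝ} {W : ℕ → VM} (h : ApproxH1 d D u w W) (hu : u =ᵐ[Λ D] u') :
    ApproxH1 d D u' w W where
  contMDiff := h.contMDiff
  isWeakGradient k := (h.isWeakGradient k).congr (by filter_upwards [hu] with p hp; rw [hp])
    (.of_forall fun _ => rfl)
  tendsto := h.tendsto.congr fun k => eLpNorm_congr_ae (by filter_upwards [hu] with p hp; rw [hp])
  tendsto_grad := h.tendsto_grad

lemma IsTrace.congr (h : Tr D u τ) (hu : u =ᵐ[Λ D] u') : Tr D u' τ := by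
  obtain ⟨h1, w, W, h2, h3⟩ := isTrace_iff.1 h; exact isTrace_iff.2 ⟨h1, w, W, h2.congr hu, h3⟩

lemma ApproxH1.mono {D' : Set M} {w : ℕ → M → ℝ} {W : ℕ → VM} (hD : IsOpen D) (h : ApproxH1 d D u w
    W) (hs : D' ⊆ D) : ApproxH1 d D' u w W where
  contMDiff := h.contMDiff
  isWeakGradient k := (h.isWeakGradient k).mono hD hs
  tendsto := squeeze h.tendsto fun _ => eLpNorm_mono_measure _ (restrict_mono hs le_rfl)
  tendsto_grad := squeeze h.tendsto_grad fun _ => eLpNorm_mono_measure _ (restrict_mono hs le_rfl)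

lemma IsTrace.add (hD : IsLD D) (hu : MemLp u 2 Λ D) (hu' : MemLp u' 2 Λ D) (h : Tr D u τ) (h' : Tr
    D u' τ') : Tr D (fun p => u p + u' p) (fun p => τ p + τ' p) := by
  obtain ⟨hτ, w, W, hw, ht⟩ := isTrace_iff.1 h; obtain ⟨hτ', w', W', hw', ht'⟩ := isTrace_iff.1 h'
  have m1 : ∀ k, MemLp (fun p => w k p - u p) 2 Λ D := fun k =>
    (memLp_of_cont (d := d) (hw.contMDiff k).continuous 2 D).sub hu
  have m2 : ∀ k, MemLp (fun p => w' k p - u' p) 2 Λ D := fun k =>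
    (memLp_of_cont (d := d) (hw'.contMDiff k).continuous 2 D).sub hu'
  refine isTrace_iff.2 ⟨hτ.add hτ', fun k p => w k p + w' k p, fun k p => W k p + W' k p,
    ⟨fun k => (hw.contMDiff k).add (hw'.contMDiff k), fun k => ?_, ?_, ?_⟩, ?_⟩
  · exact ((hw.isWeakGradient k).add hD.isOpen hD.subset_interior (m1 k) (m2 k)
      (hw'.isWeakGradient k)).congr (.of_forall fun p => by ring)
      (.of_forall fun p => rfl)
  · refine tendsto_zero_of_le hw.tendsto hw'.tendsto fun k => ?_
    refine le_trans (le_of_eq ?_) (eLpNorm_add_le (m1 k).1 (m2 k).1 one_le_two); congr 1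
    ext p; simp only [Pi.add_apply]; ring
  · refine tendsto_zero_of_le hw.tendsto_grad hw'.tendsto_grad fun k => ?_
    refine eLpNorm_le_add_of_ae_le (hw.isWeakGradient k).memLp.1 (hw'.isWeakGradient k).memLp.1
      (.of_forall fun p => ?_)
    rw [norm_norm]; exact norm_add_le _ _
  · refine tendsto_zero_of_le ht ht' fun k => ?_
    refine le_trans (le_of_eq ?_) (eLpNorm_add_le
      ((memLp_surf_of_cont hD (hw.contMDiff k).continuous).sub hτ).1
      ((memLp_surf_of_cont hD (hw'.contMDiff k).continuous).sub hτ').1 one_le_two)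
    congr 1; ext p; simp only [Pi.add_apply]; ring

lemma eLpNorm_const_mul' {α : Type*} [MeasurableSpace α] {μ : Measure α} (a : ℝ) (f : α → ℝ) :
    eLpNorm (fun p => a * f p) 2 μ = ‖a‖ₑ * eLpNorm f 2 μ := eLpNorm_const_smul a f 2 μ

lemma IsTrace.const_mul (hD : IsLD D) (h : Tr D u τ) (a : ℝ) : Tr D (fun p => a * u p) (fun p => a *
    τ p) := by
  obtain ⟨hτ, w, W, hw, ht⟩ := isTrace_iff.1 h
  have key : ∀ {f : ℕ → ℝ≥0∞}, Tendsto f atTop (𝓝 0) → Tendsto (fun k => ‖a‖ₑ * f k) atTop (𝓝 0) := by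
    intro f hf; have := ENNReal.Tendsto.const_mul hf (Or.inr (enorm_ne_top (x := a)))
    rwa [mul_zero] at this
  refine isTrace_iff.2 ⟨hτ.const_mul a, fun k p => a * w k p, fun k p => a • W k p,
    ⟨fun k => contMDiff_const.mul (hw.contMDiff k), fun k => ?_, ?_, ?_⟩, ?_⟩
  · exact ((hw.isWeakGradient k).const_smul hD.isOpen a).congr
      (.of_forall fun p => by ring) (.of_forall fun p => rfl)
  · refine (key hw.tendsto).congr fun k => ?_; rw [← eLpNorm_const_mul']; simp only [mul_sub]
  · refine (key hw.tendsto_grad).congr fun k => ?_; rw [← eLpNorm_const_mul']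
    refine eLpNorm_congr_norm_ae (.of_forall fun p => ?_); simp [norm_smul]
  · refine (key ht).congr fun k => ?_; rw [← eLpNorm_const_mul']; simp only [mul_sub]

lemma isTrace_zero : Tr D (fun _ => 0) (fun _ => 0) := by
  refine isTrace_iff.2 ⟨by simp, fun _ _ => 0, fun _ _ => 0,
    ⟨fun _ => contMDiff_const, fun _ => ?_, ?_, ?_⟩, ?_⟩
  · simpa using isWeakGradient_zero
  all_goals simp

lemma IsTrace.sum {ι : Type*} (hD : IsLD D) {u τ : ι → M → ℝ} (t : Finset ι) (hu : ∀ i ∈ t, MemLp (u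
    i) 2 Λ D) (h : ∀ i ∈ t, Tr D (u i) (τ i)) : Tr D (fun p => ∑ i ∈ t, u i p) (fun p => ∑ i ∈ t, τ
    i p) := by
  classical
  induction t using Finset.induction_on with
  | empty => simpa using isTrace_zero
  | insert a t ha ih =>
    simp only [sum_insert ha]
    refine (h a (mem_insert_self _ _)).add hD (hu a (mem_insert_self _ _)) ?_
      (ih (fun i hi => hu i (mem_insert_of_mem hi)) (fun i hi => h i (mem_insert_of_mem hi)))
    exact memLp_finsetSum t fun i hi => hu i (mem_insert_of_mem hi)

lemma frontier_preimage_act (h : Iso) (b : G) (A : Set M) : frontier ((fun p : M => b • p) ⁻¹' A) =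
    ℓ b ⁻¹' frontier A := by
  let e : M ≃ₜ M := ⟨MulAction.toPerm b, h.continuous b, h.continuous b⁻¹⟩
  exact (e.preimage_frontier A).symm

lemma IsTrace.comp (h : Iso) (hΩ : Ω ⊆ Ξ M) (b : G) (hD : IsOpen D) (hDΩ : D ⊆ Ω) (ht : Tr D u τ) :
    Tr (ℓ b ⁻¹' D) (fun q => u (b • q)) (fun q => τ (b • q)) := by
  obtain ⟨hτ, w, W, hw, htt⟩ := isTrace_iff.1 ht
  have hfr : frontier D ⊆ closure Ω := frontier_subset_closure.trans (closure_mono hDΩ)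
  have hcl : D ⊆ closure Ω := hDΩ.trans subset_closure
  have hmp := h.mpres_preimage d b hcl
  have hmp' := h.mpres_preimage (d - 1) b hfr; have he := h.measurableEmbedding b
  refine isTrace_iff.2 ⟨?_, fun k q => w k (b • q), fun k => pull b (W k),
    ⟨fun k => (hw.contMDiff k).comp ((h.smooth b).of_le one_le_infty), fun k =>
      h.isWeakGradient_pull hΩ b hD hDΩ (hw.isWeakGradient k), ?_, ?_⟩, ?_⟩
  · rw [frontier_preimage_act h]; exact h.memLp_comp (d - 1) b hfr hτ
  · refine hw.tendsto.congr fun k => ?_; rw [← hmp.map_eq, he.eLpNorm_map_measure]; rfl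
  · refine hw.tendsto_grad.congr fun k => ?_; rw [← hmp.map_eq, he.eLpNorm_map_measure]
    refine eLpNorm_congr_ae ?_
    filter_upwards [ae_restrict_mem (hD.preimage (h.continuous b)).measurableSet] with q hq
    exact (h.norm_pull b (W k) (subset_closure (h.preimage_subset b hDΩ hq))).symm
  · rw [frontier_preimage_act h]; refine htt.congr fun k => ?_
    rw [← hmp'.map_eq, he.eLpNorm_map_measure]; rfl

end Trace

/-! ### Mollification in `L²` -/

section Mollify

variable {g k : Eu d → ℝ}

/-- Strong continuity of translations on `L²`, taken from the continuous action of `DomAddAct` on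
`Lp`. -/
lemma tendsto_translate (hg : MemLp g 2 volume) : Tendsto (fun z : Є => eLpNorm (fun y => g (y + z)
    - g y) 2 volume) (𝓝 0) (𝓝 0) := by
  have : Fact ((2 : ℝ≥0∞) ≠ ⊤) := ⟨ENNReal.ofNat_ne_top⟩
  have h1 : Continuous fun z : Є => DomAddAct.mk z +ᵥ hg.toLp g :=
    (DomAddAct.continuous_mk).vadd continuous_const
  have h2 := (h1.tendsto 0); rw [tendsto_iff_edist_tendsto_0] at h2; refine h2.congr fun z => ?_
  rw [Lp.edist_def]
  have h3 : ∀ z : Є, (DomAddAct.mk z +ᵥ hg.toLp g : Lp ℝ 2 volume) =ᵐ[volume] fun y => g (y + z) := by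
    intro z; refine (DomAddAct.vadd_Lp_ae_eq _ _).trans ?_
    have := (measurePreserving_vadd z (volume : Measure Є)).quasiMeasurePreserving.ae_eq_comp
      hg.coeFn_toLp
    filter_upwards [this] with y hy; simpa [add_comm] using hy
  refine eLpNorm_congr_ae ?_; filter_upwards [h3 z, h3 0] with y hy h0
  rw [Pi.sub_apply, hy, h0, add_zero]

/-- The average of translates of `g` with weight `k`. -/
def mollify (k g : Є → ℝ) (y : Є) : ℝ := ∫ t, g t * k (t - y)

lemma mollify_eq (y : Є) : mollify k g y = ∫ z, g (y + z) * k z := by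
  rw [mollify, ← integral_add_left_eq_self _ y]; simp

lemma mollify_congr {g' : Є → ℝ} (h : g =ᵐ[volume] g') : mollify k g = mollify k g' := by
  ext y; refine integral_congr_ae ?_; filter_upwards [h] with t ht; rw [ht]

/-- The error is the average of `g(· + z) - g` over the probability measure with density `k`. By
Jensen's inequality and Tonelli its `L²` norm is at most the largest translation error over the
support of `k`. The radius `δ` serves every such kernel, in particular one whose support is not
centred at `0`. -/
lemma exists_mollify_sub_le (hg : MemLp g 2 volume) {ε : ℝ≥0∞} (hε : ε ≠ 0) : ∃ δ > 0, ∀ k : Є → ℝ,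
    Continuous k → HasCompactSupport k → (∀ x, 0 ≤ k x) → ∫ x, k x = 1 → Function.support k ⊆ ball 0
    δ → eLpNorm (fun y => mollify k g y - g y) 2 volume ≤ ε := by
  -- Tonelli needs joint measurability of `g (y + z)`, so a strongly measurable representative is
  -- used.
  wlog hm : StronglyMeasurable g generalizing g
  · obtain ⟨δ, hδ, h⟩ := this (g := hg.1.mk g) (hg.ae_eq hg.1.ae_eq_mk) hg.1.stronglyMeasurable_mk
    refine ⟨δ, hδ, fun k h1 h2 h3 h4 h5 => ?_⟩; rw [mollify_congr hg.1.ae_eq_mk]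
    refine (le_of_eq (eLpNorm_congr_ae ?_)).trans (h k h1 h2 h3 h4 h5)
    filter_upwards [hg.1.ae_eq_mk] with y hy; rw [hy]
  obtain ⟨δ', hδ', h'⟩ : ∃ δ' > 0, ∀ z ∈ ball (0 : Є) δ',
      eLpNorm (fun y => g (y + z) - g y) 2 volume ≤ ε :=
    Metric.eventually_nhds_iff_ball.1 ((tendsto_translate hg).eventually_le_const
      (pos_iff_ne_zero.2 hε))
  refine ⟨δ', hδ', fun k hk hkc hk0 hk1 hks => ?_⟩
  have hki : Integrable k := hk.integrable_of_hasCompactSupport hkc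
  set ν : Measure Є := volume.withDensity fun z => ofReal (k z) with hν
  have hmk : Measurable fun z => ofReal (k z) := (ENNReal.continuous_ofReal.comp hk).measurable
  have hprob : IsProbabilityMeasure ν := ⟨by
    rw [hν, withDensity_apply _ MeasurableSet.univ, Measure.restrict_univ,
      ← ofReal_integral_eq_lintegral_ofReal hki (Eventually.of_forall hk0), hk1, ofReal_one]⟩
  have hgm := hm.measurable
  have hpt : ∀ y, ofReal ((mollify k g y - g y) ^ 2) ≤ ∫⁻ z, ofReal ((g (y + z) - g y) ^ 2) ∂ν := by
    intro y
    have hloc : LocallyIntegrable (fun z => g (y + z)) := by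
      have : MemLp (fun z => g (y + z)) 2 volume :=
        hg.comp_measurePreserving (measurePreserving_add_left volume y)
      exact this.locallyIntegrable one_le_two
    have i1 : Integrable fun z => g (y + z) * k z := by
      simpa [mul_comm, smul_eq_mul] using hloc.integrable_smul_right_of_hasCompactSupport hk hkc
    have e1 : mollify k g y - g y = ∫ z, (g (y + z) - g y) * k z := by
      simp only [sub_mul]
      rw [integral_sub i1 (hki.const_mul _), integral_const_mul, hk1, mul_one, mollify_eq]
    have e2 : ‖mollify k g y - g y‖ₑ ≤ eLpNorm (fun z => g (y + z) - g y) 1 ν := by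
      rw [e1, eLpNorm_one_eq_lintegral_enorm, hν,
        lintegral_withDensity_eq_lintegral_mul _ hmk (by fun_prop)]
      refine (enorm_integral_le_lintegral_enorm _).trans (le_of_eq (lintegral_congr fun z => ?_))
      rw [enorm_mul, Pi.mul_apply, mul_comm, Real.enorm_of_nonneg (hk0 z)]
    have e3 := e2.trans (eLpNorm_le_eLpNorm_of_exponent_le (q := 2) one_le_two
      (by fun_prop : Measurable fun z => g (y + z) - g y).aestronglyMeasurable)
    have e4 := pow_le_pow_left₀ (zero_le) e3 2; rw [eLpNorm_two_sq] at e4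
    refine le_trans (le_of_eq ?_) e4
    rw [Real.enorm_eq_ofReal_abs, ← ENNReal.ofReal_pow (abs_nonneg _), sq_abs]
  refine (ENNReal.pow_le_pow_left_iff two_ne_zero).1 ?_; rw [eLpNorm_two_sq]
  calc ∫⁻ y, ofReal ((mollify k g y - g y) ^ 2)
      ≤ ∫⁻ y, ∫⁻ z, ofReal ((g (y + z) - g y) ^ 2) ∂ν := lintegral_mono hpt
    _ = ∫⁻ z, (∫⁻ y, ofReal ((g (y + z) - g y) ^ 2)) ∂ν :=
        lintegral_lintegral_swap
          (by fun_prop : Measurable fun x : Є × Є =>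
            ofReal ((g (x.1 + x.2) - g x.1) ^ 2)).aemeasurable
    _ ≤ ∫⁻ z, ε ^ 2 ∂ν := by
        refine lintegral_mono_ae ?_
        have : ∀ᵐ z ∂ν, z ∈ ball (0 : Є) δ' := by
          rw [hν, ae_withDensity_iff hmk]
          refine .of_forall fun z hz => hks fun h0 => hz (by rw [h0, ENNReal.ofReal_zero])
        filter_upwards [this] with z hz; rw [← eLpNorm_two_sq]
        exact pow_le_pow_left₀ zero_le (h' z hz) 2
    _ = ε ^ 2 := by rw [lintegral_const, measure_univ, mul_one]

/-- `mollify k g` is the convolution of `g` with the reflected kernel, so all derivatives fall on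
`k`, with a sign from the reflection. -/
lemma hasFDerivAt_mollify (hg : MemLp g 2 volume) (hk : ContDiff ℝ ∞ k) (hkc : HasCompactSupport k)
    : ContDiff ℝ ∞ (mollify k g) ∧ ∀ y e, fderiv ℝ (mollify k g) y e = -∫ t, g t * fderiv ℝ k (t -
    y) e := by
  have hloc : LocallyIntegrable g := hg.locallyIntegrable one_le_two
  set k' : Є → ℝ := fun x => k (-x) with hk'
  have hkc' : HasCompactSupport k' := hkc.comp_homeomorph (Homeomorph.neg Є)
  have hkd' : ContDiff ℝ ∞ k' := hk.comp contDiff_neg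
  have e1 : mollify k g = convolution g k' (ContinuousLinearMap.mul ℝ ℝ) volume := by
    ext y; simp [mollify, convolution, hk']
  refine ⟨e1 ▸ hkc'.contDiff_convolution_right _ hloc hkd', fun y e => ?_⟩
  have h1 := hkc'.hasFDerivAt_convolution_right (ContinuousLinearMap.mul ℝ ℝ) (μ := volume) hloc
    (hkd'.of_le one_le_infty) y
  rw [e1, h1.fderiv, convolution_precompR_apply _ hloc (hkc'.fderiv ℝ)
    (hkd'.continuous_fderiv (by simp))]
  rw [convolution, ← integral_neg]; refine integral_congr_ae (.of_forall fun t => ?_)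
  have h2 : fderiv ℝ k' (y - t) = -fderiv ℝ k (t - y) := by
    have h3 := ((hk.differentiable (by simp) (-(y - t))).hasFDerivAt.comp (y - t)
      (hasFDerivAt_id (y - t)).neg).fderiv
    rw [neg_sub] at h3; ext x; change fderiv ℝ (k ∘ Neg.neg) (y - t) x = _
    simpa using congrArg (fun L : Є →L[ℝ] ℝ => L x) h3
  simp [h2]

end Mollify

/-! ### Density of `C¹` functions in `H¹` of a Lipschitz domain -/

section Density

lemma height_sub_le {v : Є} (hv : ‖v‖ = 1) {f : Є → ℝ} {K : NNReal} (hf : LipschitzWith K f) (y z :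
    Є) : |height v f y - height v f z| ≤ (1 + K) * ‖y - z‖ := by
  have h1 : |inner ℝ v y - inner ℝ v z| ≤ ‖y - z‖ := by
    rw [← inner_sub_right]; simpa [hv] using abs_real_inner_le_norm v (y - z)
  have h2 := hf.dist_le_mul (y - inner ℝ v y • v) (z - inner ℝ v z • v)
  have h3 : ‖(y - inner ℝ v y • v) - (z - inner ℝ v z • v)‖ ≤ ‖y - z‖ := by
    exact norm_hypProj_sub_le hv y z
  rw [dist_eq_norm, dist_eq_norm, norm_eq_abs] at h2
  have h4 : height v f y - height v f z = (inner ℝ v y - inner ℝ v z) -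
    (f (y - inner ℝ v y • v) - f (z - inner ℝ v z • v)) := by rw [height, height]; ring
  rw [h4]; refine (abs_sub _ _).trans ?_
  have : (K : ℝ) * ‖(y - inner ℝ v y • v) - (z - inner ℝ v z • v)‖ ≤ K * ‖y - z‖ := by gcongr
  linarith

lemma contMDiff_indicator {n : ℕ∞ω} {K : Set M} (hO : IsOpen O) (hK : IsClosed K) (hKO : K ⊆ O) (hf
    : ContMDiffOn Υ 𝓘(ℝ) n f O) (h0 : ∀ q ∈ O, q ∉ K → f q = 0) : Ck n (O.indicator f) := by
  intro q; by_cases hq : q ∈ O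
  · refine ((hf q hq).contMDiffAt (hO.mem_nhds hq)).congr_of_eventuallyEq ?_
    filter_upwards [hO.mem_nhds hq] with q' hq'; exact indicator_of_mem hq' f
  · refine (contMDiffAt_const (c := (0 : ℝ))).congr_of_eventuallyEq ?_
    filter_upwards [hK.isOpen_compl.mem_nhds fun h => hq (hKO h)] with q' hq'; by_cases h : q' ∈ O
    · rw [indicator_of_mem h, h0 q' h hq']
    · rw [indicator_of_notMem h]

variable {R C : ℝ} {K : NNReal} {v : Eu d} {f : Eu d → ℝ}

/-- The components of a weak gradient are weak partial derivatives in a chart. -/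
lemma IsWeakGradient.integral_partial (h : IsWG D u V) (hD : IsOpen D) (hDi : D ⊆ Ξ M) (hDs : D ⊆ Δ
    p) {ψ : Є → ℝ} (hψ : ContDiff ℝ ∞ ψ) (hψc : HasCompactSupport ψ) (hs : tsupport ψ ⊆ CS p D) (i :
    Fin d) : ∫ y in CS p D, inner ℝ (coordField p i (Θ p y)) (V (Θ p y)) * ψ y = -∫ y in CS p D, u
    ((Γ p).symm y) * fderiv ℝ ψ y (𝐞 i) := by
  have hDs' : D ⊆ (Γ p).source := by rwa [extChartAt_source]
  -- The test field is `s ∂ᵢ`. Dividing by the density cancels the density in the volume and inside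
  -- the divergence, which becomes `∂ᵢψ` over the density.
  set s : M → ℝ := D.indicator fun q => (VD p q)⁻¹ * ψ (Γ p q) with hsdef
  set T := (Θ p) '' tsupport ψ with hT
  have hTc : IsCompact T := hψc.isCompact.image_of_continuousOn
    ((continuousOn_extChartAt_symm p).mono (hs.trans inter_subset_left))
  have hTD : T ⊆ D := by rintro _ ⟨y, hy, rfl⟩; exact (hs hy).2
  have hs0 : ∀ q ∈ D, q ∉ T → ψ (Γ p q) = 0 := by
    intro q hq hqT; by_contra hne; exact hqT ⟨_, subset_tsupport _ hne, chart_left_inv (hDs hq)⟩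
  have hsm : Ck ∞ s := by
    refine contMDiff_indicator hD hTc.isClosed hTD ?_ fun q hq hqT => by rw [hs0 q hq hqT, mul_zero]
    refine ContMDiffOn.mul ?_ ?_
    · exact ((contMDiffOn_volDensity p).mono hDs).inv₀ fun q hq => (volDensity_pos (hDs hq)).ne'
    · exact hψ.contMDiff.comp_contMDiffOn (contMDiffOn_extChartAt.mono hDs)
  have hsupp : tsupport s ⊆ T := by
    refine closure_minimal (fun q hq => ?_) hTc.isClosed; by_contra hqT; refine hq ?_
    by_cases hqD : q ∈ D
    · rw [hsdef, indicator_of_mem hqD, hs0 q hqD hqT, mul_zero]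
    · rw [hsdef, indicator_of_notMem hqD]
  have hsy : ∀ y ∈ CS p D, s (Θ p y) = (VD p (Θ p y))⁻¹ * ψ y := by
    intro y hy; have hyD : (Θ p) y ∈ D := hy.2
    rw [hsdef, indicator_of_mem hyD, (Γ p).right_inv hy.1]
  have hX := isTest_coordField (D := D) (c := p) i hsm
    (hsupp.trans fun q hq => ⟨hTD hq, hDs (hTD hq)⟩)
  have hdiv : ∀ q ∈ D, Dv (fun q => s q • coordField p i q) q =
      (VD p q)⁻¹ * fderiv ℝ ψ (Γ p q) (𝐞 i) := by
    intro q hq; rw [← chartDiv_eq_divergence hX.smooth (hDs hq) (hDi hq), chartDiv]; congr 1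
    have hyq := chart_mem_chartSet hq (hDs hq); have hn := (isOpen_chartSet p hD hDi).mem_nhds hyq
    have key : ∀ j : Fin d, (fun y => VD p (Θ p y) *
        VC (fun q => s q • coordField p i q) p (Θ p y) j)
        =ᶠ[𝓝 (Γ p q)] fun y => (𝐞 i : Є) j * ψ y := by
      intro j; filter_upwards [hn] with y hy; have hys := mem_source_of_mem hy
      rw [vecCoord_eq hys, map_smul, coordField, coord_lift hys, PiLp.smul_apply, smul_eq_mul,
        hsy y hy]
      have := (volDensity_pos (d := d) hys).ne'; field_simp
    have hr := range_mem_nhds hD hDi hyq; rw [Finset.sum_eq_single i]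
    · rw [fderivWithin_of_mem_nhds hr, (key i).fderiv_eq]; simp
    · intro j _ hj; rw [fderivWithin_of_mem_nhds hr, (key j).fderiv_eq]; simp [hj]
    · simp
  have h1 := h.test hX
  rw [setIntegral_chart p hD.measurableSet hDs', setIntegral_chart p hD.measurableSet hDs'] at h1
  have hm : MeasurableSet (CS p D) := measSet_chartSet p hD.measurableSet
  rw [setIntegral_congr_fun hm (g := fun y => chartDensity p y * inner ℝ
      (s (Θ p y) • coordField p i (Θ p y))
      (V (Θ p y))), h1]
  · congr 1; refine setIntegral_congr_fun hm fun y hy => ?_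
    have hys := mem_source_of_mem hy; have := (volDensity_pos (d := d) hys).ne'
    simp only [hdiv _ hy.2, (Γ p).right_inv hy.1, chartDensity]; field_simp
  · intro y hy; have hys := mem_source_of_mem hy; have := (volDensity_pos (d := d) hys).ne'
    simp only [inner_smul_left, hsy y hy, chartDensity, conj_trivial]; field_simp

lemma chartBall_subset_source : ChB p R ⊆ Δ p := by
  rw [← extChartAt_source Υ]; exact inter_subset_left

lemma GraphChart.mem_of_mem_chartSet (hA : A ⊆ ChB p R) {y : Є} (hy : y ∈ CS p A) : y ∈ ball (Γ p p)
    R ∩ (Γ p).target := by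
  refine ⟨?_, hy.1⟩; have := (hA hy.2).2; rwa [mem_preimage, (Γ p).right_inv hy.1] at this

lemma GraphChart.eLpNorm_le (h : GraphChart D p R C K v f) (hA : MeasurableSet A) (hAs : A ⊆ ChB p
    R) (w : M → ℝ) : eLpNorm w 2 Λ A ≤ (ofReal C + 1) * eLpNorm (fun y => w (Θ p y)) 2
    (volume.restrict (CS p A)) ∧ eLpNorm (fun y => w (Θ p y)) 2 (volume.restrict (CS p A)) ≤ (ofReal
    C + 1) * eLpNorm w 2 (Λ A) := by
  have hm : MeasurableSet (CS p A) := measSet_chartSet p hA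
  -- The comparison is made between squared norms; using `C + 1` avoids a square root of `C`.
  have hC : ofReal C ≤ (ofReal C + 1) ^ 2 := by
    calc ofReal C ≤ (ofReal C + 1) * 1 := by rw [mul_one]; exact le_self_add
      _ ≤ (ofReal C + 1) * (ofReal C + 1) := by gcongr; exact le_add_self
      _ = _ := (sq _).symm
  have e : eLpNorm w 2 Λ A ^ 2 = ∫⁻ y in CS p A, ofReal (chartDensity p y) *
        ofReal (w (Θ p y) ^ 2) := by
    rw [eLpNorm_two_sq, setLIntegral_chart p hA (hAs.trans inter_subset_left)]
  constructor
  all_goals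
    refine (ENNReal.pow_le_pow_left_iff two_ne_zero).1 ?_
    rw [mul_pow, e, eLpNorm_two_sq]; refine le_trans ?_ (mul_le_mul_left hC _)
    rw [← lintegral_ofReal_mul]; refine setLIntegral_mono' hm fun y hy => ?_
    have h1 := h.density y (GraphChart.mem_of_mem_chartSet hAs hy)
  · gcongr; exact h1.1
  · rw [← mul_assoc, ← ofReal_mul h.C_pos.le]
    exact le_mul_of_one_le_left' (ENNReal.one_le_ofReal.2 h1.2)

lemma GraphChart.norm_le (h : GraphChart D p R C K v f) (hq : q ∈ ChB p R) (X : 𝓣 q) : ‖X‖ ≤ C * ∑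
    i, |inner ℝ (coordField p i q) X| := by
  have hqs := chartBall_subset_source hq
  have h1 := (h.norm_lift _ ⟨hq.2, (Γ p).map_source hq.1⟩ (coord p q X)).2
  rw [chart_left_inv hqs, lift_coord hqs] at h1
  have h2 : ‖X‖ ^ 2 ≤ (C * ‖X‖) * ∑ i, |inner ℝ (coordField p i q) X| := by
    rw [← real_inner_self_eq_norm_sq]; nth_rw 1 [eq_sum_coordField hqs X]; rw [sum_inner, mul_sum]
    refine sum_le_sum fun i _ => ?_; rw [inner_smul_left]; refine (le_abs_self _).trans ?_
    rw [abs_mul]; gcongr; exact (PiLp.norm_apply_le (coord p q X) i).trans h1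
  rcases (norm_nonneg X).eq_or_lt with h0 | h0
  · rw [← h0]; exact mul_nonneg h.C_pos.le (sum_nonneg fun i _ => abs_nonneg _)
  · nlinarith

lemma GraphChart.norm_coordField_le (h : GraphChart D p R C K v f) (hq : q ∈ ChB p R) (i : Fin d) :
    ‖coordField p i q‖ ≤ C := by
  have h1 := (h.norm_lift _ ⟨hq.2, (Γ p).map_source hq.1⟩ (𝐞 i)).1
  rw [chart_left_inv (chartBall_subset_source hq)] at h1; simpa [coordField] using h1

lemma GraphChart.memLp_chart (h : GraphChart D p R C K v f) (hA : MeasurableSet A) (hAs : A ⊆ ChB p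
    R) (hw : MemLp w 2 Λ A) : MemLp ((CS p A).indicator fun y => w (Θ p y)) 2 volume := by
  rw [memLp_indicator_iff_restrict (measSet_chartSet p hA)]
  refine ⟨(aestronglyMeasurable_chart_iff p hA (hAs.trans inter_subset_left)).1 hw.1,
    ((h.eLpNorm_le hA hAs w).2).trans_lt (mul_lt_top (by simp) hw.2)⟩

lemma chartBall_mono {R' : ℝ} (h : R' ≤ R) : ChB p R' ⊆ ChB p R :=
  fun _ hq => ⟨hq.1, ball_subset_ball h hq.2⟩

/-- One-sided mollification in a graph chart. -/
lemma GraphChart.exists_mollifier (h : GraphChart D p R C K v f) {δ : ℝ} (hδ : 0 < δ) : ∃ k : Є → ℝ,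
    ContDiff ℝ ∞ k ∧ HasCompactSupport k ∧ (∀ x, 0 ≤ k x) ∧ ∫ x, k x = 1 ∧ Function.support k ⊆ ball
    0 δ ∧ ∀ y ∈ CS p (D ∩ ChB p (R / 2)), ∀ x ∈ tsupport k, y + x ∈ CS p (D ∩ ChB p R) := by
  have hK : (0 : ℝ) < 1 + K := by positivity
  -- The kernel lives in the ball of radius `s κ` about `s • v`. Since the height is `(1 +
  -- K)`-Lipschitz, a shift by a vector of this ball raises the height by at least `s - s/2`, so
  -- points of `D` stay above the graph.
  set κ : ℝ := 1 / (2 * (1 + K)) with hκ; have hκ0 : 0 < κ := by positivity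
  have hκK : κ * (1 + K) = 1 / 2 := by rw [hκ]; field_simp
  have hκ1 : κ ≤ 1 / 2 := by nlinarith [K.coe_nonneg]
  -- Vectors in the support have norm below `2 s`. This keeps the support inside the ball of radius
  -- `δ` and moves the ball of radius `R / 2` at most to that of radius `R`.
  set s : ℝ := min (δ / 2) (R / 4) with hs; have hR := h.R_pos; have hs0 : 0 < s := by positivity
  have hsδ : s ≤ δ / 2 := min_le_left _ _; have hsR : s ≤ R / 4 := min_le_right _ _
  let b : ContDiffBump (s • v) := ⟨s * κ / 2, s * κ, by positivity, by
    have : 0 < s * κ := by positivity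
    linarith⟩
  have hnorm : ∀ x ∈ closedBall (s • v) (s * κ), ‖x‖ ≤ s * (1 + κ) := by
    intro x hx; have h1 : ‖x - s • v‖ ≤ s * κ := by rw [← dist_eq_norm]; exact hx
    have h2 : ‖s • v‖ = s := by rw [norm_smul, h.norm_v, mul_one, norm_of_nonneg hs0.le]
    calc ‖x‖ = ‖(x - s • v) + s • v‖ := by rw [sub_add_cancel]
      _ ≤ _ := (norm_add_le _ _).trans (by rw [h2]; linarith)
  have hsub : ∀ x ∈ closedBall (s • v) (s * κ), ‖x‖ < 2 * s := fun x hx =>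
    (hnorm x hx).trans_lt (by nlinarith)
  refine ⟨b.normed volume, b.contDiff_normed, b.hasCompactSupport_normed, b.nonneg_normed,
    b.integral_normed, ?_, ?_⟩
  · rw [b.support_normed_eq]; intro x hx; have := hsub x (Metric.ball_subset_closedBall hx)
    rw [mem_ball_zero_iff]; linarith
  · intro y hy x hx; rw [b.tsupport_normed_eq] at hx
    have hy1 := GraphChart.mem_of_mem_chartSet inter_subset_right hy
    have hyR : y ∈ ball (Γ p p) R := ball_subset_ball (by linarith) hy1.1
    have hyD : y ∈ CS p D := ⟨hy.1, hy.2.1⟩; have h0 := (h.mem_iff y hyR).1 hyD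
    have hx1 := hsub x hx
    have hball : y + x ∈ ball (Γ p p) R := by
      have h2 : dist (y + x) (Γ p p) ≤ ‖x‖ + dist y (Γ p p) := by
        refine (dist_triangle _ y _).trans ?_; rw [dist_eq_norm, add_sub_cancel_left]
      have h3 : dist y (Γ p p) < R / 2 := hy1.1; rw [mem_ball]; linarith
    have h4 : ‖x - s • v‖ ≤ s * κ := by rw [← dist_eq_norm]; exact hx
    have h5 := height_sub_le h.norm_v h.lip (y + (x - s • v)) y; rw [add_sub_cancel_left] at h5
    have h6 : height v f (y + x) = height v f (y + (x - s • v)) + s := by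
      rw [← height_add_smul h.norm_v]; congr 1; abel
    have h7 : (1 + K) * ‖x - s • v‖ ≤ s / 2 := by
      calc (1 + K) * ‖x - s • v‖ ≤ (1 + K) * (s * κ) := by gcongr
        _ = s * (κ * (1 + K)) := by ring
        _ = s / 2 := by rw [hκK]; ring
    have h8 := (abs_le.1 (h5.trans h7)).1; have hmem := (h.mem_iff _ hball).2 (by rw [h6]; linarith)
    refine ⟨hmem.1, hmem.2, (Γ p).map_target hmem.1, ?_⟩; rw [mem_preimage, (Γ p).right_inv hmem.1]
    exact hball

/-- When the translated kernel is supported in the domain it is an admissible test function, so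
differentiating the mollified function amounts to mollifying the weak partial derivative. -/
lemma IsWeakGradient.fderiv_mollify (h : IsWG D u V) (hD : IsOpen D) (hDi : D ⊆ Ξ M) (hDs : D ⊆ Δ p)
    (hu : MemLp ((CS p D).indicator fun y => u ((Γ p).symm y)) 2 volume) {k : Є → ℝ} (hk : ContDiff
    ℝ ∞ k) (hkc : HasCompactSupport k) (i : Fin d) {y : Є} (hy : ∀ x ∈ tsupport k, y + x ∈ CS p D) :
    fderiv ℝ (mollify k ((CS p D).indicator fun y => u (Θ p y))) y (𝐞 i) = mollify k ((CS p
    D).indicator fun y => inner ℝ (coordField p i (Θ p y)) (V (Θ p y))) y := by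
  have hm : MeasurableSet (CS p D) := measSet_chartSet p hD.measurableSet
  rw [(hasFDerivAt_mollify hu hk hkc).2, mollify]
  have h1 : tsupport (fun t => k (t - y)) ⊆ CS p D := by
    intro t ht; have h2 := tsupport_comp_subset_preimage k (f := fun t => t - y) (by fun_prop) ht
    simpa using hy _ h2
  have h3 := h.integral_partial hD hDi hDs (hk.comp (contDiff_id.sub contDiff_const))
    (hkc.comp_homeomorph (Homeomorph.subRight y)) h1 i
  have h4 : ∀ t, fderiv ℝ (k ∘ fun t => id t - y) t = fderiv ℝ k (t - y) := fun t =>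
    fderiv_comp_sub y
  simp only [h4] at h3; rw [← integral_indicator hm, ← integral_indicator hm] at h3
  simp only [indicator_mul_left] at h3; exact h3.symm

lemma eLpNorm_le_of_support (hA : MeasurableSet A) (hAD : A ⊆ D) {F : M → ℝ} {a : ℝ} (ha : 0 ≤ a)
    (h0 : ∀ q ∈ D, q ∉ A → w q = 0) (hD : MeasurableSet D) (hw : ∀ q ∈ A, |w q| ≤ a * F q) : eLpNorm
    w 2 Λ D ≤ ofReal a * eLpNorm F 2 Λ A := by
  have h1 : eLpNorm w 2 Λ D = eLpNorm (A.indicator w) 2 Λ D := by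
    refine eLpNorm_congr_ae ?_; filter_upwards [ae_restrict_mem hD] with q hq; by_cases hqA : q ∈ A
    · rw [indicator_of_mem hqA]
    · rw [indicator_of_notMem hqA, h0 q hq hqA]
  rw [h1, eLpNorm_indicator_eq_eLpNorm_restrict hA, Measure.restrict_restrict_of_subset hAD]
  refine eLpNorm_le_mul_eLpNorm_of_ae_le_mul ?_ 2; filter_upwards [ae_restrict_mem hA] with q hq
  rw [norm_eq_abs]; exact (hw q hq).trans (mul_le_mul_of_nonneg_left (le_abs_self _) ha)

/-- `η u` is approximated by `η` times the one-sided mollification of `u` in the chart. On the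
support of `η` the partial derivatives of the mollified function are mollifications of the weak
ones, so the product rule bounds the `H¹` error by `d + 1` mollification errors. -/
lemma GraphChart.exists_approx (h : GraphChart D p R C K v f) (hD : IsOpen D) (hDi : D ⊆ Ξ M) (hu :
    MemLp u 2 Λ D) (hV : IsWG D u V) (hη : Ck ∞ η) (hηs : tsupport η ⊆ ChB p (R / 2)) : ∃ B : ℝ≥0∞,
    B ≠ ⊤ ∧ ∀ ε : ℝ≥0∞, ε ≠ 0 → ∃ (w : M → ℝ) (W : VM), Ck 1 w ∧ IsWG D (fun q => w q - η q * u q) W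
    ∧ eLpNorm (fun q => w q - η q * u q) 2 Λ D ≤ B * ε ∧ eLpNorm (fun q => ‖W q‖) 2 Λ D ≤ B * ε :=
    by
  have hR := h.R_pos; have hη1 : Ck 1 η := hη.of_le one_le_infty; set A := D ∩ ChB p R with hAdef
  set A' := D ∩ ChB p (R / 2) with hA'def; have hA : IsOpen A := hD.inter (isOpen_chartBall p R)
  have hA' : IsOpen A' := hD.inter (isOpen_chartBall p (R / 2))
  have hAs : A ⊆ ChB p R := inter_subset_right
  have hA's : A' ⊆ ChB p R := inter_subset_right.trans (chartBall_mono (by linarith))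
  have hAA : A' ⊆ A := subset_inter inter_subset_left hA's; have hAD : A ⊆ D := inter_subset_left
  have hVA := hV.mono hD hAD; have hASs : A ⊆ Δ p := hAs.trans chartBall_subset_source; set φ := Γ p
  have huA : MemLp u 2 Λ A := hu.mono_measure (restrict_mono hAD le_rfl)
  have hgi : ∀ i : Fin d, MemLp (fun q => inner ℝ (coordField p i q) (V q)) 2 Λ A := by
    intro i
    have hcm : MF A (coordField (d := d) (M := M) p i) := measField_of_contOn
      hA.measurableSet (((contMDiffOn_coordField p i).continuousOn).mono hASs)
    refine (hVA.memLp.const_mul C).mono' (MeasField.inner hA.measurableSet hcm hVA.measField) ?_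
    filter_upwards [ae_restrict_mem hA.measurableSet] with q hq
    exact (norm_inner_le_norm _ _).trans
      (mul_le_mul_of_nonneg_right (h.norm_coordField_le (hAs hq) i) (norm_nonneg _))
  set g : Є → ℝ := (CS p A).indicator fun y => u (φ.symm y) with hg
  set gi : Fin d → Є → ℝ := fun i => (CS p A).indicator fun y =>
    inner ℝ (coordField p i (φ.symm y)) (V (φ.symm y)) with hgidef
  have hgL : MemLp g 2 volume := h.memLp_chart hA.measurableSet hAs huA
  have hgiL : ∀ i, MemLp (gi i) 2 volume := fun i => h.memLp_chart hA.measurableSet hAs (hgi i)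
  obtain ⟨b, hb⟩ := exists_bound hη.continuous
  obtain ⟨b', hb'⟩ := exists_bound (continuous_norm_grad hη1)
  have hb0 : 0 ≤ b := (norm_nonneg _).trans (hb p)
  have hb0' : 0 ≤ b' := (norm_nonneg _).trans (hb' p); have hC0 := h.C_pos
  obtain ⟨χ, hχ, hχs, hχ1, -⟩ := exists_cutoff (d := d) (isClosed_tsupport η)
    (isOpen_chartBall (d := d) p (R / 2)) hηs
  set a : ℝ := b * C + b + b' with ha
  -- The index `none` stands for the function and `some i` for its `i`-th covariant derivative; each
  -- error costs a factor `C + 1` on returning from the chart. In `a`, the numbers `b` and `b'`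
  -- bound `η` and its gradient, and `C` recovers a norm from components.
  refine ⟨ofReal a * (∑ _j : Option (Fin d), (ofReal C + 1)),
    mul_ne_top ofReal_ne_top (sum_ne_top.2 fun _ _ => by simp),
    fun ε hε => ?_⟩
  obtain ⟨δ, hδ, hδ1⟩ : ∃ δ > 0, ∀ k : Є → ℝ, Continuous k → HasCompactSupport k →
      (∀ x, 0 ≤ k x) → ∫ x, k x = 1 → Function.support k ⊆ ball 0 δ →
      eLpNorm (fun y => mollify k g y - g y) 2 volume ≤ ε ∧
      ∀ i, eLpNorm (fun y => mollify k (gi i) y - gi i y) 2 volume ≤ ε := by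
    obtain ⟨δ0, hδ0, h0⟩ := exists_mollify_sub_le hgL hε
    choose δi hδi hi using fun i => exists_mollify_sub_le (hgiL i) hε
    refine ⟨min δ0 (Finset.univ.inf' ⟨0, Finset.mem_univ _⟩ δi), lt_min hδ0
      ((Finset.lt_inf'_iff _).2 fun i _ => hδi i), fun k h1 h2 h3 h4 h5 =>
      ⟨h0 k h1 h2 h3 h4 (h5.trans (ball_subset_ball (min_le_left _ _))), fun i =>
      hi i k h1 h2 h3 h4 (h5.trans (ball_subset_ball ((min_le_right _ _).trans
        (Finset.inf'_le _ (Finset.mem_univ i)))))⟩⟩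
  obtain ⟨k, hk, hkc, hk0, hk1, hks, hkA⟩ := h.exists_mollifier hδ
  obtain ⟨e0, ei⟩ := hδ1 k hk.continuous hkc hk0 hk1 hks; set m := mollify k g with hm
  have hmd : ContDiff ℝ ∞ m := (hasFDerivAt_mollify hgL hk hkc).1
  -- The cutoff `χ` equals `1` near the support of `η`; it serves only to make the mollified
  -- function globally smooth on `M`.
  set w : M → ℝ := (ChB p (R / 2)).indicator fun q => χ q * m (φ q) with hw
  have hws : Ck ∞ w := by
    refine contMDiff_indicator (isOpen_chartBall (d := d) p (R / 2)) (isClosed_tsupport χ) hχs ?_ ?_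
    · exact hχ.contMDiffOn.mul (hmd.contMDiff.comp_contMDiffOn
        (contMDiffOn_extChartAt.mono chartBall_subset_source))
    · intro q _ hq; rw [image_eq_zero_of_notMem_tsupport hq, zero_mul]
  have hw1 : Ck 1 w := hws.of_le one_le_infty
  have hwu : MemLp (fun q => w q - u q) 2 Λ D :=
    (memLp_of_cont (d := d) hws.continuous 2 D).sub hu
  have hgr : IsWG D (fun q => w q - u q) (fun q => Gd w q - V q) :=
    ((isWeakGradient_grad hD hDi hw1).sub hD hDi
      (memLp_of_cont (d := d) hws.continuous 2 D) hu hV)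
  have hprod := hgr.mul hD hDi hwu hη
  -- the error functions
  set E : Option (Fin d) → M → ℝ := fun j q => j.elim (m (φ q) - u q) fun i =>
    mollify k (gi i) (φ q) - inner ℝ (coordField p i q) (V q) with hE
  have hEn : ∀ j, eLpNorm (E j) 2 Λ A' ≤ (ofReal C + 1) * ε := by
    intro j; refine ((h.eLpNorm_le hA'.measurableSet hA's (E j)).1).trans (mul_le_mul_right ?_ _)
    have hmA : MeasurableSet (CS p A') := measSet_chartSet p hA'.measurableSet
    have hsub : ∀ y ∈ CS p A', y ∈ CS p A := fun y hy => ⟨hy.1, hAA hy.2⟩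
    cases j with
    | none =>
      refine le_trans (le_trans (le_of_eq (eLpNorm_congr_ae ?_))
        (eLpNorm_mono_measure _ Measure.restrict_le_self)) e0
      filter_upwards [ae_restrict_mem hmA] with y hy
      simp only [hE, Option.elim, hg, indicator_of_mem (hsub y hy)]; rw [φ.right_inv hy.1]
    | some i =>
      refine le_trans (le_trans (le_of_eq (eLpNorm_congr_ae ?_))
        (eLpNorm_mono_measure _ Measure.restrict_le_self)) (ei i)
      filter_upwards [ae_restrict_mem hmA] with y hy; simp only [hE, Option.elim]
      rw [φ.right_inv hy.1]; simp only [hgidef, indicator_of_mem (hsub y hy)]; rfl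
  have hsum : eLpNorm (fun q => ∑ j, |E j q|) 2 Λ A' ≤
      (∑ _j : Option (Fin d), (ofReal C + 1)) * ε := by
    have hcomp : ∀ k' : Є → ℝ, Continuous k' →
        AEStronglyMeasurable (fun q => k' (φ q)) Λ A' := fun k' hk' =>
      (hk'.comp_continuousOn ((continuousOn_extChartAt (I := Υ) p).mono
        (hA's.trans inter_subset_left))).aestronglyMeasurable hA'.measurableSet
    have hrA : Λ A' ≤ Λ A := restrict_mono hAA le_rfl
    have hEm : ∀ j, AEStronglyMeasurable (E j) Λ A' := by
      intro j; cases j with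
      | none => exact (hcomp m hmd.continuous).sub (huA.1.mono_measure hrA)
      | some i =>
        exact (hcomp _ (hasFDerivAt_mollify (hgiL i) hk hkc).1.continuous).sub
          ((hgi i).1.mono_measure hrA)
    have h1 := eLpNorm_sum_le (s := Finset.univ) (f := fun j q => |E j q|)
      (μ := Λ A') (p := 2) (fun j _ => (hEm j).norm) one_le_two
    rw [sum_mul]; refine le_trans (le_of_eq ?_) (h1.trans (sum_le_sum fun j _ => ?_))
    · congr 1; ext q; simp
    · exact (eLpNorm_norm (E j)).trans_le (hEn j)
  have hfin : ∀ F : M → ℝ, (∀ q ∈ D, q ∉ A' → F q = 0) → (∀ q ∈ A', |F q| ≤ a * ∑ j, |E j q|) →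
      eLpNorm F 2 Λ D ≤ ofReal a * (∑ _j : Option (Fin d), (ofReal C + 1)) * ε := by
    intro F h1 h2; rw [mul_assoc]
    exact (eLpNorm_le_of_support hA'.measurableSet inter_subset_left (by positivity) h1
      hD.measurableSet h2).trans (mul_le_mul_right hsum _)
  have hE0 : ∀ q, |E none q| ≤ ∑ j, |E j q| := fun q =>
    Finset.single_le_sum (f := fun j => |E j q|) (fun j _ => abs_nonneg _) (Finset.mem_univ none)
  have hEs : ∀ q, 0 ≤ ∑ j, |E j q| := fun q => sum_nonneg fun j _ => abs_nonneg _
  have hoff : ∀ q ∈ D, q ∉ A' → q ∉ tsupport η := fun q hq hqA hqs => hqA ⟨hq, hηs hqs⟩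
  have hwloc : ∀ q ∈ tsupport η, w =ᶠ[𝓝 q] fun q => m (φ q) := by
    intro q hq
    filter_upwards [(eventually_nhdsSet_iff_forall.1 hχ1 q hq),
      (isOpen_chartBall p (R / 2)).mem_nhds (hηs hq)] with q' h1 h2
    rw [hw, indicator_of_mem h2, h1, one_mul]
  have hwval : ∀ q ∈ tsupport η, w q - u q = E none q := fun q hq => by
    rw [(hwloc q hq).eq_of_nhds]; rfl
  refine ⟨fun q => η q * w q, _, hη1.mul hw1, hprod.congr
    (.of_forall fun q => mul_sub _ _ _) (.of_forall fun q => rfl), ?_, ?_⟩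
  · refine hfin _ (fun q hq hqA => ?_) fun q hq => ?_
    · simp only [image_eq_zero_of_notMem_tsupport (hoff q hq hqA), zero_mul, sub_self]
    · by_cases hqs : q ∈ tsupport η
      · change |η q * w q - η q * u q| ≤ _; rw [← mul_sub, hwval q hqs, abs_mul]; have h1 := hb q
        rw [norm_eq_abs] at h1; have h2 : b ≤ a := by rw [ha]; nlinarith
        exact mul_le_mul (h1.trans h2) (hE0 q) (abs_nonneg _) (hb0.trans h2)
      · simp only [image_eq_zero_of_notMem_tsupport hqs, zero_mul, sub_zero, abs_zero]
        exact mul_nonneg (by positivity) (hEs q)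
  · have hgr0 : ∀ q, q ∉ tsupport η → Gd η q = 0 := by
      intro q hq; have h1 := inner_grad η q (Gd η q); rw [dif_eq_zero hq] at h1
      exact inner_self_eq_zero.1 h1
    refine hfin _ (fun q hq hqA => ?_) fun q hq => ?_
    · rw [image_eq_zero_of_notMem_tsupport (hoff q hq hqA), hgr0 q (hoff q hq hqA)]; simp
    · by_cases hqs : q ∈ tsupport η
      · have hqB : q ∈ ChB p R := hA's hq; have hqS := chartBall_subset_source hqB
        have h3 : ∀ i, inner ℝ (coordField p i q) (Gd w q - V q) = E (some i) q := by
          intro i; have hyq := chart_mem_chartSet (hAA hq) hqS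
          have hnr := range_mem_nhds hA (hAD.trans hDi) hyq
          rw [inner_sub_right, inner_grad, coordField, ← fderivWithin_chart_fun
            (hw1.mdifferentiable one_ne_zero q) hqS, fderivWithin_of_mem_nhds hnr]
          have h4 : (fun y => w (φ.symm y)) =ᶠ[𝓝 (φ q)] m := by
            have h5 : Tendsto φ.symm (𝓝 (φ q)) (𝓝 q) := by
              have := continuousAt_extChartAt_symm' (I := Υ) (hqB.1)
              rwa [ContinuousAt, chart_left_inv hqS] at this
            filter_upwards [h5.eventually (hwloc q hqs),
              (isOpen_chartSet p hA (hAD.trans hDi)).mem_nhds hyq] with y h6 h7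
            rw [h6, φ.right_inv h7.1]
          rw [h4.fderiv_eq, hVA.fderiv_mollify hA (hAD.trans hDi) hASs hgL hk hkc i
            (hkA _ (chart_mem_chartSet hq hqS))]
          rfl
        have h6 := h.norm_le hqB (Gd w q - V q); simp only [h3] at h6
        have h7 : ∑ i, |E (some i) q| ≤ ∑ j, |E j q| := by
          rw [Fintype.sum_option]; linarith [abs_nonneg (E none q)]
        have h8 := hb q; have h9 := hb' q; rw [norm_norm] at h9; rw [abs_norm]
        refine (norm_add_le _ _).trans ?_
        rw [norm_smul, norm_smul, hwval q hqs, norm_eq_abs (E none q)]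
        have e1 : ‖η q‖ * ‖Gd w q - V q‖ ≤ b * (C * ∑ j, |E j q|) := by
          gcongr; exact h6.trans (by gcongr)
        have e2 : |E none q| * ‖Gd η q‖ ≤ (∑ j, |E j q|) * b' :=
          mul_le_mul (hE0 q) h9 (norm_nonneg _) (hEs q)
        have e3 : 0 ≤ b * ∑ j, |E j q| := mul_nonneg hb0 (hEs q); rw [ha]; linarith
      · rw [image_eq_zero_of_notMem_tsupport hqs, hgr0 q hqs]
        simp only [zero_smul, smul_zero, add_zero, norm_zero, abs_zero]
        exact mul_nonneg (by positivity) (hEs q)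

lemma exists_local_approx (hD : IsLD D) (hu : MemLp u 2 Λ D) (hV : IsWG D u V) (p : M) : ∃ N : Set
    M, IsOpen N ∧ p ∈ N ∧ ∀ η : M → ℝ, ContMDiff Υ 𝓘(ℝ) ∞ η → tsupport η ⊆ N → ∃ B : ℝ≥0∞, B ≠ ⊤ ∧ ∀
    ε : ℝ≥0∞, ε ≠ 0 → ∃ (w : M → ℝ) (W : VM), Ck 1 w ∧ IsWG D (fun q => w q - η q * u q) W ∧ eLpNorm
    (fun q => w q - η q * u q) 2 Λ D ≤ B * ε ∧ eLpNorm (fun q => ‖W q‖) 2 (Λ D) ≤ B * ε := by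
  by_cases hp : p ∈ closure D
  · obtain ⟨R, C, K, v, f, h, -⟩ := exists_graphChart hD hp univ_mem
    exact ⟨_, isOpen_chartBall p (R / 2), mem_chartBall p (half_pos h.R_pos), fun η hη hs =>
      h.exists_approx hD.isOpen hD.subset_interior hu hV hη hs⟩
  · refine ⟨(closure D)ᶜ, isClosed_closure.isOpen_compl, hp, fun η hη hs =>
      ⟨0, ENNReal.zero_ne_top, fun ε hε => ⟨fun _ => 0, fun _ => 0, contMDiff_const, ?_, ?_, ?_⟩⟩⟩
    · refine isWeakGradient_zero.congr ?_ (.of_forall fun _ => rfl)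
      filter_upwards [ae_restrict_mem hD.isOpen.measurableSet] with q hq
      rw [image_eq_zero_of_notMem_tsupport fun h => hs h (subset_closure hq)]; ring
    · rw [eLpNorm_congr_ae (g := fun _ => 0)]
      · simp
      · filter_upwards [ae_restrict_mem hD.isOpen.measurableSet] with q hq
        rw [image_eq_zero_of_notMem_tsupport fun h => hs h (subset_closure hq)]; ring
    · simp

/-- Density of `C¹(M)` in `H¹(D)` for a Lipschitz domain `D`. -/
lemma exists_approxH1 (hD : IsLD D) (hu : MemLp u 2 Λ D) (hV : IsWG D u V) : ∃ w W, ApproxH1 d D u w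
    W := by
  choose N hN hpN happ using exists_local_approx hD hu hV
  obtain ⟨t, η, hη, hηs, -, hsum⟩ := exists_finite_partition (d := d) N hN hpN
  choose B hB hw using fun c => happ c (η c) (hη c) (hηs c)
  choose w W h1 h2 h3 h4 using fun c (j : ℕ) => hw c ((j : ℝ≥0∞) + 1)⁻¹ (by simp)
  have hD' := hD.isOpen
  have hm : ∀ c j, MemLp (fun q => w c j q - η c q * u q) 2 Λ D := fun c j =>
    (memLp_of_cont (d := d) (h1 c j).continuous 2 D).sub
      (memLp_mul_of_cont (hη c).continuous hu)
  have heq : ∀ j, (fun q => ∑ c ∈ t, w c j q - u q) = ∑ c ∈ t, fun q => w c j q - η c q * u q := by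
    intro j; ext q; rw [Finset.sum_apply, sum_sub_distrib, ← sum_mul, hsum q, one_mul]
  have hinv : Tendsto (fun j : ℕ => (∑ c ∈ t, B c) * ((j : ℝ≥0∞) + 1)⁻¹) atTop (𝓝 0) := by
    have := ENNReal.Tendsto.const_mul (a := ∑ c ∈ t, B c) ((tendsto_add_atTop_iff_nat 1).2
      ENNReal.tendsto_inv_nat_nhds_zero) (Or.inr (sum_ne_top.2 fun c _ => hB c))
    simpa using this
  refine ⟨fun j q => ∑ c ∈ t, w c j q, fun j q => ∑ c ∈ t, W c j q, fun j => ?_, fun j => ?_, ?_, ?_⟩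
  · exact contMDiff_finsetSum fun c _ => h1 c j
  · refine (IsWeakGradient.sum hD' hD.subset_interior t (fun c _ => hm c j) fun c _ => h2 c j).congr
      (.of_forall fun q => ?_) (.of_forall fun _ => rfl)
    have := congrFun (heq j) q; rw [Finset.sum_apply] at this; exact this.symm
  · refine squeeze hinv fun j => ?_
    simp only [heq j]; refine (eLpNorm_sum_le (fun c _ => (hm c j).1) one_le_two).trans ?_
    rw [sum_mul]; exact sum_le_sum fun c _ => h3 c j
  · refine squeeze hinv fun j => ?_
    refine (eLpNorm_mono (g := ∑ c ∈ t, fun q => ‖W c j q‖) fun q => ?_).trans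
      ((eLpNorm_sum_le (fun c _ => (h2 c j).memLp.1) one_le_two).trans ?_)
    · rw [norm_norm, Finset.sum_apply]; exact (norm_sum_le _ _).trans (le_abs_self _)
    · rw [sum_mul]; exact sum_le_sum fun c _ => h4 c j

lemma MemH1.exists_isTrace (hD : IsLD D) (hu : MemH1 d D u) : Tr D u (trace d D u) := by
  obtain ⟨V, hV⟩ := hu.2; obtain ⟨w, W, h⟩ := exists_approxH1 hD hu.1 hV
  obtain ⟨τ, hτ, -⟩ := h.exists_trace hD hu.1; exact isTrace_trace ⟨τ, hτ⟩

end Density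

/-! ### Linear algebra of fixed spaces and rigidity of finite group actions -/

/-- Vectors which a linear map almost kills are close to its kernel. -/
lemma exists_norm_le_of_ker {W : Type*} [NormedAddCommGroup W] [NormedSpace ℝ W] (B : Є →ₗ[ℝ] W) : ∃
    ε > 0, ∀ h : Є, ‖B h‖ ≤ ε * ‖h‖ → ‖h‖ ≤ 2 * ‖(LinearMap.ker B).orthogonalProjectionOnto h‖ := by
  set L := LinearMap.ker B
  -- On the orthogonal complement of its kernel `B` is injective, hence bounded below, so a small
  -- value of `B` forces the complementary component to be small.
  have hinj : LinearMap.ker (B ∘ₗ Lᗮ.subtype) = ⊥ := by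
    rw [LinearMap.ker_eq_bot']; intro x hx; have h1 : (x : Є) ∈ L := hx
    have h2 : (x : Є) ∈ L ⊓ Lᗮ := ⟨h1, x.2⟩; rw [Submodule.inf_orthogonal_eq_bot] at h2
    exact Subtype.ext h2
  obtain ⟨K, hK, hB⟩ := LinearMap.exists_antilipschitzWith (B ∘ₗ Lᗮ.subtype) hinj
  have hK' : (0 : ℝ) < K := hK; refine ⟨1 / (2 * K), by positivity, fun h hh => ?_⟩
  have h1 := hB.le_mul_dist (Lᗮ.orthogonalProjectionOnto h) 0
  rw [dist_zero_right, map_zero, dist_zero_right] at h1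
  have h2 : h = L.orthogonalProjectionOnto h + Lᗮ.orthogonalProjectionOnto h :=
    (L.starProjection_add_starProjection_orthogonal h).symm
  have h3 : B h = (B ∘ₗ Lᗮ.subtype) (Lᗮ.orthogonalProjectionOnto h) := by
    conv_lhs => rw [h2]
    rw [map_add, LinearMap.mem_ker.1 (L.orthogonalProjectionOnto h).2, zero_add]; rfl
  rw [← h3] at h1
  have h4 : ‖h‖ ≤ ‖L.orthogonalProjectionOnto h‖ + ‖Lᗮ.orthogonalProjectionOnto h‖ := by
    conv_lhs => rw [h2]
    exact norm_add_le _ _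
  have h5 : (K : ℝ) * ‖B h‖ ≤ ‖h‖ / 2 := by
    calc (K : ℝ) * ‖B h‖ ≤ K * (1 / (2 * K) * ‖h‖) := by gcongr
      _ = ‖h‖ / 2 := by field_simp
  linarith

/-- Two linear isometries which fix a hyperplane pointwise: one is the identity or they agree. -/
lemma eq_id_or_eq_of_fix_hyperplane {U U' : Є →ₗ[ℝ] Є} (hU : ∀ x, ‖U x‖ = ‖x‖) (hU' : ∀ x, ‖U' x‖ =
    ‖x‖) {L : Submodule ℝ Є} (hL : d ≤ Module.finrank ℝ L + 1) (hf : ∀ x ∈ L, U x = x) (hf' : ∀ x ∈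
    L, U' x = x) : U = .id ∨ U' = .id ∨ U = U' := by
  have hfin : Module.finrank ℝ Lᗮ ≤ 1 := by
    have := L.finrank_add_finrank_orthogonal; rw [finrank_euclideanSpace_fin] at this; omega
  obtain ⟨ν, hν⟩ := finrank_le_one_iff.1 hfin
  -- The complement of `L` is at most a line, on which an isometry fixing `L` acts by a sign.
  have key : ∀ T : Є →ₗ[ℝ] Є, (∀ x, ‖T x‖ = ‖x‖) → (∀ x ∈ L, T x = x) →
      T ν = (ν : Є) ∨ T ν = -(ν : Є) := by
    intro T hT hfT
    have hin : ∀ x y, inner ℝ (T x) (T y) = inner ℝ x y := (LinearIsometry.mk T hT).inner_map_map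
    have hmem : T ν ∈ Lᗮ := by intro l hl; rw [← hfT l hl, hin]; exact ν.2 l hl
    obtain ⟨c, hc⟩ := hν ⟨T ν, hmem⟩; have hc' : c • (ν : Є) = T ν := congrArg Subtype.val hc
    by_cases h0 : (ν : Є) = 0
    · left; rw [h0, map_zero]
    · have h1 := hT ν; rw [← hc', norm_smul] at h1
      have h2 : ‖c‖ = 1 := by have := norm_pos_iff.2 h0; nlinarith
      rw [norm_eq_abs] at h2; rcases (abs_eq zero_le_one).1 h2 with rfl | rfl
      · left; rw [← hc', one_smul]
      · right; rw [← hc', neg_smul, one_smul]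
  have hext : ∀ T T' : Є →ₗ[ℝ] Є, (∀ x ∈ L, T x = T' x) → T ν = T' ν → T = T' := by
    intro T T' h1 h2; ext1 x; obtain ⟨c, hc⟩ := hν (Lᗮ.orthogonalProjectionOnto x)
    have h3 : x = L.orthogonalProjectionOnto x + c • (ν : Є) := by
      have h4 : c • (ν : Є) = Lᗮ.orthogonalProjectionOnto x := congrArg Subtype.val hc; rw [h4]
      exact (L.starProjection_add_starProjection_orthogonal x).symm
    rw [h3, map_add, map_add, map_smul, map_smul, h2, h1 _ (L.orthogonalProjectionOnto x).2]
  rcases key U hU hf with h | h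
  · exact Or.inl (hext _ _ (fun x hx => hf x hx) h)
  rcases key U' hU' hf' with h' | h'
  · exact Or.inr (Or.inl (hext _ _ (fun x hx => hf' x hx) h'))
  · exact Or.inr (Or.inr (hext _ _ (fun x hx => (hf x hx).trans (hf' x hx).symm) (h.trans h'.symm)))

variable {a b : G}

variable (d) in
/-- The derivative of a group element at a fixed point, in the preferred chart. -/
def fixDeriv (a : G) (p : M) : Є →ₗ[ℝ] Є := derivCoord ℓ a p p p

local notation "FD" => fixDeriv d

lemma eventually_strict_fix (h : SA) (hp : a • p = p) {ε : ℝ} (hε : 0 < ε) : ∃ N ∈ 𝓝 p, ∀ y ∈ N, ∀ z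
    ∈ N, ‖Γ p (a • z) - Γ p (a • y) - FD a p (Γ p z - Γ p y)‖ ≤ ε * ‖Γ p z - Γ p y‖ :=
  eventually_strict ((h a).of_le one_le_infty) (mem_chart_source _ p)
    (by rw [hp]; exact mem_chart_source _ p) hε

lemma fixDeriv_mul (h : SA) (ha : a • p = p) : FD (b * a) p = FD b p ∘ₗ FD a p := by
  ext1 v
  have hp := mem_src d p
  have key : ∀ (q : M) (X : 𝓣 q), q = p →
      coord p (b • p) (dAct d b p (lift p p (coord p q X))) = coord p (b • q) (dAct d b q X) := by
    rintro q X rfl; rw [lift_coord hp]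
  have key2 : ∀ (q q' : M) (X : 𝓣 q) (X' : 𝓣 q'), q = q' →
      (X : Є) = X' → coord p q X = coord p q' X' := by
    rintro q _ X X' rfl hX; exact congrArg (coord p q) hX
  rw [LinearMap.comp_apply]
  change coord p ((b * a) • p) (dAct d (b * a) p (lift p p v)) =
    coord p (b • p) (dAct d b p (lift p p (coord p (a • p) (dAct d a p (lift p p v)))))
  rw [key _ _ ha]; exact key2 _ _ _ _ (mul_smul b a p) (dAct_mul h a b p (lift p p v))

lemma fixDeriv_one : fixDeriv (d := d) (1 : G) p = .id := by
  ext1 v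
  have hp := mem_src d p
  have key : ∀ f : M → M, f = id → coord p (f p) (mfderiv Υ Υ f p (lift p p v)) = v := by
    rintro _ rfl; rw [mfderiv_id]; exact coord_lift hp v
  exact key (fun q => (1 : G) • q) (by ext q; exact one_smul G q)

/-- A group element of finite order with a fixed point at which its derivative is the identity
fixes a neighbourhood of the point. -/
lemma eventually_fixed [Finite G] (h : SA) (hp : a • p = p) (hd : FD a p = .id) : ∀ᶠ q in 𝓝 p, a • q
    = q := by
  set φ := Γ p; have ha : Continuous fun q : M => a • q := (h a).continuous
  have hstep : ∀ (j : ℕ) (ε : ℝ), 0 < ε → ∃ N ∈ 𝓝 p, ∀ y ∈ N, ∀ z ∈ N,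
      ‖φ (a ^ j • z) - φ (a ^ j • y) - (φ z - φ y)‖ ≤ ε * ‖φ z - φ y‖ := by
    intro j ε hε
    have hj : a ^ j • p = p := by
      induction j with
      | zero => simp
      | succ j ih => rw [pow_succ, mul_smul, hp, ih]
    have hdj : FD (a ^ j) p = .id := by
      induction j with
      | zero => rw [pow_zero, fixDeriv_one]
      | succ j ih =>
        rw [pow_succ, fixDeriv_mul h hp, hd, LinearMap.comp_id]; refine ih ?_
        rwa [pow_succ, mul_smul, hp] at hj
    obtain ⟨N, hN, h1⟩ := eventually_strict_fix h hj hε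
    exact ⟨N, hN, fun y hy z hz => by have h2 := h1 y hy z hz; rwa [hdj] at h2⟩
  choose N hN hNj using fun j => hstep j (1 / 2) one_half_pos; set n := orderOf a
  have hn : 0 < n := orderOf_pos a
  have hU : (⋂ j ∈ Finset.range n, N j) ∈ 𝓝 p := (biInter_finset_mem _).2 fun j _ => hN j
  have hsrc : Δ p ∈ 𝓝 p := (𝓒 p).open_source.mem_nhds (mem_chart_source _ p)
  have ht : Tendsto ℓ a (𝓝 p) (𝓝 p) := by simpa [hp] using ha.tendsto p
  filter_upwards [hU, hsrc, ht hU, ht hsrc] with q h1 h2 h3 h4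
  -- Averaging over the cyclic group: the sum of `φ ∘ a ^ j` is `a`-invariant, and each summand
  -- differs from `φ` by a map of Lipschitz constant `1/2`. Hence the displacement `φ (a • q) - φ q`
  -- is at most half of itself in norm.
  have hΦ : ∑ j ∈ Finset.range n, φ (a ^ j • a • q) = ∑ j ∈ Finset.range n, φ (a ^ j • q) := by
    have e1 := sum_range_succ (fun j => φ (a ^ j • q)) n; rw [Finset.sum_range_succ'] at e1
    have e2 : a ^ n = 1 := pow_orderOf_eq_one a; rw [e2, pow_zero] at e1; rw [← add_right_cancel e1]
    refine sum_congr rfl fun j _ => ?_; rw [pow_succ, mul_smul]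
  have hsum : (n : ℝ) • (φ (a • q) - φ q) = -∑ j ∈ Finset.range n,
      (φ (a ^ j • a • q) - φ (a ^ j • q) - (φ (a • q) - φ q)) := by
    rw [sum_sub_distrib, sum_sub_distrib, hΦ, sub_self, zero_sub, neg_neg,
      sum_const, Finset.card_range, Nat.cast_smul_eq_nsmul]
  have hle : n * ‖φ (a • q) - φ q‖ ≤ n * (1 / 2 * ‖φ (a • q) - φ q‖) := by
    calc n * ‖φ (a • q) - φ q‖ = ‖(n : ℝ) • (φ (a • q) - φ q)‖ := by
          rw [norm_smul, norm_of_nonneg (Nat.cast_nonneg n)]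
      _ ≤ ∑ j ∈ Finset.range n, 1 / 2 * ‖φ (a • q) - φ q‖ := by
          rw [hsum, norm_neg]; refine (norm_sum_le _ _).trans (sum_le_sum fun j hj => ?_)
          exact hNj j q (mem_iInter₂.1 h1 j hj) _ (mem_iInter₂.1 h3 j hj)
      _ = _ := by rw [sum_const, Finset.card_range, nsmul_eq_mul]
  have hn' : (0 : ℝ) < n := Nat.cast_pos.2 hn
  have h0 : ‖φ (a • q) - φ q‖ ≤ 0 := by have := le_of_mul_le_mul_left hle hn'; linarith
  refine φ.injOn ?_ ?_ (sub_eq_zero.1 (norm_le_zero_iff.1 h0))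
  · rw [extChartAt_source]; exact h4
  · rw [extChartAt_source]; exact h2

/-- On a short segment inside the open set of fixed points near `p`, increments of `a` are those of
the identity. Strict differentiability at `p` compares these increments with the derivative at `p`,
in every direction. -/
lemma fixDeriv_eq_id (h : SA) (hpi : p ∈ Ξ M) (hp : p ∈ closure (interior {q : M | a • q = q})) : FD
    a p = .id := by
  have hps := mem_src d p
  have hfix : a • p = p := by
    have hc : IsClosed {q : M | a • q = q} := isClosed_eq (h a).continuous continuous_id
    exact closure_minimal interior_subset hc hp
  set φ := Γ p; ext1 w; rw [LinearMap.id_apply]; by_contra hne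
  have hw : w ≠ 0 := by rintro rfl; exact hne (map_zero _)
  have hpos : 0 < ‖FD a p w - w‖ := norm_pos_iff.2 (sub_ne_zero.2 hne)
  set ε := ‖FD a p w - w‖ / (2 * ‖w‖) with hε; have hw0 := norm_pos_iff.2 hw
  have hε0 : 0 < ε := by positivity
  obtain ⟨N, hN, h1⟩ := eventually_strict_fix h hfix hε0
  obtain ⟨N', hN', hN'o, hpN'⟩ := mem_nhds_iff.1 hN; set O := (N' ∩ Δ p) ∩ Ξ M
  have hO : IsOpen O := (hN'o.inter (𝓒 p).open_source).inter isOpen_interior_M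
  obtain ⟨y, hyO, hyF⟩ := mem_closure_iff.1 hp O hO ⟨⟨hpN', hps⟩, hpi⟩
  have hO' : IsOpen (CS p (O ∩ interior {q : M | a • q = q})) :=
    isOpen_chartSet p (hO.inter isOpen_interior) fun q hq => hq.1.2
  have hy := chart_mem_chartSet (c := p) (d := d)
    (show y ∈ O ∩ interior {q : M | a • q = q} from ⟨hyO, hyF⟩) hyO.1.2
  have ht := tendsto_add_smul (φ y) w
  obtain ⟨s, hs, hs0⟩ := ((ht.eventually (hO'.mem_nhds hy)).and self_mem_nhdsWithin).exists
  have hs0' : (0 : ℝ) < s := hs0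
  have hz : φ (φ.symm (φ y + s • w)) = φ y + s • w := φ.right_inv hs.1
  have hf1 : a • φ.symm (φ y + s • w) = φ.symm (φ y + s • w) := interior_subset (s := {q : M | a • q = q}) hs.2.2
  have hf2 : a • y = y := interior_subset (s := {q : M | a • q = q}) hyF
  have h2 := h1 y (hN' hyO.1.1) _ (hN' hs.2.1.1.1)
  rw [hf1, hf2, hz, add_sub_cancel_left, map_smul, ← smul_sub, norm_smul, norm_smul, norm_sub_rev,
    norm_of_nonneg hs0'.le] at h2
  have h3 : ε * (s * ‖w‖) = s * (‖FD a p w - w‖ / 2) := by rw [hε]; field_simp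
  rw [h3] at h2; have := le_of_mul_le_mul_left h2 hs0'; linarith

/-- The action of a finite group on a connected open set: a group element with derivative the identity
at a fixed point in the closure is trivial. -/
lemma eq_one_of_fixDeriv_eq_id [Finite G] (h : SA) (hΩ : IsPreconnected Ω) (hΩi : Ω ⊆ Ξ M)
    (hfaithful : ∀ a : G, (∀ p ∈ Ω, a • p = p) → a = 1) (hp : p ∈ closure Ω) (hfix : a • p = p) (hd
    : FD a p = .id) : a = 1 := by
  refine hfaithful a ?_
  -- The interior of the fixed set meets `Ω` because `p` is in the closure of `Ω`. It is relatively
  -- closed in `Ω`, since at a limit point the derivative is again the identity. Connectedness does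
  -- the rest.
  have hsub : Ω ⊆ interior {q : M | a • q = q} := by
    refine hΩ.subset_of_closure_inter_subset isOpen_interior ?_ ?_
    · have := interior_mem_nhds.2 (eventually_fixed h hfix hd)
      exact mem_closure_iff_nhds.1 hp _ this |>.imp fun q hq => ⟨hq.2, hq.1⟩
    · rintro q ⟨hq, hqΩ⟩
      have hc : IsClosed {q : M | a • q = q} := isClosed_eq (h a).continuous continuous_id
      exact mem_interior_iff_mem_nhds.2 (eventually_fixed h
        (closure_minimal interior_subset hc hq) (fixDeriv_eq_id h (hΩi hqΩ) hq))
  exact fun q hq => interior_subset (s := {q : M | a • q = q}) (hsub hq)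

/-! ### Negligibility of sets of fixed points -/

section NullSets

variable {a b : G}

lemma hausdorff_eq_zero {L : Submodule ℝ Є} {m : ℕ} (h : Module.finrank ℝ L < m) (T : Set L) :
    μHE[m] T = 0 := by
  rw [Measure.euclideanHausdorffMeasure_def, Measure.smul_apply]
  have h1 : dimH T < ((m : NNReal) : ℝ≥0∞) :=
    ((dimH_mono (subset_univ T)).trans_eq (Real.dimH_univ_eq_finrank L)).trans_lt
      (by exact_mod_cast h)
  have h2 := hausdorffMeasure_of_dimH_lt h1; simp only [NNReal.coe_natCast] at h2
  rw [h2, smul_zero]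

/-- A set which is locally a Lipschitz graph over a subspace of dimension less than `m`. -/
lemma measure_null_of_proj (m : ℕ) {S : Set M} (h : ∀ p ∈ S, ∃ L : Submodule ℝ Є, Module.finrank ℝ L
    < m ∧ ∃ C : ℝ, ∃ N ∈ 𝓝 p, ∀ y ∈ S ∩ N, ∀ z ∈ S ∩ N, ‖Γ p z - Γ p y‖ ≤ C *
    ‖L.orthogonalProjectionOnto (Γ p z - Γ p y)‖) : (μHE[m] : Measure M) S = 0 := by
  have : SecondCountableTopology M := EMetric.secondCountable_of_sigmaCompact M
  refine measure_null_of_locally_null S fun p hp => ?_; obtain ⟨L, hL, C, N, hN, h1⟩ := h p hp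
  obtain ⟨C1, hC1, N1, hN1, h2⟩ := exists_chart_bilipschitz (d := d) (mem_chart_source _ p)
  set A := S ∩ (N ∩ N1); refine ⟨A, inter_mem_nhdsWithin S (inter_mem hN hN1), ?_⟩
  -- On `A` the projection to `L` has a Lipschitz inverse, so `A` is a Lipschitz image of a subset
  -- of a space of dimension less than `m`.
  set P : M → L := fun q => L.orthogonalProjectionOnto (Γ p q)
  have hle : ∀ y ∈ A, ∀ z ∈ A, edist y z ≤ ofReal (C1 * C) * edist (P y) (P z) := by
    intro y hy z hz; refine (h2 y hy.2.2 z hz.2.2).1.trans ?_; rw [ofReal_mul hC1.le, mul_assoc]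
    refine mul_le_mul_right ?_ _; have h3 := h1 z ⟨hz.1, hz.2.1⟩ y ⟨hy.1, hy.2.1⟩
    rw [edist_dist, edist_dist, ← ENNReal.ofReal_mul' dist_nonneg, dist_eq_norm, dist_eq_norm]
    refine ofReal_le_ofReal ?_; rwa [map_sub] at h3
  have hinj : InjOn P A := fun y hy z hz hyz => by
    have := hle y hy z hz; rw [hyz, edist_self, mul_zero] at this
    exact edist_eq_zero.1 (le_antisymm this zero_le)
  have : Nonempty M := ⟨p⟩
  have him : Function.invFunOn P A '' (P '' A) = A := by
    rw [image_image]; exact (image_congr fun x hx => hinj.leftInvOn_invFunOn hx).trans (image_id' A)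
  have h4 := hausdorff_image_le (f := Function.invFunOn P A) (A := P '' A) m
    (r := C1 * C) (by
      rintro _ ⟨y, hy, rfl⟩ _ ⟨z, hz, rfl⟩
      rw [hinj.leftInvOn_invFunOn hy, hinj.leftInvOn_invFunOn hz]; exact hle y hy z hz)
  rw [him, hausdorff_eq_zero hL, mul_zero] at h4
  exact le_antisymm h4 zero_le

lemma norm_lift_fixDeriv (h : Iso) (hp : p ∈ closure Ω) (hfix : a • p = p) (w : Є) : ‖lift p p (FD a
    p w)‖ = ‖lift p p w‖ := by
  have key : ∀ (q : M) (X : 𝓣 q), q = p → ‖lift p p (coord p q X)‖ = ‖X‖ := by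
    rintro q X rfl; rw [lift_coord (mem_chart_source _ q)]
  exact (key _ _ hfix).trans (h.norm_mfderiv a hp (lift p p w))

/-- Between two fixed points the increment of `a` equals that of the identity. Chords of the fixed
set are therefore almost in the kernel of the derivative minus the identity. -/
lemma norm_fixDeriv_le [Finite G] (h : Iso) (hfix : a • p = p) {ε : ℝ} (hε : 0 < ε) : ∃ N ∈ 𝓝 p, ∀ y
    ∈ N, ∀ z ∈ N, a • y = y → a • z = z → ‖(FD a p - .id) (Γ p z - Γ p y)‖ ≤ ε * ‖Γ p z - Γ p y‖ :=
    by
  obtain ⟨N, hN, h1⟩ := eventually_strict_fix h.smooth hfix hε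
  refine ⟨N, hN, fun y hy z hz hy' hz' => ?_⟩; have h2 := h1 y hy z hz
  rw [hy', hz', norm_sub_rev] at h2; exact h2

variable [Finite G]

/-- The points fixed by two distinct nontrivial group elements are negligible for surface
measure. -/
lemma surf_fix_inter_fix (h : Iso) (hΩ : IsPreconnected Ω) (hΩi : Ω ⊆ Ξ M) (hfaithful : ∀ a : G, (∀
    p ∈ Ω, a • p = p) → a = 1) (ha : a ≠ 1) (hb : b ≠ 1) (hab : a ≠ b) : surf d M {q ∈ closure Ω | a
    • q = q ∧ b • q = q} = 0 := by
  refine measure_null_of_proj (d := d) (d - 1) fun p ⟨hpΩ, hpa, hpb⟩ => ?_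
  set B : Є →ₗ[ℝ] Є × Є := (FD a p - .id).prod (FD b p - .id)
  have hker : ∀ x ∈ LinearMap.ker B, FD a p x = x ∧ FD b p x = x := by
    intro x hx; have h1 : B x = 0 := hx
    exact ⟨sub_eq_zero.1 (congrArg Prod.fst h1), sub_eq_zero.1 (congrArg Prod.snd h1)⟩
  refine ⟨LinearMap.ker B, ?_, 2, ?_⟩
  -- If the common fixed space had dimension at least `d - 1`, then in an orthonormal frame the two
  -- derivatives would be isometries fixing a hyperplane. One of them would be the identity or they
  -- would coincide, against `a ≠ 1`, `b ≠ 1` or `a ≠ b`.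
  · by_contra hcon; obtain ⟨T, hT⟩ := exists_isometry_frame (d := d) (mem_src d p)
    have hTn : ∀ x, ‖T x‖ = ‖lift p p x‖ := fun x => by
      rw [norm_eq_sqrt_real_inner, norm_eq_sqrt_real_inner, hT]
    set U : G → Є →ₗ[ℝ] Є := fun c => T.toLinearMap ∘ₗ FD c p ∘ₗ T.symm.toLinearMap with hU
    have hUn : ∀ c : G, c • p = p → ∀ x, ‖U c x‖ = ‖x‖ := by
      intro c hc x; change ‖T (FD c p (T.symm x))‖ = ‖x‖
      rw [hTn, norm_lift_fixDeriv h hpΩ hc, ← hTn, T.apply_symm_apply]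
    have hUe : ∀ c : G, ∀ x, FD c p x = T.symm (U c (T x)) := fun c x => by
      change _ = T.symm (T (FD c p (T.symm (T x)))); rw [T.symm_apply_apply, T.symm_apply_apply]
    have hUid : ∀ c : G, c • p = p → U c = .id → c = 1 := by
      intro c hc hcU; refine eq_one_of_fixDeriv_eq_id h.smooth hΩ hΩi hfaithful hpΩ hc ?_; ext1 x
      rw [hUe, hcU, LinearMap.id_apply, LinearMap.id_apply, T.symm_apply_apply]
    have hfin : Module.finrank ℝ ((LinearMap.ker B).map (T.toLinearMap)) =
        Module.finrank ℝ (LinearMap.ker B) := LinearEquiv.finrank_map_eq T.toLinearEquiv _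
    have hfixT : ∀ c : G, (∀ x ∈ LinearMap.ker B, FD c p x = x) →
        ∀ x ∈ (LinearMap.ker B).map (T.toLinearMap), U c x = x := by
      rintro c hc _ ⟨x, hx, rfl⟩; change T (FD c p (T.symm (T x))) = T x
      rw [T.symm_apply_apply, hc x hx]
    rcases eq_id_or_eq_of_fix_hyperplane (hUn a hpa) (hUn b hpb)
      (L := (LinearMap.ker B).map (T.toLinearMap)) (by omega)
      (hfixT a fun x hx => (hker x hx).1) (hfixT b fun x hx => (hker x hx).2) with h1 | h1 | h1
    · exact ha (hUid a hpa h1)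
    · exact hb (hUid b hpb h1)
    · have hinv : a⁻¹ • p = p := by rw [inv_smul_eq_iff, hpa]
      refine hab (inv_mul_eq_one.1 (eq_one_of_fixDeriv_eq_id h.smooth hΩ hΩi hfaithful hpΩ
        (a := a⁻¹ * b) (by rw [mul_smul, hpb, hinv]) ?_))
      rw [fixDeriv_mul h.smooth hpb]
      have h2 : FD b p = FD a p := by
        ext1 x
        rw [hUe, hUe, h1]
      rw [h2, ← fixDeriv_mul h.smooth hpa, inv_mul_cancel, fixDeriv_one]
  · obtain ⟨ε, hε, hB⟩ := exists_norm_le_of_ker B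
    obtain ⟨N, hN, h1⟩ := norm_fixDeriv_le h hpa hε
    obtain ⟨N', hN', h2⟩ := norm_fixDeriv_le h hpb hε
    refine ⟨N ∩ N', inter_mem hN hN', fun y hy z hz => hB _ ?_⟩
    exact max_le (h1 y hy.2.1 z hz.2.1 hy.1.2.1 hz.1.2.1) (h2 y hy.2.2 z hz.2.2 hy.1.2.2 hz.1.2.2)

/-- Chords of the fixed set are close to the kernel of the derivative minus the identity, a proper
subspace because `a ≠ 1`. -/
lemma vol_fix_eq_zero (h : Iso) (hΩ : IsPreconnected Ω) (hΩi : Ω ⊆ Ξ M) (hfaithful : ∀ a : G, (∀ p ∈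
    Ω, a • p = p) → a = 1) (ha : a ≠ 1) : ϑ {q ∈ closure Ω | a • q = q} = 0 := by
  refine measure_null_of_proj (d := d) d fun p ⟨hpΩ, hpa⟩ => ?_; set B : Є →ₗ[ℝ] Є := FD a p - .id
  refine ⟨LinearMap.ker B, ?_, 2, ?_⟩
  · have := Submodule.finrank_lt (s := LinearMap.ker B) fun htop => ha (eq_one_of_fixDeriv_eq_id h.smooth
      hΩ hΩi hfaithful hpΩ hpa (sub_eq_zero.1 (LinearMap.ker_eq_top.1 htop)))
    rwa [finrank_euclideanSpace_fin] at this
  · obtain ⟨ε, hε, hB⟩ := exists_norm_le_of_ker B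
    obtain ⟨N, hN, h1⟩ := norm_fixDeriv_le h hpa hε
    exact ⟨N, hN, fun y hy z hz => hB _ (h1 y hy.2 z hz.2 hy.1.2 hz.1.2)⟩

/-- The interior cone condition at the sum of the images of a cone direction under the powers of a
group element. -/
lemma exists_cone_of_fix (h : Iso) (hL : IsLD Ω) (hp : p ∈ closure Ω) (hfix : a • p = p) : ∃ e : Є,
    FD a p e = e ∧ ∃ κ > 0, ∃ s₀ > 0, ∃ N ∈ 𝓝 p, ∀ x ∈ closure Ω ∩ N, ∀ y ∈ N, ∀ s : ℝ, 0 < s → s <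
    s₀ → ‖Γ p y - Γ p x - s • e‖ ≤ κ * s → y ∈ Ω := by
  obtain ⟨R, C, K, v, f, hg, -⟩ := exists_graphChart hL hp univ_mem; set φ := Γ p with hφ
  have hps := mem_src d p; have hv0 : ‖v‖ = 1 := hg.norm_v
  -- The cone condition in the graph chart: a deviation from `s • v` smaller than `s / (1 + K)`
  -- cannot undo the height gained along `v`.
  have hcone : ∀ x ∈ closure Ω ∩ ChB p R, ∀ y ∈ ball (φ p) R, ∀ s : ℝ, 0 < s →
      (1 + K) * ‖y - φ x - s • v‖ < s → y ∈ CS p Ω := by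
    intro x hx y hy s hs hle; refine (hg.mem_iff y hy).2 ?_
    have h0 := (hg.mem_closure_iff hx.2).1 hx.1
    have h1 := height_sub_le hv0 hg.lip (y - s • v) (φ x)
    rw [show y - s • v - φ x = y - φ x - s • v by abel] at h1
    have h2 : height v f y = height v f (y - s • v) + s := by
      rw [← height_add_smul hv0, sub_add_cancel]
    have := (abs_le.1 h1).1; rw [h2]; have h3 : 0 ≤ height v f (φ x) := h0; linarith
  have hpow : ∀ j : ℕ, a ^ j • p = p := by
    intro j; induction j with
    | zero => simp
    | succ j ih => rw [pow_succ, mul_smul, hfix, ih]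
  have hpow' : ∀ j : ℕ, (a ^ j)⁻¹ • p = p := fun j => by rw [inv_smul_eq_iff, hpow]
  set A : ℕ → Є →ₗ[ℝ] Є := fun j => FD (a ^ j) p
  -- One step goes to the preimage under `a ^ (k + 1)`, moves by `s • v` into `Ω`, and comes back.
  -- As `closure Ω` is invariant the walk stays in it, and to first order the step is `s • A (k + 1)
  -- v`.
  have hiter : ∀ k : ℕ, ∀ ε > 0, ∀ N ∈ 𝓝 p, ∃ N' ∈ 𝓝 p, ∃ s₀ > 0, ∀ x ∈ closure Ω ∩ N', ∀ s : ℝ,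
      0 < s → s < s₀ → ∃ q ∈ closure Ω ∩ N,
        ‖φ q - φ x - s • ∑ j ∈ Finset.range k, A (j + 1) v‖ ≤ ε * s := by
    intro k; induction k with
    | zero =>
      intro ε hε N hN; refine ⟨N, hN, 1, one_pos, fun x hx s hs _ => ⟨x, hx, ?_⟩⟩
      simp only [sub_self, Finset.range_zero, Finset.sum_empty, smul_zero, norm_zero]; positivity
    | succ k ih =>
      intro ε hε N hN
      obtain ⟨N1, hN1, h1⟩ := eventually_strict_fix h.smooth (hpow (k + 1)) (half_pos hε)
      have hc1 : Tendsto (fun q : M => (a ^ (k + 1)) • q) (𝓝 p) (𝓝 p) := by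
        simpa [hpow] using (h.continuous (a ^ (k + 1))).tendsto p
      have hc2 : Tendsto (fun q : M => (a ^ (k + 1))⁻¹ • q) (𝓝 p) (𝓝 p) := by
        simpa [hpow'] using (h.continuous (a ^ (k + 1))⁻¹).tendsto p
      obtain ⟨r, hr, h2⟩ := exists_ball_extChartAt (d := d) hps (inter_mem hN1 (hc1 hN))
      have hr' : 0 < min R r := lt_min hg.R_pos hr; set N2 := ChB p (min R r / 2) ∩ N1
      have hN2 : N2 ∈ 𝓝 p := inter_mem ((isOpen_chartBall p _).mem_nhds
        (mem_chartBall p (half_pos hr'))) hN1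
      obtain ⟨N', hN', s₀, hs₀, h3⟩ := ih (ε / 2) (half_pos hε) _ (hc2 hN2)
      refine ⟨N', hN', min s₀ (min R r / 2), lt_min hs₀ (half_pos hr'), fun x hx s hs hss => ?_⟩
      obtain ⟨q, hq, hq1⟩ := h3 x hx s hs (hss.trans_le (min_le_left _ _))
      set q' := (a ^ (k + 1))⁻¹ • q with hq'; have hq'N : q' ∈ N2 := hq.2
      have hq'c : q' ∈ closure Ω := h.smul_mem_closure _ hq.1; set y := φ q' + s • v with hy
      have hyb : y ∈ ball (φ p) (min R r) := by
        rw [mem_ball, hy]; have e1 : dist (φ q') (φ p) < min R r / 2 := hq'N.1.2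
        have e2 : dist (φ q' + s • v) (φ q') = s := by
          rw [dist_eq_norm, add_sub_cancel_left, norm_smul, hv0, mul_one, norm_of_nonneg hs.le]
        have e3 := dist_triangle (φ q' + s • v) (φ q') (φ p)
        have e4 := hss.trans_le (min_le_right _ _); linarith
      have hyΩ : y ∈ CS p Ω := by
        refine hcone q' ⟨hq'c, chartBall_mono ?_ hq'N.1⟩ y
          (ball_subset_ball (min_le_left _ _) hyb) s hs ?_
        · linarith [min_le_left R r]
        · rw [hy, add_sub_cancel_left, sub_self, norm_zero, mul_zero]; exact hs
      obtain ⟨-, hy2⟩ := h2 y ⟨ball_subset_ball (min_le_right _ _) hyb,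
        extChartAt_target_subset_range p hyΩ.1⟩
      refine ⟨a ^ (k + 1) • φ.symm y, ⟨h.smul_mem_closure _ (subset_closure hyΩ.2), hy2.2⟩, ?_⟩
      have h4 := h1 q' hq'N.2 _ hy2.1; have e5 : φ (φ.symm y) = y := φ.right_inv hyΩ.1
      have e6 : a ^ (k + 1) • q' = q := smul_inv_smul _ _
      rw [e6, e5, hy, add_sub_cancel_left, map_smul, norm_smul, hv0, mul_one,
        norm_of_nonneg hs.le, ← hy] at h4
      rw [sum_range_succ, smul_add]
      calc ‖φ (a ^ (k + 1) • φ.symm y) - φ x - (s • ∑ j ∈ Finset.range k, A (j + 1) v +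
            s • A (k + 1) v)‖ = ‖(φ (a ^ (k + 1) • φ.symm y) - φ q - s • A (k + 1) v) +
            (φ q - φ x - s • ∑ j ∈ Finset.range k, A (j + 1) v)‖ := by congr 1; abel
        _ ≤ ε / 2 * s + ε / 2 * s := (norm_add_le _ _).trans (add_le_add h4 hq1)
        _ = ε * s := by ring
  have hn : 0 < orderOf a := orderOf_pos a
  obtain ⟨n, hn⟩ : ∃ n, orderOf a = n + 1 := ⟨orderOf a - 1, by omega⟩
  have hAn : A (n + 1) = .id := by
    change FD (a ^ (n + 1)) p = _; rw [← hn, pow_orderOf_eq_one, fixDeriv_one]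
  have hAs : ∀ j, FD a p (A j v) = A (j + 1) v := by
    intro j; change _ = FD (a ^ (j + 1)) p v; rw [pow_succ', fixDeriv_mul h.smooth (hpow j)]; rfl
  -- The order of `a` is `n + 1`, so this is the sum of `v` over the whole cyclic orbit and is fixed
  -- by the derivative. The summand `v` is kept apart: it is taken as the last step, where the cone
  -- condition lands in the open set `Ω` itself.
  refine ⟨∑ j ∈ Finset.range n, A (j + 1) v + v, ?_, ?_⟩
  · have hA0 : A 0 v = v := by change FD (a ^ 0) p v = v; rw [pow_zero, fixDeriv_one]; rfl
    have e1 := Finset.sum_range_succ' (fun j => A j v) n; rw [hA0] at e1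
    rw [← e1, map_sum, sum_range_succ]; simp only [hAs]; rw [hAn, LinearMap.id_apply, e1]
  · have hK : (0 : ℝ) < 1 + K := by positivity
    -- Two errors of size `κ s`, one from the walk and one from the hypothesis on `y`, add up to at
    -- most `s / (2 (1 + K))`.
    set κ : ℝ := 1 / (4 * (1 + K)) with hκ; have hκ0 : 0 < κ := by positivity
    have hκK : (1 + K) * κ = 1 / 4 := by rw [hκ]; field_simp
    have hball : ChB p R ∈ 𝓝 p := (isOpen_chartBall p R).mem_nhds (mem_chartBall p hg.R_pos)
    obtain ⟨N', hN', s₀, hs₀, h1⟩ := hiter n κ hκ0 _ hball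
    refine ⟨κ, hκ0, s₀, hs₀, N' ∩ ChB p R, inter_mem hN' hball, fun x hx y hy s hs hss hle => ?_⟩
    obtain ⟨q, hq, hq1⟩ := h1 x ⟨hx.1, hx.2.1⟩ s hs hss
    refine (chart_mem_iff hy.2.1).1 (hcone q hq _ hy.2.2 s hs ?_)
    have e1 : ‖φ y - φ q - s • v‖ ≤ κ * s + κ * s := by
      calc ‖φ y - φ q - s • v‖ = ‖(φ y - φ x - s • (∑ j ∈ Finset.range n, A (j + 1) v + v)) -
            (φ q - φ x - s • ∑ j ∈ Finset.range n, A (j + 1) v)‖ := by rw [smul_add]; congr 1; abel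
        _ ≤ _ := (norm_sub_le _ _).trans (add_le_add hle hq1)
    calc (1 + K) * ‖φ y - φ q - s • v‖ ≤ (1 + K) * (κ * s + κ * s) := by gcongr
      _ = ((1 + K) * κ) * (2 * s) := by ring
      _ < s := by rw [hκK]; linarith

/-- The boundary points fixed by a nontrivial group element are negligible. -/
lemma surf_frontier_inter_fix (h : Iso) (hL : IsLD Ω) (hΩ : IsPreconnected Ω) (hfaithful : ∀ a : G,
    (∀ p ∈ Ω, a • p = p) → a = 1) (ha : a ≠ 1) : surf d M {q ∈ frontier Ω | a • q = q} = 0 := by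
  refine measure_null_of_proj (d := d) (d - 1) fun p ⟨hpΩ, hpa⟩ => ?_
  have hpc := frontier_subset_closure hpΩ
  obtain ⟨e, he, κ, hκ, s₀, hs₀, N, hN, hcone⟩ := exists_cone_of_fix h hL hpc hpa; set φ := Γ p
  have hnot : ∀ q ∈ frontier Ω, q ∉ Ω := fun q hq => by rw [hL.isOpen.frontier_eq] at hq; exact hq.2
  have he0 : e ≠ 0 := by
    rintro rfl
    refine hnot p hpΩ (hcone p ⟨hpc, mem_of_mem_nhds hN⟩ p (mem_of_mem_nhds hN) (s₀ / 2)
      (half_pos hs₀) (half_lt_self hs₀) ?_)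
    simp only [sub_self, smul_zero, norm_zero]; positivity
  have hen : 0 < ‖e‖ := norm_pos_iff.2 he0; set B₁ : Є →ₗ[ℝ] Є := FD a p - .id
  -- The direction `e` is fixed by the derivative, but chords between boundary points stay away from
  -- it by the cone condition. Removing the component along `e` costs only a constant and leaves
  -- vectors close to the fixed space intersected with the complement of `e`, of dimension at most
  -- `d - 2`.
  set B : Є →ₗ[ℝ] Є × ℝ := B₁.prod (innerₛₗ ℝ e); have hB₁e : B₁ e = 0 := sub_eq_zero.2 he
  refine ⟨LinearMap.ker B, ?_, ?_⟩
  · have h1 : LinearMap.ker B < LinearMap.ker B₁ := by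
      refine lt_of_le_of_ne (fun x hx => ?_) fun heq => ?_
      · have : B x = 0 := hx; exact congrArg Prod.fst this
      · have h2 : e ∈ LinearMap.ker B := heq ▸ hB₁e; have h3 : B e = 0 := h2
        exact he0 (inner_self_eq_zero.1 (congrArg Prod.snd h3 : inner ℝ e e = 0))
    have h2 : LinearMap.ker B₁ < ⊤ := by
      refine lt_top_iff_ne_top.2 fun htop => ha (eq_one_of_fixDeriv_eq_id h.smooth hΩ
        hL.subset_interior hfaithful hpc hpa ?_)
      exact sub_eq_zero.1 (LinearMap.ker_eq_top.1 htop)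
    have h3 := Submodule.finrank_lt_finrank_of_lt h1; have h4 := Submodule.finrank_lt h2.ne
    rw [finrank_euclideanSpace_fin] at h4; omega
  · obtain ⟨ε, hε, hB⟩ := exists_norm_le_of_ker B; set c : ℝ := 1 + ‖e‖ / κ with hc
    have hc0 : 0 < c := by positivity
    obtain ⟨N', hN', h1⟩ := norm_fixDeriv_le h hpa (div_pos hε hc0)
    have hr : 0 < s₀ * ‖e‖ / 2 := by positivity
    refine ⟨c * 2, N ∩ N' ∩ ChB p (s₀ * ‖e‖ / 2), inter_mem (inter_mem hN hN')
      ((isOpen_chartBall p _).mem_nhds (mem_chartBall p hr)), fun y hy z hz => ?_⟩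
    set w := φ z - φ y with hw; set s := inner ℝ e w / ‖e‖ ^ 2 with hs; set w₁ := w - s • e with hw₁
    have hwn : ‖w‖ < s₀ * ‖e‖ := by
      have e1 : dist (φ y) (φ p) < s₀ * ‖e‖ / 2 := hy.2.2.2
      have e2 : dist (φ z) (φ p) < s₀ * ‖e‖ / 2 := hz.2.2.2
      have e3 := dist_triangle_right (φ z) (φ y) (φ p); rw [dist_eq_norm (φ z) (φ y)] at e3
      linarith
    have hs1 : |s| < s₀ := by
      rw [hs, abs_div, abs_of_nonneg (sq_nonneg ‖e‖), div_lt_iff₀ (by positivity)]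
      calc |inner ℝ e w| ≤ ‖e‖ * ‖w‖ := abs_real_inner_le_norm e w
        _ < ‖e‖ * (s₀ * ‖e‖) := by gcongr
        _ = s₀ * ‖e‖ ^ 2 := by ring
    -- Otherwise one of the two boundary points would lie in the cone based at the other, hence in
    -- `Ω`.
    have hsw : κ * |s| ≤ ‖w₁‖ := by
      by_contra hlt; push Not at hlt; rcases lt_trichotomy s 0 with hs0 | hs0 | hs0
      · refine hnot y hy.1.1 (hcone z ⟨frontier_subset_closure hz.1.1, hz.2.1.1⟩ y hy.2.1.1 (-s)
          (by linarith) (by rwa [abs_of_neg hs0] at hs1) ?_)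
        rw [abs_of_neg hs0] at hlt; refine le_trans (le_of_eq ?_) hlt.le; rw [← norm_neg]; congr 1
        rw [hw₁, hw, neg_smul]; abel
      · rw [hs0, abs_zero, mul_zero] at hlt; exact absurd hlt (norm_nonneg _).not_gt
      · refine hnot z hz.1.1 (hcone y ⟨frontier_subset_closure hy.1.1, hy.2.1.1⟩ z hz.2.1.1 s hs0
          (by rwa [abs_of_pos hs0] at hs1) ?_)
        rw [abs_of_pos hs0] at hlt; exact hlt.le
    have hww : ‖w‖ ≤ c * ‖w₁‖ := by
      have e1 : ‖w‖ ≤ ‖w₁‖ + |s| * ‖e‖ := by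
        calc ‖w‖ = ‖w₁ + s • e‖ := by rw [hw₁, sub_add_cancel]
          _ ≤ _ := (norm_add_le _ _).trans (by rw [norm_smul, norm_eq_abs])
      have e2 : |s| ≤ ‖w₁‖ / κ := by rw [le_div_iff₀ hκ]; linarith
      have e3 : |s| * ‖e‖ ≤ ‖w₁‖ / κ * ‖e‖ := by gcongr
      have e4 : ‖w₁‖ / κ * ‖e‖ = ‖e‖ / κ * ‖w₁‖ := by ring
      rw [hc, add_mul, one_mul]; linarith
    have hew : inner ℝ e w₁ = 0 := by
      rw [hw₁, inner_sub_right, inner_smul_right, real_inner_self_eq_norm_sq, hs]; field_simp; ring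
    have hBw : ‖B w₁‖ ≤ ε * ‖w₁‖ := by
      refine max_le ?_ ?_
      · have e1 : B₁ w₁ = B₁ w := by rw [hw₁, map_sub, map_smul, hB₁e, smul_zero, sub_zero]
        change ‖B₁ w₁‖ ≤ _; rw [e1]; refine (h1 y hy.2.1.2 z hz.2.1.2 hy.1.2 hz.1.2).trans ?_
        calc ε / c * ‖w‖ ≤ ε / c * (c * ‖w₁‖) := by gcongr
          _ = ε * ‖w₁‖ := by field_simp
      · change ‖inner ℝ e w₁‖ ≤ _; rw [hew, norm_zero]; positivity
    have hproj : (LinearMap.ker B).orthogonalProjectionOnto w₁ =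
        (LinearMap.ker B).orthogonalProjectionOnto w := by
      have e1 : (LinearMap.ker B).orthogonalProjectionOnto e = 0 := by
        rw [Submodule.orthogonalProjectionOnto_eq_zero_iff]; intro x hx; have h5 : B x = 0 := hx
        rw [real_inner_comm]; exact congrArg Prod.snd h5
      rw [hw₁, map_sub, map_smul, e1, smul_zero, sub_zero]
    rw [← hproj]
    calc ‖w‖ ≤ c * ‖w₁‖ := hww
      _ ≤ c * (2 * _) := by gcongr; exact hB w₁ hBw
      _ = _ := by ring

end NullSets

/-! ### The partition: interior and exterior boundaries up to null sets -/

/-- A Lipschitz domain is locally connected at its boundary. -/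
lemma IsLipschitzDomain.exists_connected (hL : IsLD Ω) (hp : p ∈ frontier Ω) {N : Set M} (hN : N ∈ 𝓝
    p) : ∃ W : Set M, IsPreconnected W ∧ W ⊆ Ω ∩ N ∧ ∃ N' ∈ 𝓝 p, Ω ∩ N' ⊆ W := by
  obtain ⟨R, C, K, v, f, hg, hRN⟩ := exists_graphChart hL (frontier_subset_closure hp) hN
  set φ := Γ p; have hv := hg.norm_v; have hpB := mem_chartBall (d := d) p hg.R_pos
  have h0 := (hg.mem_frontier_iff hL.isOpen hpB).1 hp
  have hc := continuous_graphMap v hg.lip.continuous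
  have e0 : graphMap v f (hypProj hv (φ p), 0) = φ p := by rw [← h0]; exact graphMap_hypProj hv f _
  have h1 : graphMap v f ⁻¹' ball (φ p) R ∈ 𝓝 (hypProj hv (φ p), (0 : ℝ)) :=
    hc.continuousAt.preimage_mem_nhds (by rw [e0]; exact ball_mem_nhds _ hg.R_pos)
  obtain ⟨r, hr, hr1⟩ := Metric.mem_nhds_iff.1 h1; rw [← ball_prod_same] at hr1
  set S : Set (Hyp v × ℝ) := ball (hypProj hv (φ p)) r ×ˢ Ioo 0 r with hS
  have hS1 : ∀ x ∈ S, graphMap v f x ∈ CS p Ω ∧ graphMap v f x ∈ ball (φ p) R := by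
    rintro x ⟨hx1, hx2⟩
    have hb : graphMap v f x ∈ ball (φ p) R := by
      refine hr1 ⟨hx1, ?_⟩; rw [Real.ball_eq_Ioo]; exact ⟨by linarith [hx2.1], by linarith [hx2.2]⟩
    exact ⟨(hg.mem_iff _ hb).2 (by rw [height_graphMap hv]; exact hx2.1), hb⟩
  refine ⟨(fun x => φ.symm (graphMap v f x)) '' S, ?_, ?_, ?_⟩
  · refine IsPreconnected.image (((convex_ball _ _).prod (convex_Ioo 0 r)).isPreconnected) _ ?_
    exact (continuousOn_extChartAt_symm p).comp hc.continuousOn fun x hx => (hS1 x hx).1.1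
  · rintro _ ⟨x, hx, rfl⟩; refine ⟨(hS1 x hx).1.2, hRN ⟨φ.map_target (hS1 x hx).1.1, ?_⟩⟩
    rw [mem_preimage, φ.right_inv (hS1 x hx).1.1]; exact (hS1 x hx).2
  · have hcφ : ContinuousAt φ p := continuousAt_extChartAt p
    have h2 : ∀ᶠ q in 𝓝 p, hypProj hv (φ q) ∈ ball (hypProj hv (φ p)) r :=
      ((continuous_hypProj hv).continuousAt.comp hcφ).preimage_mem_nhds (ball_mem_nhds _ hr)
    have h3 : ∀ᶠ q in 𝓝 p, height v f (φ q) < r :=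
      (hg.continuous_height.continuousAt.comp hcφ).preimage_mem_nhds
        ((isOpen_Iio).mem_nhds (by change height v f (Γ p p) < r; rw [h0]; exact hr))
    refine ⟨_, inter_mem ((isOpen_chartBall p R).mem_nhds hpB) (inter_mem h2 h3), ?_⟩
    rintro q ⟨hq, hqB, hq2, hq3⟩
    refine ⟨(hypProj hv (φ q), height v f (φ q)), ⟨hq2, (hg.mem_dom_iff hqB).1 hq, hq3⟩, ?_⟩
    dsimp only; rw [graphMap_hypProj, φ.left_inv hqB.1]

variable (d σ B P k) in
/-- The standing assumptions: the admissible problem `B` on the connected domain `B.dom`, with a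
faithful symmetry group `G`, and the transitive partition `P` with the distinguished piece `P k`. -/
structure SymPartition : Prop where
  admissible : B.IsAdmissible d G
  connected : IsConnected B.dom
  faithful : ∀ a : G, (∀ p ∈ B.dom, a • p = p) → a = 1
  partition : IsTransitivePartition d G B.dom P
  cover : intBdry B.dom (P k) ⊆ closure (plusBdry σ B.dom (P k)) ∪ closure (minusBdry σ B.dom (P k))

local notation "SymP" => SymPartition d σ B P k

variable (G) in
/-- The points of `closure Ω` with nontrivial stabilizer. -/
def fixSet (Ω : Set M) : Set M := {q ∈ closure Ω | ∃ a : G, a ≠ 1 ∧ a • q = q}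

namespace SymPartition

section Partition

variable [Finite G]

lemma isAction (h : SymP) : IsomAction d G B.dom :=
  ⟨h.admissible.smooth_act, h.admissible.lipschitz.isOpen, h.admissible.act_dom,
    h.admissible.isometry⟩

lemma lip (h : SymP) : IsLD (P k) := h.partition.lipschitz k

lemma isClosed_fixSet (h : SymP) : IsClosed (fixSet G B.dom) := by
  have : fixSet G B.dom = closure B.dom ∩ ⋃ a ∈ {a : G | a ≠ 1}, {q | a • q = q} := by
    ext q; simp only [fixSet, mem_ofPred_eq, mem_inter_iff, mem_iUnion, exists_prop]
  rw [this]
  exact isClosed_closure.inter ((toFinite _).isClosed_biUnion fun a _ =>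
    isClosed_eq (h.isAction.continuous a) continuous_id)

lemma smul_mem_fixSet (h : SymP) (b : G) (hq : q ∈ fixSet G B.dom) : b • q ∈ fixSet G B.dom := by
  obtain ⟨hq1, a, ha, haq⟩ := hq
  refine ⟨h.isAction.smul_mem_closure b hq1, b * a * b⁻¹, fun h1 => ha ?_, ?_⟩
  · rwa [mul_inv_eq_one, mul_eq_left] at h1
  · rw [mul_smul, mul_smul, inv_smul_smul, haq]

lemma exists_fixer_of_mem (hp : p ∈ plusBdry σ Ω D ∪ minusBdry σ Ω D) : ∃ a : G, a ≠ 1 ∧ localFixer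
    G Ω D p = {1, a} := by
  have h1 : (localFixer G Ω D p).ncard = 2 := by rcases hp with hp | hp <;> exact hp.2.1
  obtain ⟨x, y, hxy, he⟩ := Set.ncard_eq_two.1 h1
  have h2 : (1 : G) ∈ localFixer G Ω D p := ⟨univ, isOpen_univ, mem_univ p, fun q _ => one_smul G q⟩
  rw [he] at h2 ⊢; rcases h2 with rfl | h2
  · exact ⟨y, hxy.symm, rfl⟩
  · have h3 : (1 : G) = y := h2; subst h3; exact ⟨x, hxy, pair_comm _ _⟩

lemma localFixer_smul_eq (hp : p ∈ intBdry Ω D) {a : G} (ha : a ∈ localFixer G Ω D p) : a • p = p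
    := by obtain ⟨U, -, hpU, h⟩ := ha; exact h p ⟨hpU, hp⟩

/-- Points of `∂₊` and `∂₋` are fixed by a nontrivial element, the set of such points of `closure Ω`
is closed because `G` is finite, and `∂₊` and `∂₋` are dense in the interior boundary. -/
lemma intBdry_subset (h : SymP) : intBdry B.dom (P k) ⊆ fixSet G B.dom := by
  have h1 : ∀ p ∈ plusBdry σ B.dom (P k) ∪ minusBdry σ B.dom (P k), p ∈ fixSet G B.dom := by
    intro p hp; obtain ⟨a, ha, hpa⟩ := exists_fixer_of_mem hp
    have hpi : p ∈ intBdry B.dom (P k) := by rcases hp with hp | hp <;> exact hp.1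
    exact ⟨subset_closure hpi.2, a, ha, localFixer_smul_eq hpi (by rw [hpa]; simp)⟩
  refine h.cover.trans (union_subset ?_ ?_)
  · exact closure_minimal (fun p hp => h1 p (Or.inl hp)) h.isClosed_fixSet
  · exact closure_minimal (fun p hp => h1 p (Or.inr hp)) h.isClosed_fixSet

lemma smul_frontier (h : SymP) (a : G) (A : Set M) : frontier (a • A) = a • frontier A := by
  have h1 := frontier_preimage_act h.isAction a⁻¹ A
  rwa [preimage_smul, preimage_smul, inv_inv] at h1

lemma smul_intBdry (h : SymP) (a : G) (A : Set M) : intBdry B.dom (a • A) = a • intBdry B.dom A :=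
    by
  rw [intBdry, intBdry, h.smul_frontier, smul_set_inter, h.admissible.act_dom]

lemma closure_intBdry_subset (h : SymP) (i : Fin n) : closure (intBdry B.dom (P i)) ⊆ fixSet G B.dom
    := by
  obtain ⟨a, ha⟩ := h.partition.transitive k i; refine closure_minimal ?_ h.isClosed_fixSet
  rw [← ha, h.smul_intBdry]; rintro _ ⟨q, hq, rfl⟩; exact h.smul_mem_fixSet a (h.intBdry_subset hq)

lemma surf_frontier_inter_fixSet (h : SymP) : surf d M (frontier B.dom ∩ fixSet G B.dom) = 0 := by
  have : frontier B.dom ∩ fixSet G B.dom ⊆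
      ⋃ a ∈ {a : G | a ≠ 1}, {q ∈ frontier B.dom | a • q = q} := by
    rintro q ⟨hq, -, a, ha, haq⟩; exact mem_iUnion₂.2 ⟨a, ha, hq, haq⟩
  refine measure_mono_null this ((measure_biUnion_null_iff (toFinite _).countable).2 fun a ha => ?_)
  exact surf_frontier_inter_fix h.isAction h.admissible.lipschitz h.connected.isPreconnected
    h.faithful ha

lemma mem_frontier_piece (h : SymP) (hp : p ∈ frontier B.dom) : ∃ i, p ∈ frontier (P i) := by
  have h1 : closure B.dom ⊆ ⋃ i, closure (P i) :=
    closure_minimal h.partition.cover (isClosed_iUnion_of_finite fun _ => isClosed_closure)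
  obtain ⟨i, hi⟩ := mem_iUnion.1 (h1 (frontier_subset_closure hp)); refine ⟨i, ?_⟩
  rw [(h.partition.lipschitz i).isOpen.frontier_eq]; refine ⟨hi, fun hpi => ?_⟩
  rw [h.admissible.lipschitz.isOpen.frontier_eq] at hp; exact hp.2 (h.partition.subset i hpi)

/-- The boundaries of distinct pieces meet `∂Ω` in sets which are disjoint up to fixed points. -/
lemma mem_fixSet_of_mem_frontier (h : SymP) (hp : p ∈ frontier B.dom) {i j : Fin n} (hij : i ≠ j)
    (hi : p ∈ frontier (P i)) (hj : p ∈ frontier (P j)) : p ∈ fixSet G B.dom := by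
  by_contra hpF
  obtain ⟨W, hW, hWs, N', hN', hNW⟩ := h.admissible.lipschitz.exists_connected hp
    (h.isClosed_fixSet.isOpen_compl.mem_nhds hpF)
  -- The connected set `W` avoids all fixed points and hence all interior boundaries, so a piece
  -- that meets `W` contains it. Two different pieces cannot both do so.
  have key : ∀ i, p ∈ frontier (P i) → W ⊆ P i ∧ W.Nonempty := by
    intro i hi; obtain ⟨q, hqN, hqP⟩ := mem_closure_iff_nhds.1 (frontier_subset_closure hi) N' hN'
    have hqW := hNW ⟨h.partition.subset i hqP, hqN⟩
    refine ⟨hW.subset_of_closure_inter_subset (h.partition.lipschitz i).isOpen ⟨q, hqW, hqP⟩ ?_, q, hqW⟩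
    rintro x ⟨hx, hxW⟩; by_contra hxP
    have hxf : x ∈ frontier (P i) := by
      rw [(h.partition.lipschitz i).isOpen.frontier_eq]; exact ⟨hx, hxP⟩
    exact (hWs hxW).2 (h.closure_intBdry_subset i (subset_closure ⟨hxf, (hWs hxW).1⟩))
  obtain ⟨q, hq⟩ := (key i hi).2
  exact disjoint_left.1 (h.partition.disjoint i j hij) ((key i hi).1 hq) ((key j hj).1 hq)

/-- Up to a negligible set, the interior boundary consists of `∂₊` and `∂₋`. -/
lemma surf_intBdry_diff (h : SymP) : surf d M (intBdry B.dom (P k) \ (plusBdry σ B.dom (P k) ∪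
    minusBdry σ B.dom (P k))) = 0 := by
  set E := plusBdry σ B.dom (P k) ∪ minusBdry σ B.dom (P k) with hE
  have hsub : intBdry B.dom (P k) \ E ⊆ ⋃ x ∈ {x : G × G | x.1 ≠ 1 ∧ x.2 ≠ 1 ∧ x.1 ≠ x.2},
      {q ∈ closure B.dom | x.1 • q = q ∧ x.2 • q = q} := by
    rintro p ⟨hp, hpE⟩; have hpc : p ∈ closure E := by rw [hE, closure_union]; exact h.cover hp
    -- the nontrivial elements fixing boundary points near `p`
    choose! f hf1 hf2 using fun (q : M) (hq : q ∈ E) => exists_fixer_of_mem hq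
    have hEi : ∀ q ∈ E, q ∈ intBdry B.dom (P k) := fun q hq => by
      rcases hq with hq | hq <;> exact hq.1
    have hfix : ∀ q ∈ E, f q • q = q := fun q hq =>
      localFixer_smul_eq (hEi q hq) (by rw [hf2 q hq]; simp)
    set A : Set G := {a | p ∈ closure {q ∈ E | f q = a}} with hA
    have hAE : p ∈ ⋃ a : G, closure {q ∈ E | f q = a} := by
      have : closure E ⊆ ⋃ a : G, closure {q ∈ E | f q = a} :=
        closure_minimal (fun q hq => mem_iUnion.2 ⟨f q, subset_closure ⟨hq, rfl⟩⟩)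
          (isClosed_iUnion_of_finite fun _ => isClosed_closure)
      exact this hpc
    obtain ⟨a, ha⟩ := mem_iUnion.1 hAE
    have hAfix : ∀ a ∈ A, a ≠ 1 ∧ a • p = p := by
      intro a ha; obtain ⟨q, -, hq⟩ := mem_closure_iff_nhds.1 ha univ univ_mem
      refine ⟨hq.2 ▸ hf1 q hq.1, ?_⟩
      have hc : IsClosed {q : M | a • q = q} := isClosed_eq (h.isAction.continuous a) continuous_id
      refine closure_minimal ?_ hc ha; rintro q' ⟨hq', hqa⟩; change a • q' = q'; rw [← hqa]
      exact hfix q' hq'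
    -- `A` consists of the elements whose fixed wall points accumulate at `p`. Two such elements
    -- both fix `p`. If there is only one, it is the sole fixer of wall points of `E` near `p`, and
    -- then `p` itself belongs to `E`.
    by_cases hA2 : ∃ b ∈ A, a ≠ b
    · obtain ⟨b, hb, hab⟩ := hA2
      exact mem_iUnion₂.2 ⟨(a, b), ⟨(hAfix a ha).1, (hAfix b hb).1, hab⟩, subset_closure hp.2,
        (hAfix a ha).2, (hAfix b hb).2⟩
    · push Not at hA2
      refine absurd ?_ hpE
      -- near `p` all points of `E` have the fixer `{1, a}`
      have hnear : ∀ᶠ q in 𝓝 p, q ∈ E → f q = a := by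
        have h1 : ∀ b : G, b ≠ a → ∀ᶠ q in 𝓝 p, q ∉ {q ∈ E | f q = b} := by
          intro b hb; by_contra hcon; exact hb (hA2 b (mem_closure_iff_frequently.2 hcon)).symm
        have h2 : ∀ᶠ q in 𝓝 p, ∀ b : G, b ≠ a → q ∉ {q ∈ E | f q = b} :=
          eventually_all.2 fun b => by
            by_cases hb : b = a
            · exact .of_forall fun q hq => absurd hb hq
            · exact (h1 b hb).mono fun q hq _ => hq
        filter_upwards [h2] with q hq hqE; by_contra hne; exact hq (f q) hne ⟨hqE, rfl⟩
      obtain ⟨U, hU, hUo, hpU⟩ := mem_nhds_iff.1 hnear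
      have hfa : a ∈ localFixer G B.dom (P k) p := by
        refine ⟨U, hUo, hpU, fun x hx => ?_⟩
        have hc : IsClosed {q : M | a • q = q} := isClosed_eq (h.isAction.continuous a) continuous_id
        have hxc : x ∈ closure (U ∩ E) := by
          have hxE : x ∈ closure E := by rw [hE, closure_union]; exact h.cover hx.2
          exact hUo.inter_closure ⟨hx.1, hxE⟩
        refine closure_minimal ?_ hc hxc; rintro q ⟨hqU, hqE⟩; have := hU hqU hqE
        exact this ▸ hfix q hqE
      have hloc : localFixer G B.dom (P k) p = {1, a} := by
        refine Subset.antisymm (fun b hb => ?_) ?_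
        · obtain ⟨U', hU', hpU', hb'⟩ := hb
          obtain ⟨q, ⟨hqU, hqU'⟩, hqE⟩ := mem_closure_iff_nhds.1 hpc (U ∩ U')
            ((hUo.inter hU').mem_nhds ⟨hpU, hpU'⟩)
          have hbq : b ∈ localFixer G B.dom (P k) q := ⟨U', hU', hqU', hb'⟩
          rwa [hf2 q hqE, hU hqU hqE] at hbq
        · rintro b (rfl | rfl)
          · exact ⟨univ, isOpen_univ, mem_univ p, fun q _ => one_smul G q⟩
          · exact hfa
      have hcard : (localFixer G B.dom (P k) p).ncard = 2 := by
        rw [hloc, ncard_pair (hAfix a ha).1.symm]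
      have himg : σ '' localFixer G B.dom (P k) p = {1, σ a} := by rw [hloc, image_pair, map_one]
      rcases Int.units_eq_one_or (σ a) with hs | hs
      · exact Or.inl ⟨hp, hcard, by rw [himg, hs, pair_eq_singleton]⟩
      · exact Or.inr ⟨hp, hcard, by rw [himg, hs]⟩
  refine measure_mono_null hsub ((measure_biUnion_null_iff (toFinite _).countable).2 ?_)
  rintro ⟨a, b⟩ ⟨ha, hb, hab⟩
  exact surf_fix_inter_fix h.isAction h.connected.isPreconnected
    h.admissible.lipschitz.subset_interior h.faithful ha hb hab

lemma vol_dom_diff (h : SymP) : ϑ (B.dom \ ⋃ i, P i) = 0 := by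
  refine measure_mono_null (t := ⋃ i, frontier (P i)) ?_ (measure_iUnion_null_iff.2 fun i =>
    vol_frontier_eq_zero (h.partition.lipschitz i))
  rintro q ⟨hq, hqP⟩; obtain ⟨i, hi⟩ := mem_iUnion.1 (h.partition.cover hq)
  refine mem_iUnion.2 ⟨i, ?_⟩; rw [(h.partition.lipschitz i).isOpen.frontier_eq]
  exact ⟨hi, fun hqi => hqP (mem_iUnion.2 ⟨i, hqi⟩)⟩

end Partition

end SymPartition

/-! ### The flux through a Lipschitz boundary -/

section Euclid

variable {v : Eu d} {f : Eu d → ℝ} {K : NNReal} {Ψ : Eu d → ℝ}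

/-- Differentiation under the integral: for `|s| < 1` the derivative is bounded and supported in a
fixed ball. -/
lemma hasDerivAt_integral_translate (hΨ : ContDiff ℝ 1 Ψ) (hc : HasCompactSupport Ψ) (S : Set Є) (e
    : Є) : HasDerivAt (fun s : ℝ => ∫ y in S, Ψ (y + s • e)) (∫ y in S, fderiv ℝ Ψ y e) 0 := by
  obtain ⟨L, hL⟩ := (hΨ.continuous_fderiv one_ne_zero).bounded_above_of_compact_support
    (hc.fderiv (𝕜 := ℝ))
  obtain ⟨r, hr⟩ := hc.isBounded.subset_closedBall (0 : Є)
  have hd : ∀ y s, HasDerivAt (fun s : ℝ => Ψ (y + s • e)) (fderiv ℝ Ψ (y + s • e) e) s := by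
    intro y s
    have h1 : HasDerivAt (fun s : ℝ => y + s • e) e s := by
      simpa using ((hasDerivAt_id s).smul_const e).const_add y
    exact ((hΨ.differentiable one_ne_zero _).hasFDerivAt).comp_hasDerivAt s h1
  have hint : Integrable Ψ := hΨ.continuous.integrable_of_hasCompactSupport hc
  have := (hasDerivAt_integral_of_dominated_loc_of_deriv_le (μ := volume.restrict S)
    (F := fun s y => Ψ (y + s • e)) (F' := fun s y => fderiv ℝ Ψ (y + s • e) e) (x₀ := (0 : ℝ))
    (bound := (closedBall (0 : Є) (r + ‖e‖)).indicator fun _ => L * ‖e‖)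
    (s := ball 0 1) (ball_mem_nhds _ one_pos) (.of_forall fun s =>
      (hΨ.continuous.comp (by fun_prop)).aestronglyMeasurable) (by simpa only [zero_smul, add_zero] using hint.restrict)
    (((hΨ.continuous_fderiv one_ne_zero).comp (by fun_prop)).clm_apply
      continuous_const).aestronglyMeasurable (.of_forall fun y s hs => ?_) ?_
    (.of_forall fun y s _ => hd y s)).2
  · simpa using this
  · by_cases hy : y ∈ closedBall (0 : Є) (r + ‖e‖)
    · rw [indicator_of_mem hy]
      exact ((fderiv ℝ Ψ (y + s • e)).le_opNorm e).trans
        (mul_le_mul_of_nonneg_right (hL _) (norm_nonneg _))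
    · rw [indicator_of_notMem hy]
      have : y + s • e ∉ tsupport Ψ := fun h => by
        refine hy ?_; have h1 := hr h; rw [mem_closedBall_zero_iff] at h1 ⊢
        have h2 : ‖s • e‖ ≤ ‖e‖ := by
          rw [norm_smul]; exact mul_le_of_le_one_left (norm_nonneg _) (mem_ball_zero_iff.1 hs).le
        calc ‖y‖ = ‖(y + s • e) - s • e‖ := by congr 1; abel
          _ ≤ _ := (norm_sub_le _ _).trans (add_le_add h1 h2)
      rw [Function.notMem_support.1 fun h => this (support_fderiv_subset ℝ h)]; simp
  · exact (((integrable_indicator_iff measurableSet_closedBall).2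
      (integrableOn_const (measure_closedBall_lt_top.ne)))).restrict

/-- Integrating a derivative over the region above a Lipschitz graph gives at most a multiple of
the integral over the graph. -/
lemma exists_setIntegral_fderiv_le (hv : ‖v‖ = 1) (hf : LipschitzWith K f) (e : Є) : ∃ c : ℝ≥0∞, c ≠
    ⊤ ∧ ∀ Ψ : Є → ℝ, ContDiff ℝ 1 Ψ → HasCompactSupport Ψ → ‖∫ y in {y | 0 < height v f y}, fderiv ℝ
    Ψ y e‖ₑ ≤ c * ∫⁻ z : Hyp v, ‖Ψ (graphMap v f (z, 0))‖ₑ := by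
  obtain ⟨c, -, hct, hvol⟩ := exists_volume_eq_map hv hf.continuous
  set a : ℝ := (1 + K) * ‖e‖ with ha; have ha0 : 0 ≤ a := by positivity
  refine ⟨c * ofReal (2 * a), mul_ne_top hct ofReal_ne_top, fun Ψ hΨ hc => ?_⟩
  set S : Set Є := {y | 0 < height v f y} with hS; have hhc := continuous_height v hf.continuous
  have hSm : MeasurableSet S := (isOpen_lt continuous_const hhc).measurableSet
  obtain ⟨L, hL⟩ := hΨ.lipschitzWith_of_hasCompactSupport hc one_ne_zero
  obtain ⟨r, hr⟩ := hc.isBounded.subset_closedBall (0 : Є)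
  have hint : Integrable Ψ := hΨ.continuous.integrable_of_hasCompactSupport hc
  set Z : Set (Hyp v) := closedBall 0 r with hZ
  have hproj : ∀ z : Hyp v, ∀ t, ‖(z : Є)‖ ≤ ‖graphMap v f (z, t)‖ := fun z t => by
    have := norm_hypProj_sub_le hv (graphMap v f (z, t)) 0; rw [hypProj_graphMap] at this
    simpa [hypProj] using this
  have hI := hasDerivAt_integral_translate hΨ hc S e
  -- Translating `Ψ` by `s • e` is the same as translating the region. The two regions differ only
  -- in the layer `|height| ≤ a s`, and by Fubini and the Lipschitz bound on `Ψ` the integral over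
  -- this layer is at most a multiple of `s` times the graph integral, up to higher order.
  have key : ∀ s : ℝ, 0 < s → ‖(∫ y in S, Ψ (y + s • e)) - ∫ y in S, Ψ (y + (0 : ℝ) • e)‖ₑ ≤
      ofReal s * (c * ofReal (2 * a) * ((∫⁻ z : Hyp v, ‖Ψ (graphMap v f (z, 0))‖ₑ) +
        ofReal s * (ofReal (L * a) * volume Z))) := by
    intro s hs; set T : Set Є := {y | |height v f y| ≤ a * s} with hT
    have hTm : MeasurableSet T := (isClosed_le hhc.abs continuous_const).measurableSet
    have e1 : ∫ y in S, Ψ (y + s • e) = ∫ y, (S.indicator (fun _ => (1 : ℝ)) (y - s • e)) * Ψ y := by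
      rw [← integral_indicator hSm, ← integral_add_right_eq_self
        (fun y => S.indicator (fun _ => (1 : ℝ)) (y - s • e) * Ψ y) (s • e)]
      refine integral_congr_ae (.of_forall fun y => ?_); by_cases hy : y ∈ S <;> simp [hy]
    have e2 : ∫ y in S, Ψ (y + (0 : ℝ) • e) = ∫ y, (S.indicator (fun _ => (1 : ℝ)) y) * Ψ y := by
      rw [← integral_indicator hSm]; refine integral_congr_ae (.of_forall fun y => ?_)
      by_cases hy : y ∈ S <;> simp [hy]
    have hi1 : Integrable fun y => (S.indicator (fun _ => (1 : ℝ)) (y - s • e)) * Ψ y := by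
      refine hint.bdd_mul (c := 1) ?_ (.of_forall fun y => ?_)
      · exact ((measurable_const.indicator hSm).comp (by fun_prop)).aestronglyMeasurable
      · by_cases hy : y - s • e ∈ S <;> simp [hy]
    have hi2 : Integrable fun y => (S.indicator (fun _ => (1 : ℝ)) y) * Ψ y := by
      refine hint.bdd_mul (c := 1) ((measurable_const.indicator hSm)).aestronglyMeasurable
        (.of_forall fun y => ?_)
      by_cases hy : y ∈ S <;> simp [hy]
    have hpt : ∀ y, ‖(S.indicator (fun _ => (1 : ℝ)) (y - s • e)) * Ψ y -
        (S.indicator (fun _ => (1 : ℝ)) y) * Ψ y‖ₑ ≤ T.indicator (fun y => ‖Ψ y‖ₑ) y := by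
      intro y; have h1 := height_sub_le hv hf y (y - s • e)
      have h2 : (1 + K) * ‖y - (y - s • e)‖ = a * s := by
        rw [sub_sub_cancel, norm_smul, norm_of_nonneg hs.le, ha]; ring
      rw [h2, abs_le] at h1; by_cases hy : y ∈ T
      · rw [indicator_of_mem hy]
        by_cases hy1 : y ∈ S <;> by_cases hy2 : y - s • e ∈ S <;> simp [hy1, hy2]
      · have h3 : y - s • e ∈ S ↔ y ∈ S := by
          simp only [hT, mem_ofPred_eq, not_le, lt_abs] at hy; simp only [hS, mem_ofPred_eq]
          constructor <;> intro h <;> rcases hy with hy | hy <;> nlinarith [mul_nonneg ha0 hs.le]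
        by_cases hy1 : y ∈ S <;> simp [hy1, h3]
    rw [e1, e2, ← integral_sub hi1 hi2]
    refine (enorm_integral_le_lintegral_enorm _).trans ((lintegral_mono hpt).trans ?_)
    have hmeas : Measurable (T.indicator fun y => ‖Ψ y‖ₑ) :=
      (hΨ.continuous.enorm.measurable).indicator hTm
    have hgm := (continuous_graphMap v hf.continuous).measurable
    rw [hvol, lintegral_smul_measure, lintegral_map hmeas hgm,
      lintegral_prod (fun x => T.indicator (fun y => ‖Ψ y‖ₑ) (graphMap v f x))
        (hmeas.comp hgm).aemeasurable, smul_eq_mul]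
    have hin : ∀ z : Hyp v, ∫⁻ t, T.indicator (fun y => ‖Ψ y‖ₑ) (graphMap v f (z, t)) ≤
        ofReal (2 * (a * s)) * (‖Ψ (graphMap v f (z, 0))‖ₑ +
          Z.indicator (fun _ => ofReal (L * (a * s))) z) := by
      intro z
      have h1 : ∀ t, T.indicator (fun y => ‖Ψ y‖ₑ) (graphMap v f (z, t)) ≤
          (Icc (-(a * s)) (a * s)).indicator (fun _ => ‖Ψ (graphMap v f (z, 0))‖ₑ +
          Z.indicator (fun _ => ofReal (L * (a * s))) z) t := by
        intro t; by_cases ht : graphMap v f (z, t) ∈ T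
        · have ht' : |t| ≤ a * s := by simpa [hT, height_graphMap hv] using ht
          rw [indicator_of_mem ht, indicator_of_mem (mem_Icc.2 (abs_le.1 ht'))]; by_cases hz : z ∈ Z
          · rw [indicator_of_mem hz]
            have h2 : ‖Ψ (graphMap v f (z, t))‖ ≤ ‖Ψ (graphMap v f (z, 0))‖ + L * (a * s) := by
              have h3 := hL.dist_le_mul (graphMap v f (z, t)) (graphMap v f (z, 0))
              have h4 : dist (graphMap v f (z, t)) (graphMap v f (z, 0)) = |t| := by
                rw [dist_eq_norm]
                have : graphMap v f (z, t) - graphMap v f (z, 0) = t • v := by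
                  simp only [graphMap, add_zero, add_smul]; abel
                rw [this, norm_smul, hv, mul_one, norm_eq_abs]
              rw [h4, Real.dist_eq] at h3; have h5 := mul_le_mul_of_nonneg_left ht' L.coe_nonneg
              have h6 := abs_sub_abs_le_abs_sub (Ψ (graphMap v f (z, t))) (Ψ (graphMap v f (z, 0)))
              simp only [norm_eq_abs]; linarith
            rw [← ofReal_norm, ← ofReal_norm, ← ENNReal.ofReal_add (norm_nonneg _) (by positivity)]
            exact ofReal_le_ofReal h2
          · have : Ψ (graphMap v f (z, t)) = 0 := by
              by_contra h; have := hr (subset_tsupport _ h); rw [mem_closedBall_zero_iff] at this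
              exact hz (mem_closedBall_zero_iff.2 ((hproj z t).trans this))
            simp [this]
        · rw [indicator_of_notMem ht]; exact zero_le
      refine (lintegral_mono h1).trans ?_
      rw [lintegral_indicator measurableSet_Icc, setLIntegral_const, Real.volume_Icc, mul_comm]
      gcongr; linarith
    have hmz : Measurable fun z : Hyp v => ‖Ψ (graphMap v f (z, 0))‖ₑ :=
      (hΨ.continuous.comp ((continuous_graphMap v hf.continuous).comp (by fun_prop))).enorm.measurable
    refine (mul_le_mul_right (lintegral_mono hin) c).trans (le_of_eq ?_)
    rw [lintegral_ofReal_mul, lintegral_add_left hmz,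
      lintegral_indicator measurableSet_closedBall, setLIntegral_const,
      show 2 * (a * s) = s * (2 * a) by ring, show L * (a * s) = s * (L * a) by ring,
      ofReal_mul hs.le, ofReal_mul hs.le]
    ring
  set A := ∫⁻ z : Hyp v, ‖Ψ (graphMap v f (z, 0))‖ₑ with hA
  have hlim := (hasDerivAt_iff_tendsto_slope_zero.1 hI).mono_left
    (nhdsWithin_mono 0 (fun x hx => ne_of_gt (mem_Ioi.1 hx)) : 𝓝[>] (0 : ℝ) ≤ 𝓝[≠] 0)
  have hB : ofReal (L * a) * volume Z ≠ ⊤ := mul_ne_top ofReal_ne_top measure_closedBall_lt_top.ne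
  have hr : Tendsto (fun s : ℝ => c * ofReal (2 * a) * (A + ofReal s *
      (ofReal (L * a) * volume Z))) (𝓝[>] 0) (𝓝 (c * ofReal (2 * a) * (A + 0))) := by
    refine ENNReal.Tendsto.const_mul (tendsto_const_nhds.add ?_)
      (Or.inr (mul_ne_top hct ofReal_ne_top))
    have h1 : Tendsto (fun s : ℝ => ofReal s) (𝓝[>] 0) (𝓝 0) := by
      rw [← ENNReal.ofReal_zero]
      exact (ENNReal.continuous_ofReal.tendsto 0).mono_left nhdsWithin_le_nhds
    simpa using ENNReal.Tendsto.mul_const h1 (Or.inr hB)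
  rw [add_zero] at hr; refine le_of_tendsto_of_tendsto hlim.enorm hr ?_
  filter_upwards [self_mem_nhdsWithin] with s hs; have hs' : (0 : ℝ) < s := hs
  rw [smul_eq_mul, enorm_mul, zero_add]; refine (mul_le_mul_right (key s hs') _).trans ?_
  rw [← mul_assoc, Real.enorm_eq_ofReal (inv_pos.2 hs').le, ← ofReal_mul (inv_pos.2 hs').le,
    inv_mul_cancel₀ hs'.ne', ofReal_one, one_mul]

end Euclid

/-- `∫_D div (w X)`, the flux of `w X` through the boundary of `D`. -/
def flux (D : Set M) (X : VM) (w : M → ℝ) : ℝ := ∫ p in D, (w p * Dv X p + Df w p (X p)) ∂ϑ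

lemma IsTest.integrable_flux (hX : IsTest Ω X) (hΩ : Ω ⊆ Ξ M) (hw : ContMDiff Υ 𝓘(ℝ) 1 w) (D : Set
    M) : IntegrableOn (fun p => w p * Dv X p + Df w p (X p)) D ϑ :=
  integrable_of_cont ((hw.continuous.mul (continuous_divergence hX.smooth
    (hX.supp.trans hΩ))).add (continuous_dif hX.smooth hw)) D

lemma IsTest.flux_sum (hX : IsTest Ω X) (hΩ : Ω ⊆ Ξ M) {ι : Type*} (t : Finset ι) {w : ι → M → ℝ}
    (hw : ∀ i ∈ t, Ck 1 (w i)) : flux D X (fun p => ∑ i ∈ t, w i p) = ∑ i ∈ t, flux D X (w i) := by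
  unfold flux; rw [← integral_finsetSum _ fun i hi => hX.integrable_flux hΩ (hw i hi) D]; congr 1
  ext p
  rw [sum_add_distrib, ← sum_mul, ← dif_sum fun i hi => (hw i hi).mdifferentiable one_ne_zero p]

lemma flux_mul (hX : SmoothField X) (hw : Ck 1 w) (hη : Ck ∞ η) : flux D X (fun p => η p * w p) =
    flux D (fun p => η p • X p) w := by
  unfold flux; congr 1; ext p
  rw [divergence_smul hX hη, map_smul, smul_eq_mul,
    dif_mul (hη.mdifferentiable (by simp) p) (hw.mdifferentiable one_ne_zero p)]
  ring

lemma flux_eq_zero (h : ∀ p ∈ D, p ∉ closure {p | X p ≠ 0}) : flux D X w = 0 := by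
  refine setIntegral_eq_zero_of_forall_eq_zero fun p hp => ?_; have hp' := h p hp
  have h0 : X p = 0 := by by_contra h0; exact hp' (subset_closure h0)
  simp only [divergence_eq_zero hp', h0, map_zero, mul_zero, add_zero]

/-- In the chart the flux is a sum of integrals of `∂ᵢ Fᵢ` over the region above the graph, and each
is bounded by the integral of `Fᵢ` over the graph. No normal vector or trace of a field is needed.
-/
lemma GraphChart.exists_flux_le {R C : ℝ} {K : NNReal} {v : Є} {f : Є → ℝ} (h : GraphChart D p R C K
    v f) (hD : IsOpen D) (hO : ChB p R ⊆ Ξ M) (hX : IsTest (ChB p R) X) : ∃ c : ℝ≥0∞, c ≠ ⊤ ∧ ∀ w :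
    M → ℝ, Ck 1 w → ‖flux D X w‖ₑ ≤ c * ∫⁻ q in frontier D ∩ ChB p R, ‖w q‖ₑ ∂(surf d M) := by
  choose c hc hcF using fun i : Fin d => exists_setIntegral_fderiv_le h.norm_v h.lip (𝐞 i)
  obtain ⟨b, hb⟩ := exists_bound hX.smooth.continuous_norm; set φ := Γ p with hφ
  set O := ChB p R with hOdef; have hOs : O ⊆ Δ p := chartBall_subset_source
  have hOo : IsOpen O := isOpen_chartBall p R; have hC := h.C_pos
  have hb0 : 0 ≤ b := (norm_nonneg _).trans (hb p); set S : Set Є := {y | 0 < height v f y} with hS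
  have hSm : MeasurableSet S := (isOpen_lt continuous_const h.continuous_height).measurableSet
  refine ⟨∑ i, c i * (ofReal (C * (C * b)) * ofReal C ^ (d - 1)), ?_, fun w hw => ?_⟩
  · exact sum_ne_top.2 fun i _ => mul_ne_top (hc i)
      (mul_ne_top ofReal_ne_top (ENNReal.pow_ne_top ofReal_ne_top))
  obtain ⟨F, hF, hFs, hFeq, hpt⟩ := exists_chartDiv_eq_sum hX.smooth hw (c := p) hOo hO hOs
    (K := closure {q | X q ≠ 0}) isClosed_closure.isCompact hX.supp fun q _ hq =>
      Or.inr (by by_contra h0; exact hq (subset_closure h0))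
  have hK : ∀ i, HasCompactSupport (F i) := fun i =>
    (isClosed_closure.isCompact.image_of_continuousOn ((continuousOn_extChartAt p).mono
      (hX.supp.trans inter_subset_left))).of_isClosed_subset (isClosed_tsupport _) (hFs i)
  have hmem : ∀ i, ∀ y ∈ tsupport (F i), y ∈ ball (φ p) R ∧ y ∈ φ.target ∧ φ.symm y ∈ O := by
    intro i y hy; obtain ⟨q, hq, rfl⟩ := hFs i hy; have hqO := hX.supp hq
    exact ⟨hqO.2, φ.map_source hqO.1, by rw [φ.left_inv hqO.1]; exact hqO⟩
  set A := CS p (D ∩ O) with hA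
  have hAS : A ⊆ S := fun y hy =>
    (h.mem_iff y (GraphChart.mem_of_mem_chartSet inter_subset_right hy).1).1 ⟨hy.1, hy.2.1⟩
  have e1 : flux D X w = ∑ i, ∫ y in S, fderiv ℝ (F i) y (𝐞 i) := by
    have h1 : flux D X w = ∫ q in D ∩ O, (w q * Dv X q + Df w q (X q)) ∂ϑ := by
      refine (setIntegral_eq_of_subset_of_forall_sdiff_eq_zero hD.measurableSet inter_subset_left
        fun q hq => ?_)
      have hq' : q ∉ O := fun h' => hq.2 ⟨hq.1, h'⟩
      rw [hX.eq_zero hq', hX.divergence_eq_zero hq', map_zero, mul_zero, add_zero]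
    have h2 : EqOn (fun q => w q * Dv X q + Df w q (X q))
        (fun q => w q * chartDiv p X q + Df w q (X q)) (D ∩ O) := fun q hq => by
      simp only [chartDiv_eq_divergence hX.smooth (hOs hq.2) (hO hq.2)]
    have hDO := (hD.inter hOo).measurableSet
    rw [h1, setIntegral_congr_fun hDO h2, setIntegral_chart p hDO
      (inter_subset_right.trans inter_subset_left), setIntegral_congr_fun
      (measSet_chartSet p hDO) fun y hy => hpt y ⟨hy.1, hy.2.2⟩, ← integral_finsetSum]
    · refine (setIntegral_eq_of_subset_of_forall_sdiff_eq_zero hSm hAS fun y hy => ?_).symm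
      refine sum_eq_zero fun i _ => ?_
      have hy' : y ∉ tsupport (F i) := fun h' => by
        obtain ⟨hyb, hyt, hyO⟩ := hmem i y h'; exact hy.2 ⟨hyt, ((h.mem_iff y hyb).2 hy.1).2, hyO⟩
      rw [Function.notMem_support.1 fun h => hy' (support_fderiv_subset ℝ h)]; rfl
    · intro i _
      refine (Continuous.integrable_of_hasCompactSupport
        (((hF i).continuous_fderiv one_ne_zero).clm_apply continuous_const) ?_).integrableOn
      exact ((hK i).fderiv (𝕜 := ℝ)).comp_left (g := fun L : Є →L[ℝ] ℝ => L _) (by simp)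
  rw [e1, sum_mul]; refine (enorm_sum_le _ _).trans (sum_le_sum fun i _ => ?_)
  refine (hcF i _ (hF i) (hK i)).trans ?_; rw [mul_assoc, mul_assoc]
  refine mul_le_mul_right ?_ (c i)
  have e2 : ∀ z : Hyp v, ‖F i (graphMap v f (z, 0))‖ₑ ≤ (base p R v f).indicator
      (fun z => ofReal (C * (C * b)) * ‖w (bdryMap p v f z)‖ₑ) z := by
    intro z; by_cases hz : z ∈ base p R v f
    · set y := graphMap v f (z, 0) with hy; have hyt : y ∈ φ.target := h.base_target hz
      have hyO : φ.symm y ∈ O := (h.bdryMap_mem hD hz).2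
      rw [indicator_of_mem hz, hFeq i y ⟨hyt, hyO⟩, enorm_mul, mul_comm]
      refine mul_le_mul_left ?_ _; rw [← ofReal_norm]; refine ofReal_le_ofReal ?_
      have hd := chartDensity_pos hyt; rw [norm_mul, norm_of_nonneg hd.le]
      refine mul_le_mul (h.density y ⟨hz, hyt⟩).1 ?_ (norm_nonneg _) hC.le
      refine (PiLp.norm_apply_le _ i).trans ?_
      have h3 := (h.norm_lift y ⟨hz, hyt⟩ (VC X p (φ.symm y))).2
      rw [vecCoord_eq (hOs hyO), ← hφ, lift_coord (hOs hyO)] at h3; rw [vecCoord_eq (hOs hyO)]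
      have h4 := hb (φ.symm y); rw [norm_norm] at h4
      exact h3.trans (mul_le_mul_of_nonneg_left h4 hC.le)
    · have : F i (graphMap v f (z, 0)) = 0 := by
        by_contra h0; exact hz (hmem i _ (subset_tsupport _ h0)).1
      rw [this, enorm_zero]; exact zero_le
  refine (lintegral_mono e2).trans ?_
  rw [lintegral_indicator h.isOpen_base.measurableSet, lintegral_ofReal_mul]
  refine mul_le_mul_right ?_ _; have e3 := lintegral_mono' (h.le_surf hD) (le_refl fun q => ‖w q‖ₑ)
  rwa [lintegral_map' hw.continuous.enorm.measurable.aemeasurable h.aemeasurable_bdryMap,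
    lintegral_smul_measure, smul_eq_mul] at e3

/-- The flux through the boundary of a Lipschitz subdomain is controlled by the boundary values
inside `Ω`. -/
lemma exists_flux_le (hD : IsLD D) (hΩo : IsOpen Ω) (hΩ : Ω ⊆ Ξ M) (hX : IsTest Ω X) : ∃ c : ℝ≥0∞, c
    ≠ ⊤ ∧ ∀ w : M → ℝ, Ck 1 w → ‖flux D X w‖ₑ ≤ c * ∫⁻ q in frontier D ∩ Ω, ‖w q‖ₑ ∂(surf d M) := by
  have hloc : ∀ p : M, ∃ N : Set M, IsOpen N ∧ p ∈ N ∧ ∀ η : M → ℝ, Ck ∞ η →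
      tsupport η ⊆ N → ∃ c : ℝ≥0∞, c ≠ ⊤ ∧ ∀ w : M → ℝ, Ck 1 w →
        ‖flux D X (fun q => η q * w q)‖ₑ ≤ c * ∫⁻ q in frontier D ∩ Ω, ‖w q‖ₑ ∂(surf d M) := by
    intro p
    have hs : ∀ {η : M → ℝ} {q : M}, q ∈ closure {q | η q • X q ≠ 0} →
        q ∈ tsupport η ∧ q ∈ closure {q | X q ≠ 0} := fun {η q} hq =>
      ⟨closure_mono (fun q (h : η q • X q ≠ 0) (h0 : η q = 0) => h (by rw [h0, zero_smul])) hq,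
        closure_mono (fun q (h : η q • X q ≠ 0) (h0 : X q = 0) => h (by rw [h0, smul_zero])) hq⟩
    -- Locally the flux is zero off the support of `X` and off `closure D`, zero inside `D` by the
    -- divergence theorem, and controlled by the graph estimate at the remaining points, which lie
    -- in `Ω`.
    by_cases hpX : p ∈ closure {q | X q ≠ 0}
    swap
    · refine ⟨_, isClosed_closure.isOpen_compl, hpX, fun η hη hηs => ⟨0, by simp, fun w hw => ?_⟩⟩
      rw [flux_mul hX.smooth hw hη, flux_eq_zero (fun q _ hq => hηs (hs hq).1 (hs hq).2)]; simp
    by_cases hpD : p ∈ D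
    · refine ⟨D, hD.isOpen, hpD, fun η hη hηs => ⟨0, by simp, fun w hw => ?_⟩⟩
      rw [flux_mul hX.smooth hw hη, flux, integral_divergence (d := d) (hX.smooth.smul hη) hw hD.isOpen
        hD.subset_interior fun q hq => hηs (hs hq).1]
      simp
    by_cases hpc : p ∈ closure D
    · obtain ⟨R, C, K, v, f, h, hN⟩ := exists_graphChart hD hpc (hΩo.mem_nhds (hX.supp hpX))
      refine ⟨_, isOpen_chartBall (d := d) p R, mem_chartBall p h.R_pos, fun η hη hηs => ?_⟩
      obtain ⟨c, hc, hcw⟩ := h.exists_flux_le (X := fun q => η q • X q) hD.isOpen (hN.trans hΩ)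
        ⟨hX.smooth.smul hη, fun q hq => hηs (hs hq).1⟩
      refine ⟨c, hc, fun w hw => ?_⟩; rw [flux_mul hX.smooth hw hη]
      exact (hcw w hw).trans (mul_le_mul_right (lintegral_mono_set
        (inter_subset_inter_right _ hN)) c)
    · refine ⟨_, isClosed_closure.isOpen_compl, hpc, fun η hη hηs => ⟨0, by simp, fun w hw => ?_⟩⟩
      rw [flux_mul hX.smooth hw hη, flux_eq_zero (fun q hq hq' =>
        hηs (hs hq').1 (subset_closure hq))]
      simp
  choose N hNo hpN hN using hloc
  obtain ⟨t, η, hη, hηs, -, hsum⟩ := exists_finite_partition (d := d) N hNo hpN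
  choose c hc hcw using fun p => hN p (η p) (hη p) (hηs p)
  refine ⟨∑ p ∈ t, c p, sum_ne_top.2 fun p _ => hc p, fun w hw => ?_⟩
  have e : w = fun q => ∑ p ∈ t, η p q * w q := by ext q; rw [← sum_mul, hsum, one_mul]
  rw [sum_mul]
  conv_lhs => rw [e]
  rw [hX.flux_sum hΩ t (w := fun p q => η p q * w q) fun p _ => ((hη p).of_le one_le_infty).mul hw]
  exact (enorm_sum_le _ _).trans (sum_le_sum fun p _ => hcw p w hw)

/-! ### No flux through the walls of a reflection -/

section Reflection

variable {a : G}

/-- In a chart the derivative of a smooth function along a smooth field is `C¹`, hence locally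
Lipschitz. -/
lemma SmoothField.exists_dif_sub_le (hX : SmoothField X) (hp : p ∈ Ξ M) (hf : Ck ∞ f) : ∃ L : ℝ, 0 ≤
    L ∧ ∃ N ∈ 𝓝 p, ∀ q ∈ N, ∀ q' ∈ N, |Df f q (X q) - Df f q' (X q')| ≤ L * ‖Γ p q - Γ p q'‖ := by
  set φ := Γ p with hφ; set O := Δ p ∩ Ξ M with hO
  have hOo : IsOpen O := (𝓒 p).open_source.inter isOpen_interior_M
  have hpO : p ∈ O := ⟨mem_chart_source _ p, hp⟩; set W := CS p O with hW
  have hWo : IsOpen W := isOpen_chartSet p hOo inter_subset_right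
  have hpW : φ p ∈ W := chart_mem_chartSet hpO hpO.1
  have h1 : ContDiffOn ℝ ∞ (fun y => f (φ.symm y)) W :=
    (contDiffOn_chart_fun le_rfl hf.contMDiffOn).mono inter_subset_left
  have h2 : ContDiffOn ℝ ∞ (fun y => VC X p (φ.symm y)) W :=
    (contDiffOn_chart_fun le_rfl (hX.contMDiffOn_vecCoord p)).mono inter_subset_left
  have h3 : ContDiffOn ℝ 1 (fun y => fderiv ℝ (fun y => f (φ.symm y)) y (VC X p (φ.symm y))) W :=
    (h1.fderiv_of_isOpen (m := 1) hWo (WithTop.coe_le_coe.2 le_top)).clm_apply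
      (h2.of_le one_le_infty)
  obtain ⟨L, t, ht, hL⟩ := (h3.contDiffAt (hWo.mem_nhds hpW)).exists_lipschitzOnWith
  refine ⟨L, L.2, O ∩ φ ⁻¹' t, inter_mem (hOo.mem_nhds hpO)
    ((continuousAt_extChartAt p).preimage_mem_nhds ht), fun q hq q' hq' => ?_⟩
  have key : ∀ q ∈ O, Df f q (X q) = fderiv ℝ (fun y => f (φ.symm y)) (φ q)
      (VC X p (φ.symm (φ q))) := by
    intro q hq
    rw [dif_eq_fderivWithin (hf.mdifferentiable (by simp) q) hq.1, chart_left_inv hq.1,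
      vecCoord_eq hq.1, fderivWithin_of_mem_nhds (range_mem_nhds hOo
        inter_subset_right (chart_mem_chartSet hq hq.1))]
  rw [key q hq.1, key q' hq'.1, ← Real.dist_eq, ← dist_eq_norm]; exact hL.dist_le_mul _ hq.2 _ hq'.2

/-- A smooth function measuring the displacement by an involution, whose derivative along an
invariant field is controlled by the function itself. -/
lemma exists_displacement (h : SA) (ha : a * a = 1) (hX : SmoothField X) (hpull : ∀ q, pull a X q =
    X q) (hp : p ∈ Ξ M) (hfix : a • p = p) : ∃ H : M → ℝ, ContMDiff Υ 𝓘(ℝ) ∞ H ∧ (∀ q, 0 ≤ H q) ∧ ∃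
    C : ℝ, 0 ≤ C ∧ ∀ᶠ q in 𝓝 p, (H q = 0 ↔ a • q = q) ∧ |Df H q (X q)| ≤ C * H q := by
  set φ := Γ p with hφ; set s := Δ p with hs; have hso : IsOpen s := (𝓒 p).open_source
  have hac : Continuous fun q : M => a • q := (h a).continuous; set O := s ∩ ℓ a ⁻¹' s with hO
  have hOo : IsOpen O := hso.inter (hso.preimage hac)
  have hpO : p ∈ O := ⟨mem_chart_source _ p, by rw [mem_preimage, hfix]; exact mem_chart_source _ p⟩
  obtain ⟨χ, hχ, hχs, hχ1, -⟩ := exists_cutoff (d := d) (isClosed_singleton (x := p)) hOo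
    (singleton_subset_iff.2 hpO)
  rw [nhdsSet_singleton] at hχ1; have hφs : ContMDiffOn Υ 𝓘(ℝ, Є) ∞ φ s := contMDiffOn_extChartAt
  have hg : ContMDiffOn Υ 𝓘(ℝ, Є) ∞ (fun q => φ q - φ (a • q)) O :=
    (hφs.mono inter_subset_left).sub (hφs.comp (h a).contMDiffOn fun q hq => hq.2)
  have hgi : ∀ i : Fin d, ContMDiffOn Υ 𝓘(ℝ) ∞ (fun q => χ q * (φ q - φ (a • q)) i) O :=
    fun i => hχ.contMDiffOn.mul
      ((EuclideanSpace.proj (𝕜 := ℝ) i).contDiff.contMDiff.comp_contMDiffOn hg)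
  set F : Fin d → M → ℝ := fun i => O.indicator fun q => χ q * (φ q - φ (a • q)) i with hF
  have hFs : ∀ i, Ck ∞ (F i) := fun i =>
    contMDiff_indicator hOo (isClosed_tsupport χ) hχs (hgi i) fun q _ hq => by
      rw [image_eq_zero_of_notMem_tsupport hq, zero_mul]
  have hF1 : ∀ᶠ q in 𝓝 p, q ∈ O ∧ ∀ i, F i q = (φ q - φ (a • q)) i := by
    filter_upwards [hχ1, hOo.mem_nhds hpO] with q hq hqO; refine ⟨hqO, fun i => ?_⟩
    change O.indicator _ q = _; rw [indicator_of_mem hqO, hq, one_mul]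
  have hta : Tendsto ℓ a (𝓝 p) (𝓝 p) := by simpa only [hfix] using hac.tendsto p
  have hodd : ∀ᶠ q in 𝓝 p, ∀ i, F i (a • q) = 0 - F i q := by
    filter_upwards [hF1, hta.eventually hF1] with q hq hq' i
    rw [hq.2, hq'.2, smul_smul, ha, one_smul, zero_sub, PiLp.sub_apply, PiLp.sub_apply, neg_sub]
  -- The `F i` are the coordinates of the displacement, odd under the involution, and `X` is
  -- invariant, so `dFᵢ(X)` is odd too. It is thus half the difference of its values at `q` and `a •
  -- q`, and the Lipschitz bound estimates it by the displacement.
  have hdodd : ∀ᶠ q in 𝓝 p, ∀ i, Df (F i) (a • q) (X (a • q)) = -Df (F i) q (X q) := by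
    filter_upwards [hodd.eventually_nhds] with q hq i
    have h1 : Ck 1 (F i) := (hFs i).of_le one_le_infty; have h2 := dif_comp_act h a h1 q (X q)
    conv_rhs at h2 => rw [← hpull q, dAct_pull h]
    rw [← h2, dif_congr (hq.mono fun q' h' => h' i), dif_sub (f := fun _ => (0 : ℝ))
      mdifferentiableAt_const (h1.mdifferentiable one_ne_zero q), dif_const, zero_sub]
  choose L hL0 N hN hL using fun i => hX.exists_dif_sub_le hp (hFs i)
  have hNN : ∀ᶠ q in 𝓝 p, ∀ i, q ∈ N i ∧ a • q ∈ N i :=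
    eventually_all.2 fun i => (Filter.Eventually.and (hN i) (hta.eventually (hN i)))
  refine ⟨fun q => ∑ i, F i q * F i q, contMDiff_finsetSum fun i _ => (hFs i).mul (hFs i),
    fun q => sum_nonneg fun i _ => mul_self_nonneg _, ∑ i, L i,
    sum_nonneg fun i _ => hL0 i, ?_⟩
  filter_upwards [hF1, hdodd, hNN] with q hq hqd hqN
  have hsq : ∑ i, F i q * F i q = ‖φ q - φ (a • q)‖ ^ 2 := by
    rw [EuclideanSpace.norm_sq_eq]; refine sum_congr rfl fun i _ => ?_
    rw [hq.2, norm_eq_abs, sq_abs, sq]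
  constructor
  · rw [hsq, sq_eq_zero_iff, norm_eq_zero, sub_eq_zero]; refine ⟨fun h' => ?_, fun h' => by rw [h']⟩
    have h1 := congrArg φ.symm h'
    exact ((chart_left_inv hq.1.1).symm.trans (h1.trans (chart_left_inv hq.1.2))).symm
  · have hb : ∀ i, |Df (F i) q (X q)| ≤ L i / 2 * ‖φ q - φ (a • q)‖ := by
      intro i; have h1 := hL i q (hqN i).1 (a • q) (hqN i).2
      rw [hqd i, sub_neg_eq_add, ← two_mul, abs_mul, abs_two] at h1; linarith
    have hFb : ∀ i, |F i q| ≤ ‖φ q - φ (a • q)‖ := fun i => by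
      rw [hq.2, ← norm_eq_abs]; exact PiLp.norm_apply_le _ i
    rw [hsq, dif_sum (f := fun i q => F i q * F i q) fun i _ =>
      ((hFs i).mul (hFs i)).mdifferentiable (by simp) q, sum_mul]
    refine (abs_sum_le_sum_abs _ _).trans (sum_le_sum fun i _ => ?_)
    have hm := (hFs i).mdifferentiable (by simp) q
    rw [dif_mul hm hm, ← two_mul, abs_mul, abs_mul, abs_two]
    have := mul_le_mul (hFb i) (hb i) (abs_nonneg _) (norm_nonneg _); nlinarith

/-- Multiplying `w` by `θ n = H / (H + 1/(n+1))` removes its boundary values, so the flux vanishes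
for each `n`. Almost every point of `D` is not fixed by `a`; there `θ n` tends to `1` and its
derivative along `X` tends to `0`, with the bound `C` from `|dH(X)| ≤ C H`. Dominated convergence
gives the claim. -/
lemma exists_flux_eq_zero (h : SA) (ha : a * a = 1) (hX : IsTest Ω X) (hpull : ∀ q, pull a X q = X
    q) (hΩo : IsOpen Ω) (hΩ : Ω ⊆ Ξ M) (hp : p ∈ Ω) (hfix : a • p = p) (hD : IsLD D) (hnull : ϑ {q ∈
    D | a • q = q} = 0) : ∃ N : Set M, IsOpen N ∧ p ∈ N ∧ ∀ w : M → ℝ, Ck 1 w → tsupport w ⊆ N → (∀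
    q ∈ frontier D ∩ Ω, w q ≠ 0 → a • q = q) → flux D X w = 0 := by
  obtain ⟨H, hH, hH0, C, hC, hev⟩ := exists_displacement h ha hX.smooth hpull (hΩ hp) hfix
  obtain ⟨N, hN, hNo, hpN⟩ := eventually_nhds_iff.1 hev
  refine ⟨N, hNo, hpN, fun w hw hws hbd => ?_⟩; obtain ⟨c, -, hc⟩ := exists_flux_le hD hΩo hΩ hX
  set θ : ℕ → M → ℝ := fun n q => H q / (H q + 1 / ((n : ℝ) + 1)) with hθ
  have hε : ∀ n : ℕ, (0 : ℝ) < 1 / ((n : ℝ) + 1) := fun n => Nat.one_div_pos_of_nat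
  have hpos : ∀ (n : ℕ) q, 0 < H q + 1 / ((n : ℝ) + 1) := fun n q => add_pos_of_nonneg_of_pos (hH0 q) (hε n)
  have hθs : ∀ n, Ck ∞ (θ n) := fun n => hH.div₀ (hH.add contMDiff_const) fun q => (hpos n q).ne'
  have hθ1 : ∀ n q, θ n q ∈ Icc (0 : ℝ) 1 := fun n q =>
    ⟨div_nonneg (hH0 q) (hpos n q).le, (div_le_one (hpos n q)).2 (le_add_of_nonneg_right (hε n).le)⟩
  have hdθ : ∀ n q, Df (θ n) q (X q) = (1 - θ n q) * Df H q (X q) / (H q + 1 / ((n : ℝ) + 1)) := by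
    intro n q
    have hm1 : MDifferentiableAt Υ 𝓘(ℝ) (fun q => H q - (-(1 / ((n : ℝ) + 1)))) q :=
      (hH.sub contMDiff_const).mdifferentiable (by simp) q
    have h1 := dif_mul hm1 ((hθs n).mdifferentiable (by simp) q) (X q)
    have h2 : (fun q => (H q - (-(1 / ((n : ℝ) + 1)))) * θ n q) = H := by
      ext q; rw [sub_neg_eq_add, hθ]; exact mul_div_cancel₀ _ (hpos n q).ne'
    rw [h2, dif_sub (g := fun _ => (-(1 / ((n : ℝ) + 1)))) (hH.mdifferentiable (by simp) q)
      mdifferentiableAt_const, dif_const, sub_zero, sub_neg_eq_add] at h1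
    rw [eq_div_iff (hpos n q).ne', sub_mul, one_mul]; linarith
  have hdb : ∀ n, ∀ q ∈ N, |Df (θ n) q (X q)| ≤ C := by
    intro n q hq
    rw [hdθ, abs_div, abs_of_pos (hpos n q), div_le_iff₀ (hpos n q), abs_mul,
      abs_of_nonneg (sub_nonneg.2 (hθ1 n q).2)]
    have h1 := (hN q hq).2; have h2 := (hθ1 n q).1
    calc (1 - θ n q) * |Df H q (X q)| ≤ 1 * (C * H q) :=
          mul_le_mul (by linarith) h1 (abs_nonneg _) zero_le_one
      _ ≤ C * (H q + 1 / ((n : ℝ) + 1)) := by rw [one_mul]; gcongr; linarith [hε n]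
  have hθw : ∀ n, Ck 1 (fun q => θ n q * w q) := fun n => ((hθs n).of_le one_le_infty).mul hw
  have hzero : ∀ n, flux D X (fun q => θ n q * w q) = 0 := by
    intro n
    have h1 : ∫⁻ q in frontier D ∩ Ω, ‖θ n q * w q‖ₑ ∂(surf d M) = 0 := by
      refine (setLIntegral_congr_fun (isClosed_frontier.measurableSet.inter hΩo.measurableSet)
        fun q hq => ?_).trans lintegral_zero
      by_cases hwq : w q = 0
      · simp [hwq]
      · have := ((hN q (hws (subset_tsupport w hwq))).1).2 (hbd q hq hwq); simp [hθ, this]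
    have h2 := hc _ (hθw n); rwa [h1, mul_zero, nonpos_iff_eq_zero, enorm_eq_zero] at h2
  have hlim : Tendsto (fun n => flux D X (fun q => θ n q * w q)) atTop (𝓝 (flux D X w)) := by
    refine tendsto_integral_of_dominated_convergence
      (fun q => |w q * Dv X q| + |Df w q (X q)| + |w q| * C)
      (fun n => (hX.integrable_flux hΩ (hθw n) D).1) ?_ (fun n => .of_forall fun q => ?_) ?_
    · exact integrable_of_cont ((((hw.continuous.mul (continuous_divergence hX.smooth
        (hX.supp.trans hΩ))).abs).add (continuous_dif hX.smooth hw).abs).add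
        (hw.continuous.abs.mul continuous_const)) D
    · rw [dif_mul ((hθs n).mdifferentiable (by simp) q) (hw.mdifferentiable one_ne_zero q),
        norm_eq_abs, mul_assoc, ← add_assoc]
      refine (abs_add_le _ _).trans (add_le_add ((abs_add_le _ _).trans (add_le_add ?_ ?_)) ?_)
      · rw [abs_mul, abs_of_nonneg (hθ1 n q).1]
        exact mul_le_of_le_one_left (abs_nonneg _) (hθ1 n q).2
      · rw [abs_mul, abs_of_nonneg (hθ1 n q).1]
        exact mul_le_of_le_one_left (abs_nonneg _) (hθ1 n q).2
      · rw [abs_mul]; by_cases hqN : q ∈ N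
        · exact mul_le_mul_of_nonneg_left (hdb n q hqN) (abs_nonneg _)
        · simp [image_eq_zero_of_notMem_tsupport fun h' => hqN (hws h')]
    · have hae : ∀ᵐ q ∂Λ D, ¬ a • q = q := by
        rw [ae_restrict_iff' hD.isOpen.measurableSet]
        refine measure_mono_null (fun q hq => ?_) hnull
        simp only [mem_compl_iff, mem_ofPred_eq, not_forall, not_not] at hq; exact ⟨hq.1, hq.2⟩
      filter_upwards [hae] with q hq; by_cases hqN : q ∈ N
      · have hHq : 0 < H q := lt_of_le_of_ne (hH0 q) fun h' => hq ((hN q hqN).1.1 h'.symm)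
        have e1 : Tendsto (fun n : ℕ => H q + 1 / ((n : ℝ) + 1)) atTop (𝓝 (H q)) := by
          simpa using tendsto_const_nhds.add (tendsto_one_div_add_atTop_nhds_zero_nat (𝕜 := ℝ))
        have e2 : Tendsto (fun n => θ n q) atTop (𝓝 1) := by
          have := (tendsto_const_nhds (x := H q)).div e1 hHq.ne'; rwa [div_self hHq.ne'] at this
        have e3 : Tendsto (fun n => Df (θ n) q (X q)) atTop (𝓝 0) := by
          simp only [hdθ]
          have := ((tendsto_const_nhds (x := (1 : ℝ)).sub e2).mul_const (Df H q (X q))).div e1 hHq.ne'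
          rwa [sub_self, zero_mul, zero_div] at this
        have e4 : ∀ n, θ n q * w q * Dv X q + Df (fun q => θ n q * w q) q (X q) =
            θ n q * (w q * Dv X q + Df w q (X q)) + w q * Df (θ n) q (X q) := by
          intro n
          rw [dif_mul ((hθs n).mdifferentiable (by simp) q) (hw.mdifferentiable one_ne_zero q)]
          ring
        simp only [e4]; simpa using (e2.mul_const _).add (e3.const_mul (w q))
      · have hq' : q ∉ tsupport w := fun h' => hqN (hws h')
        have h0 : ∀ n, Df (fun q => θ n q * w q) q (X q) = 0 := fun n =>
          dif_eq_zero (fun h' => hq' (tsupport_mul_subset_right h')) _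
        simp [image_eq_zero_of_notMem_tsupport hq', dif_eq_zero hq', h0]
  simp only [hzero] at hlim; exact tendsto_nhds_unique tendsto_const_nhds hlim |>.symm

end Reflection

/-! ### Integration by parts on a piece against equivariant fields -/

namespace SymPartition

variable [Finite G]

lemma dom_interior (h : SymP) : B.dom ⊆ Ξ M := h.admissible.lipschitz.subset_interior

/-- At a point of `∂₊` the nontrivial local fixer is an involution, since its square also fixes the
wall. Its sign is `1`, so it preserves the equivariant field `X`. -/
lemma exists_isOpen_flux_eq_zero (h : SymP) (hX : IsTest B.dom X) (hpull : ∀ a q, pull a X q = ((σ a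
    : ℤ) : ℝ) • X q) (hp : p ∈ plusBdry σ B.dom (P k)) : ∃ N : Set M, IsOpen N ∧ p ∈ N ∧ Disjoint N
    (minusBdry σ B.dom (P k)) ∧ ∀ w : M → ℝ, Ck 1 w → tsupport w ⊆ N → flux (P k) X w = 0 := by
  obtain ⟨a, ha1, ha⟩ := exists_fixer_of_mem (Or.inl hp)
  have hσ : σ a = 1 := by
    have := hp.2.2; rw [ha] at this
    exact mem_singleton_iff.1 (this ▸ mem_image_of_mem σ (mem_insert_of_mem 1 rfl))
  have haf : a ∈ localFixer G B.dom (P k) p := ha ▸ mem_insert_of_mem 1 rfl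
  obtain ⟨U, hUo, hpU, hU⟩ := haf
  have haa : a * a = 1 := by
    have h1 : a * a ∈ localFixer G B.dom (P k) p :=
      ⟨U, hUo, hpU, fun x hx => by rw [mul_smul, hU x hx, hU x hx]⟩
    rw [ha] at h1; rcases h1 with h1 | h1
    · exact h1
    · exact absurd (mul_eq_left.1 h1) ha1
  have hpull' : ∀ q, pull a X q = X q := fun q => by rw [hpull, hσ]; simp
  have hnull : ϑ {q ∈ P k | a • q = q} = 0 := by
    refine measure_mono_null ?_
      (vol_fix_eq_zero h.isAction h.connected.isPreconnected h.dom_interior h.faithful ha1)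
    exact fun q hq => ⟨subset_closure (h.partition.subset k hq.1), hq.2⟩
  obtain ⟨N, hNo, hpN, hN⟩ := exists_flux_eq_zero h.isAction.smooth haa hX hpull'
    h.admissible.lipschitz.isOpen h.dom_interior hp.1.2 (hU p ⟨hpU, hp.1⟩) h.lip hnull
  refine ⟨N ∩ U, hNo.inter hUo, ⟨hpN, hpU⟩, disjoint_left.2 fun q hq hqm => ?_, fun w hw hws =>
    hN w hw (hws.trans inter_subset_left) fun q hq hwq => hU q ⟨(hws (subset_tsupport w hwq)).2, hq⟩⟩
  · obtain ⟨b, -, hb⟩ := exists_fixer_of_mem (Or.inr hqm)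
    have h1 : a ∈ localFixer G B.dom (P k) q := ⟨U, hUo, hq.2, hU⟩; have h2 := hqm.2.2
    rw [hb] at h1 h2; have h3 : a = b := h1.resolve_left ha1
    have h4 : (-1 : ℤˣ) ∈ σ '' {1, b} := by rw [h2]; exact mem_insert_of_mem _ rfl
    obtain ⟨x, rfl | hx, hx1⟩ := h4
    · rw [map_one] at hx1; exact absurd hx1 (by decide)
    · rw [mem_singleton_iff.1 hx, ← h3, hσ] at hx1; exact absurd hx1 (by decide)

/-- For a `σ`-equivariant field, only the boundary values on the minus part matter. -/
lemma exists_flux_le (h : SymP) (hX : IsTest B.dom X) (hpull : ∀ a q, pull a X q = ((σ a : ℤ) : ℝ) •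
    X q) : ∃ c : ℝ≥0∞, c ≠ ⊤ ∧ ∀ w : M → ℝ, Ck 1 w → ‖flux (P k) X w‖ₑ ≤ c * ∫⁻ q in minusBdry σ
    B.dom (P k), ‖w q‖ₑ ∂(surf d M) := by
  obtain ⟨c, hc, hcw⟩ := EquivSpectrum.exists_flux_le h.lip h.admissible.lipschitz.isOpen
    h.dom_interior hX
  refine ⟨c, hc, fun w hw => ?_⟩; set m := minusBdry σ B.dom (P k) with hm
  set I := frontier (P k) ∩ B.dom with hI
  have hfin : surf d M I < ⊤ := (measure_mono inter_subset_left).trans_lt (surf_frontier_lt_top h.lip)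
  have hIm : MeasurableSet I :=
    isClosed_frontier.measurableSet.inter h.admissible.lipschitz.isOpen.measurableSet
  choose! N hNo hpN hNm hN using fun p (hp : p ∈ plusBdry σ B.dom (P k)) =>
    h.exists_isOpen_flux_eq_zero hX hpull hp
  set V := ⋃ p ∈ plusBdry σ B.dom (P k), N p with hV
  have hVo : IsOpen V := isOpen_biUnion fun p hp => hNo p hp
  have hmeas : Measurable fun q => ‖w q‖ₑ := hw.continuous.enorm.measurable
  -- The finite measure `|w| dS` on the interior boundary. Off the neighbourhoods making up `V` it
  -- charges only the minus part, the rest of the wall being null.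
  set ν : Measure M := (𝓢 I).withDensity fun q => ‖w q‖ₑ with hν
  have hνV : ν Vᶜ ≤ ∫⁻ q in m, ‖w q‖ₑ ∂(surf d M) := by
    rw [hν, withDensity_apply _ hVo.isClosed_compl.measurableSet,
      restrict_restrict hVo.isClosed_compl.measurableSet]
    refine lintegral_mono_set' ?_; have h0 := h.surf_intBdry_diff
    filter_upwards [measure_eq_zero_iff_ae_notMem.1 h0] with q hq hq'; by_contra hqm
    refine hq ⟨hq'.2, fun h' => h'.elim (fun h' => hq'.1 ?_) hqm⟩; exact mem_biUnion h' (hpN q h')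
  obtain ⟨b, hb⟩ := exists_bound hw.continuous
  have hνfin : IsFiniteMeasure ν := by
    refine isFiniteMeasure_withDensity (ne_top_of_le_ne_top (b := ofReal b * surf d M I) ?_ ?_)
    · exact mul_ne_top ofReal_ne_top hfin.ne
    · rw [← setLIntegral_const]; refine lintegral_mono fun q => ?_; rw [← ofReal_norm]
      exact ofReal_le_ofReal (hb q)
  -- The members of a partition of unity supported near `∂₊` carry no flux and are discarded. What
  -- remains of `w` vanishes off `U`, and the general flux bound applies to it.
  have key : ∀ U : Set M, IsOpen U → Vᶜ ⊆ U → ‖flux (P k) X w‖ₑ ≤ c * ν U := by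
    intro U hU hVU
    have hex : ∀ p : M, ∃ O : Set M, IsOpen O ∧ p ∈ O ∧ (O ⊆ U ∨ ∀ w : M → ℝ,
        Ck 1 w → tsupport w ⊆ O → flux (P k) X w = 0) := by
      intro p; by_cases hp : p ∈ V
      · obtain ⟨p', hp', hpp⟩ := mem_iUnion₂.1 hp; exact ⟨N p', hNo p' hp', hpp, Or.inr (hN p' hp')⟩
      · exact ⟨U, hU, hVU hp, Or.inl Subset.rfl⟩
    choose O hOo hpO hO using hex
    obtain ⟨t, η, hη, hηs, hη0, hsum⟩ := exists_finite_partition (d := d) O hOo hpO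
    have hηw : ∀ p, Ck 1 fun q => η p q * w q := fun p => ((hη p).of_le one_le_infty).mul hw
    classical
    set t' := t.filter fun p => O p ⊆ U with ht'
    have e1 : flux (P k) X w = flux (P k) X fun q => ∑ p ∈ t', η p q * w q := by
      have e : w = fun q => ∑ p ∈ t, η p q * w q := by ext q; rw [← sum_mul, hsum, one_mul]
      conv_lhs => rw [e]
      rw [hX.flux_sum h.dom_interior t (w := fun p q => η p q * w q) fun p _ => hηw p,
        hX.flux_sum h.dom_interior t' (w := fun p q => η p q * w q) fun p _ => hηw p]
      refine (Finset.sum_subset (Finset.filter_subset _ t) fun p hp hp' => ?_).symm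
      exact ((hO p).resolve_left fun h' => hp' (Finset.mem_filter.2 ⟨hp, h'⟩)) _ (hηw p)
        (tsupport_mul_subset_left.trans (hηs p))
    rw [e1]; refine (hcw _ (contMDiff_finsetSum fun p _ => hηw p)).trans (mul_le_mul_right ?_ c)
    rw [hν, withDensity_apply _ hU.measurableSet, ← lintegral_indicator hU.measurableSet]
    refine lintegral_mono fun q => ?_; dsimp only; by_cases hq : q ∈ U
    · rw [indicator_of_mem hq, ← sum_mul, enorm_mul]; refine mul_le_of_le_one_left zero_le ?_
      rw [Real.enorm_eq_ofReal (sum_nonneg fun p _ => hη0 p q), ENNReal.ofReal_le_one, ← hsum q]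
      exact Finset.sum_le_sum_of_subset_of_nonneg (Finset.filter_subset _ t) fun p _ _ => hη0 p q
    · rw [sum_eq_zero fun p hp => ?_, enorm_zero]
      · exact zero_le
      · rw [image_eq_zero_of_notMem_tsupport fun h' =>
          hq ((Finset.mem_filter.1 hp).2 (hηs p h')), zero_mul]
  -- Outer regularity of `ν` shrinks `U` to the complement of `V`.
  refine ENNReal.le_of_forall_pos_le_add fun ε hε _ => ?_
  have hε' : (ε : ℝ≥0∞) / c ≠ 0 := (ENNReal.div_pos (by exact_mod_cast hε.ne') hc).ne'
  obtain ⟨U, hVU, hU, hUν⟩ := Vᶜ.exists_isOpen_le_add ν hε'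
  calc ‖flux (P k) X w‖ₑ ≤ c * ν U := key U hU hVU
    _ ≤ c * (∫⁻ q in m, ‖w q‖ₑ ∂(surf d M) + ε / c) :=
      mul_le_mul_right (hUν.trans (add_le_add_left hνV _)) c
    _ ≤ _ := by rw [mul_add]; gcongr; exact ENNReal.mul_div_le

/-- Functions with vanishing trace on the minus part can be integrated by parts against
`σ`-equivariant fields which do not vanish on the interior boundary. -/
lemma integral_inner_eq (h : SymP) (hX : IsTest B.dom X) (hpull : ∀ a q, pull a X q = ((σ a : ℤ) :
    ℝ) • X q) (hv : MemLp v 2 (Λ (P k))) (hV : IsWG (P k) v V) (hτ : Tr (P k) v τ) (h0 : τ =ᵐ[𝓢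
    (minusBdry σ B.dom (P k))] 0) : ∫ p in P k, inner ℝ (X p) (V p) ∂ϑ = -∫ p in P k, v p * Dv X p
    ∂ϑ := by
  obtain ⟨c, hc, hcw⟩ := h.exists_flux_le hX hpull; obtain ⟨-, w, W, hw, hwt⟩ := isTrace_iff.1 hτ
  have hDo := h.lip.isOpen; have hDm := hDo.measurableSet; have hDi := h.lip.subset_interior
  have := finite_vol (d := d) (M := M); have := isFiniteMeasure_surf_frontier h.lip
  have hdiv : Continuous (Dv X) := continuous_divergence hX.smooth (hX.supp.trans h.dom_interior)
  have hiv : IntegrableOn (fun p => v p * Dv X p) (P k) ϑ :=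
    (memLp_one_iff_integrable.1 ((memLp_mul_of_cont hdiv hv).mono_exponent one_le_two)).congr
      (.of_forall fun p => mul_comm _ _)
  have hiV := IsTest.integrable_inner hDm hX.smooth hV.measField hV.memLp
  have hivV : IntegrableOn (fun p => v p * Dv X p + inner ℝ (X p) (V p)) (P k) ϑ := hiv.add hiV
  obtain ⟨b, hb⟩ := exists_bound hdiv; obtain ⟨b', hb'⟩ := exists_bound hX.smooth.continuous_norm
  -- On a finite measure space convergence in `L²` implies convergence in `L¹`, the norm in which
  -- fluxes are bounded.
  have hL1 : ∀ {α : Type _} [MeasurableSpace α] (μ : Measure α) [IsFiniteMeasure μ] (f : ℕ → α → ℝ)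
      (C : ℝ≥0∞), C ≠ ⊤ → (∀ j, AEStronglyMeasurable (f j) μ) →
      Tendsto (fun j => eLpNorm (f j) 2 μ) atTop (𝓝 0) →
      Tendsto (fun j => C * ∫⁻ x, ‖f j x‖ₑ ∂μ) atTop (𝓝 0) := by
    intro α _ μ _ f C hC hf ht
    have h1 : Tendsto (fun j => C * (eLpNorm (f j) 2 μ * μ univ ^ (1 / (1 : ℝ≥0∞).toReal -
        1 / (2 : ℝ≥0∞).toReal))) atTop (𝓝 (C * (0 * μ univ ^ (1 / (1 : ℝ≥0∞).toReal -
        1 / (2 : ℝ≥0∞).toReal)))) :=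
      ENNReal.Tendsto.const_mul (ENNReal.Tendsto.mul_const ht (Or.inr
        (ENNReal.rpow_ne_top_of_nonneg (by norm_num) (measure_ne_top _ _)))) (Or.inr hC)
    rw [zero_mul, mul_zero] at h1; refine squeeze h1 fun j => mul_le_mul_right ?_ C
    rw [← eLpNorm_one_eq_lintegral_enorm]
    exact eLpNorm_le_eLpNorm_mul_rpow_measure_univ one_le_two (hf j)
  have hwv : ∀ j, MemLp (w j) 2 (Λ (P k)) := fun j =>
    memLp_of_cont (hw.contMDiff j).continuous 2 _
  -- the fluxes of the approximating functions tend to zero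
  have t1 : Tendsto (fun j => ‖flux (P k) X (w j)‖ₑ) atTop (𝓝 0) := by
    refine squeeze (hL1 (𝓢 (frontier (P k))) (fun j q => w j q - τ q) c hc (fun j =>
        (hw.contMDiff j).continuous.aestronglyMeasurable.sub hτ.1.1) hwt)
      fun j => (hcw _ (hw.contMDiff j)).trans (mul_le_mul_right ?_ c)
    calc ∫⁻ q in minusBdry σ B.dom (P k), ‖w j q‖ₑ ∂(surf d M)
        = ∫⁻ q in minusBdry σ B.dom (P k), ‖w j q - τ q‖ₑ ∂(surf d M) := by
          refine lintegral_congr_ae ?_; filter_upwards [h0] with q hq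
          rw [hq, Pi.zero_apply, sub_zero]
      _ ≤ _ := lintegral_mono_set fun q hq => hq.1.1
  have t2 : Tendsto (fun j => ofReal b * ∫⁻ q in P k, ‖w j q - v q‖ₑ ∂ϑ) atTop (𝓝 0) :=
    hL1 (Λ (P k)) (fun j q => w j q - v q) _ ofReal_ne_top (fun j => ((hwv j).sub hv).1) hw.tendsto
  have t3 : Tendsto (fun j => ofReal b' * ∫⁻ q in P k, ‖‖W j q‖‖ₑ ∂ϑ) atTop (𝓝 0) :=
    hL1 (Λ (P k)) (fun j q => ‖W j q‖) _ ofReal_ne_top (fun j =>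
      (hw.isWeakGradient j).memLp.1) hw.tendsto_grad
  have hle : ∀ j, ‖∫ p in P k, (v p * Dv X p + inner ℝ (X p) (V p)) ∂ϑ‖ₑ ≤
      ‖flux (P k) X (w j)‖ₑ + (ofReal b * ∫⁻ q in P k, ‖w j q - v q‖ₑ ∂ϑ +
        ofReal b' * ∫⁻ q in P k, ‖‖W j q‖‖ₑ ∂ϑ) := by
    intro j; have hg := isWeakGradient_grad hDo hDi (hw.contMDiff j)
    have hu := IsWeakGradient.unique hDo (hw.isWeakGradient j) (hg.sub hDo hDi (hwv j) hv hV)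
    have e1 : ∫ p in P k, (v p * Dv X p + inner ℝ (X p) (V p)) ∂ϑ =
        flux (P k) X (w j) - ∫ p in P k, ((w j p - v p) * Dv X p + inner ℝ (X p) (W j p)) ∂ϑ := by
      rw [eq_sub_iff_add_eq, flux, ← integral_add hivV]
      · refine integral_congr_ae ?_; filter_upwards [hu] with p hp
        rw [hp, inner_sub_right, inner_grad]; ring
      · refine ((hX.integrable_flux h.dom_interior (hw.contMDiff j) (P k)).sub (hiv.add hiV)).congr ?_
        filter_upwards [hu] with p hp
        simp only [hp, inner_sub_right, inner_grad, Pi.add_apply, Pi.sub_apply]; ring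
    rw [e1]
    refine (enorm_sub_le).trans (add_le_add_right ((enorm_integral_le_lintegral_enorm _).trans ?_) _)
    rw [← lintegral_ofReal_mul, ← lintegral_const_mul' _ _ ofReal_ne_top, ← lintegral_add_left'
      (f := fun q => ofReal b * ‖w j q - v q‖ₑ) (((hwv j).sub hv).1.enorm.const_mul _)]
    refine lintegral_mono fun p => (enorm_add_le _ _).trans (add_le_add ?_ ?_)
    · rw [enorm_mul, mul_comm, ← ofReal_norm (Dv X p)]
      exact mul_le_mul_left (ofReal_le_ofReal (hb p)) _
    · rw [enorm_norm, ← ofReal_norm, ← ofReal_norm, ← ofReal_mul ((norm_nonneg _).trans (hb' p))]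
      refine ofReal_le_ofReal ((norm_inner_le_norm _ _).trans
        (mul_le_mul_of_nonneg_right ?_ (norm_nonneg _)))
      have := hb' p; rwa [norm_norm] at this
  have hz := ge_of_tendsto' (t1.add (t2.add t3)) hle
  simp only [add_zero, nonpos_iff_eq_zero, enorm_eq_zero] at hz; rw [integral_add hiv hiV] at hz
  linarith

end SymPartition

/-! ### Symmetrization over the group -/

section Symm

/-- The sign `σ(a)` as a real number. -/
def sgn (σ : G →* ℤˣ) (a : G) : ℝ := ((σ a : ℤ) : ℝ)

lemma sgn_mul (a b : G) : sgn σ (a * b) = sgn σ a * sgn σ b := by simp [sgn]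

lemma sgn_mul_self (a : G) : sgn σ a * sgn σ a = 1 := by
  unfold sgn; rcases Int.units_eq_one_or (σ a) with h | h <;> simp [h]

lemma sgn_inv (a : G) : sgn σ a⁻¹ = sgn σ a := by unfold sgn; rw [map_inv, Int.units_inv_eq_self]

variable [Fintype G]

/-- The sum of the translates of `u`, with signs. -/
def symm (σ : G →* ℤˣ) (u : M → ℝ) (p : M) : ℝ := ∑ a, sgn σ a * u (a • p)

/-- The sum of the translates of the field `V`, with signs. -/
def symmField (σ : G →* ℤˣ) (V : VM) (p : M) : 𝓣 p := ∑ a, sgn σ a • pull a V p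

lemma symm_smul (b : G) (p : M) : symm σ u (b • p) = sgn σ b * symm σ u p := by
  unfold symm; rw [← Equiv.sum_comp (Equiv.mulRight b⁻¹), mul_sum]
  refine sum_congr rfl fun a _ => ?_
  rw [Equiv.coe_mulRight, sgn_mul, sgn_inv, smul_smul, inv_mul_cancel_right]; ring

lemma pull_symmField (h : SA) (b : G) (p : M) : pull b (symmField σ V) p = sgn σ b • symmField σ V p
    := by
  refine dAct_injective h b p ?_; rw [dAct_pull h]; unfold symmField
  rw [← Equiv.sum_comp (Equiv.mulRight b⁻¹), Finset.smul_sum, map_sum]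
  refine sum_congr rfl fun a _ => ?_; have h1 := dAct_pull h b (pull (a * b⁻¹) V) p
  rw [pull_pull h, inv_mul_cancel_right] at h1
  rw [Equiv.coe_mulRight, sgn_mul, sgn_inv, map_smul, map_smul, h1, smul_smul, mul_comm]

/-- The set `A` is invariant under the group. -/
def InvSet (G : Type*) [Group G] [MulAction G M] (A : Set M) : Prop := ∀ a : G, ℓ a ⁻¹' A = A

lemma invSet_of_smul (h : ∀ a : G, a • A = A) : InvSet G A := fun a => by rw [preimage_smul, h]

lemma memLp_symm (h : Iso) {m : ℕ} (hA : A ⊆ closure Ω) (hAi : InvSet G A) (hu : MemLp u 2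
    (μHE[m].restrict A)) : MemLp (symm σ u) 2 (μHE[m].restrict A) := by
  refine memLp_finsetSum _ fun a _ => ?_; have := h.memLp_comp m a hA hu; rw [hAi a] at this
  exact this.const_mul _

lemma integral_comp_act (h : Iso) {m : ℕ} (hA : A ⊆ closure Ω) (hAi : InvSet G A) (f : M → ℝ) (a :
    G) : ∫ p in A, f (a • p) ∂(μHE[m] : Measure M) = ∫ p in A, f p ∂(μHE[m] : Measure M)
    := by rw [← h.setIntegral_comp m a hA f, hAi a]

/-- Symmetrization is self-adjoint: change variables by `a` in each summand and reindex by
inversion, which leaves the signs unchanged. -/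
lemma integral_symm_mul (h : Iso) {m : ℕ} (hA : A ⊆ closure Ω) (hAi : InvSet G A) (hu : MemLp u 2
    (μHE[m].restrict A)) (hf : MemLp f 2 (μHE[m].restrict A)) : ∫ p in A, symm σ u p * f p ∂(μHE[m]
    : Measure M) = ∫ p in A, u p * symm σ f p ∂(μHE[m] : Measure M) := by
  have hc : ∀ {u : M → ℝ}, MemLp u 2 (μHE[m].restrict A) → ∀ a : G,
      MemLp (fun p => u (a • p)) 2 (μHE[m].restrict A) := fun {u} hu a => by
    have := h.memLp_comp m a hA hu; rwa [hAi a] at this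
  simp only [symm, sum_mul, mul_sum]
  rw [integral_finsetSum _ fun a _ => ?_, integral_finsetSum _ fun a _ => ?_,
    ← Equiv.sum_comp (Equiv.inv G)]
  · refine sum_congr rfl fun a _ => ?_; rw [← integral_comp_act h hA hAi _ a]
    simp only [Equiv.inv_apply, sgn_inv, inv_smul_smul]; congr 1; ext p; ring
  · exact hu.integrable_mul ((hc hf a).const_mul _)
  · exact ((hc hu a).const_mul _).integrable_mul hf

lemma measField_symmField (h : Iso) (hV : MF Ω V) : MF Ω (symmField σ V) := by
  have hΩ := h.isOpen; have hi : InvSet G Ω := invSet_of_smul h.dom; unfold symmField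
  induction (Finset.univ : Finset G) using Finset.cons_induction with
  | empty => simp only [Finset.sum_empty]; exact isWeakGradient_zero.measField
  | cons a t ha ih =>
    simp only [Finset.sum_cons]; have h1 := h.measField_pull a hΩ Subset.rfl hV; rw [hi a] at h1
    exact (MeasField.smul hΩ.measurableSet h1 aestronglyMeasurable_const).add hΩ.measurableSet ih

lemma memLp_norm_pull (h : Iso) (hV : MemLp (fun p => ‖V p‖) 2 (Λ Ω)) (a : G) : MemLp (fun p =>
    ‖pull a V p‖) 2 Λ Ω := by
  have h1 := h.memLp_comp d a subset_closure hV; rw [invSet_of_smul h.dom a] at h1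
  refine (memLp_congr_ae ?_).1 h1; filter_upwards [ae_restrict_mem h.isOpen.measurableSet] with p hp
  rw [h.norm_pull a V (subset_closure hp)]

lemma memLp_norm_symmField (h : Iso) (hV : MF Ω V) (hV2 : MemLp (fun p => ‖V p‖) 2 Λ Ω) : MemLp (fun
    p => ‖symmField σ V p‖) 2 (Λ Ω) := by
  refine (memLp_finsetSum (f := fun a p => ‖sgn σ a‖ * ‖pull a V p‖) Finset.univ fun a _ =>
    (memLp_norm_pull h hV2 a).const_mul _).mono' ((measField_symmField h hV).norm
      h.isOpen.measurableSet) (.of_forall fun p => ?_)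
  rw [norm_norm]; exact (norm_sum_le _ _).trans (sum_le_sum fun a _ => (norm_smul _ _).le)

/-- The analogue for fields, where the isometry property moves the pullback from one factor of the
inner product to the other. -/
lemma integral_inner_symmField (h : Iso) (hV : MF Ω V) (hW : MF Ω W) (hV2 : MemLp (fun p => ‖V p‖) 2
    Λ Ω) (hW2 : MemLp (fun p => ‖W p‖) 2 Λ Ω) : ∫ p in Ω, inner ℝ (symmField σ V p) (W p) ∂ϑ = ∫ p
    in Ω, inner ℝ (V p) (symmField σ W p) ∂ϑ := by
  have hm := h.isOpen.measurableSet; have hi : InvSet G Ω := invSet_of_smul h.dom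
  have hpm : ∀ {V : VM}, MF Ω V → ∀ a : G, MF Ω (pull a V) := fun {V} hV a => by
    have := h.measField_pull a h.isOpen Subset.rfl hV; rwa [hi a] at this
  simp only [symmField, sum_inner, inner_sum, inner_smul_left, inner_smul_right]
  rw [integral_finsetSum _ fun a _ => ?_, integral_finsetSum _ fun a _ => ?_,
    ← Equiv.sum_comp (Equiv.inv G)]
  · refine sum_congr rfl fun a _ => ?_; rw [integral_const_mul, integral_const_mul]
    have h1 : ∫ p in Ω, inner ℝ (pull a⁻¹ V p) (W p) ∂ϑ =
        ∫ p in Ω, inner ℝ (V p) (pull a W p) ∂ϑ := by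
      rw [← integral_comp_act h subset_closure hi _ a]
      refine setIntegral_congr_fun hm fun p hp => ?_
      rw [← h.inner_pull_pull a _ _ (subset_closure hp), pull_pull h.smooth, inv_mul_cancel,
        pull_one h.smooth]
    rw [Equiv.inv_apply, h1, sgn_inv]; rfl
  · exact (integrable_inner hm hV (hpm hW a) hV2 (memLp_norm_pull h hW2 a)).const_mul _
  · exact (integrable_inner hm (hpm hV a) hW (memLp_norm_pull h hV2 a) hW2).const_mul _

lemma isTest_symmField (h : SA) (hi : InvSet G Ω) (hX : IsTest Ω X) : IsTest Ω (symmField σ X) := by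
  have hp : ∀ a : G, IsTest Ω (pull a X) := fun a => by
    have := isTest_pull h a hX; rwa [hi a] at this
  constructor
  · have : ∀ t : Finset G, SmoothField fun p => ∑ a ∈ t, sgn σ a • pull a X p := fun t => by
      induction t using Finset.cons_induction with
      | empty => simpa using SmoothField.smul (hX.smooth) (f := fun _ => 0) contMDiff_const
      | cons a t ha ih =>
        simp only [Finset.sum_cons]; exact ((hp a).smooth.smul contMDiff_const).add ih
    exact this Finset.univ
  · refine (closure_mono (t := ⋃ a : G, {p | pull a X p ≠ 0}) fun p hp' => ?_).trans ?_
    · by_contra h0; simp only [mem_iUnion, not_exists, mem_ofPred_eq, not_not] at h0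
      exact hp' (sum_eq_zero fun a _ => by rw [h0 a, smul_zero])
    · rw [closure_iUnion_of_finite]; exact iUnion_subset fun a => (hp a).supp

lemma divergence_symmField (h : Iso) (hΩ : Ω ⊆ Ξ M) (hX : SmoothField X) (hp : p ∈ Ω) : Dv
    (symmField σ X) p = symm σ (Dv X) p := by
  have : ∀ t : Finset G, (SmoothField fun p => ∑ a ∈ t, sgn σ a • pull a X p) ∧
      Dv (fun p => ∑ a ∈ t, sgn σ a • pull a X p) p = ∑ a ∈ t, sgn σ a * Dv X (a • p) := fun t => by
    induction t using Finset.cons_induction with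
    | empty =>
      simp only [Finset.sum_empty]
      exact ⟨by simpa using SmoothField.smul hX (f := fun _ => 0) contMDiff_const, divergence_zero p⟩
    | cons a t ha ih =>
      simp only [Finset.sum_cons]
      have h1 : SmoothField (pull a X) := SmoothField.pull h.smooth a hX
      have h2 : SmoothField fun p => sgn σ a • pull a X p := h1.smul contMDiff_const
      refine ⟨h2.add ih.1, ?_⟩
      rw [divergence_add h2 ih.1, ih.2, divergence_smul h1 contMDiff_const, dif_const, add_zero,
        h.divergence_pull hΩ a hX hp]
  exact (this Finset.univ).2

end Symm

/-! ### Symmetrization of weak gradients, traces and approximations -/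

section Symm

variable {τ' : M → ℝ}

lemma InvSet.ae_comp (hAi : InvSet G A) (h : Iso) {m : ℕ} (hA : A ⊆ closure Ω) {p : M → Prop} (hp :
    ∀ᵐ q ∂(μHE[m] : Measure M).restrict A, p q) (a : G) : ∀ᵐ q ∂(μHE[m] : Measure M).restrict A, p
    (a • q) := by
  have := (h.mpres_preimage m a hA).quasiMeasurePreserving.ae hp; rwa [hAi a] at this

/-- The field `V` on `D`, extended by zero. -/
def indField (D : Set M) (V : VM) (p : M) : 𝓣 p := D.indicator (fun _ => (1 : ℝ)) p • V p

lemma indField_of_mem (hp : p ∈ D) : indField D V p = V p := by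
  rw [indField, indicator_of_mem hp, one_smul]

lemma indField_of_notMem (hp : p ∉ D) : indField D V p = 0 := by
  rw [indField, indicator_of_notMem hp, zero_smul]

lemma memLp_indicator_sub {m : ℕ} (hA : MeasurableSet A) (hf : MemLp f 2 (μHE[m].restrict A)) (E :
    Set M) : MemLp (A.indicator f) 2 (μHE[m].restrict E) :=
  ((memLp_indicator_iff_restrict hA).2 hf).restrict E

lemma memLp_norm_indField (hD : MeasurableSet D) (hV2 : MemLp (fun p => ‖V p‖) 2 (Λ D)) (E : Set M)
    : MemLp (fun p => ‖indField D V p‖) 2 Λ E := by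
  convert memLp_indicator_sub hD hV2 E using 2 with p
  by_cases hp : p ∈ D
  · rw [indField_of_mem hp, indicator_of_mem hp]
  · rw [indField_of_notMem hp, indicator_of_notMem hp, norm_zero]

lemma measField_indField (hD : MeasurableSet D) (hV : MF D V) (E : Set M) : MF E (indField D V) :=
    by
  intro c
  have h1 : AEStronglyMeasurable (D.indicator (VC V c))
      (Λ Δ c) := by rw [aestronglyMeasurable_indicator_iff hD, restrict_restrict hD]; exact hV c
  refine (h1.mono_measure (restrict_mono inter_subset_right le_rfl)).congr ?_
  have hs := (𝓒 c).open_source.measurableSet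
  filter_upwards [ae_mono (restrict_mono inter_subset_right le_rfl) (ae_restrict_mem hs)] with p hp
  rw [vecCoord_eq hp]; by_cases hpD : p ∈ D
  · rw [indicator_of_mem hpD, indField_of_mem hpD, vecCoord_eq hp]
  · rw [indicator_of_notMem hpD, indField_of_notMem hpD, map_zero]

/-- The traces on the boundaries of a domain and of a subdomain agree on the common part. -/
lemma IsTrace.eq_of_subset (hD : IsLD D) (hΩ : IsOpen Ω) (hDΩ : D ⊆ Ω) (hu : MemLp u 2 Λ D) (h : Tr
    Ω u τ) (h' : Tr D u τ') : τ =ᵐ[(surf d M).restrict (frontier D ∩ frontier Ω)] τ' := by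
  obtain ⟨hτ, w, W, hw, hwt⟩ := isTrace_iff.1 h
  -- The same `C¹` functions approximate `u` on `Ω` and on `D`, so on the common boundary both
  -- traces are limits of one sequence.
  obtain ⟨τ₁, h₁, hw₁⟩ := (hw.mono hΩ hDΩ).exists_trace hD hu
  have e1 : τ₁ =ᵐ[𝓢 (frontier D ∩ frontier Ω)] τ' :=
    ae_mono (restrict_mono inter_subset_left le_rfl) (h₁.unique hD hu h')
  refine EventuallyEq.trans ?_ e1
  have m1 := hτ.1.mono_measure (restrict_mono (inter_subset_right (s := frontier D)) le_rfl)
  have m2 := h₁.1.1.mono_measure (restrict_mono (inter_subset_left (t := frontier Ω)) le_rfl)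
  have h0 : eLpNorm (fun p => τ p - τ₁ p) 2 (𝓢 (frontier D ∩ frontier Ω)) = 0 := by
    have hle : ∀ j, eLpNorm (fun p => τ p - τ₁ p) 2 (𝓢 (frontier D ∩ frontier Ω)) ≤
        eLpNorm (fun p => w j p - τ p) 2 (𝓢 (frontier Ω)) +
          eLpNorm (fun p => w j p - τ₁ p) 2 (𝓢 (frontier D)) := by
      intro j
      have mw := (hw.contMDiff j).continuous.aestronglyMeasurable (μ := 𝓢 (frontier D ∩ frontier Ω))
      have := eLpNorm_sub_le (p := 2) (mw.sub m2) (mw.sub m1) one_le_two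
      rw [show ((w j - τ₁) - (w j - τ)) = fun p => τ p - τ₁ p by ext p; simp, add_comm] at this
      exact this.trans (add_le_add
        (eLpNorm_mono_measure _ (restrict_mono inter_subset_right le_rfl))
        (eLpNorm_mono_measure _ (restrict_mono inter_subset_left le_rfl)))
    exact nonpos_iff_eq_zero.1 (by simpa using ge_of_tendsto' (hwt.add hw₁) hle)
  filter_upwards [(eLpNorm_eq_zero_iff (m1.sub m2) two_ne_zero).1 h0] with p hp
  exact sub_eq_zero.1 hp

variable [Fintype G]

lemma isWeakGradient_symm (h : Iso) (hΩ : Ω ⊆ Ξ M) (hu : MemLp u 2 Λ Ω) (hV : IsWG Ω u V) : IsWG Ω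
    (symm σ u) (symmField σ V) := by
  have hi := invSet_of_smul (G := G) h.dom
  refine IsWeakGradient.sum h.isOpen hΩ Finset.univ (fun a _ => ?_) fun a _ => ?_
  · have := h.memLp_comp d a subset_closure hu; rw [hi a] at this; exact this.const_mul _
  · have := h.isWeakGradient_pull hΩ a h.isOpen Subset.rfl hV; rw [hi a] at this
    exact this.const_smul h.isOpen _

lemma isTrace_symm (h : Iso) (hΩ : IsLD Ω) (hu : MemLp u 2 Λ Ω) (hτ : Tr Ω u τ) : Tr Ω (symm σ u)
    (symm σ τ) := by
  have hi := invSet_of_smul (G := G) h.dom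
  refine IsTrace.sum hΩ Finset.univ (fun a _ => ?_) fun a _ => ?_
  · have := h.memLp_comp d a subset_closure hu; rw [hi a] at this; exact this.const_mul _
  · have := IsTrace.comp h hΩ.subset_interior a h.isOpen Subset.rfl hτ; rw [hi a] at this
    exact this.const_mul hΩ _

/-- Provides approximants that are themselves exactly equivariant at every point, so that their
values at fixed points can be read off. -/
lemma approxH1_symm (h : Iso) (hΩ : Ω ⊆ Ξ M) (hu : MemLp u 2 Λ Ω) {w : ℕ → M → ℝ} {W : ℕ → VM} (hw :
    ApproxH1 d Ω u w W) : ApproxH1 d Ω (symm σ u) (fun k => symm σ (w k)) (fun k => symmField σ (W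
    k)) := by
  have hi := invSet_of_smul (G := G) h.dom
  have e : ∀ k, (fun p => symm σ (w k) p - symm σ u p) = symm σ fun p => w k p - u p := fun k => by
    ext p; simp only [symm, mul_sub, sum_sub_distrib]
  have hm : ∀ k, MemLp (fun p => w k p - u p) 2 Λ Ω := fun k =>
    (memLp_of_cont (hw.contMDiff k).continuous 2 Ω).sub hu
  have hn : ∀ {f : M → ℝ} (a : G), MemLp f 2 Λ Ω →
      eLpNorm (fun p => f (a • p)) 2 Λ Ω = eLpNorm f 2 Λ Ω :=
    fun {f} a hf => by
      have hmp := h.mpres_preimage d a (A := Ω) subset_closure; rw [hi a] at hmp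
      exact eLpNorm_comp_measurePreserving hf.1 hmp
  have hs : ∀ a : G, ‖sgn σ a‖ₑ = 1 := fun a => by
    rw [← ofReal_norm, norm_eq_abs, ← Real.sqrt_mul_self_eq_abs, sgn_mul_self]; simp
  have hmc : ∀ {f : M → ℝ} (a : G), MemLp f 2 Λ Ω →
      MemLp (fun p => f (a • p)) 2 Λ Ω := fun {f} a hf => by
    have := h.memLp_comp d a subset_closure hf; rwa [hi a] at this
  have hlim : ∀ {f : ℕ → M → ℝ}, Tendsto (fun k => eLpNorm (f k) 2 Λ Ω) atTop
      (𝓝 0) → Tendsto (fun k => ∑ _a : G, eLpNorm (f k) 2 Λ Ω) atTop (𝓝 0) :=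
    fun hf => by simpa using tendsto_finsetSum (Finset.univ : Finset G) fun _ _ => hf
  refine ⟨fun k => contMDiff_finsetSum fun a _ => contMDiff_const.mul ((hw.contMDiff k).comp
      ((h.smooth a).of_le one_le_infty)), fun k => ?_, ?_, ?_⟩
  · rw [e]; exact isWeakGradient_symm h hΩ (hm k) (hw.isWeakGradient k)
  · refine squeeze (hlim hw.tendsto) fun k => ?_; rw [e]
    refine (eLpNorm_sum_le (f := fun a p => sgn σ a * (w k (a • p) - u (a • p)))
      (fun a _ => ((hmc a (hm k)).const_mul _).1) one_le_two |>.trans'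
      (eLpNorm_congr_ae (.of_forall fun p => by simp [symm])).le).trans
      (sum_le_sum fun a _ => ?_)
    rw [eLpNorm_const_mul', hs, one_mul, hn (f := fun p => w k p - u p) a (hm k)]
  · refine squeeze (hlim hw.tendsto_grad) fun k => ?_; have hWk := hw.isWeakGradient k
    calc eLpNorm (fun p => ‖symmField σ (W k) p‖) 2 Λ Ω
        ≤ eLpNorm (∑ a : G, fun p => ‖W k (a • p)‖) 2 Λ Ω := by
          refine eLpNorm_mono_ae ?_
          filter_upwards [ae_restrict_mem h.isOpen.measurableSet] with p hp
          rw [norm_norm, Finset.sum_apply]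
          refine (norm_sum_le _ _).trans ((sum_le_sum fun a _ => ?_).trans (Real.le_norm_self _))
          rw [norm_smul, h.norm_pull a _ (subset_closure hp), ← toReal_enorm, hs]; simp
      _ ≤ _ := (eLpNorm_sum_le (fun a _ => (hmc (f := fun p => ‖W k p‖) a hWk.memLp).1)
          one_le_two).trans (sum_le_sum fun a _ => (hn (f := fun p => ‖W k p‖) a hWk.memLp).le)

end Symm

/-! ### Extension from a piece and restriction to it preserve the form domains -/

namespace SymPartition

variable [Fintype G]

lemma invSet_dom (h : SymP) : InvSet G B.dom := invSet_of_smul h.admissible.act_dom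

lemma dir_subset (h : SymP) : B.dir ⊆ frontier B.dom := by
  obtain ⟨U, -, hU⟩ := h.admissible.dir_open; exact hU ▸ inter_subset_left

lemma rob_subset (h : SymP) : B.rob ⊆ frontier B.dom := by
  obtain ⟨U, -, hU⟩ := h.admissible.rob_open; exact hU ▸ inter_subset_left

lemma measurableSet_rob (h : SymP) : MeasurableSet B.rob := by
  obtain ⟨U, hUo, hU⟩ := h.admissible.rob_open
  exact hU ▸ isClosed_frontier.measurableSet.inter hUo.measurableSet

lemma exists_preimage_eq (h : SymP) (b : G) : ∃ j, ℓ b ⁻¹' P k = P j := by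
  obtain ⟨j, hj⟩ := h.partition.permutes b⁻¹ k; exact ⟨j, by rw [preimage_smul, hj]⟩

/-- The extension of a function on `P k` to a `σ`-equivariant function. -/
def ext (σ : G →* ℤˣ) (D : Set M) (v : M → ℝ) : M → ℝ := symm σ (D.indicator v)

lemma memLp_ext (h : SymP) (hv : MemLp v 2 (Λ (P k))) : MemLp (ext σ (P k) v) 2 (Λ B.dom) :=
  memLp_symm h.isAction subset_closure h.invSet_dom
    (memLp_indicator_sub h.lip.isOpen.measurableSet hv _)

/-- By self-adjointness the symmetrization passes from `v` and its gradient to the test field. What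
remains is integration by parts on `P k` against an equivariant field that need not vanish on the
walls, which `integral_inner_eq` allows. -/
lemma isWeakGradient_ext (h : SymP) (hv : MemLp v 2 (Λ (P k))) (hV : IsWG (P k) v V) (hτ : Tr (P k)
    v τ) (h0 : τ =ᵐ[(surf d M).restrict (minusBdry σ B.dom (P k))] 0) : IsWG B.dom (ext σ (P k) v)
    (symmField σ (indField (P k) V)) := by
  have hDm := h.lip.isOpen.measurableSet; have hΩm := h.isAction.isOpen.measurableSet
  have hs := h.partition.subset k; have m1 := measField_indField hDm hV.measField B.dom
  have m2 := memLp_norm_indField hDm hV.memLp B.dom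
  refine ⟨measField_symmField h.isAction m1, memLp_norm_symmField h.isAction m1 m2,
    fun X hX hXs => ?_⟩
  have hXt : IsTest B.dom X := ⟨hX, hXs⟩
  have hY : IsTest B.dom (symmField σ X) := isTest_symmField h.isAction.smooth h.invSet_dom hXt
  have hdiv : Continuous (Dv X) := continuous_divergence hX (hXs.trans h.dom_interior)
  have e1 : ∀ p, inner ℝ (symmField σ X p) (indField (P k) V p) =
      (P k).indicator (fun p => inner ℝ (symmField σ X p) (V p)) p := fun p => by
    by_cases hp : p ∈ P k
    · rw [indField_of_mem hp, indicator_of_mem hp]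
    · rw [indField_of_notMem hp, indicator_of_notMem hp, inner_zero_right]
  have e2 : ∀ p ∈ B.dom, (P k).indicator v p * symm σ (Dv X) p =
      (P k).indicator (fun p => v p * Dv (symmField σ X) p) p := fun p hpΩ => by
    rw [← divergence_symmField h.isAction h.dom_interior hX hpΩ]; by_cases hp : p ∈ P k
    · simp only [indicator_of_mem hp]
    · simp only [indicator_of_notMem hp, zero_mul]
  rw [← integral_inner_symmField h.isAction (hXt.smooth.measField hΩm) m1
    (memLp_of_cont hXt.smooth.continuous_norm 2 _) m2, ext,
    integral_symm_mul h.isAction subset_closure h.invSet_dom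
      (memLp_indicator_sub hDm hv _) (memLp_of_cont hdiv 2 _),
    setIntegral_congr_fun hΩm e2]
  simp only [e1]
  rw [setIntegral_indicator hDm, setIntegral_indicator hDm, inter_eq_self_of_subset_right hs]
  exact h.integral_inner_eq hY (fun a q => pull_symmField h.isAction.smooth a q) hv hV hτ h0

/-- A trace exists because the extension is in `H¹`. On a piece `P i` the extension is the signed
sum of the translates of `v` living there, whose trace is known. Off the null set of fixed points a
point of `∂Ω` bounds one piece only, so these descriptions combine into a single formula. -/
lemma isTrace_ext (h : SymP) (hv : MemLp v 2 (Λ (P k))) (hV : IsWG (P k) v V) (hτ : Tr (P k) v τ)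
    (h0 : τ =ᵐ[𝓢 (minusBdry σ B.dom (P k))] 0) : Tr B.dom (ext σ (P k) v) (symm σ ((frontier (P
    k)).indicator τ)) := by
  classical
  have htr := MemH1.exists_isTrace h.admissible.lipschitz
    ⟨h.memLp_ext hv, _, h.isWeakGradient_ext hv hV hτ h0⟩
  refine htr.congr_trace ?_
  have hfr : ∀ b : G, ℓ b ⁻¹' frontier (P k) = frontier (ℓ b ⁻¹' P k) :=
    fun b => (frontier_preimage_act h.isAction b _).symm
  have hpc : ∀ i, ∀ᵐ p ∂𝓢 (frontier (P i) ∩ frontier B.dom),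
      trace d B.dom (ext σ (P k) v) p = ∑ b : G with ℓ b ⁻¹' P k = P i, sgn σ b * τ (b • p) := by
    intro i; have hs := h.partition.subset i
    have h1 : Tr (P i) (fun p => ∑ b : G with ℓ b ⁻¹' P k = P i, sgn σ b * v (b • p))
        (fun p => ∑ b : G with ℓ b ⁻¹' P k = P i, sgn σ b * τ (b • p)) := by
      refine IsTrace.sum (h.partition.lipschitz i) _ (fun b hb => ?_) fun b hb => ?_
      · have := h.isAction.memLp_comp d b ((h.partition.subset k).trans subset_closure) hv
        rw [(Finset.mem_filter.1 hb).2] at this; exact this.const_mul _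
      · have := IsTrace.comp h.isAction h.dom_interior b h.lip.isOpen (h.partition.subset k) hτ
        rw [(Finset.mem_filter.1 hb).2] at this; exact this.const_mul (h.partition.lipschitz i) _
    refine IsTrace.eq_of_subset (h.partition.lipschitz i) h.isAction.isOpen hs
      ((h.memLp_ext hv).mono_measure (restrict_mono hs le_rfl)) htr (h1.congr ?_)
    filter_upwards [ae_restrict_mem (h.partition.lipschitz i).isOpen.measurableSet] with p hp
    rw [sum_filter]; refine sum_congr rfl fun b _ => ?_; split_ifs with hb
    · rw [indicator_of_mem (show b • p ∈ P k from (hb ▸ hp : p ∈ ℓ b ⁻¹' P k))]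
    · obtain ⟨j, hj⟩ := h.exists_preimage_eq b; rw [indicator_of_notMem fun h' => ?_, mul_zero]
      have h2 : p ∈ P j := hj ▸ (h' : p ∈ ℓ b ⁻¹' P k)
      exact disjoint_left.1 (h.partition.disjoint i j fun hij => hb (by rw [hj, hij])) hp h2
  have hall : ∀ᵐ p ∂𝓢 (frontier B.dom), ∀ i, p ∈ frontier (P i) →
      trace d B.dom (ext σ (P k) v) p = ∑ b : G with ℓ b ⁻¹' P k = P i, sgn σ b * τ (b • p) := by
    refine eventually_all.2 fun i => ?_; have := hpc i
    rwa [← restrict_restrict isClosed_frontier.measurableSet,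
      ae_restrict_iff' isClosed_frontier.measurableSet] at this
  have hnull : ∀ᵐ p ∂𝓢 (frontier B.dom), p ∉ fixSet G B.dom := by
    rw [ae_restrict_iff' isClosed_frontier.measurableSet]
    filter_upwards [measure_eq_zero_iff_ae_notMem.1 h.surf_frontier_inter_fixSet] with p hp hp' hp2
    exact hp ⟨hp', hp2⟩
  filter_upwards [hall, hnull, ae_restrict_mem isClosed_frontier.measurableSet] with p hp hpn hpf
  obtain ⟨i, hpi⟩ := h.mem_frontier_piece hpf; rw [hp i hpi, sum_filter]
  refine sum_congr rfl fun b _ => ?_; split_ifs with hb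
  · rw [indicator_of_mem (show b • p ∈ frontier (P k) from ?_)]; change p ∈ ℓ b ⁻¹' frontier (P k)
    rwa [hfr, hb]
  · obtain ⟨j, hj⟩ := h.exists_preimage_eq b; rw [indicator_of_notMem fun h' => ?_, mul_zero]
    have h2 : p ∈ frontier (P j) := by rw [← hj, ← hfr]; exact h'
    exact hpn (h.mem_fixSet_of_mem_frontier hpf (fun hij : i = j => hb (by rw [hj, hij])) hpi h2)

/-- The closure of the interior boundary consists of points with nontrivial stabilizer, and these
are negligible on `∂Ω`. -/
lemma ae_mem_extBdry (h : SymP) : ∀ᵐ p ∂surf d M, p ∈ frontier B.dom → (p ∈ frontier (P k) ↔ p ∈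
    extBdry B.dom (P k)) := by
  filter_upwards [measure_eq_zero_iff_ae_notMem.1 h.surf_frontier_inter_fixSet] with p hp hpf
  exact ⟨fun h' => ⟨h', fun h2 => hp ⟨hpf, h.closure_intBdry_subset k h2⟩⟩, fun h' => h'.1⟩

/-- On `∂_D Ω` the trace is a signed sum of translates of the trace of `v` cut off to `∂P k`. Each
translate is evaluated on `∂_D Ω` again, where the cut-off trace vanishes almost everywhere. -/
lemma memH1D_ext (h : SymP) (hv : (B.reduced σ (P k)).MemH1D d v) : B.MemH1D d (ext σ (P k) v) := by
  obtain ⟨⟨hv2, V, hV⟩, τ, hτ, h0⟩ := hv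
  have h0' : τ =ᵐ[𝓢 (minusBdry σ B.dom (P k))] 0 :=
    ae_mono (restrict_mono subset_union_left le_rfl) h0
  refine ⟨⟨h.memLp_ext hv2, _, h.isWeakGradient_ext hv2 hV hτ h0'⟩, _,
    h.isTrace_ext hv2 hV hτ h0', ?_⟩
  have hdm : MeasurableSet B.dir := by
    obtain ⟨U, hUo, hU⟩ := h.admissible.dir_open
    exact hU ▸ isClosed_frontier.measurableSet.inter hUo.measurableSet
  have hem : MeasurableSet (extBdry B.dom (P k) ∩ B.dir) :=
    (isClosed_frontier.measurableSet.diff isClosed_closure.measurableSet).inter hdm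
  have h1 : ∀ᵐ p ∂𝓢 B.dir, (frontier (P k)).indicator τ p = 0 := by
    have h2 : ∀ᵐ p ∂𝓢 (extBdry B.dom (P k) ∩ B.dir), τ p = 0 :=
      ae_mono (restrict_mono subset_union_right le_rfl) h0
    rw [ae_restrict_iff' hdm]; rw [ae_restrict_iff' hem] at h2
    filter_upwards [h2, h.ae_mem_extBdry] with p hp hp' hpd; by_cases hpf : p ∈ frontier (P k)
    · rw [indicator_of_mem hpf]; exact hp ⟨(hp' (h.dir_subset hpd)).1 hpf, hpd⟩
    · exact indicator_of_notMem hpf _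
  have h2 := eventually_all.2 fun a : G => (invSet_of_smul h.admissible.act_dir).ae_comp h.isAction
    (h.dir_subset.trans frontier_subset_closure) h1 a
  filter_upwards [h2] with p hp; exact sum_eq_zero fun a _ => by rw [hp a, mul_zero]

/-- A point of `∂₋` is fixed by an element of sign `-1`, so there a symmetrized `C¹` function equals
its own negative. The vanishing survives the limit defining the trace. -/
lemma isTrace_symm_piece (h : SymP) (hu : MemLp u 2 (Λ B.dom)) (hτ : Tr B.dom u τ) : ∃ τ₁, Tr (P k)
    (symm σ u) τ₁ ∧ τ₁ =ᵐ[(surf d M).restrict (minusBdry σ B.dom (P k))] 0 := by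
  obtain ⟨-, w, W, hw, -⟩ := isTrace_iff.1 hτ; have hs := h.partition.subset k
  have hsw := (approxH1_symm (σ := σ) h.isAction h.dom_interior hu hw).mono h.isAction.isOpen hs
  obtain ⟨τ₁, h₁, hw₁⟩ := hsw.exists_trace h.lip ((memLp_symm h.isAction subset_closure
    h.invSet_dom hu).mono_measure (restrict_mono hs le_rfl))
  refine ⟨τ₁, h₁, ?_⟩; have hsub : minusBdry σ B.dom (P k) ⊆ frontier (P k) := fun q hq => hq.1.1
  have hz : ∀ j, ∀ q ∈ minusBdry σ B.dom (P k), symm σ (w j) q = 0 := by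
    intro j q hq; obtain ⟨a, -, ha⟩ := exists_fixer_of_mem (Or.inr hq); have h2 := hq.2.2
    rw [ha] at h2; have h4 : (-1 : ℤˣ) ∈ σ '' {1, a} := by rw [h2]; exact mem_insert_of_mem _ rfl
    have hσ : σ a = -1 := by
      obtain ⟨x, rfl | hx, hx1⟩ := h4
      · rw [map_one] at hx1; exact absurd hx1 (by decide)
      · rw [← mem_singleton_iff.1 hx, hx1]
    have h5 := symm_smul (σ := σ) (u := w j) a q
    rw [localFixer_smul_eq hq.1 (ha ▸ mem_insert_of_mem 1 rfl), sgn, hσ] at h5; push_cast at h5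
    linarith
  -- Passing to the closed set of common zeros of the approximants avoids the question whether the
  -- minus part is measurable.
  set Z : Set M := ⋂ j, {q | symm σ (w j) q = 0} with hZ
  have hZm : MeasurableSet (frontier (P k) ∩ Z) := isClosed_frontier.measurableSet.inter
    (isClosed_iInter fun j => isClosed_eq (hsw.contMDiff j).continuous continuous_const).measurableSet
  have hle : 𝓢 (frontier (P k) ∩ Z) ≤ 𝓢 (frontier (P k)) := restrict_mono inter_subset_left le_rfl
  have e : eLpNorm τ₁ 2 (𝓢 (frontier (P k) ∩ Z)) = 0 := by
    refine nonpos_iff_eq_zero.1 (ge_of_tendsto' hw₁ fun j => ?_)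
    refine le_trans (le_of_eq ?_) (eLpNorm_mono_measure _ hle); rw [← eLpNorm_neg]
    refine eLpNorm_congr_ae ?_; filter_upwards [ae_restrict_mem hZm] with q hq
    rw [show symm σ (w j) q = 0 from mem_iInter.1 hq.2 j, zero_sub, Pi.neg_apply]
  have hsZ : minusBdry σ B.dom (P k) ⊆ frontier (P k) ∩ Z := fun q hq =>
    ⟨hsub hq, mem_iInter.2 fun j => hz j q hq⟩
  exact ae_mono (restrict_mono hsZ le_rfl)
    ((eLpNorm_eq_zero_iff (h₁.1.1.mono_measure hle) two_ne_zero).1 e)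

/-- On the piece, the Dirichlet condition on the exterior boundary is inherited from `Ω` by
agreement of traces, and the one on `∂₋` comes from antisymmetry. -/
lemma memH1D_symm (h : SymP) (hu : B.MemH1D d u) : B.MemH1D d (symm σ u) ∧ (B.reduced σ (P
    k)).MemH1D d (symm σ u) := by
  obtain ⟨⟨hu2, V, hV⟩, τ, hτ, h0⟩ := hu; have hs := h.partition.subset k
  have hm := memLp_symm (σ := σ) h.isAction subset_closure h.invSet_dom hu2
  have hg := isWeakGradient_symm (σ := σ) h.isAction h.dom_interior hu2 hV
  have ht := isTrace_symm (σ := σ) h.isAction h.admissible.lipschitz hu2 hτ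
  have hmk := hm.mono_measure (restrict_mono hs le_rfl)
  have h1 : symm σ τ =ᵐ[𝓢 B.dir] 0 := by
    filter_upwards [eventually_all.2 fun a : G => (invSet_of_smul h.admissible.act_dir).ae_comp
      h.isAction (h.dir_subset.trans frontier_subset_closure) h0 a] with p hp
    exact sum_eq_zero fun a _ => by rw [hp a, Pi.zero_apply, mul_zero]
  obtain ⟨τ₁, h₁, hz⟩ := h.isTrace_symm_piece hu2 hτ
  refine ⟨⟨⟨hm, _, hg⟩, _, ht, h1⟩, ⟨hmk, _, hg.mono h.isAction.isOpen hs⟩, τ₁, h₁, ?_⟩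
  refine (ae_restrict_union_iff _ _ _).2 ⟨hz, ?_⟩
  have h2 := ht.eq_of_subset h.lip h.isAction.isOpen hs hmk h₁
  have hsd : extBdry B.dom (P k) ∩ B.dir ⊆ frontier (P k) ∩ frontier B.dom := fun q hq =>
    ⟨hq.1.1, h.dir_subset hq.2⟩
  filter_upwards [ae_mono (restrict_mono hsd le_rfl) h2,
    ae_mono (restrict_mono inter_subset_right le_rfl) h1] with q hq hq'
  rw [← hq, hq']

end SymPartition

/-! ### The form under symmetrization and extension -/

variable {U : VF d M} {v' τ' : M → ℝ}

lemma Problem.MemH1D.congr (hu : B.MemH1D d u) (h : u =ᵐ[Λ B.dom] u') : B.MemH1D d u' := by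
  obtain ⟨⟨h1, V, hV⟩, τ, hτ, h0⟩ := hu
  exact ⟨⟨(memLp_congr_ae h).1 h1, V, hV.congr h (.of_forall fun _ => rfl)⟩, τ, hτ.congr h, h0⟩

lemma Problem.MemH1D.const_mul (hL : IsLD B.dom) (hu : B.MemH1D d u) (a : ℝ) : B.MemH1D d (fun p =>
    a * u p) := by
  obtain ⟨⟨h1, V, hV⟩, τ, hτ, h0⟩ := hu
  refine ⟨⟨h1.const_mul a, _, hV.const_smul hL.isOpen a⟩, _, hτ.const_mul hL a, ?_⟩
  filter_upwards [h0] with p hp; rw [hp, Pi.zero_apply, mul_zero]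

/-- By uniqueness almost everywhere, any weak gradients and traces may replace the chosen ones in
the form. -/
lemma Problem.form_eq (hL : IsLD B.dom) (hrob : B.rob ⊆ frontier B.dom) (hu : MemLp u 2 (Λ B.dom))
    (hU : IsWG B.dom u U) (hτ : Tr B.dom u τ) (hv : MemLp v 2 (Λ B.dom)) (hV : IsWG B.dom v V) (hτ'
    : Tr B.dom v τ') : B.form d u v = ∫ p in B.dom, (inner ℝ (U p) (V p) - B.q p * u p * v p) ∂ϑ - ∫
    p in B.rob, B.r p * τ p * τ' p ∂(surf d M) := by
  have e : ∀ {u : M → ℝ} {U : VM}, MemLp u 2 (Λ B.dom) → IsWG B.dom u U →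
      ∀ᵐ p ∂Λ B.dom, weakGrad d B.dom u p = U p := fun {u U} hu hU =>
    IsWeakGradient.unique hL.isOpen (MemH1.isWeakGradient ⟨hu, U, hU⟩) hU
  have e' : ∀ {u τ : M → ℝ}, MemLp u 2 (Λ B.dom) → Tr B.dom u τ →
      ∀ᵐ p ∂𝓢 B.rob, trace d B.dom u p = τ p := fun {u τ} hu hτ =>
    ae_mono (restrict_mono hrob le_rfl) ((isTrace_trace ⟨τ, hτ⟩).unique hL hu hτ)
  rw [Problem.form]; congr 1
  · refine integral_congr_ae ?_; filter_upwards [e hu hU, e hv hV] with p h1 h2; rw [h1, h2]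
  · refine integral_congr_ae ?_; filter_upwards [e' hu hτ, e' hv hτ'] with p h1 h2; rw [h1, h2]

lemma Problem.form_congr (hL : IsLD B.dom) (hrob : B.rob ⊆ frontier B.dom) (hu : B.MemH1D d u) (hv :
    B.MemH1D d v) (h : u =ᵐ[Λ B.dom] u') (h' : v =ᵐ[Λ B.dom] v') : B.form d u v = B.form d u' v' :=
    by
  obtain ⟨⟨h1, U, hU⟩, τ, hτ, -⟩ := hu; obtain ⟨⟨h2, V, hV⟩, τ', hτ', -⟩ := hv
  rw [form_eq hL hrob h1 hU hτ h2 hV hτ', form_eq hL hrob ((memLp_congr_ae h).1 h1)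
    (hU.congr h (.of_forall fun _ => rfl)) (hτ.congr h) ((memLp_congr_ae h').1 h2)
    (hV.congr h' (.of_forall fun _ => rfl)) (hτ'.congr h')]
  congr 1; refine integral_congr_ae ?_; filter_upwards [h, h'] with p hp hp'; rw [hp, hp']

namespace SymPartition

variable [Fintype G]

/-- In each of the three terms symmetrization moves onto `u`, its gradient or its trace, past the
invariant coefficients, and acts there as multiplication by `|G|`. The data `z`, `Z`, `ζ` are
unrelated to each other, because the lemma is also applied to extensions by zero, for which `Z` need
not be a weak gradient. -/
lemma form_symm_aux (h : SymP) (hu : MemLp u 2 (Λ B.dom)) (hU : IsWG B.dom u U) (hτ : Tr B.dom u τ)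
    (hi : symm σ u =ᵐ[Λ B.dom] fun p => (Fintype.card G : ℝ) * u p) {z ζ : M → ℝ} {Z : VM} (hz :
    MemLp z 2 (Λ B.dom)) (hZ : MF B.dom Z) (hZ2 : MemLp (fun p => ‖Z p‖) 2 (Λ B.dom)) (hζ : MemLp ζ
    2 (𝓢 (frontier B.dom))) : ∫ p in B.dom, (inner ℝ (U p) (symmField σ Z p) - B.q p * u p * symm σ
    z p) ∂ϑ - ∫ p in B.rob, B.r p * τ p * symm σ ζ p ∂(surf d M) = Fintype.card G * (∫ p in B.dom,
    (inner ℝ (U p) (Z p) - B.q p * u p * z p) ∂ϑ - ∫ p in B.rob, B.r p * τ p * ζ p ∂(surf d M)) :=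
    by
  have hΩm := h.isAction.isOpen.measurableSet; have hΩL := h.admissible.lipschitz
  have hrm : ∀ {f : M → ℝ}, MemLp f 2 (𝓢 (frontier B.dom)) → MemLp f 2 (𝓢 B.rob) := fun hf =>
    hf.mono_measure (restrict_mono h.rob_subset le_rfl)
  have hqu : MemLp (fun p => B.q p * u p) 2 (Λ B.dom) :=
    memLp_mul_of_cont h.admissible.smooth_q.continuous hu
  have hrτ : MemLp (fun p => B.r p * τ p) 2 (𝓢 B.rob) := by
    have hc := h.admissible.smooth_r.continuous; obtain ⟨b, hb⟩ := exists_bound hc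
    exact (hrm hτ.1).of_le_mul (c := b) (hc.aestronglyMeasurable.mul (hrm hτ.1).1)
      (.of_forall fun p => by
        rw [norm_mul]; exact mul_le_mul_of_nonneg_right (hb p) (norm_nonneg _))
  have e1 : ∫ p in B.dom, inner ℝ (U p) (symmField σ Z p) ∂ϑ =
      Fintype.card G * ∫ p in B.dom, inner ℝ (U p) (Z p) ∂ϑ := by
    rw [← integral_inner_symmField h.isAction hU.measField hZ hU.memLp hZ2, ← integral_const_mul]
    refine integral_congr_ae ?_
    filter_upwards [IsWeakGradient.unique h.isAction.isOpen ((isWeakGradient_symm (σ := σ) h.isAction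
      h.dom_interior hu hU).congr hi (.of_forall fun _ => rfl))
      (hU.const_smul h.isAction.isOpen (Fintype.card G : ℝ))] with p hp
    rw [hp, inner_smul_left]; rfl
  have e2 : ∫ p in B.dom, B.q p * u p * symm σ z p ∂ϑ =
      Fintype.card G * ∫ p in B.dom, B.q p * u p * z p ∂ϑ := by
    rw [← integral_symm_mul h.isAction subset_closure h.invSet_dom hqu hz, ← integral_const_mul]
    refine integral_congr_ae ?_; filter_upwards [hi, ae_restrict_mem hΩm] with p hp hpΩ
    have : symm σ (fun p => B.q p * u p) p = B.q p * symm σ u p := by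
      simp only [symm, mul_sum, h.admissible.act_q _ p (subset_closure hpΩ), mul_left_comm]
    rw [this, hp]; ring
  have e3 : ∫ p in B.rob, B.r p * τ p * symm σ ζ p ∂(surf d M) =
      Fintype.card G * ∫ p in B.rob, B.r p * τ p * ζ p ∂(surf d M) := by
    have hrc := h.rob_subset.trans frontier_subset_closure
    rw [← integral_symm_mul h.isAction hrc (invSet_of_smul h.admissible.act_rob) hrτ (hrm hζ),
      ← integral_const_mul]
    have h1 : ∀ᵐ p ∂𝓢 B.rob, symm σ τ p = Fintype.card G * τ p :=
      ae_mono (restrict_mono h.rob_subset le_rfl) (IsTrace.unique hΩL (hu.const_mul _)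
        ((isTrace_symm h.isAction hΩL hu hτ).congr hi) (hτ.const_mul hΩL _))
    refine integral_congr_ae ?_
    filter_upwards [h1, ae_restrict_mem h.measurableSet_rob] with p hp hpr
    have : symm σ (fun p => B.r p * τ p) p = B.r p * symm σ τ p := by
      simp only [symm, mul_sum, h.admissible.act_r _ p (hrc hpr), mul_left_comm]
    rw [this, hp]; ring
  have i1 := integrable_inner hΩm hU.measField (measField_symmField (σ := σ) h.isAction hZ) hU.memLp
    (memLp_norm_symmField h.isAction hZ hZ2)
  have i2 : IntegrableOn (fun p => B.q p * u p * symm σ z p) B.dom ϑ :=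
    hqu.integrable_mul (memLp_symm h.isAction subset_closure h.invSet_dom hz)
  have i3 : IntegrableOn (fun p => B.q p * u p * z p) B.dom ϑ := hqu.integrable_mul hz
  rw [integral_sub i1 i2, integral_sub (integrable_inner hΩm hU.measField hZ hU.memLp hZ2)
    i3, e1, e2, e3]
  ring

lemma form_symm (h : SymP) (hu : B.MemH1D d u) (hi : symm σ u =ᵐ[Λ B.dom] fun p => (Fintype.card G :
    ℝ) * u p) (hv : B.MemH1D d v) : B.form d u (symm σ v) = Fintype.card G * B.form d u v := by
  obtain ⟨⟨hu2, U, hU⟩, τ, hτ, -⟩ := hu; obtain ⟨⟨hv2, V, hV⟩, τ', hτ', -⟩ := hv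
  have hL := h.admissible.lipschitz
  rw [Problem.form_eq hL h.rob_subset hu2 hU hτ hv2 hV hτ', Problem.form_eq hL h.rob_subset hu2 hU hτ
    (memLp_symm h.isAction subset_closure h.invSet_dom hv2)
    (isWeakGradient_symm h.isAction h.dom_interior hv2 hV) (isTrace_symm h.isAction hL hv2 hτ')]
  exact h.form_symm_aux hu2 hU hτ hi hv2 hV.measField hV.memLp hτ'.1

/-- The preceding computation with `v`, its gradient and its trace extended by zero. The integrals
then localize to `P k` and to the Robin part of its exterior boundary, up to a null set. -/
lemma form_ext (h : SymP) (hu : B.MemH1D d u) (hi : symm σ u =ᵐ[Λ B.dom] fun p => (Fintype.card G :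
    ℝ) * u p) (hv : (B.reduced σ (P k)).MemH1D d v) : B.form d u (ext σ (P k) v) = Fintype.card G *
    (B.reduced σ (P k)).form d u v := by
  obtain ⟨⟨hu2, U, hU⟩, τ, hτ, -⟩ := hu; obtain ⟨⟨hv2, V, hV⟩, τ', hτ', h0⟩ := hv
  have hv2' : MemLp v 2 (Λ (P k)) := hv2; have hL := h.admissible.lipschitz
  have hs := h.partition.subset k; have hDm := h.lip.isOpen.measurableSet
  have hfm := (isClosed_frontier (s := P k)).measurableSet
  have h0' : τ' =ᵐ[𝓢 (minusBdry σ B.dom (P k))] 0 :=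
    ae_mono (restrict_mono subset_union_left le_rfl) h0
  have huk := hu2.mono_measure (restrict_mono hs le_rfl)
  have hτk := MemH1.exists_isTrace h.lip ⟨huk, _, hU.mono h.isAction.isOpen hs⟩
  rw [Problem.form_eq hL h.rob_subset hu2 hU hτ (h.memLp_ext hv2) (h.isWeakGradient_ext hv2 hV hτ' h0')
    (h.isTrace_ext hv2 hV hτ' h0'), Problem.form_eq (B := B.reduced σ (P k)) h.lip
    (fun q hq => hq.1.1) huk (hU.mono h.isAction.isOpen hs) hτk hv2 hV hτ', ext,
    h.form_symm_aux hu2 hU hτ hi (memLp_indicator_sub hDm hv2' _)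
      (measField_indField hDm hV.measField _) (memLp_norm_indField hDm hV.memLp _)
      (memLp_indicator_sub hfm hτ'.1 _)]
  congr 2
  · have e : ∀ p, inner ℝ (U p) (indField (P k) V p) - B.q p * u p * (P k).indicator v p =
        (P k).indicator (fun p => inner ℝ (U p) (V p) - B.q p * u p * v p) p := fun p => by
      by_cases hp : p ∈ P k
      · simp only [indField_of_mem hp, indicator_of_mem hp]
      · simp only [indField_of_notMem hp, indicator_of_notMem hp, inner_zero_right, mul_zero, sub_zero]
    simp only [e]; rw [setIntegral_indicator hDm, inter_eq_self_of_subset_right hs]; rfl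
  · have e : ∀ p, B.r p * τ p * (frontier (P k)).indicator τ' p =
        (frontier (P k)).indicator (fun p => B.r p * τ p * τ' p) p := fun p => by
      by_cases hp : p ∈ frontier (P k)
      · simp only [indicator_of_mem hp]
      · simp only [indicator_of_notMem hp, mul_zero]
    simp only [e]; rw [setIntegral_indicator hfm]
    have hset : (B.rob ∩ frontier (P k) : Set M) =ᵐ[surf d M] (B.reduced σ (P k)).rob := by
      filter_upwards [h.ae_mem_extBdry] with p hp
      refine propext ⟨fun hq => ⟨(hp (h.rob_subset hq.1)).1 hq.2, hq.1⟩, fun hq => ⟨hq.2, hq.1.1⟩⟩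
    rw [setIntegral_congr_set hset]; refine integral_congr_ae ?_
    have hsr : (B.reduced σ (P k)).rob ⊆ frontier (P k) ∩ frontier B.dom := fun q hq =>
      ⟨hq.1.1, h.rob_subset hq.2⟩
    filter_upwards [ae_mono (restrict_mono hsr le_rfl) (hτ.eq_of_subset h.lip h.isAction.isOpen hs huk hτk)] with p hp
    rw [hp]; rfl

lemma integral_mul_symm (h : SymP) (hu : MemLp u 2 (Λ B.dom)) (hi : symm σ u =ᵐ[Λ B.dom] fun p =>
    (Fintype.card G : ℝ) * u p) (hv : MemLp v 2 (Λ B.dom)) : ∫ p in B.dom, u p * symm σ v p ∂ϑ =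
    Fintype.card G * ∫ p in B.dom, u p * v p ∂ϑ := by
  rw [← integral_symm_mul h.isAction subset_closure h.invSet_dom hu hv, ← integral_const_mul]
  refine integral_congr_ae ?_; filter_upwards [hi] with p hp; rw [hp, mul_assoc]

lemma integral_mul_ext (h : SymP) (hu : MemLp u 2 (Λ B.dom)) (hi : symm σ u =ᵐ[Λ B.dom] fun p =>
    (Fintype.card G : ℝ) * u p) (hv : MemLp v 2 (Λ (P k))) : ∫ p in B.dom, u p * ext σ (P k) v p ∂ϑ
    = Fintype.card G * ∫ p in P k, u p * v p ∂ϑ := by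
  have hDm := h.lip.isOpen.measurableSet
  rw [ext, h.integral_mul_symm hu hi (memLp_indicator_sub hDm hv _)]
  simp only [← indicator_mul_right]
  rw [setIntegral_indicator hDm, inter_eq_self_of_subset_right (h.partition.subset k)]

end SymPartition

-- Invariant eigenfunctions and eigenvalues

local notation "Inv" => Problem.IsInvariant d B.dom (⊤ : Subgroup G) σ

namespace SymPartition

variable [Fintype G] {t : ℝ}

lemma ae_piece_comp (h : SymP) {i : Fin n} {b : G} (hb : b • P i = P k) {p : M → Prop} (hp : ∀ᵐ q ∂Λ
    (P k), p q) : ∀ᵐ q ∂Λ (P i), p (b • q) := by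
  have := (h.isAction.mpres_preimage d b ((h.partition.subset k).trans
    subset_closure)).quasiMeasurePreserving.ae hp
  rwa [preimage_smul, ← hb, inv_smul_smul] at this

lemma symm_eq_of_isInvariant (hu : Inv u) : symm σ u =ᵐ[Λ B.dom] fun p => (Fintype.card G : ℝ) * u p
    := by
  filter_upwards [eventually_all.2 fun a : G => hu a⁻¹ (Subgroup.mem_top _)] with p hp
  have : ∀ a : G, sgn σ a * u (a • p) = u p := fun a => by rw [← hp a, inv_inv, ← sgn_inv]; rfl
  simp only [symm, this, sum_const, Finset.card_univ, nsmul_eq_mul]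

lemma isInvariant_of_smul {K : Subgroup G} (hu : ∀ (a : G) (p : M), u (a • p) = sgn σ a * u p) :
    Problem.IsInvariant d Ω K σ u := fun a _ => .of_forall fun p => by
  change sgn σ a * u (a⁻¹ • p) = u p; rw [hu, sgn_inv, ← mul_assoc, sgn_mul_self, one_mul]

lemma isInvariant_congr (h : SymP) (hu : Inv u) (he : u =ᵐ[Λ B.dom] u') : Inv u' := fun a ha => by
  filter_upwards [hu a ha, he, h.invSet_dom.ae_comp h.isAction subset_closure he a⁻¹] with p h1 h2 h3
  rw [← h2, ← h3, h1]

lemma isInvariant_piece (h : SymP) (hu : Inv u) (he : u =ᵐ[Λ (P k)] u') : Problem.IsInvariant d (P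
    k) (MulAction.stabilizer G (P k)) σ u' := fun a ha => by
  have hi := ae_mono (restrict_mono (h.partition.subset k) le_rfl) (hu a (Subgroup.mem_top a))
  filter_upwards [hi, he, h.ae_piece_comp (MulAction.mem_stabilizer_iff.1 (inv_mem ha)) he]
    with p h1 h2 h3
  rw [← h2, ← h3, h1]

/-- Invariant functions are determined by their restrictions to one piece. -/
lemma ae_eq_of_isInvariant (h : SymP) (hu : Inv u) (hu' : Inv u') (he : u =ᵐ[Λ (P k)] u') : u =ᵐ[Λ
    B.dom] u' := by
  have h1 : ∀ i, ∀ᵐ p ∂Λ (P i), u p = u' p := by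
    intro i; obtain ⟨a, ha⟩ := h.partition.transitive k i
    have hs := restrict_mono (μ := ϑ) (h.partition.subset i) le_rfl
    filter_upwards [h.ae_piece_comp (b := a⁻¹) (by rw [← ha, inv_smul_smul]) he,
      ae_mono hs (hu a (Subgroup.mem_top a)), ae_mono hs (hu' a (Subgroup.mem_top a))] with p h1 h2 h3
    rw [← h2, ← h3, h1]
  have h2 := (ae_restrict_iUnion_iff _ _).2 h1
  rw [ae_restrict_iff' (MeasurableSet.iUnion fun i => (h.partition.lipschitz i).isOpen.measurableSet)]
    at h2
  refine (ae_restrict_iff' h.isAction.isOpen.measurableSet).2 ?_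
  filter_upwards [h2, measure_eq_zero_iff_ae_notMem.1 h.vol_dom_diff] with p hp hp' hpΩ
  exact hp (by by_contra hn; exact hp' ⟨hpΩ, hn⟩)

/-- On the piece itself, the extension of an invariant function is a multiple of the function. -/
lemma ext_eq (h : SymP) (hv : Problem.IsInvariant d (P k) (MulAction.stabilizer G (P k)) σ v) : ext
    σ (P k) v =ᵐ[Λ (P k)] fun p => (Nat.card (MulAction.stabilizer G (P k)) : ℝ) * v p := by
  classical
  have h1 : ∀ᵐ p ∂Λ (P k), ∀ a ∈ MulAction.stabilizer G (P k), sgn σ a * v (a • p) = v p := by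
    refine eventually_all.2 fun a => ?_; by_cases ha : a ∈ MulAction.stabilizer G (P k)
    · filter_upwards [hv a⁻¹ (inv_mem ha)] with p hp _; rw [← hp, inv_inv, ← sgn_inv]; rfl
    · exact .of_forall fun p h' => absurd h' ha
  filter_upwards [h1, ae_restrict_mem h.lip.isOpen.measurableSet] with p hp hpk
  -- Elements outside the stabilizer move `P k` to a disjoint piece and contribute zero; each
  -- element of the stabilizer contributes `v p`.
  have e : ∀ a : G, sgn σ a * (P k).indicator v (a • p) =
      if a ∈ MulAction.stabilizer G (P k) then v p else 0 := by
    intro a; obtain ⟨j, hj⟩ := h.partition.permutes a k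
    have haj : a • p ∈ P j := hj ▸ smul_mem_smul_set hpk; split_ifs with ha
    · rw [← hp a ha, indicator_of_mem]; rwa [← hj, MulAction.mem_stabilizer_iff.1 ha] at haj
    · rw [indicator_of_notMem, mul_zero]; refine disjoint_left.1 (h.partition.disjoint j k ?_) haj
      rintro rfl; exact ha hj
  rw [ext, symm, sum_congr rfl fun a _ => e a, ← sum_filter, sum_const,
    nsmul_eq_mul, Nat.card_eq_fintype_card, Fintype.card_subtype]

lemma restrictLp_ae {Ω₁ : Set M} (h : Ω₁ ⊆ Ω) (u : Lp ℝ 2 Λ Ω) : Problem.restrictLp d h u =ᵐ[Λ Ω₁] u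
    := MemLp.coeFn_toLp _

/-- Restriction as a linear map. -/
def restrictLin {Ω₁ : Set M} (h : Ω₁ ⊆ Ω) : Lp ℝ 2 Λ Ω →ₗ[ℝ] Lp ℝ 2 (Λ Ω₁) where
  toFun := Problem.restrictLp d h
  map_add' u v := by
    have hm : ae Λ Ω₁ ≤ ae Λ Ω := ae_mono (restrict_mono h le_rfl); refine Lp.ext ?_
    filter_upwards [restrictLp_ae h (u + v), restrictLp_ae h u, restrictLp_ae h v,
      hm (Lp.coeFn_add u v), Lp.coeFn_add (Problem.restrictLp d h u) (Problem.restrictLp d h v)]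
      with p h1 h2 h3 h4 h5
    rw [h1, h4, h5, Pi.add_apply, Pi.add_apply, h2, h3]
  map_smul' c u := by
    have hm : ae Λ Ω₁ ≤ ae Λ Ω := ae_mono (restrict_mono h le_rfl); refine Lp.ext ?_
    filter_upwards [restrictLp_ae h (c • u), restrictLp_ae h u, hm (Lp.coeFn_smul c u),
      Lp.coeFn_smul c (Problem.restrictLp d h u)] with p h1 h2 h3 h4
    rw [h1, h3, RingHom.id_apply, h4, Pi.smul_apply, Pi.smul_apply, h2]

lemma reduced_rob_subset : (B.reduced σ (P k)).rob ⊆ frontier (B.reduced σ (P k)).dom :=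
  fun _ hq => hq.1.1

/-- Testing the equation on `Ω` with the extension of `v` gives the equation on the piece,
multiplied by `|G|` on both sides. The restriction lies in the form domain because an invariant `u`
is `|G|⁻¹` times its symmetrization. It is nonzero because invariant functions are determined by one
piece. -/
lemma mapsTo_restrictLp (h : SymP) (hs : P k ⊆ B.dom) (t : ℝ) : MapsTo (Problem.restrictLp d hs)
    (B.invEigenfunctions d (⊤ : Subgroup G) σ t) ((B.reduced σ (P k)).invEigenfunctions d
    (MulAction.stabilizer G (P k)) σ t) := by
  rintro u ⟨⟨hu0, huD, hu⟩, hinv⟩; have hr := restrictLp_ae (d := d) hs u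
  have hL := h.admissible.lipschitz; have hi := symm_eq_of_isInvariant hinv
  have hc : (Fintype.card G : ℝ) ≠ 0 := Nat.cast_ne_zero.2 Fintype.card_ne_zero
  have hmono : ae (Λ (P k)) ≤ ae (Λ B.dom) := ae_mono (restrict_mono hs le_rfl)
  have huk : (B.reduced σ (P k)).MemH1D d u := by
    refine ((h.memH1D_symm huD).2.const_mul h.lip (Fintype.card G : ℝ)⁻¹).congr ?_
    filter_upwards [hmono hi] with p hp; rw [hp, inv_mul_cancel_left₀ hc]
  refine ⟨⟨fun h0 => hu0 ?_, huk.congr hr.symm, fun v hv => ?_⟩, h.isInvariant_piece hinv hr.symm⟩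
  · refine Lp.ext ((h.ae_eq_of_isInvariant hinv (isInvariant_of_smul (u := fun _ => 0)
      fun a p => by simp) ?_).trans (Lp.coeFn_zero _ _ _).symm)
    rw [h0] at hr; exact hr.symm.trans (Lp.coeFn_zero _ _ _)
  · have e1 := h.form_ext huD hi hv
    rw [hu _ (h.memH1D_ext hv), h.integral_mul_ext (Lp.memLp u) hi hv.1.1, mul_left_comm] at e1
    have e2 : ∫ p in P k, u p * v p ∂ϑ = ∫ p in P k, Problem.restrictLp d hs u p * v p ∂ϑ := by
      refine integral_congr_ae ?_; filter_upwards [hr] with p hp; rw [hp]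
    rw [e2] at e1
    exact (Problem.form_congr (B := B.reduced σ (P k)) h.lip reduced_rob_subset huk hv hr.symm
      EventuallyEq.rfl).symm.trans (mul_left_cancel₀ hc e1).symm

/-- The preimage of `v` is its extension divided by the order of the stabilizer. It satisfies the
equation for an arbitrary test function because both sides see only the symmetrized test function.
-/
lemma surjOn_restrictLp (h : SymP) (hs : P k ⊆ B.dom) (t : ℝ) : SurjOn (Problem.restrictLp d hs)
    (B.invEigenfunctions d (⊤ : Subgroup G) σ t) ((B.reduced σ (P k)).invEigenfunctions d
    (MulAction.stabilizer G (P k)) σ t) := by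
  rintro v ⟨⟨hv0, hvD, hv⟩, hinv⟩; have hL := h.admissible.lipschitz
  have hc : (Fintype.card G : ℝ) ≠ 0 := Nat.cast_ne_zero.2 Fintype.card_ne_zero
  set m : ℝ := ((Nat.card (MulAction.stabilizer G (P k)) : ℕ) : ℝ) with hm
  have hm0 : m ≠ 0 := Nat.cast_ne_zero.2 Nat.card_pos.ne'
  set u₀ : M → ℝ := fun p => m⁻¹ * ext σ (P k) v p with hu₀
  have hsm : ∀ (f : M → ℝ) (a : G) (p : M), m⁻¹ * symm σ f (a • p) = sgn σ a * (m⁻¹ * symm σ f p) :=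
    fun f a p => by rw [symm_smul, mul_left_comm]
  have hinv₀ : Inv u₀ := isInvariant_of_smul (hsm _)
  have hD₀ : B.MemH1D d u₀ := (h.memH1D_ext hvD).const_mul hL m⁻¹
  set u : Lp ℝ 2 (Λ B.dom) := hD₀.1.1.toLp u₀ with hu
  have huu : u =ᵐ[Λ B.dom] u₀ := MemLp.coeFn_toLp _
  have huv : u₀ =ᵐ[Λ (P k)] v := by
    filter_upwards [h.ext_eq hinv] with p hp
    exact (congrArg (m⁻¹ * ·) hp).trans (inv_mul_cancel_left₀ hm0 _)
  have hruv : Problem.restrictLp d hs u = v := by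
    refine Lp.ext ((restrictLp_ae hs u).trans (EventuallyEq.trans ?_ huv))
    exact ae_mono (restrict_mono hs le_rfl) huu
  have hi := symm_eq_of_isInvariant hinv₀
  refine ⟨u, ⟨⟨fun h0 => hv0 ?_, hD₀.congr huu.symm, fun w hw => ?_⟩,
    h.isInvariant_congr hinv₀ huu.symm⟩, hruv⟩
  · rw [← hruv, h0]; exact map_zero (restrictLin (d := d) hs)
  -- With `w₁` the suitably scaled restriction, `symm σ w` is the extension of `w₁`: both are
  -- invariant and they agree on `P k`. The form on `Ω` thus reduces to the form on the piece, where
  -- the equation for `v` is available.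
  · have hw' := h.memH1D_symm hw; set w₁ : M → ℝ := fun p => m⁻¹ * symm σ w p with hw₁
    have hw₁D : (B.reduced σ (P k)).MemH1D d w₁ := hw'.2.const_mul h.lip m⁻¹
    have he : symm σ w =ᵐ[Λ B.dom] ext σ (P k) w₁ := by
      refine h.ae_eq_of_isInvariant (isInvariant_of_smul fun a p => symm_smul a p)
        (isInvariant_of_smul fun a p => symm_smul a p) ?_
      filter_upwards [h.ext_eq (v := w₁) (isInvariant_of_smul (hsm w))] with p hp; rw [hp, hw₁]
      dsimp only; rw [← hm, mul_inv_cancel_left₀ hm0]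
    have e1 := h.form_symm hD₀ hi hw
    have e4 : (B.reduced σ (P k)).form d u₀ w₁ = t * ∫ p in P k, v p * w₁ p ∂ϑ :=
      (Problem.form_congr (B := B.reduced σ (P k)) h.lip reduced_rob_subset (hvD.congr huv.symm)
        hw₁D huv EventuallyEq.rfl).trans (hv w₁ hw₁D)
    rw [Problem.form_congr hL h.rob_subset hD₀ hw'.1 EventuallyEq.rfl he, h.form_ext hD₀ hi hw₁D,
      e4] at e1
    have e2 : ∫ p in P k, v p * w₁ p ∂ϑ = ∫ p in P k, u₀ p * w₁ p ∂ϑ := by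
      refine integral_congr_ae ?_; filter_upwards [huv] with p hp; rw [hp]
    have e3 : ∫ p in B.dom, u₀ p * symm σ w p ∂ϑ = ∫ p in B.dom, u₀ p * ext σ (P k) w₁ p ∂ϑ := by
      refine integral_congr_ae ?_; filter_upwards [he] with p hp; rw [hp]
    rw [h.integral_mul_symm hD₀.1.1 hi hw.1.1, h.integral_mul_ext hD₀.1.1 hi hw₁D.1.1] at e3
    rw [e2, ← mul_left_cancel₀ hc e3] at e1
    rw [← Problem.form_congr hL h.rob_subset hD₀ hw huu.symm EventuallyEq.rfl,
      ← mul_left_cancel₀ hc e1]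
    congr 1; refine integral_congr_ae ?_; filter_upwards [huu] with p hp; rw [hp]

lemma injOn_restrictLp (h : SymP) (hs : P k ⊆ B.dom) : InjOn (Problem.restrictLp d hs) {u | Inv u}
    := fun u hu u' hu' he =>
  Lp.ext (h.ae_eq_of_isInvariant hu hu'
    ((restrictLp_ae hs u).symm.trans (he ▸ restrictLp_ae hs u')))

lemma bijOn_restrictLp (h : SymP) (hs : P k ⊆ B.dom) (t : ℝ) : BijOn (Problem.restrictLp d hs)
    (B.invEigenfunctions d (⊤ : Subgroup G) σ t) ((B.reduced σ (P k)).invEigenfunctions d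
    (MulAction.stabilizer G (P k)) σ t) :=
  ⟨h.mapsTo_restrictLp hs t, (h.injOn_restrictLp hs).mono fun _ hu => hu.2, h.surjOn_restrictLp hs t⟩

/-- The invariant square integrable functions. -/
def invariantSubmodule (h : SymP) : Submodule ℝ (Lp ℝ 2 (Λ B.dom)) where
  carrier := {u | Inv u}
  zero_mem' := h.isInvariant_congr (isInvariant_of_smul (u := fun _ => 0) fun a p => by simp)
    (Lp.coeFn_zero _ _ _).symm
  add_mem' {u v} hu hv := by
    refine h.isInvariant_congr (fun a ha => ?_) (Lp.coeFn_add u v).symm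
    filter_upwards [hu a ha, hv a ha] with p h1 h2; rw [Pi.add_apply, Pi.add_apply, mul_add, h1, h2]
  smul_mem' c u hu := by
    refine h.isInvariant_congr (fun a ha => ?_) (Lp.coeFn_smul c u).symm
    filter_upwards [hu a ha] with p h1
    rw [Pi.smul_apply, Pi.smul_apply, smul_eq_mul, smul_eq_mul, mul_left_comm, h1]

/-- For every `s ≤ t` restriction maps invariant eigenfunctions onto those of the piece, so it maps
one span onto the other. It is injective on the whole space of invariant functions, hence on the
span of eigenfunctions with different eigenvalues, and the ranks agree. -/
lemma eigenvalue_eq (h : SymP) (i : ℕ) : B.eigenvalue d (⊤ : Subgroup G) σ i = (B.reduced σ (P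
    k)).eigenvalue d (MulAction.stabilizer G (P k)) σ i := by
  have hs := h.partition.subset k
  have key : ∀ t : ℝ, Module.rank ℝ (Submodule.span ℝ
      (⋃ s ∈ Iic t, B.invEigenfunctions d (⊤ : Subgroup G) σ s)) = Module.rank ℝ (Submodule.span ℝ
      (⋃ s ∈ Iic t, (B.reduced σ (P k)).invEigenfunctions d (MulAction.stabilizer G (P k)) σ s)) := by
    intro t; set S := ⋃ s ∈ Iic t, B.invEigenfunctions d (⊤ : Subgroup G) σ s with hS
    have h1 : (restrictLin (d := d) hs) '' S = ⋃ s ∈ Iic t,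
        (B.reduced σ (P k)).invEigenfunctions d (MulAction.stabilizer G (P k)) σ s := by
      rw [hS, image_iUnion₂]; exact iUnion₂_congr fun s _ => (h.bijOn_restrictLp hs s).image_eq
    have h2 : Submodule.span ℝ S ≤ h.invariantSubmodule :=
      Submodule.span_le.2 (iUnion₂_subset fun s _ u hu => hu.2)
    have h3 : Submodule.span ℝ ((restrictLin (d := d) hs) '' S) =
        LinearMap.range ((restrictLin (d := d) hs).domRestrict (Submodule.span ℝ S)) := by
      rw [LinearMap.range_domRestrict, Submodule.map_span]
    have h4 : Module.rank ℝ (Submodule.span ℝ S) =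
        Module.rank ℝ (Submodule.span ℝ ((restrictLin (d := d) hs) '' S)) := by
      rw [h3]; refine (LinearEquiv.ofInjective _ fun u u' he => Subtype.ext ?_).rank_eq
      exact h.injOn_restrictLp hs (h2 u.2) (h2 u'.2) he
    exact h4.trans (congrArg (fun T : Set (Lp ℝ 2 (Λ (P k))) =>
      Module.rank ℝ (Submodule.span ℝ T)) h1)
  unfold Problem.eigenvalue; simp only [key]

end SymPartition

end EquivSpectrum

end

theorem lemma3p5 {d : ℕ} [NeZero d] (hd : 2 ≤ d)
    {M : Type*} [EMetricSpace M] [CompactSpace M] [ChartedSpace (EuclideanHalfSpace d) M]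
    [IsManifold (𝓡∂ d) ∞ M] [RiemannianBundle (fun p : M ↦ TangentSpace (𝓡∂ d) p)]
    [IsContMDiffRiemannianBundle (𝓡∂ d) ∞ (EuclideanSpace ℝ (Fin d))
      (fun p : M ↦ TangentSpace (𝓡∂ d) p)]
    [IsRiemannianManifold (𝓡∂ d) M] [MeasurableSpace M] [BorelSpace M]
    {G : Type*} [Group G] [Finite G] [MulAction G M] (σ : G →* ℤˣ)
    (B : EquivSpectrum.Problem M) (hB : B.IsAdmissible d G)
    (hconn : IsConnected B.dom)
    (hfaithful : ∀ a : G, (∀ p ∈ B.dom, a • p = p) → a = 1)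
    {n : ℕ} (P : Fin n → Set M) (hP : EquivSpectrum.IsTransitivePartition d G B.dom P) (k : Fin n)
    (hcover : EquivSpectrum.intBdry B.dom (P k) ⊆
      closure (EquivSpectrum.plusBdry σ B.dom (P k)) ∪
        closure (EquivSpectrum.minusBdry σ B.dom (P k))) :
    (∀ i : ℕ, 1 ≤ i →
      B.eigenvalue d (⊤ : Subgroup G) σ i =
        (B.reduced σ (P k)).eigenvalue d (MulAction.stabilizer G (P k)) σ i) ∧
    ∀ t : ℝ, BijOn (EquivSpectrum.Problem.restrictLp d (hP.subset k))
      (B.invEigenfunctions d (⊤ : Subgroup G) σ t)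
      ((B.reduced σ (P k)).invEigenfunctions d (MulAction.stabilizer G (P k)) σ t) := by
  cases nonempty_fintype G
  have h : EquivSpectrum.SymPartition d σ B P k := ⟨hB, hconn, hfaithful, hP, hcover⟩
  exact ⟨fun i _ ↦ h.eigenvalue_eq i, fun t ↦ h.bijOn_restrictLp (hP.subset k) t⟩
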